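/- Let $k$ be a commutative ring with $\tfrac12\in k$. **Vertex algebras.** A vertex algebra is a $\mathbb Z_{\ge0}$-graded $k$-module $V=\bigoplus_{i\ge 0} V_i$ with a vacuum $\mathbf 1\in V_0$ and bilinear products $a_{(n)}b$ ($n\in\mathbb Z$) of degree $-n-1$ satisfying $\mathbf 1_{(n)}a=\delta_{n,-1}a$, $a_{(-1)}\mathbf 1=a$, $a_{(n)}\mathbf 1=0$ for $n\ge0$, and the Borcherds identity $\sum_{j\ge0}\binom mj(a_{(n+j)}b)_{(m+l-j)}c=\sum_{j\ge0}(-1)^j\binom nj\{a_{(m+n-j)}b_{(l+j)}c-(-1)^nb_{(n+l-j)}a_{(m+j)}c\}$ for all $m,n,l\in\mathbb Z$; $\partial^{(j)}a:=a_{(-1-j)}\mathbf 1$. The weight $\le1$ part of $V$, with the operations $\partial=\partial^{(1)},{}_{(-1)},{}_{(0)},{}_{(1)}$, is a 1-truncated vertex algebra $V_{\le1}$. Put $\Omega(V)=V_{0(-1)}\partial V_0\subset V_1$ (the $k$-span of all $a_{(-1)}\partial b$) and $T(V)=V_1/\Omega(V)$. $V$ is splittable if $V_1\to T(V)$ has a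 $k$-linear section $s$; let $\mathcal Vert'\subset\mathcal Vert$ be the full subcategory of splittable vertex algebras. **Vertex algebroids.** A vertex algebroid $\mathcal A=(A,T,\Omega,\partial,\gamma,\langle,\rangle,c)$ consists of: a commutative $k$-algebra $A$; a Lie algebroid $T$ over $A$, i.e. a $k$-Lie algebra and $A$-module acting on $A$ by derivations with $[\tau,a\tau']=a[\tau,\tau']+\tau(a)\tau'$ and $(a\tau)(b)=a\,\tau(b)$; an $A$-module $\Omega$ with a $k$-linear action $\omega\mapsto\tau(\omega)$ of the Lie algebra $T$, a $k$-linear derivation $\partial:A\to\Omega$ commuting with $T$, and an $A$-bilinear pairing $\langle,\rangle:T\times\Omega\to A$ such that $\langle\tau,\partial a\rangle=\tau(a)$, $\tau(a\omega)=\tau(a)\omega+a\tau(\omega)$, $(a\tau)(\omega)=a\tau(\omega)+\langle\tau,\omega\rangle\partial a$ and $\tau(\langle\tau',\omega\rangle)=\langle[\tau,\tau'],\omega\rangle+\langle\tau',\tau(\omega)\rangle$; and $k$-bilinear maps $\gamma:A\times T\to\Omega$, $\langle,\rangle:T\times T\to A$ (symmetric), $c:T\times T\to\Omega$ (skew-symmetric)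 such that $$\gamma(a,b\tau)=\gamma(ab,\tau)-a\gamma(b,\tau)-\tau(a)\partial b-\tau(b)\partial a,$$ $$\langle a\tau_1,\tau_2\rangle=a\langle\tau_1,\tau_2\rangle+\langle\gamma(a,\tau_1),\tau_2\rangle-\tau_1\tau_2(a),$$ $$c(a\tau_1,\tau_2)=ac(\tau_1,\tau_2)+\gamma(a,[\tau_1,\tau_2])-\gamma(\tau_2(a),\tau_1)+\tau_2(\gamma(a,\tau_1))-\tfrac12\langle\tau_1,\tau_2\rangle\partial a+\tfrac12\partial\tau_1\tau_2(a)-\tfrac12\partial\langle\tau_2,\gamma(a,\tau_1)\rangle,$$ $$\langle[\tau_1,\tau_2],\tau_3\rangle+\langle\tau_2,[\tau_1,\tau_3]\rangle=\tau_1(\langle\tau_2,\tau_3\rangle)-\tfrac12\tau_2(\langle\tau_1,\tau_3\rangle)-\tfrac12\tau_3(\langle\tau_1,\tau_2\rangle)+\langle\tau_2,c(\tau_1,\tau_3)\rangle+\langle\tau_3,c(\tau_1,\tau_2)\rangle,$$ $$d_{Lie}c(\tau_1,\tau_2,\tau_3)=-\tfrac12\partial\bigl\{\langle[\tau_1,\tau_2],\tau_3\rangle+\langle[\tau_1,\tau_3],\tau_2\rangle-\langle[\tau_2,\tau_3],\tau_1\rangle-\tau_1(\langle\tau_2,\tau_3\rangle)+\tau_2(\langle\tau_1,\tau_3\rangle)-2\langle\tau_3,c(\tau_1,\tau_2)\rangle\bigr\},$$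 where $d_{Lie}c(\tau_1,\tau_2,\tau_3)=\tau_1(c(\tau_2,\tau_3))-\tau_2(c(\tau_1,\tau_3))+\tau_3(c(\tau_1,\tau_2))-c([\tau_1,\tau_2],\tau_3)+c([\tau_1,\tau_3],\tau_2)-c([\tau_2,\tau_3],\tau_1)$. The pairing is extended to $T\oplus\Omega$ symmetrically, by zero on $\Omega\times\Omega$. It has an associated 1-truncated vertex algebra $u\mathcal A=(A,T\oplus\Omega,\dots)$ with $a_{(-1)}\tau=a\tau-\gamma(a,\tau)$, $a_{(-1)}\omega=a\omega$, $\tau_{(0)}a=\tau(a)$, $\tau_{(0)}\omega=\tau(\omega)$, $\tau_{(0)}\tau'=[\tau,\tau']-c(\tau,\tau')+\frac12\partial\langle\tau,\tau'\rangle$, $\omega_{(0)}a=\omega_{(0)}\omega'=0$, $x_{(1)}y=\langle x,y\rangle$, the remaining products being determined by $x_{(0)}a=-a_{(0)}x$, $x_{(0)}y=-y_{(0)}x+\partial(y_{(1)}x)$ and $x_{(-1)}a=a_{(-1)}x+\partial(x_{(0)}a)$. A morphism of 1-truncated vertex algebras is a pair of $k$-linear maps in weights $0,1$ preserving $\mathbf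 1$ and all operations. A morphism $\mathcal A\to\mathcal B$ in the category $\mathcal Alg$ is a morphism $u\mathcal A\to u\mathcal B$ of 1-truncated vertex algebras carrying $\Omega_{\mathcal A}$ into $\Omega_{\mathcal B}$. Let $\mathcal Alg^{Sur}\subset\mathcal Alg$ be the full subcategory of those $\mathcal A$ for which $\Omega$ is generated by $\partial A$ as an $A$-module. A splittable $V$ with a splitting $s$ yields a vertex algebroid $\mathcal A(V;s)=(V_0,T(V),\Omega(V),\dots)\in\mathcal Alg^{Sur}$ with $\gamma(a,\tau)=s(a\tau)-a_{(-1)}s(\tau)$, $\langle\tau,\tau'\rangle=s(\tau)_{(1)}s(\tau')$, $c(\tau,\tau')=s([\tau,\tau'])-\frac12\bigl(s(\tau)_{(0)}s(\tau')-s(\tau')_{(0)}s(\tau)\bigr)$, and a canonical isomorphism $u\mathcal A(V;s)\cong V_{\le1}$ given by $s$ on $T(V)$ and the inclusion on $\Omega(V)$. For a choice of a splitting of every splittable vertex algebra, $V\mapsto\mathcal A(V;s)$ becomes in this way a functor $\mathcal A(-;s):\mathcal Vert'\to\mathcal Alg^{Sur}$. **Vertex envelope.** A conformal algebra is a $\mathbb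 Z_{\ge0}$-graded $k$-module $C$ with operators $\partial^{(j)}$ of degree $j$ and products ${}_{(n)}$ of degree $-n-1$ ($j,n\ge0$) such that $\partial^{(0)}=\mathrm{Id}$, $\partial^{(i)}\partial^{(j)}=\binom{i+j}{i}\partial^{(i+j)}$, $(\partial^{(i)}a)_{(n)}b=(-1)^i\binom ni a_{(n-i)}b$, $a_{(n)}b=(-1)^{n+1}\sum_{j\ge0}(-1)^j\partial^{(j)}(b_{(n+j)}a)$ and $a_{(m)}b_{(n)}c=b_{(n)}a_{(m)}c+\sum_{j=0}^m\binom mj(a_{(j)}b)_{(m+n-j)}c$. For a vertex algebroid $\mathcal A$, let $C=C\mathcal A$ be the conformal algebra which as a $k$-module is generated by symbols $\partial^{(i)}a,\partial^{(i)}x$ ($a\in A$, $x\in T\oplus\Omega$, $i\ge0$), $k$-linear in $a$ and $x$, with the relations $(i+1)\partial^{(i+1)}a=\partial^{(i)}(\partial a)$ only, and whose products extend the products ${}_{(0)},{}_{(1)}$ of $u\mathcal A$. Let $TC$ be the tensor algebra of the $k$-module $C$, with the operators $\partial^{(j)}$ extended by $\partial^{(j)}(xy)=\sum_p\partial^{(p)}x\cdot\partial^{(j-p)}y$.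 The vertex envelope $UC$ of $C$ is the quotient $p:TC\to UC$ by the two-sided ideal generated by all $xy-yx-\sum_{j\ge0}(-1)^j\partial^{(j+1)}(x_{(j)}y)$ with $x,y\in C$, with the vertex algebra structure with vacuum $p(1)$ such that $p(xz)=p(x)_{(-1)}p(z)$ for $x\in C$, $z\in TC$, and such that $p|_C:C\to UC$ is a morphism of conformal algebras. Let $R\subset TC$ be the smallest left ideal, closed under all $\partial^{(j)}$, which contains the elements $$(1_A-1_{TC})\,u\ (u\in TC),\qquad a\cdot x-ax\ (a\in A,\ x\in A\cup\Omega),\qquad a\cdot\tau-a\tau+\gamma(a,\tau)\ (a\in A,\ \tau\in T).$$ The vertex envelope of $\mathcal A$ is $U\mathcal A:=UC\mathcal A/p(R)$. **Theorem.** For every vertex algebroid $\mathcal A$, the conformal algebra $C\mathcal A$ and the vertex algebra structure on $UC\mathcal A$ exist, and $p(R)$ is the kernel of a surjective morphism of vertex algebras $UC\mathcal A\to U\mathcal A$. Moreover: 1. $\mathcal A\mapsto U\mathcal A$ is a functor $U:\mathcal Alg\to\mathcal Vert$, and the canonical maps $A\to (U\mathcal A)_0$, $T\oplus\Omega\to(U\mathcal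 A)_1$ are the components of a natural transformation $\eta_{\mathcal A}:u\mathcal A\to(U\mathcal A)_{\le1}$ of functors to 1-truncated vertex algebras. For every vertex algebroid $\mathcal A$, every vertex algebra $V$ and every morphism $f:u\mathcal A\to V_{\le1}$ there is a unique morphism $F:U\mathcal A\to V$ with $F_{\le1}\circ\eta_{\mathcal A}=f$. 2. If $\mathcal A\in\mathcal Alg^{Sur}$, then $U\mathcal A$ is splittable. For every choice $s$ of splittings, the resulting functor $U:\mathcal Alg^{Sur}\to\mathcal Vert'$ is left adjoint to $\mathcal A(-;s):\mathcal Vert'\to\mathcal Alg^{Sur}$, and its unit $\mathcal A\to\mathcal A(U\mathcal A;s)$, composed with $u\mathcal A(U\mathcal A;s)\cong(U\mathcal A)_{\le1}$, is $\eta_{\mathcal A}$. -/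

import Mathlib

open CategoryTheory

universe u

set_option linter.unusedVariables false
set_option linter.unusedSectionVars false
set_option linter.unusedSimpArgs false

/-- A `ℤ≥0`-graded module `M = ⨁ᵢ Mᵢ` over `k`, the homogeneous parts being submodules of `M`. -/
structure GrMod (k : Type u) [CommRing k] where
  carrier : Type u
  [addCommGroup : AddCommGroup carrier]
  [module : Module k carrier]
  gr : ℕ → Submodule k carrier
  isInternal : DirectSum.IsInternal gr

attribute [instance] GrMod.addCommGroup GrMod.module

namespace GrMod

variable {k : Type u} [CommRing k] (M : GrMod k)

/-- The homogeneous part of integer weight `n`; it is zero for `n < 0`. -/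
def wt : ℤ → Submodule k M.carrier
  | Int.ofNat n => M.gr n
  | Int.negSucc _ => ⊥

theorem wt_of_neg {n : ℤ} (h : n < 0) : M.wt n = ⊥ := by
  obtain ⟨m, rfl⟩ := Int.eq_negSucc_of_lt_zero h
  rfl

theorem wt_of_eq {n : ℤ} {m : ℕ} (h : n = m) : M.wt n = M.gr m := by
  subst h
  rfl

end GrMod

/-- A `ℤ≥0`-graded vertex algebra over `k`: `prod n a b` is the product `a₍ₙ₎b`. All sums in the
Borcherds identity are finite, since the `n`-th product has degree `-n-1`
and the grading is bounded below. -/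
structure VertexAlgebra (k : Type u) [CommRing k] extends GrMod k where
  vac : carrier
  prod : ℤ → carrier →ₗ[k] carrier →ₗ[k] carrier
  vac_mem : vac ∈ gr 0
  prod_mem : ∀ (n : ℤ) (i j : ℕ) (a b : carrier), a ∈ gr i → b ∈ gr j →
    prod n a b ∈ toGrMod.wt ((i : ℤ) + j - n - 1)
  vac_prod : ∀ (n : ℤ) (a : carrier), prod n vac a = if n = -1 then a else 0
  prod_vac : ∀ a : carrier, prod (-1) a vac = a
  prod_vac_of_nonneg : ∀ (n : ℤ) (a : carrier), 0 ≤ n → prod n a vac = 0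
  borcherds : ∀ (a b c : carrier) (m n l : ℤ),
    ∑ᶠ j : ℕ, Ring.choose m j • prod (m + l - j) (prod (n + j) a b) c =
      ∑ᶠ j : ℕ, ((-1) ^ j * Ring.choose n j : ℤ) •
        (prod (m + n - j) a (prod (l + j) b c) -
          (n.negOnePow : ℤ) • prod (n + l - j) b (prod (m + j) a c))

namespace VertexAlgebra

variable {k : Type u} [CommRing k]

/-- The endomorphisms `∂⁽ʲ⁾ a = a₍₋₁₋ⱼ₎ 𝟏`. -/
def der (V : VertexAlgebra k) (j : ℕ) : V.carrier →ₗ[k] V.carrier :=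
  (V.prod (-1 - j)).flip V.vac

/-- Morphisms of vertex algebras. -/
@[ext]
structure Hom (V W : VertexAlgebra k) where
  toLin : V.carrier →ₗ[k] W.carrier
  map_gr : ∀ (n : ℕ) (a : V.carrier), a ∈ V.gr n → toLin a ∈ W.gr n
  map_vac : toLin V.vac = W.vac
  map_prod : ∀ (n : ℤ) (a b : V.carrier), toLin (V.prod n a b) = W.prod n (toLin a) (toLin b)

instance : Category (VertexAlgebra k) where
  Hom := Hom
  id V := ⟨LinearMap.id, fun _ _ h => h, rfl, fun _ _ _ => rfl⟩
  comp f g := ⟨g.toLin ∘ₗ f.toLin, fun n a h => g.map_gr n _ (f.map_gr n a h),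
    by simp [f.map_vac, g.map_vac], fun n a b => by simp [f.map_prod, g.map_prod]⟩

variable (V : VertexAlgebra k)

theorem prod_eq_zero {i j : ℕ} {n : ℤ} {a b : V.carrier} (ha : a ∈ V.gr i) (hb : b ∈ V.gr j)
    (h : (i : ℤ) + j - n - 1 < 0) : V.prod n a b = 0 := by
  have := V.prod_mem n i j a b ha hb
  rwa [V.wt_of_neg h, Submodule.mem_bot] at this

theorem prod_mem_gr {i j l : ℕ} {n : ℤ} {a b : V.carrier} (ha : a ∈ V.gr i) (hb : b ∈ V.gr j)
    (h : (i : ℤ) + j - n - 1 = l) : V.prod n a b ∈ V.gr l := by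
  have := V.prod_mem n i j a b ha hb
  rwa [V.wt_of_eq h] at this

theorem finsum_range {M : Type u} [AddCommGroup M] (f : ℕ → M) (N : ℕ)
    (h : ∀ j, N ≤ j → f j = 0) : ∑ᶠ j, f j = ∑ j ∈ Finset.range N, f j := by
  apply finsum_eq_sum_of_support_subset
  intro j hj
  by_contra hc
  exact hj (h j (by simpa using hc))

theorem assoc_formula (a b c : V.carrier) (n l : ℤ) (N : ℕ)
    (h1 : ∀ j : ℕ, N ≤ j → V.prod (l + j) b c = 0) (h2 : ∀ j : ℕ, N ≤ j → V.prod j a c = 0) :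
    V.prod l (V.prod n a b) c = ∑ j ∈ Finset.range N, ((-1) ^ j * Ring.choose n j : ℤ) •
        (V.prod (n - j) a (V.prod (l + j) b c) -
          (n.negOnePow : ℤ) • V.prod (n + l - j) b (V.prod j a c)) := by
  have h := V.borcherds a b c 0 n l
  rw [finsum_eq_single _ 0, finsum_range _ N] at h
  · simpa using h
  · intro j hj
    simp [h1 j hj, h2 j hj]
  · intro j hj
    obtain ⟨m, rfl⟩ := Nat.exists_eq_succ_of_ne_zero hj
    simp [Ring.choose_zero_succ]

theorem zero_prod (a b c : V.carrier) (l : ℤ) :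
    V.prod l (V.prod 0 a b) c = V.prod 0 a (V.prod l b c) - V.prod l b (V.prod 0 a c) := by
  have h := V.borcherds a b c 0 0 l
  rw [finsum_eq_single _ 0, finsum_eq_single _ 0] at h
  · simpa using h
  all_goals
    intro j hj
    obtain ⟨m, rfl⟩ := Nat.exists_eq_succ_of_ne_zero hj
    simp [Ring.choose_zero_succ]

theorem choose_neg_one (j : ℕ) : Ring.choose (-1 : ℤ) j = (-1) ^ j := by
  have := Ring.choose_neg (1 : ℤ) j
  rw [this]
  simp [Int.negOnePow_def, Units.smul_def, Ring.choose_natCast]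

theorem negOne_prod (a b c : V.carrier) (l : ℤ) (N : ℕ)
    (h1 : ∀ j : ℕ, N ≤ j → V.prod (l + j) b c = 0) (h2 : ∀ j : ℕ, N ≤ j → V.prod j a c = 0) :
    V.prod l (V.prod (-1) a b) c = ∑ j ∈ Finset.range N,
        (V.prod (-1 - j) a (V.prod (l + j) b c) + V.prod (-1 + l - j) b (V.prod j a c)) := by
  rw [V.assoc_formula a b c (-1) l N h1 h2]
  refine Finset.sum_congr rfl fun j _ => ?_
  rw [choose_neg_one, ← mul_pow]
  simp

theorem comm_formula (a b : V.carrier) (n : ℤ) (N : ℕ)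
    (h : ∀ j : ℕ, N ≤ j → V.prod (n + j) a b = 0) :
    V.prod n b a = - (n.negOnePow : ℤ) •
      ∑ j ∈ Finset.range N, (-1 : ℤ) ^ j • V.der j (V.prod (n + j) a b) := by
  have hb := V.borcherds a b V.vac (-1) n 0
  rw [finsum_range _ N, finsum_eq_single _ 0] at hb
  · simp only [V.prod_vac, V.prod_vac_of_nonneg 0 b le_rfl, Nat.cast_zero, add_zero] at hb
    simp only [choose_neg_one, map_zero, Ring.choose_zero_right] at hb
    have e : ∑ j ∈ Finset.range N, (-1 : ℤ) ^ j • V.der j (V.prod (n + j) a b) =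
        - (n.negOnePow : ℤ) • V.prod n b a := by
      simpa [der] using hb
    rw [e, smul_smul]
    rcases Int.even_or_odd n with hn | hn
    · simp [Int.negOnePow_even n hn]
    · simp [Int.negOnePow_odd n hn]
  · intro j hj
    have h1 : (0 : ℤ) ≤ -1 + j := by omega
    have h2 : (0 : ℤ) ≤ j := by omega
    simp [V.prod_vac_of_nonneg _ _ h1, V.prod_vac_of_nonneg _ _ h2]
  · intro j hj
    simp [h j hj]

end VertexAlgebra

/-- A `1`-truncated vertex algebra: `k`-modules `V0`, `V1` with a vacuum, a map `∂ = d` and the seven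
operations `mul a b = a₍₋₁₎b`, `lmul a x = a₍₋₁₎x`, `rmul x a = x₍₋₁₎a`, `res01 a x = a₍₀₎x`,
`res10 x a = x₍₀₎a`, `res11 x y = x₍₀₎y`, `pair x y = x₍₁₎y`. The fields `zero_…` say that the
operation `₍₀₎` is a derivation of all operations, whenever both sides are defined. -/
structure TruncVA (k : Type u) [CommRing k] where
  V0 : Type u
  V1 : Type u
  [addCommGroup0 : AddCommGroup V0]
  [module0 : Module k V0]
  [addCommGroup1 : AddCommGroup V1]
  [module1 : Module k V1]
  vac : V0
  d : V0 →ₗ[k] V1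
  mul : V0 →ₗ[k] V0 →ₗ[k] V0
  lmul : V0 →ₗ[k] V1 →ₗ[k] V1
  rmul : V1 →ₗ[k] V0 →ₗ[k] V1
  res01 : V0 →ₗ[k] V1 →ₗ[k] V0
  res10 : V1 →ₗ[k] V0 →ₗ[k] V0
  res11 : V1 →ₗ[k] V1 →ₗ[k] V1
  pair : V1 →ₗ[k] V1 →ₗ[k] V0
  mul_vac : ∀ a, mul a vac = a
  rmul_vac : ∀ x, rmul x vac = x
  res10_vac : ∀ x, res10 x vac = 0
  d_res10 : ∀ a b, res10 (d a) b = 0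
  d_res11 : ∀ a x, res11 (d a) x = 0
  d_pair : ∀ a x, pair (d a) x = -res01 a x
  d_mul : ∀ a b, d (mul a b) = rmul (d a) b + lmul a (d b)
  d_res : ∀ x a, d (res10 x a) = res11 x (d a)
  mul_comm : ∀ a b, mul a b = mul b a
  lmul_eq : ∀ a x, lmul a x = rmul x a - d (res10 x a)
  res10_eq : ∀ x a, res10 x a = -res01 a x
  res11_eq : ∀ x y, res11 x y = -res11 y x + d (pair y x)
  pair_comm : ∀ x y, pair x y = pair y x
  mul_assoc : ∀ a b c, mul (mul a b) c = mul a (mul b c)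
  zero_mul : ∀ x a b, res10 x (mul a b) = mul (res10 x a) b + mul a (res10 x b)
  zero_lmul : ∀ x a y, res11 x (lmul a y) = lmul (res10 x a) y + lmul a (res11 x y)
  zero_rmul : ∀ x y a, res11 x (rmul y a) = rmul (res11 x y) a + rmul y (res10 x a)
  zero_lmul' : ∀ a b y, res01 a (lmul b y) = mul b (res01 a y)
  zero_rmul' : ∀ a y b, res01 a (rmul y b) = mul (res01 a y) b
  zero_res11 : ∀ x y z, res11 x (res11 y z) = res11 (res11 x y) z + res11 y (res11 x z)
  zero_res10 : ∀ x y a, res10 x (res10 y a) = res10 (res11 x y) a + res10 y (res10 x a)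
  zero_res01 : ∀ x a y, res10 x (res01 a y) = res01 (res10 x a) y + res01 a (res11 x y)
  zero_res01' : ∀ a x y, res01 a (res11 x y) = res01 (res01 a x) y + res10 x (res01 a y)
  zero_pair : ∀ x y z, res10 x (pair y z) = pair (res11 x y) z + pair y (res11 x z)
  lmul_res10 : ∀ a x b, res10 (lmul a x) b = mul a (res10 x b)
  mul_lmul : ∀ a b x,
    lmul (mul a b) x = lmul a (lmul b x) + rmul (d a) (res01 b x) + rmul (d b) (res01 a x)
  lmul_pair : ∀ a x y, pair (lmul a x) y = mul a (pair x y) - res10 x (res10 y a)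

namespace TruncVA

variable {k : Type u} [CommRing k]

attribute [instance] addCommGroup0 module0 addCommGroup1 module1

/-- Morphisms of `1`-truncated vertex algebras. -/
@[ext]
structure Hom (v w : TruncVA k) where
  f0 : v.V0 →ₗ[k] w.V0
  f1 : v.V1 →ₗ[k] w.V1
  map_vac : f0 v.vac = w.vac
  map_d : ∀ a, f1 (v.d a) = w.d (f0 a)
  map_mul : ∀ a b, f0 (v.mul a b) = w.mul (f0 a) (f0 b)
  map_lmul : ∀ a x, f1 (v.lmul a x) = w.lmul (f0 a) (f1 x)
  map_rmul : ∀ x a, f1 (v.rmul x a) = w.rmul (f1 x) (f0 a)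
  map_res01 : ∀ a x, f0 (v.res01 a x) = w.res01 (f0 a) (f1 x)
  map_res10 : ∀ x a, f0 (v.res10 x a) = w.res10 (f1 x) (f0 a)
  map_res11 : ∀ x y, f1 (v.res11 x y) = w.res11 (f1 x) (f1 y)
  map_pair : ∀ x y, f0 (v.pair x y) = w.pair (f1 x) (f1 y)

instance : Category (TruncVA k) where
  Hom := Hom
  id v := ⟨LinearMap.id, LinearMap.id, rfl, fun _ => rfl, fun _ _ => rfl, fun _ _ => rfl,
    fun _ _ => rfl, fun _ _ => rfl, fun _ _ => rfl, fun _ _ => rfl, fun _ _ => rfl⟩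
  comp f g :=
    { f0 := g.f0 ∘ₗ f.f0
      f1 := g.f1 ∘ₗ f.f1
      map_vac := by simp [f.map_vac, g.map_vac]
      map_d := fun _ => by simp [f.map_d, g.map_d]
      map_mul := fun _ _ => by simp [f.map_mul, g.map_mul]
      map_lmul := fun _ _ => by simp [f.map_lmul, g.map_lmul]
      map_rmul := fun _ _ => by simp [f.map_rmul, g.map_rmul]
      map_res01 := fun _ _ => by simp [f.map_res01, g.map_res01]
      map_res10 := fun _ _ => by simp [f.map_res10, g.map_res10]
      map_res11 := fun _ _ => by simp [f.map_res11, g.map_res11]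
      map_pair := fun _ _ => by simp [f.map_pair, g.map_pair] }

end TruncVA

namespace VertexAlgebra

variable {k : Type u} [CommRing k] (V : VertexAlgebra k)

/-- The operation `₍ₙ₎` on homogeneous parts. -/
def op (n : ℤ) (i j l : ℕ) (h : (i : ℤ) + j - n - 1 = l) :
    V.gr i →ₗ[k] V.gr j →ₗ[k] V.gr l :=
  LinearMap.mk₂ k (fun a b => ⟨V.prod n a b, V.prod_mem_gr a.2 b.2 h⟩)
    (fun _ _ _ => Subtype.ext (by simp)) (fun _ _ _ => Subtype.ext (by simp))
    (fun _ _ _ => Subtype.ext (by simp)) (fun _ _ _ => Subtype.ext (by simp))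

@[simp]
theorem coe_op (n : ℤ) (i j l : ℕ) (h : (i : ℤ) + j - n - 1 = l) (a : V.gr i) (b : V.gr j) :
    (V.op n i j l h a b : V.carrier) = V.prod n a b := rfl

/-- The vacuum as a vector of weight `0`. -/
def vac0 : V.gr 0 := ⟨V.vac, V.vac_mem⟩

@[simp]
theorem coe_vac0 : (V.vac0 : V.carrier) = V.vac := rfl

theorem neg_two_prod (a : V.carrier) (n : ℤ) (h1 : -1 ≤ n) (h2 : n ≤ 1) (c : V.carrier) :
    V.prod n (V.prod (-2) a V.vac) c =
      V.prod (-2) a (if n = -1 then c else 0) - if n = 1 then V.prod 0 a c else 0 := by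
  have h := V.borcherds a V.vac c 0 (-2) n
  rw [finsum_eq_single _ 0, finsum_eq_single _ 0] at h
  · have e : (0 : ℤ) + n - (0 : ℕ) = n := by simp
    have e' : (-2 : ℤ) + (0 : ℕ) = -2 := by simp
    have e'' : (-2 + n = -1) ↔ n = 1 := by omega
    have en : (-2 : ℤ).negOnePow = 1 := Int.negOnePow_even _ (by decide)
    rw [e, e'] at h
    simpa [V.vac_prod, e'', en] using h
  · intro j hj
    have e : ¬ n + j = -1 := by omega
    have e'' : ¬ -2 + n - j = -1 := by omega
    simp [V.vac_prod, e, e'']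
  · intro j hj
    obtain ⟨m, rfl⟩ := Nat.exists_eq_succ_of_ne_zero hj
    simp [Ring.choose_zero_succ]

theorem prod_neg_two (a b : V.carrier) : V.prod (-1) (V.prod (-2) a V.vac) b = V.prod (-2) a b := by
  simpa using V.neg_two_prod a (-1) (by norm_num) (by norm_num) b

theorem trunc_d_mul (a b : V.carrier) :
    V.prod (-2) (V.prod (-1) a b) V.vac =
      V.prod (-1) (V.prod (-2) a V.vac) b + V.prod (-1) a (V.prod (-2) b V.vac) := by
  have h := V.negOne_prod a b V.vac (-2) 2
    (fun j hj => V.prod_vac_of_nonneg _ _ (by omega))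
    (fun j _ => V.prod_vac_of_nonneg _ _ (by omega))
  have h1 := V.prod_vac_of_nonneg 0 a le_rfl
  have h2 := V.prod_vac_of_nonneg 1 a (by norm_num)
  norm_num [Finset.sum_range_succ, V.prod_vac, h1, h2] at h
  rw [h, V.prod_neg_two, add_comm]

theorem trunc_lmul (a x : V.carrier) (ha : a ∈ V.gr 0) (hx : x ∈ V.gr 1) :
    V.prod (-1) a x = V.prod (-1) x a - V.prod (-2) (V.prod 0 x a) V.vac := by
  have h := V.comm_formula a x (-1) 2 (fun j hj => V.prod_eq_zero ha hx (by push_cast; omega))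
  have h' := V.comm_formula x a 0 1 (fun j hj => V.prod_eq_zero hx ha (by push_cast; omega))
  norm_num [der, V.prod_vac, Finset.sum_range_succ] at h h'
  rw [h, h']
  simp

theorem trunc_res11 (x y : V.carrier) (hx : x ∈ V.gr 1) (hy : y ∈ V.gr 1) :
    V.prod 0 x y = -V.prod 0 y x + V.prod (-2) (V.prod 1 y x) V.vac := by
  have h := V.comm_formula y x 0 2 (fun j hj => V.prod_eq_zero hy hx (by push_cast; omega))
  norm_num [der, V.prod_vac, Finset.sum_range_succ] at h
  rw [h]

theorem trunc_mul_lmul (a b x : V.carrier) (ha : a ∈ V.gr 0) (hb : b ∈ V.gr 0) (hx : x ∈ V.gr 1) :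
    V.prod (-1) (V.prod (-1) a b) x = V.prod (-1) a (V.prod (-1) b x) +
      V.prod (-1) (V.prod (-2) a V.vac) (V.prod 0 b x) +
      V.prod (-1) (V.prod (-2) b V.vac) (V.prod 0 a x) := by
  have h := V.negOne_prod a b x (-1) 2
    (fun j hj => V.prod_eq_zero hb hx (by push_cast; omega))
    (fun j hj => V.prod_eq_zero ha hx (by push_cast; omega))
  have h0 := V.prod_eq_zero (n := 1) ha hx (by norm_num)
  norm_num [Finset.sum_range_succ, h0] at h
  rw [h, V.prod_neg_two, V.prod_neg_two]
  abel

theorem trunc_lmul_pair (a x y : V.carrier) (ha : a ∈ V.gr 0) (hx : x ∈ V.gr 1) (hy : y ∈ V.gr 1) :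
    V.prod 1 (V.prod (-1) a x) y = V.prod (-1) a (V.prod 1 x y) - V.prod 0 x (V.prod 0 y a) := by
  have h := V.negOne_prod a x y 1 1
    (fun j hj => V.prod_eq_zero hx hy (by push_cast; omega))
    (fun j hj => V.prod_eq_zero ha hy (by push_cast; omega))
  have h' := V.comm_formula a y 0 1 (fun j hj => V.prod_eq_zero ha hy (by push_cast; omega))
  norm_num [der, V.prod_vac] at h h'
  rw [h, h', map_neg]
  abel

/-- The truncation of a vertex algebra to weights `≤ 1`. -/
def trunc : TruncVA k where
  V0 := V.gr 0
  V1 := V.gr 1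
  vac := V.vac0
  d := (V.op (-2) 0 0 1 (by norm_num)).flip V.vac0
  mul := V.op (-1) 0 0 0 (by norm_num)
  lmul := V.op (-1) 0 1 1 (by norm_num)
  rmul := V.op (-1) 1 0 1 (by norm_num)
  res01 := V.op 0 0 1 0 (by norm_num)
  res10 := V.op 0 1 0 0 (by norm_num)
  res11 := V.op 0 1 1 1 (by norm_num)
  pair := V.op 1 1 1 0 (by norm_num)
  mul_vac a := Subtype.ext (V.prod_vac a)
  rmul_vac x := Subtype.ext (V.prod_vac x)
  res10_vac x := Subtype.ext (V.prod_vac_of_nonneg 0 x le_rfl)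
  d_res10 a b := Subtype.ext (by
    simpa using V.neg_two_prod a 0 (by norm_num) (by norm_num) b)
  d_res11 a x := Subtype.ext (by
    simpa using V.neg_two_prod a 0 (by norm_num) (by norm_num) x)
  d_pair a x := Subtype.ext (by
    simpa using V.neg_two_prod a 1 (by norm_num) (by norm_num) x)
  d_mul a b := Subtype.ext (V.trunc_d_mul a b)
  d_res x a := Subtype.ext (by
    have h := V.zero_prod x a V.vac (-2)
    simpa [V.prod_vac_of_nonneg] using h)
  mul_comm a b := Subtype.ext (by
    have h := V.comm_formula b a (-1) 1 (fun j hj => V.prod_eq_zero b.2 a.2 (by push_cast; omega))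
    simpa [der, V.prod_vac] using h)
  lmul_eq a x := Subtype.ext (V.trunc_lmul a x a.2 x.2)
  res10_eq x a := Subtype.ext (by
    have h := V.comm_formula a x 0 1 (fun j hj => V.prod_eq_zero a.2 x.2 (by push_cast; omega))
    simpa [der, V.prod_vac] using h)
  res11_eq x y := Subtype.ext (V.trunc_res11 x y x.2 y.2)
  pair_comm x y := Subtype.ext (by
    have h := V.comm_formula y x 1 1 (fun j hj => V.prod_eq_zero y.2 x.2 (by push_cast; omega))
    simpa [der, V.prod_vac] using h)
  mul_assoc a b c := Subtype.ext (by
    have h := V.negOne_prod a b c (-1) 1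
      (fun j hj => V.prod_eq_zero b.2 c.2 (by push_cast; omega))
      (fun j hj => V.prod_eq_zero a.2 c.2 (by push_cast; omega))
    have h0 := V.prod_eq_zero (n := 0) a.2 c.2 (by norm_num)
    simpa [h0] using h)
  zero_mul x a b := Subtype.ext (by simp [V.zero_prod])
  zero_lmul x a y := Subtype.ext (by simp [V.zero_prod])
  zero_rmul x y a := Subtype.ext (by simp [V.zero_prod])
  zero_lmul' a b y := Subtype.ext (by
    have h := V.zero_prod a b y (-1)
    rw [V.prod_eq_zero (n := 0) a.2 b.2 (by norm_num)] at h
    exact sub_eq_zero.mp (by simpa using h.symm))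
  zero_rmul' a y b := Subtype.ext (by
    have h := V.zero_prod a y b (-1)
    rw [V.prod_eq_zero (n := 0) a.2 b.2 (by norm_num)] at h
    simpa [eq_comm] using h)
  zero_res11 x y z := Subtype.ext (by simp [V.zero_prod])
  zero_res10 x y a := Subtype.ext (by simp [V.zero_prod])
  zero_res01 x a y := Subtype.ext (by simp [V.zero_prod])
  zero_res01' a x y := Subtype.ext (by simp [V.zero_prod])
  zero_pair x y z := Subtype.ext (by simp [V.zero_prod])
  lmul_res10 a x b := Subtype.ext (by
    have h := V.negOne_prod a x b 0 1
      (fun j hj => V.prod_eq_zero x.2 b.2 (by push_cast; omega))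
      (fun j hj => V.prod_eq_zero a.2 b.2 (by push_cast; omega))
    have h0 := V.prod_eq_zero (n := 0) a.2 b.2 (by norm_num)
    simpa [h0] using h)
  mul_lmul a b x := Subtype.ext (V.trunc_mul_lmul a b x a.2 b.2 x.2)
  lmul_pair a x y := Subtype.ext (V.trunc_lmul_pair a x y a.2 x.2 y.2)

/-- The truncation functor from vertex algebras to `1`-truncated vertex algebras. -/
def truncFunctor (k : Type u) [CommRing k] : VertexAlgebra k ⥤ TruncVA k where
  obj V := V.trunc
  map {V W} f :=
    { f0 := f.toLin.restrict (f.map_gr 0)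
      f1 := f.toLin.restrict (f.map_gr 1)
      map_vac := Subtype.ext f.map_vac
      map_d := fun a => Subtype.ext ((f.map_prod _ _ _).trans (by
        rw [show f.toLin (V.vac0 : V.carrier) = W.vac from f.map_vac]; rfl))
      map_mul := fun _ _ => Subtype.ext (f.map_prod _ _ _)
      map_lmul := fun _ _ => Subtype.ext (f.map_prod _ _ _)
      map_rmul := fun _ _ => Subtype.ext (f.map_prod _ _ _)
      map_res01 := fun _ _ => Subtype.ext (f.map_prod _ _ _)
      map_res10 := fun _ _ => Subtype.ext (f.map_prod _ _ _)
      map_res11 := fun _ _ => Subtype.ext (f.map_prod _ _ _)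
      map_pair := fun _ _ => Subtype.ext (f.map_prod _ _ _) }

end VertexAlgebra

/-- A vertex algebroid `(A, T, Ω, ∂, γ, ⟨,⟩, c)` over `k ∋ 1/2`. Here `anchor τ a = τ(a)`,
`lieΩ τ ω = τ(ω)`, `d = ∂`, and the symmetric pairing on `T ⊕ Ω`, which vanishes on `Ω × Ω`,
is given by its restrictions `pairΩ` to `T × Ω` and `pairT` to `T × T`. -/
structure VertexAlgebroid (k : Type u) [CommRing k] [Invertible (2 : k)] where
  A : Type u
  T : Type u
  Ω : Type u
  [commRingA : CommRing A]
  [algebraA : Algebra k A]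
  [lieRingT : LieRing T]
  [lieAlgebraT : LieAlgebra k T]
  [moduleT : Module A T]
  [towerT : IsScalarTower k A T]
  [addCommGroupΩ : AddCommGroup Ω]
  [moduleKΩ : Module k Ω]
  [moduleΩ : Module A Ω]
  [towerΩ : IsScalarTower k A Ω]
  -- the Lie algebroid `T`
  anchor : T →ₗ⁅k⁆ Derivation k A A
  lie_smul : ∀ (τ ν : T) (a : A), ⁅τ, a • ν⁆ = a • ⁅τ, ν⁆ + anchor τ a • ν
  anchor_smul : ∀ (a : A) (τ : T) (b : A), anchor (a • τ) b = a * anchor τ b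
  -- the extended Lie algebroid `(A, T, Ω, ∂, ⟨,⟩)`
  lieΩ : T →ₗ[k] Ω →ₗ[k] Ω
  lieΩ_lie : ∀ (τ ν : T) (ω : Ω), lieΩ ⁅τ, ν⁆ ω = lieΩ τ (lieΩ ν ω) - lieΩ ν (lieΩ τ ω)
  d : Derivation k A Ω
  d_anchor : ∀ (τ : T) (a : A), d (anchor τ a) = lieΩ τ (d a)
  pairΩ : T →ₗ[A] Ω →ₗ[A] A
  pairΩ_d : ∀ (τ : T) (a : A), pairΩ τ (d a) = anchor τ a
  lieΩ_smul : ∀ (τ : T) (a : A) (ω : Ω), lieΩ τ (a • ω) = anchor τ a • ω + a • lieΩ τ ω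
  smul_lieΩ : ∀ (a : A) (τ : T) (ω : Ω), lieΩ (a • τ) ω = a • lieΩ τ ω + pairΩ τ ω • d a
  anchor_pairΩ : ∀ (τ ν : T) (ω : Ω),
    anchor τ (pairΩ ν ω) = pairΩ ⁅τ, ν⁆ ω + pairΩ ν (lieΩ τ ω)
  -- the remaining operations
  pairT : T →ₗ[k] T →ₗ[k] A
  pairT_symm : ∀ τ ν : T, pairT τ ν = pairT ν τ
  γ : A →ₗ[k] T →ₗ[k] Ω
  c : T →ₗ[k] T →ₗ[k] Ω
  c_skew : ∀ τ ν : T, c τ ν = -c ν τ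
  ax1 : ∀ (a b : A) (τ : T),
    γ a (b • τ) = γ (a * b) τ - a • γ b τ - anchor τ a • d b - anchor τ b • d a
  ax2 : ∀ (a : A) (τ₁ τ₂ : T),
    pairT (a • τ₁) τ₂ = a * pairT τ₁ τ₂ + pairΩ τ₂ (γ a τ₁) - anchor τ₁ (anchor τ₂ a)
  ax3 : ∀ (a : A) (τ₁ τ₂ : T),
    c (a • τ₁) τ₂ = a • c τ₁ τ₂ + γ a ⁅τ₁, τ₂⁆ - γ (anchor τ₂ a) τ₁ + lieΩ τ₂ (γ a τ₁) -
      (⅟2 : k) • (pairT τ₁ τ₂ • d a) + (⅟2 : k) • d (anchor τ₁ (anchor τ₂ a)) -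
      (⅟2 : k) • d (pairΩ τ₂ (γ a τ₁))
  ax4 : ∀ τ₁ τ₂ τ₃ : T,
    pairT ⁅τ₁, τ₂⁆ τ₃ + pairT τ₂ ⁅τ₁, τ₃⁆ =
      anchor τ₁ (pairT τ₂ τ₃) - (⅟2 : k) • anchor τ₂ (pairT τ₁ τ₃) -
        (⅟2 : k) • anchor τ₃ (pairT τ₁ τ₂) + pairΩ τ₂ (c τ₁ τ₃) + pairΩ τ₃ (c τ₁ τ₂)
  -- the left hand side is the Chevalley differential of `c`
  ax5 : ∀ τ₁ τ₂ τ₃ : T,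
    lieΩ τ₁ (c τ₂ τ₃) - lieΩ τ₂ (c τ₁ τ₃) + lieΩ τ₃ (c τ₁ τ₂) -
        c ⁅τ₁, τ₂⁆ τ₃ + c ⁅τ₁, τ₃⁆ τ₂ - c ⁅τ₂, τ₃⁆ τ₁ =
      -((⅟2 : k) • d (pairT ⁅τ₁, τ₂⁆ τ₃ + pairT ⁅τ₁, τ₃⁆ τ₂ - pairT ⁅τ₂, τ₃⁆ τ₁ -
        anchor τ₁ (pairT τ₂ τ₃) + anchor τ₂ (pairT τ₁ τ₃) - (2 : ℤ) • pairΩ τ₃ (c τ₁ τ₂)))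

namespace VertexAlgebroid

attribute [instance] commRingA algebraA lieRingT lieAlgebraT moduleT towerT addCommGroupΩ
  moduleKΩ moduleΩ towerΩ

variable {k : Type u} [CommRing k] [Invertible (2 : k)] (𝒜 : VertexAlgebroid k)

theorem half_add_half {M : Type u} [AddCommGroup M] [Module k M] (m : M) :
    (⅟2 : k) • m + (⅟2 : k) • m = m := by
  rw [← add_smul, ← two_mul, mul_invOf_self, one_smul]

theorem smul_smul_comm_T (t : k) (a : 𝒜.A) (τ : 𝒜.T) : a • t • τ = t • a • τ := by
  rw [← algebraMap_smul 𝒜.A t τ, ← algebraMap_smul 𝒜.A t (a • τ), smul_smul, smul_smul, mul_comm]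

theorem smul_smul_comm_Ω (t : k) (a : 𝒜.A) (ω : 𝒜.Ω) : a • t • ω = t • a • ω := by
  rw [← algebraMap_smul 𝒜.A t ω, ← algebraMap_smul 𝒜.A t (a • ω), smul_smul, smul_smul, mul_comm]

theorem pairΩ_smul_k (t : k) (τ : 𝒜.T) (ω : 𝒜.Ω) : 𝒜.pairΩ τ (t • ω) = t • 𝒜.pairΩ τ ω := by
  rw [← algebraMap_smul 𝒜.A t ω, map_smul, algebraMap_smul]

theorem pairΩ_smul_k' (t : k) (τ : 𝒜.T) (ω : 𝒜.Ω) : 𝒜.pairΩ (t • τ) ω = t • 𝒜.pairΩ τ ω := by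
  rw [← algebraMap_smul 𝒜.A t τ, map_smul, LinearMap.smul_apply, algebraMap_smul]

/-- `x₍₀₎a` on `T ⊕ Ω`. -/
def uRes10 : 𝒜.T × 𝒜.Ω →ₗ[k] 𝒜.A →ₗ[k] 𝒜.A :=
  LinearMap.mk₂ k (fun x a => 𝒜.anchor x.1 a) (by simp) (by simp) (by simp) (by simp)

/-- `a₍₋₁₎x` on `T ⊕ Ω`. -/
def uLmul : 𝒜.A →ₗ[k] 𝒜.T × 𝒜.Ω →ₗ[k] 𝒜.T × 𝒜.Ω :=
  LinearMap.mk₂ k (fun a x => (a • x.1, a • x.2 - 𝒜.γ a x.1))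
    (fun a b x => Prod.ext (by simp [add_smul]) (by simp [add_smul]; abel))
    (fun t a x => Prod.ext (by simp) (by simp [smul_sub]))
    (fun a x y => Prod.ext (by simp) (by simp; abel))
    (fun t a x => Prod.ext (by simp [smul_smul_comm_T])
      (by simp [smul_sub, smul_smul_comm_Ω]))

/-- `∂` with values in `T ⊕ Ω`. -/
def uD : 𝒜.A →ₗ[k] 𝒜.T × 𝒜.Ω := LinearMap.inr k 𝒜.T 𝒜.Ω ∘ₗ (𝒜.d : 𝒜.A →ₗ[k] 𝒜.Ω)

/-- `x₍₁₎y` on `T ⊕ Ω`. -/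
def uPair : 𝒜.T × 𝒜.Ω →ₗ[k] 𝒜.T × 𝒜.Ω →ₗ[k] 𝒜.A :=
  LinearMap.mk₂ k (fun x y => 𝒜.pairT x.1 y.1 + 𝒜.pairΩ x.1 y.2 + 𝒜.pairΩ y.1 x.2)
    (fun x y z => by simp; abel)
    (fun t x y => by simp [smul_add, pairΩ_smul_k, pairΩ_smul_k'])
    (fun x y z => by simp; abel)
    (fun t x y => by simp [smul_add, pairΩ_smul_k, pairΩ_smul_k'])

/-- `x₍₀₎y` on `T ⊕ Ω`. -/
def uRes11 : 𝒜.T × 𝒜.Ω →ₗ[k] 𝒜.T × 𝒜.Ω →ₗ[k] 𝒜.T × 𝒜.Ω :=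
  LinearMap.mk₂ k (fun x y => (⁅x.1, y.1⁆,
      -𝒜.c x.1 y.1 + (⅟2 : k) • 𝒜.d (𝒜.pairT x.1 y.1) + 𝒜.lieΩ x.1 y.2 - 𝒜.lieΩ y.1 x.2 +
        𝒜.d (𝒜.pairΩ y.1 x.2)))
    (fun x y z => Prod.ext (by simp) (by simp [smul_add]; abel))
    (fun t x y => Prod.ext (by simp)
      (by simp [smul_add, smul_sub, pairΩ_smul_k, smul_comm t (⅟2 : k)]))
    (fun x y z => Prod.ext (by simp) (by simp [smul_add]; abel))
    (fun t x y => Prod.ext (by simp)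
      (by simp [smul_add, smul_sub, pairΩ_smul_k', smul_comm t (⅟2 : k)]))

@[simp] theorem uRes10_apply (x : 𝒜.T × 𝒜.Ω) (a : 𝒜.A) : 𝒜.uRes10 x a = 𝒜.anchor x.1 a := rfl

@[simp] theorem uLmul_apply (a : 𝒜.A) (x : 𝒜.T × 𝒜.Ω) :
    𝒜.uLmul a x = (a • x.1, a • x.2 - 𝒜.γ a x.1) := rfl

@[simp] theorem uD_apply (a : 𝒜.A) : 𝒜.uD a = (0, 𝒜.d a) := rfl

@[simp] theorem uPair_apply (x y : 𝒜.T × 𝒜.Ω) :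
    𝒜.uPair x y = 𝒜.pairT x.1 y.1 + 𝒜.pairΩ x.1 y.2 + 𝒜.pairΩ y.1 x.2 := rfl

@[simp] theorem uRes11_apply (x y : 𝒜.T × 𝒜.Ω) :
    𝒜.uRes11 x y = (⁅x.1, y.1⁆,
      -𝒜.c x.1 y.1 + (⅟2 : k) • 𝒜.d (𝒜.pairT x.1 y.1) + 𝒜.lieΩ x.1 y.2 - 𝒜.lieΩ y.1 x.2 +
        𝒜.d (𝒜.pairΩ y.1 x.2)) := rfl

theorem γ_one (τ : 𝒜.T) : 𝒜.γ 1 τ = 0 := by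
  have h := 𝒜.ax1 1 1 τ
  simp only [one_smul, mul_one, sub_self, zero_sub, Derivation.map_one_eq_zero, smul_zero,
    sub_zero] at h
  simpa using h

theorem anchor_anchor (τ ν : 𝒜.T) (a : 𝒜.A) :
    𝒜.anchor ⁅τ, ν⁆ a = 𝒜.anchor τ (𝒜.anchor ν a) - 𝒜.anchor ν (𝒜.anchor τ a) := by
  rw [LieHom.map_lie, Derivation.commutator_apply]

theorem smul_lie' (a : 𝒜.A) (τ ν : 𝒜.T) : ⁅a • τ, ν⁆ = a • ⁅τ, ν⁆ - 𝒜.anchor ν a • τ := by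
  rw [← lie_skew, 𝒜.lie_smul, ← lie_skew ν τ, smul_neg]
  abel

theorem u_res11_eq (x y : 𝒜.T × 𝒜.Ω) :
    𝒜.uRes11 x y = -𝒜.uRes11 y x + 𝒜.uD (𝒜.uPair y x) := by
  ext
  · simp
  · have h := half_add_half (k := k) (𝒜.d (𝒜.pairT x.1 y.1))
    simp only [uRes11_apply, uPair_apply, uD_apply, Prod.snd_add, Prod.snd_neg, map_add,
      𝒜.pairT_symm y.1 x.1, 𝒜.c_skew y.1 x.1]
    rw [← h]
    simp only [smul_add]
    have h2 := half_add_half (k := k) ((⅟2 : k) • 𝒜.d (𝒜.pairT x.1 y.1))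
    rw [h2]
    abel

theorem u_zero_lmul (x y : 𝒜.T × 𝒜.Ω) (a : 𝒜.A) :
    𝒜.uRes11 x (𝒜.uLmul a y) = 𝒜.uLmul (𝒜.uRes10 x a) y + 𝒜.uLmul a (𝒜.uRes11 x y) := by
  obtain ⟨x₁, x₂⟩ := x
  obtain ⟨y₁, y₂⟩ := y
  ext
  · simp [𝒜.lie_smul, add_comm]
  · simp only [uRes11_apply, uLmul_apply, uRes10_apply, Prod.snd_add, 𝒜.c_skew x₁ (a • y₁),
      𝒜.c_skew x₁ y₁, 𝒜.pairT_symm x₁ (a • y₁), 𝒜.pairT_symm x₁ y₁, 𝒜.ax3, 𝒜.ax2, map_add,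
      map_sub, Derivation.leibniz, 𝒜.smul_lieΩ, 𝒜.lieΩ_smul, map_smul, LinearMap.smul_apply,
      smul_eq_mul, ← lie_skew y₁ x₁, map_neg]
    module

theorem u_zero_pair (x y z : 𝒜.T × 𝒜.Ω) : 𝒜.uRes10 x (𝒜.uPair y z) =
    𝒜.uPair (𝒜.uRes11 x y) z + 𝒜.uPair y (𝒜.uRes11 x z) := by
  obtain ⟨x₁, x₂⟩ := x
  obtain ⟨y₁, y₂⟩ := y
  obtain ⟨z₁, z₂⟩ := z
  have h4 := 𝒜.ax4 x₁ y₁ z₁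
  have h1 := 𝒜.anchor_pairΩ x₁ y₁ z₂
  have h2 := 𝒜.anchor_pairΩ x₁ z₁ y₂
  have h3 := 𝒜.anchor_pairΩ z₁ y₁ x₂
  have h5 := 𝒜.anchor_pairΩ y₁ z₁ x₂
  rw [← lie_skew z₁ y₁] at h3
  simp only [uRes11_apply, uPair_apply, uRes10_apply, map_add, map_sub, map_neg, pairΩ_smul_k,
    𝒜.pairΩ_d, LinearMap.neg_apply] at h3 ⊢
  linear_combination h1 + h2 - h3 - h5 - h4

theorem u_zero_res11 (x y z : 𝒜.T × 𝒜.Ω) : 𝒜.uRes11 x (𝒜.uRes11 y z) =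
    𝒜.uRes11 (𝒜.uRes11 x y) z + 𝒜.uRes11 y (𝒜.uRes11 x z) := by
  obtain ⟨x₁, x₂⟩ := x
  obtain ⟨y₁, y₂⟩ := y
  obtain ⟨z₁, z₂⟩ := z
  ext
  · simp
  · have h5 := 𝒜.ax5 x₁ y₁ z₁
    have h1 := congrArg 𝒜.d (𝒜.anchor_pairΩ x₁ z₁ y₂)
    have h2 := congrArg 𝒜.d (𝒜.anchor_pairΩ y₁ z₁ x₂)
    simp only [uRes11_apply, Prod.snd_add, map_add, map_sub, map_neg, map_smul, 𝒜.lieΩ_lie,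
      ← 𝒜.d_anchor, 𝒜.pairΩ_d, LinearMap.neg_apply, 𝒜.pairT_symm x₁ ⁅y₁, z₁⁆,
      𝒜.pairT_symm y₁ ⁅x₁, z₁⁆, 𝒜.c_skew x₁ ⁅y₁, z₁⁆, 𝒜.c_skew y₁ ⁅x₁, z₁⁆, pairΩ_smul_k,
      smul_add, smul_sub, map_zsmul, two_zsmul,
      Derivation.map_smul] at h1 h2 h5 ⊢
    have e := half_add_half (k := k) (𝒜.d (𝒜.pairΩ z₁ (𝒜.c x₁ y₁)))
    linear_combination (norm := module) h1 - h2 - h5 - e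

/-- The `1`-truncated vertex algebra `u𝒜 = (A, T ⊕ Ω, …)` of a vertex algebroid. -/
def toTrunc : TruncVA k where
  V0 := 𝒜.A
  V1 := 𝒜.T × 𝒜.Ω
  vac := 1
  d := 𝒜.uD
  mul := LinearMap.mul k 𝒜.A
  lmul := 𝒜.uLmul
  rmul := 𝒜.uLmul.flip + 𝒜.uRes10.compr₂ 𝒜.uD
  res01 := -𝒜.uRes10.flip
  res10 := 𝒜.uRes10
  res11 := 𝒜.uRes11
  pair := 𝒜.uPair
  mul_vac a := by simp
  rmul_vac x := by simp [γ_one]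
  res10_vac x := by simp
  d_res10 a b := by simp
  d_res11 a x := by
    simp [𝒜.pairΩ_d, 𝒜.d_anchor]
  d_pair a x := by simp [𝒜.pairΩ_d]
  d_mul a b := by simp [add_comm]
  d_res x a := by simp [𝒜.d_anchor]
  mul_comm a b := by simp [mul_comm]
  lmul_eq a x := by simp
  res10_eq x a := by simp
  res11_eq := 𝒜.u_res11_eq
  pair_comm x y := by simp [𝒜.pairT_symm x.1 y.1]; abel
  mul_assoc a b c := by simp [mul_assoc]
  zero_mul x a b := by simp; ring
  zero_lmul x a y := 𝒜.u_zero_lmul x y a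
  zero_rmul x y a := by
    have h := 𝒜.u_zero_lmul x y a
    have h2 (b : 𝒜.A) : 𝒜.uRes11 x (𝒜.uD b) = 𝒜.uD (𝒜.uRes10 x b) := by simp [𝒜.d_anchor]
    have h3 : 𝒜.uRes10 (𝒜.uRes11 x y) a =
        𝒜.uRes10 x (𝒜.uRes10 y a) - 𝒜.uRes10 y (𝒜.uRes10 x a) := 𝒜.anchor_anchor _ _ _
    simp only [LinearMap.add_apply, LinearMap.flip_apply, LinearMap.compr₂_apply, map_add, h, h2,
      h3, map_sub]
    abel
  zero_lmul' a b y := by simp [𝒜.anchor_smul]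
  zero_rmul' a y b := by simp [𝒜.anchor_smul, mul_comm]
  zero_res11 := 𝒜.u_zero_res11
  zero_res10 x y a := by
    simp only [uRes10_apply, uRes11_apply, anchor_anchor]
    abel
  zero_res01 x a y := by
    simp only [uRes10_apply, uRes11_apply, anchor_anchor, LinearMap.neg_apply,
      LinearMap.flip_apply, map_neg]
    abel
  zero_res01' a x y := by
    simp only [uRes10_apply, uRes11_apply, anchor_anchor, LinearMap.neg_apply,
      LinearMap.flip_apply, map_neg]
    abel
  zero_pair := 𝒜.u_zero_pair
  lmul_res10 a x b := by simp [𝒜.anchor_smul]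
  mul_lmul a b x := by
    ext
    · simp [mul_smul]
    · simp [mul_smul, 𝒜.ax1, smul_sub]; abel
  lmul_pair a x y := by
    simp [𝒜.ax2, mul_add]; ring

end VertexAlgebroid

namespace TruncVA

variable {k : Type u} [CommRing k] (v : TruncVA k)

/-- `Ω ⊆ V₁`: the `k`-submodule generated by all `a₍₋₁₎∂b`. -/
def Omega : Submodule k v.V1 := Submodule.span k {x | ∃ a b : v.V0, x = v.lmul a (v.d b)}

/-- `T = V₁/Ω`. -/
abbrev Tan : Type u := v.V1 ⧸ v.Omega

/-- A `k`-linear splitting of the projection `V₁ → T`. -/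
structure Splitting where
  s : v.Tan →ₗ[k] v.V1
  mkQ_s : ∀ τ, v.Omega.mkQ (s τ) = τ

variable {v}

theorem lmul_d_mem (a b : v.V0) : v.lmul a (v.d b) ∈ v.Omega := Submodule.subset_span ⟨a, b, rfl⟩

theorem Omega_induction {p : (x : v.V1) → x ∈ v.Omega → Prop}
    (h : ∀ a b, p (v.lmul a (v.d b)) (lmul_d_mem a b)) (h0 : p 0 (zero_mem _))
    (hadd : ∀ x y hx hy, p x hx → p y hy → p (x + y) (add_mem hx hy))
    (hsmul : ∀ (t : k) x hx, p x hx → p (t • x) (Submodule.smul_mem _ t hx)) {x : v.V1}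
    (hx : x ∈ v.Omega) : p x hx := by
  refine Submodule.span_induction ?_ h0 hadd hsmul hx
  rintro _ ⟨a, b, rfl⟩
  exact h a b

theorem vac_lmul (x : v.V1) : v.lmul v.vac x = x := by
  rw [v.lmul_eq, v.rmul_vac, v.res10_vac, map_zero, sub_zero]

theorem d_mem (a : v.V0) : v.d a ∈ v.Omega := by
  rw [← vac_lmul (v.d a)]
  exact lmul_d_mem _ _

theorem res01_eq (a : v.V0) (x : v.V1) : v.res01 a x = -v.res10 x a := by
  rw [v.res10_eq, neg_neg]

theorem d_vac : v.d v.vac = 0 := by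
  have h := v.d_mul v.vac v.vac
  rw [v.mul_vac, v.rmul_vac, vac_lmul] at h
  simpa using h

theorem rmul_eq (x : v.V1) (a : v.V0) : v.rmul x a = v.lmul a x + v.d (v.res10 x a) := by
  rw [v.lmul_eq, sub_add_cancel]

theorem Omega_res10 {ω : v.V1} (h : ω ∈ v.Omega) (b : v.V0) : v.res10 ω b = 0 := by
  induction h using Omega_induction with
  | h a c => rw [v.lmul_res10, v.d_res10, map_zero]
  | h0 => simp
  | hadd x y _ _ hx hy => simp [hx, hy]
  | hsmul t x _ hx => simp [hx]

theorem Omega_rmul {ω : v.V1} (h : ω ∈ v.Omega) (b : v.V0) : v.rmul ω b = v.lmul b ω := by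
  rw [rmul_eq, Omega_res10 h, map_zero, add_zero]

theorem mul_lmul_eq (a b : v.V0) (x : v.V1) : v.lmul (v.mul a b) x =
    v.lmul a (v.lmul b x) - v.lmul (v.res10 x b) (v.d a) - v.lmul (v.res10 x a) (v.d b) := by
  rw [v.mul_lmul, Omega_rmul (d_mem a), Omega_rmul (d_mem b), res01_eq, res01_eq]
  simp [sub_eq_add_neg]

theorem Omega_mul_lmul (a b : v.V0) {ω : v.V1} (h : ω ∈ v.Omega) :
    v.lmul (v.mul a b) ω = v.lmul a (v.lmul b ω) := by
  simp [mul_lmul_eq, Omega_res10 h]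

theorem d_mul_eq (a b : v.V0) : v.d (v.mul a b) = v.lmul a (v.d b) + v.lmul b (v.d a) := by
  rw [v.d_mul, Omega_rmul (d_mem a), add_comm]

theorem Omega_lmul (a : v.V0) {ω : v.V1} (h : ω ∈ v.Omega) : v.lmul a ω ∈ v.Omega := by
  induction h using Omega_induction with
  | h b c => rw [← Omega_mul_lmul _ _ (d_mem c)]; exact lmul_d_mem _ _
  | h0 => simp
  | hadd x y _ _ hx hy => rw [map_add]; exact add_mem hx hy
  | hsmul t x _ hx => rw [map_smul]; exact Submodule.smul_mem _ _ hx

theorem res11_Omega (x : v.V1) {ω : v.V1} (h : ω ∈ v.Omega) : v.res11 x ω ∈ v.Omega := by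
  induction h using Omega_induction with
  | h b c =>
    rw [v.zero_lmul, ← v.d_res]
    exact add_mem (lmul_d_mem _ _) (lmul_d_mem _ _)
  | h0 => simp
  | hadd x y _ _ hx hy => rw [map_add]; exact add_mem hx hy
  | hsmul t x _ hx => rw [map_smul]; exact Submodule.smul_mem _ _ hx

theorem Omega_res11 (x : v.V1) {ω : v.V1} (h : ω ∈ v.Omega) : v.res11 ω x ∈ v.Omega := by
  rw [v.res11_eq]
  exact add_mem (neg_mem (res11_Omega x h)) (d_mem _)

theorem Omega_res11_Omega {ω ω' : v.V1} (h : ω ∈ v.Omega) (h' : ω' ∈ v.Omega) :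
    v.res11 ω ω' = 0 := by
  induction h' using Omega_induction with
  | h b c => rw [v.zero_lmul, ← v.d_res, Omega_res10 h, Omega_res10 h]; simp
  | h0 => simp
  | hadd x y _ _ hx hy => simp [hx, hy]
  | hsmul t x _ hx => simp [hx]

theorem lmul_d_pair (a b : v.V0) (x : v.V1) :
    v.pair (v.lmul a (v.d b)) x = v.mul a (v.res10 x b) := by
  rw [v.lmul_pair, v.d_pair, v.d_res10, sub_zero, res01_eq, neg_neg]

theorem Omega_pair_Omega {ω ω' : v.V1} (h : ω ∈ v.Omega) (h' : ω' ∈ v.Omega) :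
    v.pair ω ω' = 0 := by
  induction h using Omega_induction with
  | h b c => rw [lmul_d_pair, Omega_res10 h', map_zero]
  | h0 => simp
  | hadd x y _ _ hx hy => simp [hx, hy]
  | hsmul t x _ hx => simp [hx]

theorem lmul_pair_Omega (a : v.V0) (x : v.V1) {ω : v.V1} (h : ω ∈ v.Omega) :
    v.pair (v.lmul a x) ω = v.mul a (v.pair x ω) := by
  rw [v.lmul_pair, Omega_res10 h, map_zero, sub_zero]

theorem pair_lmul_Omega (a : v.V0) (x : v.V1) {ω : v.V1} (h : ω ∈ v.Omega) :
    v.pair x (v.lmul a ω) = v.mul a (v.pair x ω) := by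
  rw [v.pair_comm, v.lmul_pair, Omega_res10 h, sub_zero, v.pair_comm]

variable (v)

/-- The commutative algebra `A = V₀`. -/
instance commRing0 : CommRing v.V0 :=
  { v.addCommGroup0 with
    mul := fun a b => v.mul a b
    one := v.vac
    left_distrib := fun a b c => map_add _ _ _
    right_distrib := fun a b c => LinearMap.map_add₂ _ _ _ _
    zero_mul := fun a => LinearMap.map_zero₂ _ _
    mul_zero := fun a => map_zero _
    mul_assoc := v.mul_assoc
    mul_comm := v.mul_comm
    mul_one := v.mul_vac
    one_mul := fun a => (v.mul_comm _ _).trans (v.mul_vac a) }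

theorem mul_def (a b : v.V0) : a * b = v.mul a b := rfl

theorem one_def : (1 : v.V0) = v.vac := rfl

instance algebra0 : Algebra k v.V0 :=
  Algebra.ofModule (fun t a b => LinearMap.map_smul₂ _ _ _ _) (fun t a b => map_smul _ _ _)

/-- The `A`-module `Ω`. -/
instance moduleOmega : Module v.V0 v.Omega where
  smul a ω := ⟨v.lmul a ω, Omega_lmul a ω.2⟩
  one_smul ω := Subtype.ext (vac_lmul _)
  mul_smul a b ω := Subtype.ext (Omega_mul_lmul a b ω.2)
  smul_zero a := Subtype.ext (map_zero _)
  smul_add a ω ω' := Subtype.ext (map_add _ _ _)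
  add_smul a b ω := Subtype.ext (LinearMap.map_add₂ _ _ _ _)
  zero_smul ω := Subtype.ext (LinearMap.map_zero₂ _ _)

@[simp]
theorem coe_smul_Omega (a : v.V0) (ω : v.Omega) : ((a • ω : v.Omega) : v.V1) = v.lmul a ω := rfl

instance : IsScalarTower k v.V0 v.Omega where
  smul_assoc t a ω := Subtype.ext (LinearMap.map_smul₂ _ _ _ _)

instance smulTan : SMul v.V0 v.Tan where
  smul a := v.Omega.mapQ v.Omega (v.lmul a) fun _ h => Omega_lmul a h

@[simp]
theorem smul_mk (a : v.V0) (x : v.V1) : a • v.Omega.mkQ x = v.Omega.mkQ (v.lmul a x) := rfl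

/-- The `A`-module `T`. -/
instance moduleTan : Module v.V0 v.Tan where
  one_smul τ := by
    obtain ⟨x, rfl⟩ := v.Omega.mkQ_surjective τ
    rw [smul_mk, one_def, vac_lmul]
  mul_smul a b τ := by
    obtain ⟨x, rfl⟩ := v.Omega.mkQ_surjective τ
    rw [smul_mk, smul_mk, smul_mk, mul_def, mul_lmul_eq, ← sub_eq_zero, ← map_sub]
    rw [Submodule.mkQ_apply, Submodule.Quotient.mk_eq_zero]
    have h := add_mem (lmul_d_mem (v.res10 x b) a) (lmul_d_mem (v.res10 x a) b)
    convert neg_mem h using 1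
    abel
  smul_zero a := map_zero (v.Omega.mapQ v.Omega (v.lmul a) fun _ h => Omega_lmul a h)
  smul_add a := map_add (v.Omega.mapQ v.Omega (v.lmul a) fun _ h => Omega_lmul a h)
  add_smul a b τ := by
    obtain ⟨x, rfl⟩ := v.Omega.mkQ_surjective τ
    simp only [smul_mk, map_add, LinearMap.add_apply]
  zero_smul τ := by
    obtain ⟨x, rfl⟩ := v.Omega.mkQ_surjective τ
    simp only [smul_mk, map_zero, LinearMap.zero_apply]

instance : IsScalarTower k v.V0 v.Tan where
  smul_assoc t a τ := by
    obtain ⟨x, rfl⟩ := v.Omega.mkQ_surjective τ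
    rw [smul_mk, smul_mk, LinearMap.map_smul₂, map_smul]

/-- The action of `T` on `A`, induced by `x₍₀₎a`. -/
def actA : v.Tan →ₗ[k] v.V0 →ₗ[k] v.V0 :=
  v.Omega.liftQ v.res10 fun _ h => LinearMap.mem_ker.mpr (LinearMap.ext fun b => Omega_res10 h b)

@[simp]
theorem actA_mk (x : v.V1) (a : v.V0) : v.actA (v.Omega.mkQ x) a = v.res10 x a := rfl

/-- The action of `T` on `Ω`, induced by `x₍₀₎ω`. -/
def actΩ : v.Tan →ₗ[k] v.Omega →ₗ[k] v.Omega :=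
  v.Omega.liftQ
    (LinearMap.mk₂ k (fun x ω => ⟨v.res11 x ω, res11_Omega x ω.2⟩)
      (fun _ _ _ => Subtype.ext (by simp)) (fun _ _ _ => Subtype.ext (by simp))
      (fun _ _ _ => Subtype.ext (by simp)) (fun _ _ _ => Subtype.ext (by simp)))
    fun _ h => LinearMap.mem_ker.mpr (LinearMap.ext fun ω =>
      Subtype.ext (Omega_res11_Omega h ω.2))

@[simp]
theorem actΩ_mk (x : v.V1) (ω : v.Omega) :
    (v.actΩ (v.Omega.mkQ x) ω : v.V1) = v.res11 x ω := rfl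

/-- The bracket of `T`, induced by `x₍₀₎y`. -/
def bracketT : v.Tan →ₗ[k] v.Tan →ₗ[k] v.Tan :=
  v.Omega.liftQ
    (LinearMap.mk₂ k
      (fun x => v.Omega.mapQ v.Omega (v.res11 x) fun _ h => res11_Omega x h)
      (fun x y τ => by
        obtain ⟨z, rfl⟩ := v.Omega.mkQ_surjective τ
        simp)
      (fun t x τ => by
        obtain ⟨z, rfl⟩ := v.Omega.mkQ_surjective τ
        simp)
      (fun _ _ _ => map_add _ _ _) (fun _ _ _ => map_smul _ _ _))
    fun x h => LinearMap.mem_ker.mpr (LinearMap.ext fun τ => by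
      obtain ⟨z, rfl⟩ := v.Omega.mkQ_surjective τ
      exact (Submodule.Quotient.mk_eq_zero _).mpr (Omega_res11 z h))

theorem bracketT_mk (x y : v.V1) :
    v.bracketT (v.Omega.mkQ x) (v.Omega.mkQ y) = v.Omega.mkQ (v.res11 x y) := rfl

/-- The pairing `T × Ω → A`, induced by `x₍₁₎ω`. -/
def pairTΩ : v.Tan →ₗ[v.V0] v.Omega →ₗ[v.V0] v.V0 :=
  LinearMap.mk₂ v.V0
    (fun τ ω => (v.Omega.liftQ (v.pair.flip ω) fun x h =>
      LinearMap.mem_ker.mpr (Omega_pair_Omega h ω.2) : v.Tan →ₗ[k] v.V0) τ)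
    (fun _ _ _ => map_add _ _ _)
    (fun a τ ω => by
      obtain ⟨x, rfl⟩ := v.Omega.mkQ_surjective τ
      exact lmul_pair_Omega a x ω.2)
    (fun τ ω ω' => by
      obtain ⟨x, rfl⟩ := v.Omega.mkQ_surjective τ
      exact map_add (v.pair x) _ _)
    (fun a τ ω => by
      obtain ⟨x, rfl⟩ := v.Omega.mkQ_surjective τ
      exact pair_lmul_Omega a x ω.2)

@[simp]
theorem pairTΩ_mk (x : v.V1) (ω : v.Omega) : v.pairTΩ (v.Omega.mkQ x) ω = v.pair x ω := rfl

/-- `∂ : A → Ω`. -/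
def dΩ : Derivation k v.V0 v.Omega where
  toFun a := ⟨v.d a, d_mem a⟩
  map_add' a b := Subtype.ext (map_add _ _ _)
  map_smul' t a := Subtype.ext (map_smul _ _ _)
  map_one_eq_zero' := Subtype.ext d_vac
  leibniz' a b := Subtype.ext (d_mul_eq a b)

@[simp]
theorem coe_dΩ (a : v.V0) : (v.dΩ a : v.V1) = v.d a := rfl

namespace Splitting

variable {v}
variable (s : v.Splitting)

/-- `γ(a, τ) = s(aτ) - a₍₋₁₎s(τ)`. -/
def gamma : v.V0 →ₗ[k] v.Tan →ₗ[k] v.Omega :=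
  LinearMap.mk₂ k
    (fun a τ => ⟨s.s (a • τ) - v.lmul a (s.s τ), by
      rw [← Submodule.Quotient.mk_eq_zero, ← Submodule.mkQ_apply, map_sub, s.mkQ_s, ← smul_mk,
        s.mkQ_s, sub_self]⟩)
    (fun a b τ => Subtype.ext (by simp [add_smul]; abel))
    (fun t a τ => Subtype.ext (by simp [smul_sub]))
    (fun a τ ν => Subtype.ext (by simp; abel))
    (fun t a τ => Subtype.ext (by
      have h : a • t • τ = t • a • τ := by
        obtain ⟨x, rfl⟩ := v.Omega.mkQ_surjective τ
        rw [← map_smul, smul_mk, smul_mk, ← map_smul, map_smul (v.lmul a)]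
      simp [smul_sub, h]))

@[simp]
theorem coe_gamma (a : v.V0) (τ : v.Tan) :
    (s.gamma a τ : v.V1) = s.s (a • τ) - v.lmul a (s.s τ) := rfl

/-- `⟨τ, ν⟩ = s(τ)₍₁₎s(ν)`. -/
def pairT : v.Tan →ₗ[k] v.Tan →ₗ[k] v.V0 := v.pair.compl₁₂ s.s s.s

@[simp]
theorem pairT_apply (τ ν : v.Tan) : s.pairT τ ν = v.pair (s.s τ) (s.s ν) := rfl

theorem actΩ_eq (τ : v.Tan) (ω : v.Omega) : (v.actΩ τ ω : v.V1) = v.res11 (s.s τ) ω := by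
  rw [← s.mkQ_s τ, actΩ_mk, s.mkQ_s]

theorem pairTΩ_eq (τ : v.Tan) (ω : v.Omega) : v.pairTΩ τ ω = v.pair (s.s τ) ω := by
  rw [← s.mkQ_s τ, pairTΩ_mk, s.mkQ_s]

theorem s_smul (a : v.V0) (τ : v.Tan) : s.s (a • τ) = v.lmul a (s.s τ) + s.gamma a τ := by
  rw [coe_gamma]
  abel

end Splitting

variable [Invertible (2 : k)]

instance lieRingTan : LieRing v.Tan where
  bracket τ ν := v.bracketT τ ν
  add_lie _ _ _ := LinearMap.map_add₂ _ _ _ _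
  lie_add _ _ _ := map_add _ _ _
  lie_self τ := by
    obtain ⟨x, rfl⟩ := v.Omega.mkQ_surjective τ
    refine (Submodule.Quotient.mk_eq_zero _).mpr ?_
    have h := v.res11_eq x x
    have h2 : (2 : k) • v.res11 x x = v.d (v.pair x x) := by
      rw [two_smul]
      nth_rewrite 1 [h]
      abel
    rw [← invOf_smul_smul (2 : k) (v.res11 x x), h2]
    exact Submodule.smul_mem _ _ (d_mem _)
  leibniz_lie τ ν σ := by
    obtain ⟨x, rfl⟩ := v.Omega.mkQ_surjective τ
    obtain ⟨y, rfl⟩ := v.Omega.mkQ_surjective ν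
    obtain ⟨z, rfl⟩ := v.Omega.mkQ_surjective σ
    exact congrArg v.Omega.mkQ (v.zero_res11 x y z)

instance lieAlgebraTan : LieAlgebra k v.Tan where
  lie_smul _ _ _ := map_smul _ _ _

@[simp]
theorem lie_mk (x y : v.V1) :
    (⁅v.Omega.mkQ x, v.Omega.mkQ y⁆ : v.Tan) = v.Omega.mkQ (v.res11 x y) := rfl

/-- `T` acts on `A` by derivations. -/
def anchorT : v.Tan →ₗ⁅k⁆ Derivation k v.V0 v.V0 where
  toFun τ := Derivation.mk' (v.actA τ) (by
    intro a b
    obtain ⟨x, rfl⟩ := v.Omega.mkQ_surjective τ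
    simp only [smul_eq_mul, mul_def, actA_mk, v.zero_mul, v.mul_comm b]
    abel)
  map_add' τ ν := by ext; simp
  map_smul' t τ := by ext; simp
  map_lie' {τ ν} := by
    ext a
    obtain ⟨x, rfl⟩ := v.Omega.mkQ_surjective τ
    obtain ⟨y, rfl⟩ := v.Omega.mkQ_surjective ν
    rw [Derivation.commutator_apply]
    exact eq_sub_of_add_eq (v.zero_res10 x y a).symm

@[simp]
theorem anchorT_mk (x : v.V1) (a : v.V0) : v.anchorT (v.Omega.mkQ x) a = v.res10 x a := rfl

namespace Splitting

variable {v}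
variable (s : v.Splitting)

/-- `c(τ, ν) = s([τ, ν]) - [s(τ), s(ν)]`, where `[x, y] = ½(x₍₀₎y - y₍₀₎x)`. -/
def c : v.Tan →ₗ[k] v.Tan →ₗ[k] v.Omega :=
  LinearMap.mk₂ k
    (fun τ ν => ⟨s.s ⁅τ, ν⁆ - (⅟2 : k) • (v.res11 (s.s τ) (s.s ν) - v.res11 (s.s ν) (s.s τ)), by
      rw [← Submodule.Quotient.mk_eq_zero, ← Submodule.mkQ_apply, map_sub, s.mkQ_s, map_smul,
        map_sub, ← lie_mk, ← lie_mk, s.mkQ_s, s.mkQ_s, ← lie_skew ν τ, sub_neg_eq_add, ← two_smul k,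
        invOf_smul_smul, sub_self]⟩)
    (fun τ τ' ν => Subtype.ext (by simp [smul_sub]; abel))
    (fun t τ ν => Subtype.ext (by simp [smul_sub, smul_comm t (⅟2 : k)]))
    (fun τ ν ν' => Subtype.ext (by simp [smul_sub]; abel))
    (fun t τ ν => Subtype.ext (by simp [smul_sub, smul_comm t (⅟2 : k)]))

@[simp]
theorem coe_c (τ ν : v.Tan) : (s.c τ ν : v.V1) =
    s.s ⁅τ, ν⁆ - (⅟2 : k) • (v.res11 (s.s τ) (s.s ν) - v.res11 (s.s ν) (s.s τ)) := rfl

theorem actA_eq (τ : v.Tan) (a : v.V0) : v.anchorT τ a = v.res10 (s.s τ) a := by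
  rw [← s.mkQ_s τ, anchorT_mk, s.mkQ_s]

/-- `s` of a bracket, expressed through `x₍₀₎y`. -/
theorem s_lie (τ ν : v.Tan) : s.s ⁅τ, ν⁆ =
    v.res11 (s.s τ) (s.s ν) + s.c τ ν - (⅟2 : k) • v.d (v.pair (s.s τ) (s.s ν)) := by
  have h := v.res11_eq (s.s ν) (s.s τ)
  have h2 := VertexAlgebroid.half_add_half (k := k) (v.res11 (s.s τ) (s.s ν))
  rw [coe_c, h, smul_sub, smul_add, smul_neg]
  linear_combination (norm := module) h2

theorem coe_c_eq (τ ν : v.Tan) : (s.c τ ν : v.V1) =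
    s.s ⁅τ, ν⁆ - v.res11 (s.s τ) (s.s ν) + (⅟2 : k) • v.d (v.pair (s.s τ) (s.s ν)) := by
  rw [s_lie]
  abel

theorem smul_lie_tan (a : v.V0) (τ ν : v.Tan) : ⁅a • τ, ν⁆ = a • ⁅τ, ν⁆ - v.anchorT ν a • τ := by
  obtain ⟨x, rfl⟩ := v.Omega.mkQ_surjective τ
  obtain ⟨y, rfl⟩ := v.Omega.mkQ_surjective ν
  rw [← lie_skew, smul_mk, lie_mk, v.zero_lmul, map_add, ← lie_skew, lie_mk, ← map_neg, smul_mk,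
    anchorT_mk, smul_mk, map_neg]
  simp only [map_neg]
  abel

/-- The vertex algebroid `𝒜(v; s)` of a split `1`-truncated vertex algebra. -/
def toAlgebroid : VertexAlgebroid k where
  A := v.V0
  T := v.Tan
  Ω := v.Omega
  anchor := v.anchorT
  lie_smul τ ν a := by
    obtain ⟨x, rfl⟩ := v.Omega.mkQ_surjective τ
    obtain ⟨y, rfl⟩ := v.Omega.mkQ_surjective ν
    rw [smul_mk, lie_mk, lie_mk, v.zero_lmul, map_add, add_comm]
    rfl
  anchor_smul a τ b := by
    obtain ⟨x, rfl⟩ := v.Omega.mkQ_surjective τ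
    exact v.lmul_res10 a x b
  lieΩ := v.actΩ
  lieΩ_lie τ ν ω := by
    obtain ⟨x, rfl⟩ := v.Omega.mkQ_surjective τ
    obtain ⟨y, rfl⟩ := v.Omega.mkQ_surjective ν
    exact Subtype.ext (eq_sub_of_add_eq (v.zero_res11 x y ω).symm)
  d := v.dΩ
  d_anchor τ a := by
    obtain ⟨x, rfl⟩ := v.Omega.mkQ_surjective τ
    exact Subtype.ext (v.d_res x a)
  pairΩ := v.pairTΩ
  pairΩ_d τ a := by
    obtain ⟨x, rfl⟩ := v.Omega.mkQ_surjective τ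
    rw [pairTΩ_mk, coe_dΩ, v.pair_comm, v.d_pair, res01_eq, neg_neg, anchorT_mk]
  lieΩ_smul τ a ω := by
    obtain ⟨x, rfl⟩ := v.Omega.mkQ_surjective τ
    exact Subtype.ext (v.zero_lmul x a ω)
  smul_lieΩ a τ ω := by
    obtain ⟨x, rfl⟩ := v.Omega.mkQ_surjective τ
    apply Subtype.ext
    rw [smul_mk, actΩ_mk, v.res11_eq, v.zero_lmul, Omega_res10 ω.2, v.pair_comm,
      lmul_pair_Omega a x ω.2, d_mul_eq, v.res11_eq ω x, v.pair_comm x ω]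
    rw [Submodule.coe_add, coe_smul_Omega, coe_smul_Omega, actΩ_mk, coe_dΩ, pairTΩ_mk,
      v.pair_comm x ω]
    simp only [map_add, map_neg, map_zero, LinearMap.zero_apply]
    abel
  anchor_pairΩ τ ν ω := by
    obtain ⟨x, rfl⟩ := v.Omega.mkQ_surjective τ
    obtain ⟨y, rfl⟩ := v.Omega.mkQ_surjective ν
    exact v.zero_pair x y ω
  pairT := s.pairT
  pairT_symm τ ν := v.pair_comm _ _
  γ := s.gamma
  c := s.c
  c_skew τ ν := Subtype.ext (by
    rw [coe_c, Submodule.coe_neg, coe_c, ← lie_skew τ ν, map_neg]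
    module)
  ax1 a b τ := Subtype.ext (by
    simp only [Submodule.coe_sub, coe_gamma, coe_smul_Omega, mul_def, actA_eq s, coe_dΩ,
      ← mul_smul, mul_lmul_eq, map_sub]
    abel)
  ax2 a τ ν := by
    simp only [pairT_apply, s_smul, map_add, LinearMap.add_apply, v.lmul_pair, pairTΩ_eq s,
      actA_eq s, mul_def, v.pair_comm (s.s ν) (s.gamma a τ)]
    abel
  ax3 a τ ν := Subtype.ext (by
    have h := v.res11_eq (v.lmul a (s.s τ)) (s.s ν)
    have h' := v.res11_eq (s.gamma a τ) (s.s ν)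
    have h'' := v.res11_eq (s.s τ) (s.s ν)
    have e := VertexAlgebroid.half_add_half (k := k) (v.d (v.pair (s.gamma a τ) (s.s ν)))
    have e2 := VertexAlgebroid.half_add_half (k := k) (v.lmul (v.pair (s.s τ) (s.s ν)) (v.d a))
    have e3 := VertexAlgebroid.half_add_half (k := k)
      (v.d (v.res10 (s.s τ) (v.res10 (s.s ν) a)))
    simp only [coe_c_eq, smul_lie_tan, Submodule.coe_add, Submodule.coe_sub, Submodule.coe_smul,
      coe_smul_Omega, map_sub, map_add, s_smul, LinearMap.add_apply, v.lmul_pair, h, h', h'',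
      coe_dΩ, actΩ_eq s, pairTΩ_eq s, actA_eq s, pairT_apply, v.zero_lmul, d_mul_eq, map_neg,
      v.pair_comm (s.s ν), map_smul, smul_add, smul_sub]
    linear_combination (norm := module) e + e2 - e3)
  ax4 x y z := by
    have h := v.zero_pair (s.s x) (s.s y) (s.s z)
    simp only [pairT_apply, s_lie, map_add, map_sub, map_smul, LinearMap.add_apply,
      LinearMap.sub_apply, LinearMap.smul_apply, actA_eq s, pairTΩ_eq s, v.d_pair, res01_eq,
      v.pair_comm (s.s y) (v.d _), v.pair_comm _ (s.c _ _ : v.V1)]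
    linear_combination (norm := module) -h
  ax5 x y z := Subtype.ext (by
    have hj := v.zero_res11 (s.s x) (s.s y) (s.s z)
    have h1 := v.res11_eq (v.res11 (s.s x) (s.s z)) (s.s y)
    have h2 := v.res11_eq (v.res11 (s.s y) (s.s z)) (s.s x)
    have h3 := v.res11_eq (s.c x y) (s.s z)
    have h4 := v.res11_eq (s.c x z) (s.s y)
    have h5 := v.res11_eq (s.c y z) (s.s x)
    have h9 := congrArg s.s (leibniz_lie x y z)
    rw [← lie_skew x ⁅y, z⁆, ← lie_skew y ⁅x, z⁆, map_add, map_neg, map_neg] at h9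
    simp only [Submodule.coe_neg, Submodule.coe_add, Submodule.coe_sub, Submodule.coe_smul,
      coe_c_eq s ⁅_, _⁆, actΩ_eq s, actA_eq s, pairTΩ_eq s, coe_dΩ, s_lie s x y, s_lie s x z,
      s_lie s y z, pairT_apply, map_add, map_sub, map_smul, map_neg, LinearMap.add_apply,
      LinearMap.sub_apply, LinearMap.smul_apply, h1, h2, h3, h4, h5,
      v.d_res11, v.d_pair, res01_eq, two_zsmul, v.pair_comm (s.s x) (s.c _ _),
      v.pair_comm (s.s y) (s.c _ _), v.pair_comm (s.s z) (s.c _ _), v.pair_comm (s.s x) (v.res11 _ _),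
      v.pair_comm (s.s y) (v.res11 _ _), smul_neg, smul_add, smul_sub]
    have e {m : v.V1} : (⅟2 : k) • m + (⅟2 : k) • m = m := VertexAlgebroid.half_add_half m
    linear_combination (norm := module) -hj + h9 -
      e (m := v.d (v.pair (s.c x y) (s.s z))) + e (m := v.d (v.pair (s.c x z) (s.s y))) -
      e (m := v.d (v.pair (s.c y z) (s.s x))) + e (m := v.d (v.pair (v.res11 (s.s x) (s.s z)) (s.s y))) -
      e (m := v.d (v.pair (v.res11 (s.s y) (s.s z)) (s.s x))) +
      (⅟2 : k) • e (m := v.d (v.res10 (s.s x) (v.pair (s.s y) (s.s z)))) -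
      (⅟2 : k) • e (m := v.d (v.res10 (s.s y) (v.pair (s.s x) (s.s z)))))

end Splitting

end TruncVA

namespace TruncVA

variable {k : Type u} [CommRing k]

/-- A bijective morphism of `1`-truncated vertex algebras is an isomorphism. -/
def isoOfInv {v w : TruncVA k} (f : v ⟶ w) (g0 : w.V0 →ₗ[k] v.V0) (g1 : w.V1 →ₗ[k] v.V1)
    (h0 : ∀ a, g0 (f.f0 a) = a) (h0' : ∀ a, f.f0 (g0 a) = a)
    (h1 : ∀ x, g1 (f.f1 x) = x) (h1' : ∀ x, f.f1 (g1 x) = x) : v ≅ w where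
  hom := f
  inv :=
    { f0 := g0
      f1 := g1
      map_vac := by rw [← f.map_vac, h0]
      map_d := fun a => by rw [← h1 (v.d _), f.map_d, h0']
      map_mul := fun a b => by rw [← h0 (v.mul _ _), f.map_mul, h0', h0']
      map_lmul := fun a x => by rw [← h1 (v.lmul _ _), f.map_lmul, h0', h1']
      map_rmul := fun x a => by rw [← h1 (v.rmul _ _), f.map_rmul, h0', h1']
      map_res01 := fun a x => by rw [← h0 (v.res01 _ _), f.map_res01, h0', h1']
      map_res10 := fun x a => by rw [← h0 (v.res10 _ _), f.map_res10, h0', h1']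
      map_res11 := fun x y => by rw [← h1 (v.res11 _ _), f.map_res11, h1', h1']
      map_pair := fun x y => by rw [← h0 (v.pair _ _), f.map_pair, h1', h1'] }
  hom_inv_id := Hom.ext (LinearMap.ext h0) (LinearMap.ext h1)
  inv_hom_id := Hom.ext (LinearMap.ext h0') (LinearMap.ext h1')

namespace Splitting

variable [Invertible (2 : k)] {v : TruncVA k} (s : v.Splitting)

/-- `x ↦ s(x₁) + x₂` on `T ⊕ Ω`. -/
def sumMap : v.Tan × v.Omega →ₗ[k] v.V1 := LinearMap.coprod s.s v.Omega.subtype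

/-- The inverse of `sumMap`. -/
def sumInv : v.V1 →ₗ[k] v.Tan × v.Omega :=
  LinearMap.prod v.Omega.mkQ
    (LinearMap.codRestrict v.Omega (LinearMap.id - s.s ∘ₗ v.Omega.mkQ) fun x => by
      rw [← Submodule.Quotient.mk_eq_zero, ← Submodule.mkQ_apply, LinearMap.sub_apply, map_sub,
        LinearMap.comp_apply, s.mkQ_s, LinearMap.id_apply, sub_self])

theorem sumMap_apply (x : v.Tan × v.Omega) : s.sumMap x = s.s x.1 + x.2 := rfl

theorem sumInv_fst (x : v.V1) : (s.sumInv x).1 = v.Omega.mkQ x := rfl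

theorem sumInv_snd (x : v.V1) : ((s.sumInv x).2 : v.V1) = x - s.s (v.Omega.mkQ x) := rfl

theorem sumMap_sumInv (x : v.V1) : s.sumMap (s.sumInv x) = x := by
  rw [sumMap_apply, sumInv_snd, sumInv_fst]
  abel

theorem mkQ_sumMap (x : v.Tan × v.Omega) : v.Omega.mkQ (s.sumMap x) = x.1 := by
  rw [sumMap_apply, map_add, s.mkQ_s, Submodule.mkQ_apply,
    (Submodule.Quotient.mk_eq_zero _).mpr x.2.2, add_zero]

theorem sumInv_sumMap (x : v.Tan × v.Omega) : s.sumInv (s.sumMap x) = x := by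
  refine Prod.ext (s.mkQ_sumMap x) (Subtype.ext ?_)
  rw [sumInv_snd, mkQ_sumMap, sumMap_apply]
  abel

theorem res10_sumMap (x : v.Tan × v.Omega) (a : v.V0) :
    v.res10 (s.sumMap x) a = v.anchorT x.1 a := by
  rw [sumMap_apply, map_add, LinearMap.add_apply, Omega_res10 x.2.2, actA_eq s, add_zero]

theorem lmul_sumMap (a : v.V0) (x : v.Tan × v.Omega) :
    v.lmul a (s.sumMap x) = s.sumMap (a • x.1, a • x.2 - s.gamma a x.1) := by
  rw [sumMap_apply, sumMap_apply, map_add]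
  change _ = s.s (a • x.1) + (v.lmul a x.2 - s.gamma a x.1 : v.V1)
  rw [s_smul]
  abel

theorem sumMap_dΩ (a : v.V0) : s.sumMap (0, v.dΩ a) = v.d a := by
  rw [sumMap_apply, map_zero, zero_add, coe_dΩ]

theorem sumMap_add_dΩ (x : v.Tan × v.Omega) (a : v.V0) :
    s.sumMap (x + (0, v.dΩ a)) = s.sumMap x + v.d a := by
  rw [map_add, sumMap_dΩ]

theorem res11_sumMap (x y : v.Tan × v.Omega) :
    v.res11 (s.sumMap x) (s.sumMap y) = s.sumMap (⁅x.1, y.1⁆,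
      -s.c x.1 y.1 + (⅟2 : k) • v.dΩ (s.pairT x.1 y.1) + v.actΩ x.1 y.2 - v.actΩ y.1 x.2 +
        v.dΩ (v.pairTΩ y.1 x.2)) := by
  obtain ⟨τ, ω⟩ := x
  obtain ⟨ν, ω'⟩ := y
  simp only [sumMap_apply, map_add, LinearMap.add_apply, Submodule.coe_add, Submodule.coe_sub,
    Submodule.coe_neg, Submodule.coe_smul, coe_dΩ, s_lie, Omega_res11_Omega ω.2 ω'.2, actΩ_eq s,
    pairTΩ_eq s, pairT_apply]
  rw [v.res11_eq (ω : v.V1) (s.s ν)]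
  abel

theorem pair_sumMap (x y : v.Tan × v.Omega) : v.pair (s.sumMap x) (s.sumMap y) =
    s.pairT x.1 y.1 + v.pairTΩ x.1 y.2 + v.pairTΩ y.1 x.2 := by
  obtain ⟨τ, ω⟩ := x
  obtain ⟨ν, ω'⟩ := y
  simp only [sumMap_apply, map_add, LinearMap.add_apply, Omega_pair_Omega ω.2 ω'.2, pairTΩ_eq s,
    pairT_apply]
  rw [v.pair_comm (ω : v.V1) (s.s ν)]
  abel

/-- The morphism `u𝒜(v; s) → v`, which is `s` on `T` and the inclusion on `Ω`. -/
def fromAlgebroid : s.toAlgebroid.toTrunc ⟶ v where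
  f0 := LinearMap.id (M := v.V0)
  f1 := s.sumMap
  map_vac := rfl
  map_d a := s.sumMap_dΩ a
  map_mul _ _ := rfl
  map_lmul a x := (s.lmul_sumMap a x).symm
  map_rmul x a := by
    refine (s.sumMap_add_dΩ _ _).trans ?_
    rw [rmul_eq]
    refine congrArg₂ _ (s.lmul_sumMap a x).symm (congrArg v.d (s.res10_sumMap x a).symm)
  map_res01 a x := (congrArg Neg.neg (s.res10_sumMap x a).symm).trans (res01_eq _ _).symm
  map_res10 x a := (s.res10_sumMap x a).symm
  map_res11 x y := (s.res11_sumMap x y).symm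
  map_pair x y := (s.pair_sumMap x y).symm

/-- The canonical isomorphism `u𝒜(v; s) ≅ v`. -/
def algebroidIso : s.toAlgebroid.toTrunc ≅ v :=
  isoOfInv s.fromAlgebroid (LinearMap.id (M := v.V0)) s.sumInv (fun _ => rfl) (fun _ => rfl)
    s.sumInv_sumMap s.sumMap_sumInv

end Splitting

end TruncVA

namespace VertexAlgebroid

variable {k : Type u} [CommRing k] [Invertible (2 : k)]

/-- Morphisms `𝒜 → ℬ` of vertex algebroids: morphisms `g : u𝒜 → uℬ` with `g(Ω) ⊆ Ω'`. -/
@[ext]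
structure Hom (𝒜 ℬ : VertexAlgebroid k) where
  hom : 𝒜.toTrunc ⟶ ℬ.toTrunc
  map_Ω : ∀ x : 𝒜.T × 𝒜.Ω, x.1 = 0 → (hom.f1 x : ℬ.T × ℬ.Ω).1 = 0

instance : Category (VertexAlgebroid k) where
  Hom := Hom
  id 𝒜 := ⟨𝟙 _, fun _ h => h⟩
  comp {𝒜 ℬ 𝒞} f g := Hom.mk (𝒜 := 𝒜) (ℬ := 𝒞) (f.hom ≫ g.hom) fun x h =>
    g.map_Ω (f.hom.f1 x) (f.map_Ω x h)

variable (k) in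
/-- The functor `𝒜 ↦ u𝒜` to `1`-truncated vertex algebras. -/
def toTruncFunctor : VertexAlgebroid k ⥤ TruncVA k where
  obj 𝒜 := 𝒜.toTrunc
  map f := f.hom

variable (k) in
/-- The vertex algebroids for which `Ω` is generated by `∂A` as an `A`-module. -/
def isSurjective : ObjectProperty (VertexAlgebroid k) :=
  fun 𝒜 => Submodule.span 𝒜.A (Set.range 𝒜.d) = ⊤

end VertexAlgebroid

namespace VertexAlgebra

variable {k : Type u} [CommRing k]

variable (k) in
/-- Splittable vertex algebras: the projection `V₁ → T = V₁/Ω` has a `k`-linear section. -/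
def isSplittable : ObjectProperty (VertexAlgebra k) := fun V => Nonempty V.trunc.Splitting

variable [Invertible (2 : k)]

theorem toAlgebroid_isSurjective {v : TruncVA k} (s : v.Splitting) :
    VertexAlgebroid.isSurjective k s.toAlgebroid := by
  rw [VertexAlgebroid.isSurjective, eq_top_iff]
  rintro ⟨x, hx⟩ -
  change _ ∈ Submodule.span v.V0 (Set.range v.dΩ)
  induction hx using TruncVA.Omega_induction with
  | h a b =>
    exact Submodule.smul_mem (Submodule.span v.V0 (Set.range v.dΩ)) a
      (Submodule.subset_span (Set.mem_range_self b))
  | h0 => exact zero_mem _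
  | hadd x y hx hy h h' => exact add_mem h h'
  | hsmul t x hx h =>
    have e : (⟨t • x, Submodule.smul_mem _ t hx⟩ : v.Omega) =
        algebraMap k v.V0 t • ⟨x, hx⟩ := by
      rw [algebraMap_smul]
      rfl
    rw [e]
    exact Submodule.smul_mem _ _ h

theorem map_Omega {v w : TruncVA k} (f : v ⟶ w) {x : v.V1} (h : x ∈ v.Omega) :
    f.f1 x ∈ w.Omega := by
  induction h using TruncVA.Omega_induction with
  | h a b => rw [f.map_lmul, f.map_d]; exact TruncVA.lmul_d_mem _ _
  | h0 => simp
  | hadd x y _ _ hx hy => rw [map_add]; exact add_mem hx hy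
  | hsmul t x _ hx => rw [map_smul]; exact Submodule.smul_mem _ _ hx

/-- The morphism `𝒜(v; s) → 𝒜(w; s')` given by a morphism `v → w`. -/
def algebroidMap {v w : TruncVA k} (s : v.Splitting) (s' : w.Splitting) (f : v ⟶ w) :
    s.toAlgebroid ⟶ s'.toAlgebroid :=
  VertexAlgebroid.Hom.mk (s.algebroidIso.hom ≫ f ≫ s'.algebroidIso.inv) fun x h => by
    obtain ⟨τ, ω⟩ := x
    have h' : τ = 0 := h
    subst h'
    refine (Submodule.Quotient.mk_eq_zero w.Omega).mpr (map_Omega f ?_)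
    change s.sumMap ((0 : v.Tan), (ω : v.Omega)) ∈ v.Omega
    rw [s.sumMap_apply, map_zero, zero_add]
    exact (ω : v.Omega).2

theorem algebroidMap_id {v : TruncVA k} (s : v.Splitting) : algebroidMap s s (𝟙 v) = 𝟙 _ := by
  apply VertexAlgebroid.Hom.ext
  change s.algebroidIso.hom ≫ 𝟙 v ≫ s.algebroidIso.inv = 𝟙 _
  rw [Category.id_comp, Iso.hom_inv_id]

theorem algebroidMap_comp {u v w : TruncVA k} (r : u.Splitting) (s : v.Splitting)
    (t : w.Splitting) (f : u ⟶ v) (g : v ⟶ w) :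
    algebroidMap r t (f ≫ g) = algebroidMap r s f ≫ algebroidMap s t g := by
  apply VertexAlgebroid.Hom.ext
  change r.algebroidIso.hom ≫ (f ≫ g) ≫ t.algebroidIso.inv = (r.algebroidIso.hom ≫ f ≫
    s.algebroidIso.inv) ≫ s.algebroidIso.hom ≫ g ≫ t.algebroidIso.inv
  simp only [Category.assoc, Iso.inv_hom_id_assoc]

/-- The functor `V ↦ 𝒜(V; s)` from splittable vertex algebras to vertex algebroids (all of which
satisfy `isSurjective`), for a choice of a splitting of every splittable vertex algebra. A morphism
`f` goes to its truncation to weights `≤ 1`, under the identifications `u𝒜(V; s) ≅ V_{≤ 1}`. -/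
def algebroidFunctor (s : ∀ V : (isSplittable k).FullSubcategory, V.obj.trunc.Splitting) :
    (isSplittable k).FullSubcategory ⥤ (VertexAlgebroid.isSurjective k).FullSubcategory where
  obj V := ⟨(s V).toAlgebroid, toAlgebroid_isSurjective _⟩
  map {V W} f := ObjectProperty.homMk (algebroidMap (s V) (s W) ((truncFunctor k).map f.hom))
  map_id V := ObjectProperty.hom_ext _ (algebroidMap_id (s V))
  map_comp {V W X} f g := by
    apply ObjectProperty.hom_ext
    have h := (truncFunctor k).map_comp f.hom g.hom
    exact (congrArg (algebroidMap (s V) (s X)) h).trans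
      (algebroidMap_comp (s V) (s W) (s X) _ _)

end VertexAlgebra

/-- A `ℤ≥0`-graded conformal algebra over `k`: `der j` is `∂⁽ʲ⁾` and `prod n a b` is `a₍ₙ₎b`. The
sum in the commutativity axiom is finite, since the `n`-th product has degree `-n-1`. -/
structure ConformalAlgebra (k : Type u) [CommRing k] extends GrMod k where
  der : ℕ → carrier →ₗ[k] carrier
  der_mem : ∀ (j i : ℕ) (a : carrier), a ∈ gr i → der j a ∈ gr (i + j)
  der_zero : ∀ a, der 0 a = a
  der_der : ∀ (i j : ℕ) (a : carrier), der i (der j a) = (i + j).choose i • der (i + j) a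
  prod : ℕ → carrier →ₗ[k] carrier →ₗ[k] carrier
  prod_mem : ∀ (n i j : ℕ) (a b : carrier), a ∈ gr i → b ∈ gr j →
    prod n a b ∈ toGrMod.wt ((i : ℤ) + j - n - 1)
  der_prod : ∀ (i n : ℕ) (a b : carrier),
    prod n (der i a) b = ((-1) ^ i * n.choose i : ℤ) • prod (n - i) a b
  prod_comm : ∀ (n : ℕ) (a b : carrier),
    prod n a b = (-1 : ℤ) ^ (n + 1) • ∑ᶠ j : ℕ, (-1 : ℤ) ^ j • der j (prod (n + j) b a)
  prod_assoc : ∀ (m n : ℕ) (a b c : carrier), prod m a (prod n b c) = prod n b (prod m a c) +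
    ∑ j ∈ Finset.range (m + 1), m.choose j • prod (m + n - j) (prod j a b) c

/-- Data presenting `C` as the conformal algebra freely generated by the `1`-truncated conformal
algebra underlying `v`. As a `k`-module, `C` is generated by symbols `∂⁽ⁱ⁾a`, `∂⁽ⁱ⁾x` with `a ∈ V₀`,
`x ∈ V₁`, which are `k`-linear in `a` and `x`, subject to the relations
`(i + 1) ∂⁽ⁱ⁺¹⁾a = ∂⁽ⁱ⁾(∂a)` only; the operations of `C` extend those of `v`. -/
structure ConformalHull {k : Type u} [CommRing k] (v : TruncVA k) (C : ConformalAlgebra k) where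
  j0 : v.V0 →ₗ[k] C.carrier
  j1 : v.V1 →ₗ[k] C.carrier
  j0_mem : ∀ a, j0 a ∈ C.gr 0
  j1_mem : ∀ x, j1 x ∈ C.gr 1
  pres_surjective : Function.Surjective
    (LinearMap.coprod (Finsupp.lsum k fun i : ℕ => C.der i ∘ₗ j0)
      (Finsupp.lsum k fun i : ℕ => C.der i ∘ₗ j1))
  ker_pres : LinearMap.ker
    (LinearMap.coprod (Finsupp.lsum k fun i : ℕ => C.der i ∘ₗ j0)
      (Finsupp.lsum k fun i : ℕ => C.der i ∘ₗ j1)) =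
    Submodule.span k {z : (ℕ →₀ v.V0) × (ℕ →₀ v.V1) | ∃ (i : ℕ) (a : v.V0),
      z = ((i + 1) • Finsupp.single (i + 1) a, -Finsupp.single i (v.d a))}
  res01 : ∀ a x, C.prod 0 (j0 a) (j1 x) = j0 (v.res01 a x)
  res10 : ∀ x a, C.prod 0 (j1 x) (j0 a) = j0 (v.res10 x a)
  res11 : ∀ x y, C.prod 0 (j1 x) (j1 y) = j1 (v.res11 x y)
  pair : ∀ x y, C.prod 1 (j1 x) (j1 y) = j0 (v.pair x y)

namespace ConformalAlgebra

variable {k : Type u} [CommRing k] (C : ConformalAlgebra k)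

/-- The operators `∂⁽ʲ⁾` on the tensor algebra of `C`: they extend those of `C` so that
`∂⁽ʲ⁾(xy) = ∑ₚ ∂⁽ᵖ⁾x · ∂⁽ʲ⁻ᵖ⁾y`, i.e. such that `z ↦ ∑ⱼ ∂⁽ʲ⁾z Xʲ` is an algebra homomorphism. -/
noncomputable def tder (j : ℕ) :
    TensorAlgebra k C.carrier →ₗ[k] TensorAlgebra k C.carrier :=
  ((PowerSeries.coeff (R := TensorAlgebra k C.carrier) j).restrictScalars k) ∘ₗ
    (TensorAlgebra.lift k (A := PowerSeries (TensorAlgebra k C.carrier))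
      { toFun := fun x => PowerSeries.mk fun i => TensorAlgebra.ι k (C.der i x)
        map_add' := fun x y => by ext; simp
        map_smul' := fun t x => by ext; simp }).toLinearMap

@[simp]
theorem tder_ι (j : ℕ) (x : C.carrier) :
    C.tder j (TensorAlgebra.ι k x) = TensorAlgebra.ι k (C.der j x) := by
  simp [tder]

theorem tder_mul (j : ℕ) (x y : TensorAlgebra k C.carrier) :
    C.tder j (x * y) = ∑ p ∈ Finset.HasAntidiagonal.antidiagonal j, C.tder p.1 x * C.tder p.2 y := by
  simp [tder, PowerSeries.coeff_mul]

/-- The elements `xy - yx - ∑ⱼ (-1)ʲ ∂⁽ʲ⁺¹⁾(x₍ⱼ₎y)` of the tensor algebra. -/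
noncomputable def rel (x y : C.carrier) : TensorAlgebra k C.carrier :=
  TensorAlgebra.ι k x * TensorAlgebra.ι k y - TensorAlgebra.ι k y * TensorAlgebra.ι k x -
    TensorAlgebra.ι k (∑ᶠ j : ℕ, (-1 : ℤ) ^ j • C.der (j + 1) (C.prod j x y))

end ConformalAlgebra

/-- Data presenting the vertex algebra `W` as the vertex envelope `UC` of `C`: as a `k`-module it is
the quotient `p` of the tensor algebra by the two-sided ideal generated by the elements `rel x y`,
the vacuum is the class of `1`, one has `p(xz) = i(x)₍₋₁₎p(z)` for `x ∈ C`, where `i(x) = p(x)`, and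
`i : C → W` is a morphism of conformal algebras. -/
structure ConformalEnvelope {k : Type u} [CommRing k] (C : ConformalAlgebra k)
    (W : VertexAlgebra k) where
  p : TensorAlgebra k C.carrier →ₗ[k] W.carrier
  p_surjective : Function.Surjective p
  p_eq_zero : ∀ z, p z = 0 ↔ z ∈ TwoSidedIdeal.span {r | ∃ x y, r = C.rel x y}
  p_one : p 1 = W.vac
  p_mul : ∀ (x : C.carrier) (z : TensorAlgebra k C.carrier),
    p (TensorAlgebra.ι k x * z) = W.prod (-1) (p (TensorAlgebra.ι k x)) (p z)
  p_mem : ∀ (n : ℕ) (x : C.carrier), x ∈ C.gr n → p (TensorAlgebra.ι k x) ∈ W.gr n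
  p_der : ∀ (j : ℕ) (x : C.carrier),
    p (TensorAlgebra.ι k (C.der j x)) = W.der j (p (TensorAlgebra.ι k x))
  p_prod : ∀ (n : ℕ) (x y : C.carrier), p (TensorAlgebra.ι k (C.prod n x y)) =
    W.prod n (p (TensorAlgebra.ι k x)) (p (TensorAlgebra.ι k y))

namespace ConformalHull

variable {k : Type u} [CommRing k] {v : TruncVA k} {C : ConformalAlgebra k} (h : ConformalHull v C)

/-- The left `∂`-ideal of the tensor algebra of `C` (a left ideal closed under all `∂⁽ʲ⁾`) generated
by the elements `(1_A - 1)u`, `a·b - ab` and `a·x - a₍₋₁₎x`, where `1_A` is the vacuum of `v`,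
`a, b ∈ V₀`, `x ∈ V₁`. When `v = u𝒜`, the elements of the last kind are
`a·ω - aω` for `ω ∈ Ω`, and `a·τ - aτ + γ(a, τ)` for `τ ∈ T`. -/
noncomputable def relIdeal : Ideal (TensorAlgebra k C.carrier) :=
  sInf {I | (∀ u, (TensorAlgebra.ι k (h.j0 v.vac) - 1) * u ∈ I) ∧
    (∀ a b, TensorAlgebra.ι k (h.j0 a) * TensorAlgebra.ι k (h.j0 b) -
      TensorAlgebra.ι k (h.j0 (v.mul a b)) ∈ I) ∧
    (∀ a x, TensorAlgebra.ι k (h.j0 a) * TensorAlgebra.ι k (h.j1 x) -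
      TensorAlgebra.ι k (h.j1 (v.lmul a x)) ∈ I) ∧
    ∀ (j : ℕ), ∀ z ∈ I, C.tder j z ∈ I}

end ConformalHull

/-- Data presenting the vertex algebra `V` as the vertex envelope `U𝒜` of the vertex algebroid `𝒜`:
`C` is the conformal algebra of `𝒜`, `W` is its vertex envelope `UC`, and `q` presents `V` as the
quotient of `UC` by the image of the left `∂`-ideal `relIdeal`. -/
structure VertexEnvelope {k : Type u} [CommRing k] [Invertible (2 : k)] (𝒜 : VertexAlgebroid k)
    (V : VertexAlgebra k) where
  C : ConformalAlgebra k
  hull : ConformalHull 𝒜.toTrunc C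
  W : VertexAlgebra k
  env : ConformalEnvelope C W
  q : W ⟶ V
  q_surjective : Function.Surjective q.toLin
  ker_q : LinearMap.ker q.toLin = (hull.relIdeal.restrictScalars k).map env.p

namespace VertexEnvelope

variable {k : Type u} [CommRing k] [Invertible (2 : k)] {𝒜 : VertexAlgebroid k}
  {V : VertexAlgebra k} (E : VertexEnvelope 𝒜 V)

/-- The canonical map `A → U𝒜`. -/
noncomputable def can0 (a : 𝒜.A) : V.carrier :=
  E.q.toLin (E.env.p (TensorAlgebra.ι k (E.hull.j0 a)))

/-- The canonical map `T ⊕ Ω → U𝒜`. -/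
noncomputable def can1 (x : 𝒜.T × 𝒜.Ω) : V.carrier :=
  E.q.toLin (E.env.p (TensorAlgebra.ι k (E.hull.j1 x)))

end VertexEnvelope

/-! Everything is built for an arbitrary `1`-truncated vertex algebra `v`; vertex algebroids enter
only at the end, with `v = u𝒜`.

The central object is the Lie algebra `L` of modes `u_m` (`u` in `V₀` or `V₁`, `m ∈ ℤ`), with
`(∂a)_m = -m a_{m-1}` and the commutator formula as bracket; its Jacobi identity `Modes.br_br` is a
restatement of the axioms of `v`. The modes with `m ≥ 0` form a subalgebra `L₊`, those with `m < 0`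
another one. The conformal algebra `C` is, as a module, `L/L₊`, via `u_{-1-i} ↦ ∂⁽ⁱ⁾u`, and its
products come from the action of `L₊` on this quotient. The relations of `UC` then say that `UC` is
the enveloping algebra of the Lie algebra of negative modes. It carries the `L`-module structure
induced from `L₊` acting trivially on `1` (`Env.act`), constructed directly without a
Poincaré–Birkhoff–Witt theorem.

The vertex algebra structure on `UC` is the reconstruction theorem: a module generated from a vacuum
by mutually local, translation covariant fields is a vertex algebra. A field is determined by its
value on the vacuum (`FieldSystem.ev_injective`), Dong's lemma `Fields.Local.nprod` provides a field
for every state, and the Borcherds identity for local fields is the Taylor expansion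
`eq_finsum_of_dif` of a distribution killed by a power of `z - w`.

The image of `R` is an ideal of the vertex algebra as soon as the modes of `L` preserve it
(`Env.act_mem_relIdeal`). Modulo left multiplications only `L₊` matters, and on the generating
relations it acts through the axioms relating `₍₋₁₎` to `₍₀₎` and `₍₁₎`. The quotient is the
envelope. A morphism `v → V_{≤1}` makes `V` an `L`-module whose vacuum is killed by `L₊`; applying
`UC` to the vacuum gives the map `UC → V`, which kills `R`. Uniqueness holds because `v` generates
the envelope.

For the adjunction, the point is that the envelope does not change weights `0` and `1`
(`Env.unitIso`). Nothing new appears, because the relations reduce every product of weight at most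
`1` to an element of `v`; nothing collapses, because `UC` acts on `V₀ × V₁` compatibly with `R`. So
`(U𝒜)₁` is `T ⊕ Ω`, and if `Ω` is generated by `∂A` then `Ω(U𝒜) = Ω`, so that the inclusion of `T`
is a splitting. Since `u𝒜(V; s) ≅ V_{≤1}`, and since over such `𝒜` every morphism of truncations
preserves `Ω`, the universal property becomes the adjunction. -/

/-! ### Sequences that vanish from some point on -/

/-- A sequence with only finitely many nonzero terms. -/
def EvZero {M : Type*} [Zero M] (f : ℕ → M) : Prop := ∃ N, ∀ j, N ≤ j → f j = 0

namespace EvZero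

variable {M N : Type*} [AddCommGroup M] [AddCommGroup N] {f g : ℕ → M}

theorem support_finite (h : EvZero f) : (Function.support f).Finite := by
  obtain ⟨n, hn⟩ := h
  refine (Finset.range n).finite_toSet.subset fun j hj => ?_
  by_contra hc
  exact hj (hn j (by simpa using hc))

/-- Splitting off the first term is what lets Pascal's rule run through the infinite sums below.
Finiteness matters: a `finsum` with infinite support is `0` by convention. -/
theorem finsum_succ (h : EvZero f) : ∑ᶠ j, f j = f 0 + ∑ᶠ j, f (j + 1) := by
  obtain ⟨n, hn⟩ := h
  have key (f : ℕ → M) (n : ℕ) (hn : ∀ j, n ≤ j → f j = 0) :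
      ∑ᶠ j, f j = ∑ j ∈ Finset.range n, f j := by
    apply finsum_eq_sum_of_support_subset
    intro j hj
    by_contra hc
    exact hj (hn j (by simpa using hc))
  rw [key f (n + 1) fun j hj => hn j (by omega), key _ n fun j hj => hn (j + 1) (by omega),
    Finset.sum_range_succ', add_comm]

theorem finsum_add (h : EvZero f) (h' : EvZero g) :
    ∑ᶠ j, (f j + g j) = ∑ᶠ j, f j + ∑ᶠ j, g j :=
  finsum_add_distrib h.support_finite h'.support_finite

theorem finsum_sub (h : EvZero f) (h' : EvZero g) :
    ∑ᶠ j, (f j - g j) = ∑ᶠ j, f j - ∑ᶠ j, g j :=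
  finsum_sub_distrib h.support_finite h'.support_finite

theorem map_finsum (h : EvZero f) (φ : M →+ N) : φ (∑ᶠ j, f j) = ∑ᶠ j, φ (f j) :=
  φ.map_finsum h.support_finite

theorem smul (h : EvZero f) (c : ℕ → ℤ) : EvZero fun j => c j • f j := by
  obtain ⟨n, hn⟩ := h
  exact ⟨n, fun j hj => by simp [hn j hj]⟩

theorem add (h : EvZero f) (h' : EvZero g) : EvZero fun j => f j + g j := by
  obtain ⟨n, hn⟩ := h
  obtain ⟨m, hm⟩ := h'
  exact ⟨max n m, fun j hj => by
    simp [hn j (le_trans (le_max_left _ _) hj), hm j (le_trans (le_max_right _ _) hj)]⟩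

theorem map (h : EvZero f) (φ : M →+ N) : EvZero fun j => φ (f j) := by
  obtain ⟨n, hn⟩ := h
  exact ⟨n, fun j hj => by simp [hn j hj]⟩

theorem shift (h : EvZero f) (i : ℕ) : EvZero fun j => f (j + i) := by
  obtain ⟨n, hn⟩ := h
  exact ⟨n, fun j hj => hn _ (by omega)⟩

theorem finsum_shift (h : EvZero f) (i : ℕ) (h0 : ∀ j < i, f j = 0) :
    ∑ᶠ j, f j = ∑ᶠ j, f (j + i) := by
  induction i with
  | zero => rfl
  | succ i ih =>
    rw [ih fun j hj => h0 j (by omega), (h.shift i).finsum_succ, zero_add, h0 i (by omega),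
      zero_add]
    refine finsum_congr fun j => ?_
    congr 1
    omega

end EvZero

/-! ### Expansion of `(z - w) ^ n` times a doubly infinite distribution -/

section Expansion

variable {M N : Type*} [AddCommGroup M] [AddCommGroup N]

/-- The double sequence vanishes for large second index, uniformly in the first one. -/
def RightBounded (f : ℤ → ℤ → M) : Prop := ∃ L : ℤ, ∀ l, L ≤ l → ∀ m, f m l = 0

/-- Multiplication by `z - w` on the coefficients of a two-variable distribution. -/
def dif (f : ℤ → ℤ → M) : ℤ → ℤ → M := fun m l => f (m + 1) l - f m (l + 1)

/-- Multiplication by `(z - w) ^ n`, expanded in `|z| > |w|`. -/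
noncomputable def expand (n : ℤ) (f : ℤ → ℤ → M) (m l : ℤ) : M :=
  ∑ᶠ j : ℕ, ((-1) ^ j * Ring.choose n j : ℤ) • f (m + n - j) (l + j)

namespace RightBounded

variable {f g : ℤ → ℤ → M}

theorem evZero (h : RightBounded f) (m : ℕ → ℤ) (l : ℤ) : EvZero fun j : ℕ => f (m j) (l + j) := by
  obtain ⟨L, hL⟩ := h
  exact ⟨(L - l).toNat, fun j hj => hL _ (by omega) _⟩

theorem add (h : RightBounded f) (h' : RightBounded g) :
    RightBounded fun m l => f m l + g m l := by
  obtain ⟨L, hL⟩ := h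
  obtain ⟨L', hL'⟩ := h'
  exact ⟨max L L', fun l hl m => by
    simp [hL l (le_trans (le_max_left _ _) hl), hL' l (le_trans (le_max_right _ _) hl)]⟩

theorem sub (h : RightBounded f) (h' : RightBounded g) :
    RightBounded fun m l => f m l - g m l := by
  obtain ⟨L, hL⟩ := h
  obtain ⟨L', hL'⟩ := h'
  exact ⟨max L L', fun l hl m => by
    simp [hL l (le_trans (le_max_left _ _) hl), hL' l (le_trans (le_max_right _ _) hl)]⟩

theorem map (h : RightBounded f) (φ : M →+ N) : RightBounded fun m l => φ (f m l) := by
  obtain ⟨L, hL⟩ := h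
  exact ⟨L, fun l hl m => by simp [hL l hl]⟩

theorem shift (h : RightBounded f) (s t : ℤ) : RightBounded fun m l => f (m + s) (l + t) := by
  obtain ⟨L, hL⟩ := h
  exact ⟨L - t, fun l hl m => hL _ (by omega) _⟩

theorem zero : RightBounded fun _ _ => (0 : M) := ⟨0, fun _ _ _ => rfl⟩

theorem sum {ι : Type*} (s : Finset ι) {F : ι → ℤ → ℤ → M} (h : ∀ i, RightBounded (F i)) :
    RightBounded fun m l => ∑ i ∈ s, F i m l := by
  classical
  induction s using Finset.induction_on with
  | empty => simpa using zero
  | insert i s hi ih => simpa only [Finset.sum_insert hi] using (h i).add ih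

theorem expand_term (h : RightBounded f) (n m l : ℤ) :
    EvZero fun j : ℕ => ((-1) ^ j * Ring.choose n j : ℤ) • f (m + n - j) (l + j) :=
  (h.evZero _ l).smul _

theorem expand_add (h : RightBounded f) (h' : RightBounded g) (n m l : ℤ) :
    expand n (fun m l => f m l + g m l) m l = expand n f m l + expand n g m l := by
  simp only [expand, smul_add]
  exact (h.expand_term n m l).finsum_add (h'.expand_term n m l)

theorem expand_sub (h : RightBounded f) (h' : RightBounded g) (n m l : ℤ) :
    expand n (fun m l => f m l - g m l) m l = expand n f m l - expand n g m l := by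
  simp only [expand, smul_sub]
  exact (h.expand_term n m l).finsum_sub (h'.expand_term n m l)

theorem expand_sum {ι : Type*} (s : Finset ι) {F : ι → ℤ → ℤ → M} (h : ∀ i, RightBounded (F i))
    (n m l : ℤ) :
    expand n (fun m l => ∑ i ∈ s, F i m l) m l = ∑ i ∈ s, expand n (F i) m l := by
  classical
  induction s using Finset.induction_on with
  | empty => simp [expand]
  | insert i s hi ih =>
    simp only [Finset.sum_insert hi]
    rw [(h i).expand_add (sum s h), ih]

theorem map_expand (h : RightBounded f) (φ : M →+ N) (n m l : ℤ) :
    φ (expand n f m l) = expand n (fun m l => φ (f m l)) m l := by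
  simp only [expand]
  rw [(h.expand_term n m l).map_finsum φ]
  simp only [map_zsmul]

theorem expand_bounded (h : RightBounded f) (n : ℤ) : RightBounded (expand n f) := by
  obtain ⟨L, hL⟩ := h
  refine ⟨L, fun l hl m => ?_⟩
  exact finsum_eq_zero_of_forall_eq_zero fun j => by rw [hL _ (by omega), smul_zero]

/-- This is `(z - w)^(n+1) = (z - w) (z - w)^n`; on coefficients it is Pascal's rule for `(-1)ʲ C(n,
j)`. -/
theorem expand_succ (h : RightBounded f) (n m l : ℤ) :
    expand (n + 1) f m l = _root_.dif (expand n f) m l := by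
  simp only [_root_.dif, expand]
  rw [(h.expand_term (n + 1) m l).finsum_succ, (h.expand_term n (m + 1) l).finsum_succ,
    add_sub_assoc (_ • f _ _),
    ← EvZero.finsum_sub ((h.expand_term n (m + 1) l).shift 1) (h.expand_term n m (l + 1))]
  congr 1
  · simp only [Ring.choose_zero_right]
    congr 2
    push_cast; ring
  · refine finsum_congr fun j => ?_
    have e1 : m + (n + 1) - ((j + 1 : ℕ) : ℤ) = m + n - j := by push_cast; ring
    have e2 : m + 1 + n - ((j + 1 : ℕ) : ℤ) = m + n - j := by push_cast; ring
    have e3 : l + ((j + 1 : ℕ) : ℤ) = l + 1 + j := by push_cast; ring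
    rw [e1, e2, e3, ← sub_smul, Ring.choose_succ_succ, pow_succ]
    congr 1
    ring

end RightBounded

theorem expand_zero (f : ℤ → ℤ → M) (m l : ℤ) : expand 0 f m l = f m l := by
  rw [expand, finsum_eq_single _ 0]
  · simp
  · intro j hj
    obtain ⟨i, rfl⟩ := Nat.exists_eq_succ_of_ne_zero hj
    simp [Ring.choose_zero_succ]

/-- The Taylor expansion of a distribution annihilated by a power of `z - w`. -/
theorem eq_finsum_of_dif (G : ℤ → ℤ → ℤ → M)
    (hs : ∀ n m l, G (n + 1) m l = G n (m + 1) l - G n m (l + 1)) {N : ℤ}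
    (hN : ∀ n, N ≤ n → ∀ m l, G n m l = 0) (n m l : ℤ) :
    ∑ᶠ j : ℕ, Ring.choose m j • G (n + j) 0 (m + l - j) = G n m l := by
  have hz (n m l : ℤ) : EvZero fun j : ℕ => Ring.choose m j • G (n + j) 0 (m + l - j) :=
    ⟨(N - n).toNat, fun j hj => by beta_reduce; rw [hN _ (by omega), smul_zero]⟩
  -- By Pascal's rule the sums satisfy the same recursion in `n`, `m`, `l` as `G` does by `hs`.
  have hS (n m l : ℤ) : ∑ᶠ j : ℕ, Ring.choose (m + 1) j • G (n + j) 0 (m + 1 + l - j) =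
      ∑ᶠ j : ℕ, Ring.choose m j • G (n + j) 0 (m + (l + 1) - j) +
        ∑ᶠ j : ℕ, Ring.choose m j • G (n + 1 + j) 0 (m + l - j) := by
    rw [(hz n (m + 1) l).finsum_succ, (hz n m (l + 1)).finsum_succ, add_assoc (_ • G _ _ _),
      ← EvZero.finsum_add ((hz n m (l + 1)).shift 1) (hz (n + 1) m l)]
    congr 1
    · simp only [Ring.choose_zero_right]
      congr 2; ring
    · refine finsum_congr fun j => ?_
      have e1 : n + ((j + 1 : ℕ) : ℤ) = n + 1 + j := by push_cast; ring
      have e2 : m + 1 + l - ((j + 1 : ℕ) : ℤ) = m + l - j := by push_cast; ring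
      have e3 : m + (l + 1) - ((j + 1 : ℕ) : ℤ) = m + l - j := by push_cast; ring
      rw [e1, e2, e3, ← add_smul, Ring.choose_succ_succ, add_comm]
  -- Descending induction on `n`: for `n ≥ N` both sides vanish. If the formula holds at `n + 1`,
  -- the difference of the two sides at `n` is unchanged under `(m, l + 1) ↦ (m + 1, l)`, and at `m
  -- = 0` it vanishes because only `j = 0` contributes.
  have key (t : ℕ) : ∀ n, N ≤ n + t → ∀ m l,
      ∑ᶠ j : ℕ, Ring.choose m j • G (n + j) 0 (m + l - j) = G n m l := by
    induction t with
    | zero =>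
      intro n hn m l
      rw [hN n (by simpa using hn)]
      exact finsum_eq_zero_of_forall_eq_zero fun j => by
        rw [hN _ (by push_cast at hn; omega), smul_zero]
    | succ t ih =>
      intro n hn m
      have h1 := ih (n + 1) (by push_cast at hn; omega)
      have step (m l : ℤ) : ∑ᶠ j : ℕ, Ring.choose (m + 1) j • G (n + j) 0 (m + 1 + l - j) -
          G n (m + 1) l = ∑ᶠ j : ℕ, Ring.choose m j • G (n + j) 0 (m + (l + 1) - j) -
          G n m (l + 1) := by
        rw [hS, h1, hs]
        abel
      induction m using Int.induction_on with
      | zero =>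
        intro l
        rw [finsum_eq_single _ 0]
        · simp
        · intro j hj
          obtain ⟨i, rfl⟩ := Nat.exists_eq_succ_of_ne_zero hj
          simp [Ring.choose_zero_succ]
      | succ m ih =>
        intro l
        rw [← sub_eq_zero, step, ih, sub_self]
      | pred m ih =>
        intro l
        have := step (-m - 1) (l - 1)
        rw [sub_add_cancel, sub_add_cancel, ih, sub_self] at this
        rw [← sub_eq_zero, ← this]
  exact key (N - n).toNat n (by omega) m l

/-- A distribution annihilated by a power of `z - w` and bounded in `z` vanishes. -/
theorem eq_zero_of_iterate_dif (N : ℕ) : ∀ f : ℤ → ℤ → M, (∀ m l, dif^[N] f m l = 0) →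
    (∃ K : ℤ, ∀ m, K ≤ m → ∀ l, f m l = 0) → ∀ m l, f m l = 0 := by
  induction N with
  | zero => exact fun f h _ => h
  | succ N ih =>
    intro f h ⟨K, hK⟩
    have hd : ∀ m l, dif f m l = 0 := ih (dif f) h
      ⟨K, fun m hm l => by simp [dif, hK m hm, hK (m + 1) (by omega)]⟩
    -- A distribution killed by `z - w` has coefficients depending only on `m + l`, so each of them
    -- can be moved to a first index beyond the bound `K`.
    have key (t : ℕ) : ∀ m l, f m l = f (m + t) (l - t) := by
      induction t with
      | zero => simp
      | succ t ih =>
        intro m l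
        rw [ih]
        have := sub_eq_zero.mp (hd (m + t) (l - t - 1))
        rw [sub_add_cancel] at this
        rw [← this]
        congr 1 <;> push_cast <;> ring
    intro m l
    rw [key (K - m).toNat]
    exact hK _ (by omega) _

end Expansion

/-! ### Fields on a module, their products, and locality -/

section Fields

variable (k : Type*) [CommRing k] (W : Type*) [AddCommGroup W] [Module k W]

/-- The module of fields on `W`: sequences `A` of endomorphisms such that `A n v = 0` for `n ≫ 0`. -/
def Fields : Submodule k (ℤ → Module.End k W) where
  carrier := {A | ∀ v, ∃ N : ℤ, ∀ n, N ≤ n → A n v = 0}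
  add_mem' {A B} hA hB v := by
    obtain ⟨N, hN⟩ := hA v
    obtain ⟨N', hN'⟩ := hB v
    exact ⟨max N N', fun n hn => by
      simp [hN n (le_trans (le_max_left _ _) hn), hN' n (le_trans (le_max_right _ _) hn)]⟩
  zero_mem' v := ⟨0, fun _ _ => rfl⟩
  smul_mem' t A hA v := by
    obtain ⟨N, hN⟩ := hA v
    exact ⟨N, fun n hn => by simp [hN n hn]⟩

namespace Fields

variable {k W}

theorem bounded (A B : Fields k W) (v : W) : RightBounded fun m l => A.1 m (B.1 l v) := by
  obtain ⟨N, hN⟩ := B.2 v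
  exact ⟨N, fun l hl m => by simp [hN l hl]⟩

/-- The coefficients of `(z - w) ^ n A(z) B(w) - (z - w) ^ n B(w) A(z)`, where the two powers are
expanded in `|z| > |w|` and in `|w| > |z|` respectively. -/
noncomputable def bracket (n : ℤ) (A B : Fields k W) (m l : ℤ) (v : W) : W :=
  expand n (fun m l => A.1 m (B.1 l v)) m l -
    (n.negOnePow : ℤ) • expand n (fun l m => B.1 l (A.1 m v)) l m

variable (A B C : Fields k W)

theorem bracket_zero (m l : ℤ) (v : W) :
    bracket 0 A B m l v = A.1 m (B.1 l v) - B.1 l (A.1 m v) := by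
  simp [bracket, expand_zero]

/-- Apply `expand_succ` to both expansions. In the second one the variables are exchanged, which
changes the sign of `z - w`; the factor `n.negOnePow` compensates for this. -/
theorem bracket_succ (n m l : ℤ) (v : W) :
    bracket (n + 1) A B m l v = bracket n A B (m + 1) l v - bracket n A B m (l + 1) v := by
  simp only [bracket]
  rw [(bounded A B v).expand_succ, (bounded B A v).expand_succ, Int.negOnePow_succ]
  simp only [dif, Units.val_neg, neg_smul, smul_sub]
  abel

theorem bracket_swap (n m l : ℤ) (v : W) :
    bracket n B A l m v = -(n.negOnePow : ℤ) • bracket n A B m l v := by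
  simp only [bracket, smul_sub, smul_smul, neg_mul, neg_smul]
  have : (n.negOnePow : ℤ) * n.negOnePow = 1 := by
    rw [← Units.val_mul]
    simp
  rw [this, one_smul]
  abel

theorem bracket_add (n m l : ℤ) (v w : W) :
    bracket n A B m l (v + w) = bracket n A B m l v + bracket n A B m l w := by
  simp only [bracket, map_add]
  rw [(bounded A B v).expand_add (bounded A B w), (bounded B A v).expand_add (bounded B A w),
    smul_add]
  abel

theorem bracket_smul (n m l : ℤ) (t : k) (v : W) :
    bracket n A B m l (t • v) = t • bracket n A B m l v := by
  have h (f : ℤ → ℤ → W) (hf : RightBounded f) (n m l : ℤ) :=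
    hf.map_expand (DistribSMul.toAddMonoidHom W t) n m l
  simp only [DistribSMul.toAddMonoidHom_apply] at h
  simp only [bracket, map_smul]
  rw [← h _ (bounded A B v), ← h _ (bounded B A v), smul_sub, smul_comm t]

/-- This makes the products of fields into fields. The first expansion is bounded in `l` uniformly.
In the second one `A_{m+j} v = 0` for all but finitely many `j`, and each remaining term vanishes
for large `l` because `B` is a field. -/
theorem bracket_bounded (n : ℤ) (m : ℤ) (v : W) :
    ∃ L : ℤ, ∀ l, L ≤ l → bracket n A B m l v = 0 := by
  obtain ⟨L, hL⟩ := (bounded A B v).expand_bounded n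
  obtain ⟨J, hJ⟩ := A.2 v
  have h (j : ℕ) : ∃ K : ℤ, ∀ l, K ≤ l → B.1 (l + n - j) (A.1 (m + j) v) = 0 := by
    obtain ⟨K, hK⟩ := B.2 (A.1 (m + j) v)
    exact ⟨K - n + j, fun l hl => hK _ (by omega)⟩
  choose K hK using h
  obtain ⟨K', hK'⟩ : ∃ K' : ℤ, ∀ j ∈ Finset.range (J - m).toNat, K j ≤ K' := by
    obtain ⟨b, hb⟩ := ((Finset.range (J - m).toNat).image K).bddAbove
    exact ⟨b, fun j hj => hb (by simpa using ⟨j, by simpa using hj, rfl⟩)⟩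
  refine ⟨max L K', fun l hl => ?_⟩
  have h0 : expand n (fun l m => B.1 l (A.1 m v)) l m = 0 := by
    refine finsum_eq_zero_of_forall_eq_zero fun j => ?_
    beta_reduce
    by_cases hj : j < (J - m).toNat
    · rw [hK j _ ((hK' j (by simpa using hj)).trans ((le_max_right _ _).trans hl)), smul_zero]
    · rw [hJ _ (by omega), map_zero, smul_zero]
  rw [bracket, hL _ ((le_max_left _ _).trans hl), h0]
  simp

/-- The `n`-th product of fields. -/
noncomputable def nprod (n : ℤ) : Fields k W :=
  ⟨fun l =>
    { toFun := fun v => bracket n A B 0 l v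
      map_add' := bracket_add A B n 0 l
      map_smul' := bracket_smul A B n 0 l }, bracket_bounded A B n 0⟩

theorem nprod_apply (n l : ℤ) (v : W) : (nprod A B n).1 l v = bracket n A B 0 l v := rfl

/-- Mutual locality of fields. -/
def Local : Prop := ∃ N : ℕ, ∀ m l v, bracket N A B m l v = 0

variable {A B C}

theorem Local.symm (h : Local A B) : Local B A := by
  obtain ⟨N, hN⟩ := h
  exact ⟨N, fun m l v => by rw [bracket_swap, hN, smul_zero]⟩

theorem bracket_eq_zero_of_le {N : ℤ} (hN : ∀ m l v, bracket N A B m l v = 0) {n : ℤ}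
    (hn : N ≤ n) : ∀ m l v, bracket n A B m l v = 0 := by
  induction n, hn using Int.leInduction with
  | base => exact hN
  | succ n _ ih => exact fun m l v => by rw [bracket_succ, ih, ih, sub_zero]

/-- The Borcherds identity for mutually local fields. -/
theorem Local.borcherds (h : Local A B) (m n l : ℤ) (v : W) :
    ∑ᶠ j : ℕ, Ring.choose m j • (nprod A B (n + j)).1 (m + l - j) v = bracket n A B m l v := by
  obtain ⟨N, hN⟩ := h
  -- In the exponent `n` the brackets satisfy the recursion `bracket_succ` and vanish from some
  -- point on by locality; their coefficients with `m = 0` are by definition the products of fields.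
  exact eq_finsum_of_dif (fun n m l => bracket n A B m l v) (fun n m l => bracket_succ A B n m l v)
    (fun n hn m l => bracket_eq_zero_of_le hN hn m l v) n m l

theorem bracket_add_left (A A' B : Fields k W) (n m l : ℤ) (v : W) :
    bracket n (A + A') B m l v = bracket n A B m l v + bracket n A' B m l v := by
  simp only [bracket, Submodule.coe_add, Pi.add_apply, LinearMap.add_apply, map_add]
  rw [(bounded A B v).expand_add (bounded A' B v), (bounded B A v).expand_add (bounded B A' v),
    smul_add]
  abel

theorem bracket_smul_left (t : k) (A B : Fields k W) (n m l : ℤ) (v : W) :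
    bracket n (t • A) B m l v = t • bracket n A B m l v := by
  have h (f : ℤ → ℤ → W) (hf : RightBounded f) (n m l : ℤ) :=
    hf.map_expand (DistribSMul.toAddMonoidHom W t) n m l
  simp only [DistribSMul.toAddMonoidHom_apply] at h
  simp only [bracket, Submodule.coe_smul, Pi.smul_apply, LinearMap.smul_apply, map_smul]
  rw [← h _ (bounded A B v), ← h _ (bounded B A v), smul_sub, smul_comm t]

theorem Local.add_left {A' : Fields k W} (h : Local A B) (h' : Local A' B) : Local (A + A') B := by
  obtain ⟨N, hN⟩ := h
  obtain ⟨N', hN'⟩ := h'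
  refine ⟨max N N', fun m l v => ?_⟩
  rw [bracket_add_left, bracket_eq_zero_of_le hN (by simp), bracket_eq_zero_of_le hN' (by simp),
    add_zero]

theorem Local.smul_left (t : k) (h : Local A B) : Local (t • A) B := by
  obtain ⟨N, hN⟩ := h
  exact ⟨N, fun m l v => by rw [bracket_smul_left, hN, smul_zero]⟩

variable (B) in
theorem Local.zero_left : Local (0 : Fields k W) B :=
  ⟨0, fun m l v => by simp [bracket_zero]⟩

/-- The fields that are local to a given field. -/
def localTo (B : Fields k W) : Submodule k (Fields k W) where
  carrier := {A | Local A B}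
  add_mem' h h' := h.add_left h'
  zero_mem' := Local.zero_left B
  smul_mem' t _ h := h.smul_left t

-- Locality thus means that a power of `z - w` kills the commutator; in this form it can be treated
-- by the calculus of iterated differences.
variable (A B) in
theorem iterate_dif (N : ℕ) (v : W) :
    dif^[N] (fun m l => A.1 m (B.1 l v) - B.1 l (A.1 m v)) = fun m l => bracket N A B m l v := by
  induction N with
  | zero => ext m l; simp [bracket_zero]
  | succ N ih =>
    rw [Function.iterate_succ_apply', ih]
    ext m l
    simp only [dif, Nat.cast_succ, bracket_succ]

theorem local_of_iterate_dif {N : ℕ}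
    (h : ∀ v m l, dif^[N] (fun m l => A.1 m (B.1 l v) - B.1 l (A.1 m v)) m l = 0) : Local A B :=
  ⟨N, fun m l v => by rw [← h v m l, iterate_dif]⟩

end Fields

end Fields

/-! ### Dong's lemma -/

section Dong

variable (M : Type*) [AddCommGroup M]

/-- Multiplication by `u - z` on three-variable distributions. -/
def dif₁₂ : Module.End ℤ (ℤ → ℤ → ℤ → M) where
  toFun f p m l := f (p + 1) m l - f p (m + 1) l
  map_add' f g := by ext p m l; simp; abel
  map_smul' t f := by ext p m l; simp [smul_sub]

/-- Multiplication by `z - w` on three-variable distributions. -/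
def dif₂₃ : Module.End ℤ (ℤ → ℤ → ℤ → M) where
  toFun f p m l := f p (m + 1) l - f p m (l + 1)
  map_add' f g := by ext p m l; simp; abel
  map_smul' t f := by ext p m l; simp [smul_sub]

/-- Multiplication by `u - w` on three-variable distributions. -/
def dif₁₃ : Module.End ℤ (ℤ → ℤ → ℤ → M) where
  toFun f p m l := f (p + 1) m l - f p m (l + 1)
  map_add' f g := by ext p m l; simp; abel
  map_smul' t f := by ext p m l; simp [smul_sub]

theorem dif₁₂_add_dif₂₃ : dif₁₂ M + dif₂₃ M = (dif₁₃ M : Module.End ℤ (ℤ → ℤ → ℤ → M)) := by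
  ext f p m l
  simp [dif₁₂, dif₂₃, dif₁₃]

theorem dif₁₂_comm_dif₂₃ : Commute (dif₁₂ M : Module.End ℤ (ℤ → ℤ → ℤ → M)) (dif₂₃ M) := by
  ext f p m l
  simp [dif₁₂, dif₂₃]
  abel

theorem dif₁₂_comm_dif₁₃ : Commute (dif₁₂ M : Module.End ℤ (ℤ → ℤ → ℤ → M)) (dif₁₃ M) := by
  ext f p m l
  simp [dif₁₂, dif₁₃]
  abel

/-- Every monomial of degree `s + t` in the commuting operators `a`, `b` contains `a ^ s` or `b ^
t`. The induction peels off one factor `a + b`, which lowers `s` or `t` by one. -/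
theorem add_pow_apply_eq_zero {R : Type*} [Ring R] [Module R M] {a b : R} (h : Commute a b)
    (s t : ℕ) : ∀ g : M, a ^ s • g = 0 → b ^ t • g = 0 → (a + b) ^ (s + t) • g = 0 := by
  induction hn : s + t generalizing s t with
  | zero =>
    intro g hs _
    obtain rfl : s = 0 := by omega
    simpa using hs
  | succ n ih =>
    intro g hs ht
    rw [pow_succ, mul_smul, add_smul, smul_add]
    rcases s with _ | s
    · rw [pow_zero, one_smul] at hs
      simp [hs]
    rcases t with _ | t
    · rw [pow_zero, one_smul] at ht
      simp [ht]
    rw [ih s (t + 1) (by omega) (a • g) (by rwa [← mul_smul, ← pow_succ])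
      (by rw [← mul_smul, ← (h.pow_right _).eq, mul_smul, ht, smul_zero]),
      ih (s + 1) t (by omega) (b • g)
      (by rw [← mul_smul, (h.pow_left _).eq, mul_smul, hs, smul_zero])
      (by rwa [← mul_smul, ← pow_succ]), add_zero]

variable {M}

/-- Dong's trick: `u - w = (u - z) + (z - w)`. One block `(u - w)^r` is kept; in the remaining `(u -
w)^(r+t)` each monomial contains `(u - z)^r`, which kills `f` together with the kept block, or `(z -
w)^t`, which kills `f` alone. -/
theorem dif₁₃_pow_eq_zero {f : ℤ → ℤ → ℤ → M} {r t : ℕ}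
    (h : (dif₁₂ M ^ r * dif₁₃ M ^ r) f = 0) (h' : (dif₂₃ M ^ t) f = 0) :
    (dif₁₃ M ^ (r + t + r)) f = 0 := by
  have c : Commute (dif₂₃ M) (dif₁₃ M) := by
    rw [← dif₁₂_add_dif₂₃ M]
    exact (dif₁₂_comm_dif₂₃ M).symm.add_right (Commute.refl _)
  rw [pow_add, ← dif₁₂_add_dif₂₃ M]
  refine add_pow_apply_eq_zero _ (dif₁₂_comm_dif₂₃ M) r t _ ?_ ?_
  · rw [dif₁₂_add_dif₂₃ M]
    exact h
  · rw [dif₁₂_add_dif₂₃ M]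
    change (dif₂₃ M ^ t * dif₁₃ M ^ r) f = 0
    rw [(c.pow_pow t r).eq, Module.End.mul_apply, h', map_zero]

/-- Interchange of the last two variables. -/
def swap₂₃ (f : ℤ → ℤ → ℤ → M) : ℤ → ℤ → ℤ → M := fun p l m => f p m l

theorem swap₂₃_dif₁₂_pow (r : ℕ) (f : ℤ → ℤ → ℤ → M) :
    (dif₁₃ M ^ r) (swap₂₃ f) = swap₂₃ ((dif₁₂ M ^ r) f) := by
  induction r generalizing f with
  | zero => rfl
  | succ r ih => 
    rw [pow_succ, pow_succ, Module.End.mul_apply, Module.End.mul_apply, ← ih]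
    rfl

theorem swap₂₃_dif₁₃_pow (r : ℕ) (f : ℤ → ℤ → ℤ → M) :
    (dif₁₂ M ^ r) (swap₂₃ f) = swap₂₃ ((dif₁₃ M ^ r) f) := by
  induction r generalizing f with
  | zero => rfl
  | succ r ih => 
    rw [pow_succ, pow_succ, Module.End.mul_apply, Module.End.mul_apply, ← ih]
    rfl

/-- Multiplication by `u - z` and `u - w` only shifts indices and subtracts, so it commutes with the
expansion of `(z - w)^n`. The boundedness is what makes that expansion additive. -/
theorem dif₁₂_dif₁₃_expand (n : ℤ) {f : ℤ → ℤ → ℤ → M} (hf : ∀ p, RightBounded (f p)) (r s : ℕ) :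
    (dif₁₂ M ^ r * dif₁₃ M ^ s) (fun p m l => expand n (f p) m l) =
      fun p m l => expand n ((dif₁₂ M ^ r * dif₁₃ M ^ s) f p) m l := by
  have h12 (f : ℤ → ℤ → ℤ → M) (hf : ∀ p, RightBounded (f p)) :
      dif₁₂ M (fun p m l => expand n (f p) m l) = fun p m l => expand n (dif₁₂ M f p) m l := by
    ext p m l
    change expand n (f (p + 1)) m l - expand n (f p) (m + 1) l =
      expand n (fun m l => f (p + 1) m l - f p (m + 1) l) m l
    have := (hf p).shift 1 0
    simp only [add_zero] at this
    rw [(hf (p + 1)).expand_sub this]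
    congr 1
    refine finsum_congr fun j => ?_
    congr 2
    ring
  have h13 (f : ℤ → ℤ → ℤ → M) (hf : ∀ p, RightBounded (f p)) :
      dif₁₃ M (fun p m l => expand n (f p) m l) = fun p m l => expand n (dif₁₃ M f p) m l := by
    ext p m l
    change expand n (f (p + 1)) m l - expand n (f p) m (l + 1) =
      expand n (fun m l => f (p + 1) m l - f p m (l + 1)) m l
    have := (hf p).shift 0 1
    simp only [add_zero] at this
    rw [(hf (p + 1)).expand_sub this]
    congr 1
    refine finsum_congr fun j => ?_
    congr 2
    ring
  have b12 (f : ℤ → ℤ → ℤ → M) (hf : ∀ p, RightBounded (f p)) (p : ℤ) :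
      RightBounded (dif₁₂ M f p) := by
    have := (hf p).shift 1 0
    simp only [add_zero] at this
    exact (hf (p + 1)).sub this
  have b13 (f : ℤ → ℤ → ℤ → M) (hf : ∀ p, RightBounded (f p)) (p : ℤ) :
      RightBounded (dif₁₃ M f p) := by
    have := (hf p).shift 0 1
    simp only [add_zero] at this
    exact (hf (p + 1)).sub this
  induction s generalizing f with
  | zero =>
    simp only [pow_zero, mul_one]
    induction r generalizing f with
    | zero => rfl
    | succ r ih =>
      rw [pow_succ, Module.End.mul_apply, h12 f hf, ih (b12 f hf)]
      rfl
  | succ s ih =>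
    rw [pow_succ, ← mul_assoc, Module.End.mul_apply, h13 f hf, ih (b13 f hf)]
    rfl

end Dong

namespace Fields

variable {k : Type*} [CommRing k] {W : Type*} [AddCommGroup W] [Module k W] {A B C : Fields k W}

theorem dif₁₂_pow_bracket (r : ℕ) (φ : ℤ → W) :
    (dif₁₂ W ^ r) (fun p m l => bracket 0 A B p m (φ l)) =
      fun p m l => bracket r A B p m (φ l) := by
  induction r with
  | zero => rfl
  | succ r ih =>
    rw [pow_succ', Module.End.mul_apply, ih]
    ext p m l
    rw [Nat.cast_succ, bracket_succ]
    rfl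

theorem dif₁₃_pow_bracket (r : ℕ) (φ : ℤ → Module.End k W) (v : W) :
    (dif₁₃ W ^ r) (fun p m l => φ m (bracket 0 A B p l v)) =
      fun p m l => φ m (bracket r A B p l v) := by
  induction r with
  | zero => rfl
  | succ r ih =>
    rw [pow_succ', Module.End.mul_apply, ih]
    ext p m l
    rw [Nat.cast_succ, bracket_succ, map_sub]
    rfl

/-- By the Leibniz rule `[C, AB] = [C, A]B + A[C, B]`; the factor `(u - z)^r` kills the first term
and `(u - w)^r` the second. -/
theorem dif_commutator_eq_zero {r : ℕ} (hA : ∀ p m v, bracket r C A p m v = 0)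
    (hB : ∀ p m v, bracket r C B p m v = 0) (v : W) :
    (dif₁₂ W ^ r * dif₁₃ W ^ r)
      (fun p m l => C.1 p (A.1 m (B.1 l v)) - A.1 m (B.1 l (C.1 p v))) = 0 := by
  have e : (fun p m l => C.1 p (A.1 m (B.1 l v)) - A.1 m (B.1 l (C.1 p v))) =
      (fun p m l => bracket 0 C A p m (B.1 l v)) + fun p m l => A.1 m (bracket 0 C B p l v) := by
    ext p m l
    simp only [Pi.add_apply, bracket_zero, map_sub]
    abel
  rw [e, map_add]
  have h1 : (dif₁₂ W ^ r * dif₁₃ W ^ r) (fun p m l => bracket 0 C A p m (B.1 l v)) = 0 := by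
    rw [((dif₁₂_comm_dif₁₃ W).pow_pow r r).eq, Module.End.mul_apply, dif₁₂_pow_bracket]
    convert map_zero (dif₁₃ W ^ r)
    exact hA _ _ _
  have h2 : (dif₁₂ W ^ r * dif₁₃ W ^ r) (fun p m l => A.1 m (bracket 0 C B p l v)) = 0 := by
    rw [Module.End.mul_apply, dif₁₃_pow_bracket]
    convert map_zero (dif₁₂ W ^ r)
    rw [hB, map_zero]
    rfl
  rw [h1, h2, add_zero]

/-- Dong's lemma. -/
theorem Local.nprod (hAB : Local A B) (hCA : Local C A) (hCB : Local C B) (n : ℤ) :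
    Local C (nprod A B n) := by
  obtain ⟨N, hN⟩ := hAB
  obtain ⟨r₁, h₁⟩ := hCA
  obtain ⟨r₂, h₂⟩ := hCB
  set r := max r₁ r₂
  have hA : ∀ p m v, bracket r C A p m v = 0 := bracket_eq_zero_of_le h₁ (by simp [r])
  have hB : ∀ p m v, bracket r C B p m v = 0 := bracket_eq_zero_of_le h₂ (by simp [r])
  -- Multiplication by `(z - w)^t` raises the exponent `n` to at least `N`, where the bracket of `A`
  -- and `B` vanishes.
  let t := (N - n).toNat
  -- The three-variable distribution `[C(u), (z - w)^n [A(z), B(w)]]`, with the two expansions of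
  -- the power. Its coefficients with `m = 0` are the commutators of `C` with the `n`-th product.
  let H (n : ℤ) (v : W) : ℤ → ℤ → ℤ → W := fun p m l =>
    C.1 p (bracket n A B m l v) - bracket n A B m l (C.1 p v)
  have hβ (v : W) (t : ℕ) : (dif₂₃ W ^ t) (H n v) = H (n + t) v := by
    induction t with
    | zero => simp
    | succ t ih =>
      rw [pow_succ', Module.End.mul_apply, ih]
      ext p m l
      simp only [H, Nat.cast_succ, ← add_assoc, bracket_succ, map_sub]
      change C.1 p _ - _ - (C.1 p _ - _) = _
      abel
  have hb (A B : Fields k W) (v : W) (p : ℤ) : RightBounded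
      fun m l => C.1 p (A.1 m (B.1 l v)) - A.1 m (B.1 l (C.1 p v)) :=
    ((bounded A B v).map (C.1 p).toAddMonoidHom).sub (bounded A B (C.1 p v))
  have hH (v : W) : H n v = (fun p m l => expand n
        (fun m l => C.1 p (A.1 m (B.1 l v)) - A.1 m (B.1 l (C.1 p v))) m l) -
      (n.negOnePow : ℤ) • swap₂₃ (fun p l m => expand n
        (fun l m => C.1 p (B.1 l (A.1 m v)) - B.1 l (A.1 m (C.1 p v))) l m) := by
    ext p m l
    simp only [H, bracket, Pi.sub_apply, Pi.smul_apply, swap₂₃, map_sub, map_zsmul]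
    have e1 := (bounded A B v).map_expand (C.1 p).toAddMonoidHom n m l
    have e2 := (bounded B A v).map_expand (C.1 p).toAddMonoidHom n l m
    have e3 := ((bounded A B v).map (C.1 p).toAddMonoidHom).expand_sub (bounded A B (C.1 p v)) n m l
    have e4 := ((bounded B A v).map (C.1 p).toAddMonoidHom).expand_sub (bounded B A (C.1 p v)) n l m
    simp only [LinearMap.toAddMonoidHom_coe] at e1 e2 e3 e4
    rw [e1, e2, e3, e4, smul_sub]
    abel
  have hz (v : W) : (dif₁₂ W ^ r * dif₁₃ W ^ r) (H n v) = 0 := by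
    rw [hH, map_sub, map_zsmul, dif₁₂_dif₁₃_expand n (hb A B v), dif_commutator_eq_zero hA hB v,
      Module.End.mul_apply, swap₂₃_dif₁₂_pow, swap₂₃_dif₁₃_pow, ← Module.End.mul_apply,
      ← ((dif₁₂_comm_dif₁₃ W).pow_pow r r).eq, dif₁₂_dif₁₃_expand n (hb B A v),
      dif_commutator_eq_zero hB hA v]
    ext p m l
    simp [expand, swap₂₃]
  refine local_of_iterate_dif (N := r + t + r) fun v p l => ?_
  have key := dif₁₃_pow_eq_zero (hz v) (t := t) (by
    rw [hβ]
    ext p m l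
    have h0 := bracket_eq_zero_of_le hN (n := n + t) (by omega)
    simp [H, h0])
  -- Multiplication by `u - w` does not touch the index `m` of `z`, so it may be carried out on the
  -- slice `m = 0`.
  have hd (s : ℕ) (f : ℤ → ℤ → ℤ → W) (p l : ℤ) :
      dif^[s] (fun p l => f p 0 l) p l = (dif₁₃ W ^ s) f p 0 l := by
    induction s generalizing f with
    | zero => rfl
    | succ s ih =>
      rw [Function.iterate_succ_apply, pow_succ, Module.End.mul_apply, ← ih]
      rfl
  exact (hd _ (H n v) p l).trans (congrFun (congrFun (congrFun key p) 0) l)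

end Fields

/-! ### Vertex algebras generated by fields -/

theorem sum_antidiagonal_assoc {M : Type*} [AddCommMonoid M] (n : ℕ) (f : ℕ → ℕ → ℕ → M) :
    ∑ p ∈ Finset.HasAntidiagonal.antidiagonal n,
      ∑ q ∈ Finset.HasAntidiagonal.antidiagonal p.1, f q.1 q.2 p.2 =
    ∑ p ∈ Finset.HasAntidiagonal.antidiagonal n,
      ∑ q ∈ Finset.HasAntidiagonal.antidiagonal p.2, f p.1 q.1 q.2 := by
  simp only [Finset.sum_sigma']
  refine Finset.sum_nbij' (fun s => ⟨(s.2.1, s.2.2 + s.1.2), (s.2.2, s.1.2)⟩)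
    (fun s => ⟨(s.1.1 + s.2.1, s.2.2), (s.1.1, s.2.1)⟩) ?_ ?_ ?_ ?_ ?_
  all_goals
    rintro ⟨⟨a, b⟩, ⟨c, d⟩⟩ h
    simp only [Finset.mem_sigma, Finset.HasAntidiagonal.mem_antidiagonal] at h
  · simp; omega
  · simp; omega
  · obtain ⟨-, h⟩ := h
    subst h
    rfl
  · obtain ⟨-, h⟩ := h
    subst h
    rfl
  · rfl

/-! ### Iterated differences and divided power derivatives of local fields -/

theorem dif_iterate_zero {M : Type*} [AddCommGroup M] (N : ℕ) :
    dif^[N] (fun _ _ => (0 : M)) = fun _ _ => 0 := by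
  induction N with
  | zero => rfl
  | succ N ih =>
    rw [Function.iterate_succ_apply]
    convert ih using 2
    ext m l
    simp [dif]

theorem dif_iterate_add {M : Type*} [AddCommGroup M] (N : ℕ) (f g : ℤ → ℤ → M) :
    dif^[N] (f + g) = dif^[N] f + dif^[N] g := by
  induction N generalizing f g with
  | zero => rfl
  | succ N ih =>
    rw [Function.iterate_succ_apply, Function.iterate_succ_apply, Function.iterate_succ_apply, ← ih]
    congr 1
    ext m l
    simp [dif]
    abel

theorem dif_iterate_shift {M : Type*} [AddCommGroup M] (N : ℕ) (f : ℤ → ℤ → M) (s : ℤ) :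
    dif^[N] (fun m l => f (m + s) l) = fun m l => dif^[N] f (m + s) l := by
  induction N generalizing f with
  | zero => rfl
  | succ N ih =>
    rw [Function.iterate_succ_apply, Function.iterate_succ_apply, ← ih]
    congr 1
    ext m l
    simp only [dif]
    rw [add_right_comm]

theorem dif_iterate_zsmul {M : Type*} [AddCommGroup M] (N : ℕ) (c : ℤ) (f : ℤ → ℤ → M) :
    dif^[N] (fun m l => c • f m l) = fun m l => c • dif^[N] f m l := by
  induction N generalizing f with
  | zero => rfl
  | succ N ih =>
    rw [Function.iterate_succ_apply, Function.iterate_succ_apply, ← ih]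
    congr 1
    ext m l
    simp only [dif, smul_sub]

/-- The factor `C(m, i)` behaves like a derivative of order `i` and costs `i` further powers of `z -
w`. By Pascal's rule one factor `z - w` either acts on `f`, lowering `N`, or lowers `i` at the price
of a shift. -/
theorem dif_iterate_choose {M : Type*} [AddCommGroup M] (N i : ℕ) : ∀ f : ℤ → ℤ → M,
    dif^[N] f = 0 → dif^[N + i] (fun m l => Ring.choose m i • f m l) = 0 := by
  induction hn : N + i generalizing N i with
  | zero =>
    intro f hf
    obtain rfl : N = 0 := by omega
    ext m l
    have : f = 0 := hf
    simp [this]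
  | succ n ih =>
    intro f hf
    rcases N with _ | N
    · have : f = 0 := hf
      subst this
      have h0 : (fun m l => Ring.choose m i • (0 : ℤ → ℤ → M) m l) = fun _ _ => 0 := by
        ext m l
        simp
      rw [h0, dif_iterate_zero]
      rfl
    rcases i with _ | i
    · obtain rfl : n = N := by omega
      simpa using hf
    have e : dif (fun m l => Ring.choose m (i + 1) • f m l) =
        (fun m l => Ring.choose m (i + 1) • dif f m l) +
          fun m l => Ring.choose m i • f (m + 1) l := by
      ext m l
      simp only [dif, Pi.add_apply, Ring.choose_succ_succ, add_smul, smul_sub]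
      abel
    rw [Function.iterate_succ_apply, e, dif_iterate_add, ih N (i + 1) (by omega) _ hf,
      ih (N + 1) i (by omega) (fun m l => f (m + 1) l), add_zero]
    rw [dif_iterate_shift, hf]
    rfl

namespace Fields

variable {k : Type*} [CommRing k] {W : Type*} [AddCommGroup W] [Module k W]

/-- The divided power derivative `(1 / p!) (d / dz) ^ p` of a field. -/
noncomputable def hasse (p : ℕ) (A : Fields k W) : Fields k W :=
  ⟨fun n => ((-1) ^ p * Ring.choose n p : ℤ) • A.1 (n - p), fun v => by
    obtain ⟨N, hN⟩ := A.2 v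
    exact ⟨N + p, fun n hn => by simp [hN (n - p) (by omega)]⟩⟩

theorem hasse_apply (p : ℕ) (A : Fields k W) (n : ℤ) (v : W) :
    (hasse p A).1 n v = ((-1) ^ p * Ring.choose n p : ℤ) • A.1 (n - p) v := rfl

theorem Local.hasse {A B : Fields k W} (h : Local A B) (p : ℕ) : Local (hasse p A) B := by
  obtain ⟨N, hN⟩ := h
  refine local_of_iterate_dif (N := N + p) fun v m l => ?_
  have h0 : dif^[N] (fun m l => (-1 : ℤ) ^ p • bracket 0 A B (m + -p) l v) = 0 := by
    rw [dif_iterate_zsmul, dif_iterate_shift N fun m l => bracket 0 A B m l v]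
    simp only [bracket_zero]
    rw [iterate_dif]
    ext m l
    simp [hN]
  have e : (fun m l => (Fields.hasse p A).1 m (B.1 l v) - B.1 l ((Fields.hasse p A).1 m v)) =
      fun m l => Ring.choose m p • (-1 : ℤ) ^ p • bracket 0 A B (m + -p) l v := by
    ext m l
    rw [hasse_apply, hasse_apply, bracket_zero, map_zsmul, ← smul_sub, smul_smul, mul_comm,
      sub_eq_add_neg m]
  rw [e, dif_iterate_choose N p _ h0]
  rfl

/-- On the vacuum the second expansion vanishes because `A` has only negative modes there, and the
first is finite because `B` does. Its coefficients are those of the divided power derivatives of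
`A`; when `A` is translation covariant, the resulting sum is the Leibniz expansion of `D j` applied
to `A_n (B_{-1} vac)`. -/
theorem expand_left_vac (A B : Fields k W) (D : ℕ → W →ₗ[k] W) (vac : W)
    (hB : ∀ n, 0 ≤ n → B.1 n vac = 0) (hB' : ∀ j : ℕ, B.1 (-1 - j) vac = D j (B.1 (-1) vac))
    (hA : ∀ n, 0 ≤ n → A.1 n vac = 0) (n : ℤ) :
    (∀ l, 0 ≤ l → (nprod A B n).1 l vac = 0) ∧
      ∀ j : ℕ, (nprod A B n).1 (-1 - j) vac =
        ∑ p ∈ Finset.HasAntidiagonal.antidiagonal j,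
          (hasse p.1 A).1 n (D p.2 (B.1 (-1) vac)) := by
  have h0 (l : ℤ) : (nprod A B n).1 l vac =
      ∑ᶠ j : ℕ, ((-1) ^ j * Ring.choose n j : ℤ) • A.1 (n - j) (B.1 (l + j) vac) := by
    have : expand n (fun l m => B.1 l (A.1 m vac)) l 0 = 0 :=
      finsum_eq_zero_of_forall_eq_zero fun j => by
        beta_reduce
        rw [hA _ (by omega), map_zero, smul_zero]
    rw [nprod_apply, bracket, this, smul_zero, sub_zero, expand]
    simp only [zero_add]
  constructor
  · intro l hl
    rw [h0]
    exact finsum_eq_zero_of_forall_eq_zero fun j => by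
      rw [hB _ (by omega), map_zero, smul_zero]
  · intro j
    rw [h0, finsum_eq_sum_of_support_subset (s := Finset.range (j + 1)),
      Finset.Nat.sum_antidiagonal_eq_sum_range_succ_mk]
    · refine Finset.sum_congr rfl fun i hi => ?_
      have : i ≤ j := by simpa [Nat.lt_succ_iff] using hi
      have e : (-1 - j + i : ℤ) = -1 - (j - i : ℕ) := by omega
      rw [← hB', hasse_apply, e]
    · intro i hi
      by_contra hc
      have : j < i := by simpa [Nat.lt_succ_iff] using hc
      exact hi (by beta_reduce; rw [hB _ (by omega), map_zero, smul_zero])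

/-- The Leibniz rule passes from `A` and `B` to their products, `A'` and `B'` playing the role of
the families of derivatives. Boundedness allows `D j` to be applied term by term, and both orders of
composition give the same triple sum up to a permutation of indices. -/
theorem map_bracket (A B : Fields k W) (A' B' : ℕ → Fields k W) (D : ℕ → W →ₗ[k] W)
    (hA : ∀ j n v, D j (A.1 n v) =
      ∑ p ∈ Finset.HasAntidiagonal.antidiagonal j, (A' p.1).1 n (D p.2 v))
    (hB : ∀ j n v, D j (B.1 n v) =
      ∑ p ∈ Finset.HasAntidiagonal.antidiagonal j, (B' p.1).1 n (D p.2 v))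
    (n : ℤ) (j : ℕ) (m l : ℤ) (v : W) :
    D j (bracket n A B m l v) = ∑ p ∈ Finset.HasAntidiagonal.antidiagonal j,
      ∑ q ∈ Finset.HasAntidiagonal.antidiagonal p.1,
        bracket n (A' q.1) (B' q.2) m l (D p.2 v) := by
  have e1 (m l : ℤ) : D j (A.1 m (B.1 l v)) = ∑ p ∈ Finset.HasAntidiagonal.antidiagonal j,
      ∑ q ∈ Finset.HasAntidiagonal.antidiagonal p.1, (A' q.1).1 m ((B' q.2).1 l (D p.2 v)) := by
    rw [sum_antidiagonal_assoc j fun a b c => (A' a).1 m ((B' b).1 l (D c v)), hA]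
    simp only [hB, map_sum]
  have e2 (m l : ℤ) : D j (B.1 l (A.1 m v)) = ∑ p ∈ Finset.HasAntidiagonal.antidiagonal j,
      ∑ q ∈ Finset.HasAntidiagonal.antidiagonal p.1, (B' q.2).1 l ((A' q.1).1 m (D p.2 v)) := by
    have e (n : ℕ) : ∑ q ∈ Finset.HasAntidiagonal.antidiagonal n,
        (fun a b (w : W) => (B' b).1 l ((A' a).1 m w)) q.1 q.2 =
        ∑ q ∈ Finset.HasAntidiagonal.antidiagonal n,
          (fun a b (w : W) => (B' b).1 l ((A' a).1 m w)) q.2 q.1 :=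
      (Finset.Nat.sum_antidiagonal_swap (f := fun q : ℕ × ℕ =>
        (fun a b (w : W) => (B' b).1 l ((A' a).1 m w)) q.1 q.2)).symm
    rw [hB]
    simp only [hA, map_sum]
    rw [← sum_antidiagonal_assoc j fun a b c => (B' a).1 l ((A' b).1 m (D c v))]
    refine Finset.sum_congr rfl fun p _ => ?_
    have := congrFun (e p.1) (D p.2 v)
    simpa [Finset.sum_apply] using this.symm
  rw [bracket, map_sub, map_zsmul]
  have f1 := (bounded A B v).map_expand (D j).toAddMonoidHom n m l
  have f2 := (bounded B A v).map_expand (D j).toAddMonoidHom n l m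
  simp only [LinearMap.toAddMonoidHom_coe] at f1 f2
  rw [f1, f2]
  simp only [e1, e2]
  rw [RightBounded.expand_sum _ (fun p : ℕ × ℕ => RightBounded.sum _ fun q : ℕ × ℕ =>
      bounded (A' q.1) (B' q.2) (D p.2 v)),
    RightBounded.expand_sum _ (fun p : ℕ × ℕ => RightBounded.sum _ fun q : ℕ × ℕ =>
      bounded (B' q.2) (A' q.1) (D p.2 v)), Finset.smul_sum, ← Finset.sum_sub_distrib]
  refine Finset.sum_congr rfl fun p _ => ?_
  rw [RightBounded.expand_sum _ (fun q : ℕ × ℕ => bounded (A' q.1) (B' q.2) (D p.2 v)),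
    RightBounded.expand_sum _ (fun q : ℕ × ℕ => bounded (B' q.2) (A' q.1) (D p.2 v)),
    Finset.smul_sum, ← Finset.sum_sub_distrib]
  rfl

/-- The identity field. -/
def one : Fields k W :=
  ⟨fun n => if n = -1 then 1 else 0, fun v => ⟨0, fun n hn => by
    simp [show n ≠ -1 by omega]⟩⟩

theorem one_apply (n : ℤ) (v : W) : (one : Fields k W).1 n v = if n = -1 then v else 0 := by
  by_cases h : n = -1 <;> simp [one, h]

theorem local_one (A : Fields k W) : Local A one :=
  ⟨0, fun m l v => by
    by_cases h : l = -1 <;> simp [bracket_zero, one_apply, h]⟩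

end Fields

/-- A graded module generated from a vacuum vector by a module `C` of pairwise local,
translation covariant homogeneous fields. -/
structure FieldSystem (k : Type u) [CommRing k] extends GrMod k where
  C : Type u
  [addCommGroupC : AddCommGroup C]
  [moduleC : Module k C]
  grC : ℕ → Submodule k C
  vac : carrier
  fld : C →ₗ[k] Fields k carrier
  derC : ℕ → C →ₗ[k] C
  D : ℕ → carrier →ₗ[k] carrier
  vac_mem : vac ∈ gr 0
  fld_mem : ∀ (x : C) (d : ℕ) (n : ℤ) (j : ℕ) (v : carrier), x ∈ grC d → v ∈ gr j →
    (fld x).1 n v ∈ toGrMod.wt ((d : ℤ) + j - n - 1)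
  span_gr : ∀ S : ℕ → Submodule k carrier, vac ∈ S 0 →
    (∀ (d : ℕ) (x : C) (j : ℕ) (v : carrier), x ∈ grC d → v ∈ S j → (fld x).1 (-1) v ∈ S (d + j)) →
    ∀ n, gr n ≤ S n
  fld_local : ∀ x y, Fields.Local (fld x) (fld y)
  fld_vac : ∀ x n, 0 ≤ n → (fld x).1 n vac = 0
  fld_vac' : ∀ x (j : ℕ), (fld x).1 (-1 - j) vac = D j ((fld x).1 (-1) vac)
  D_zero : ∀ v, D 0 v = v
  D_vac : ∀ j, 0 < j → D j vac = 0
  D_D : ∀ i j v, D i (D j v) = (i + j).choose i • D (i + j) v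
  D_fld : ∀ j x n v, D j ((fld x).1 n v) =
    ∑ p ∈ Finset.HasAntidiagonal.antidiagonal j, (fld (derC p.1 x)).1 n (D p.2 v)
  fld_der : ∀ i x, fld (derC i x) = Fields.hasse i (fld x)

namespace FieldSystem

attribute [instance] addCommGroupC moduleC

variable {k : Type u} [CommRing k] (F : FieldSystem k)

theorem span_eq_top (S : Submodule k F.carrier) (h0 : F.vac ∈ S)
    (h : ∀ x v, v ∈ S → (F.fld x).1 (-1) v ∈ S) : S = ⊤ := by
  rw [eq_top_iff, ← F.isInternal.submodule_iSup_eq_top]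
  exact iSup_le (F.span_gr (fun _ => S) h0 fun _ x _ v _ hv => h x v hv)

/-! ### The correspondence between good fields and states -/

/-- The fields that are local to all generating fields and compatible with the vacuum. -/
def good : Submodule k (Fields k F.carrier) where
  carrier := {A | (∀ x, Fields.Local (F.fld x) A) ∧ (∀ n, 0 ≤ n → A.1 n F.vac = 0) ∧
    ∀ j : ℕ, A.1 (-1 - j) F.vac = F.D j (A.1 (-1) F.vac)}
  add_mem' {A B} hA hB := ⟨fun x => ((hA.1 x).symm.add_left (hB.1 x).symm).symm,
    fun n hn => by simp [hA.2.1 n hn, hB.2.1 n hn], fun j => by simp [hA.2.2 j, hB.2.2 j]⟩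
  zero_mem' := ⟨fun x => (Fields.Local.zero_left _).symm, by simp, by simp⟩
  smul_mem' t A hA := ⟨fun x => ((hA.1 x).symm.smul_left t).symm,
    fun n hn => by simp [hA.2.1 n hn], fun j => by simp [hA.2.2 j]⟩

theorem fld_good (x : F.C) : F.fld x ∈ F.good :=
  ⟨fun y => F.fld_local y x, F.fld_vac x, F.fld_vac' x⟩

theorem one_good : Fields.one ∈ F.good := by
  refine ⟨fun x => Fields.local_one _, fun n hn => ?_, fun j => ?_⟩
  · rw [Fields.one_apply, if_neg (by omega)]
  · rw [Fields.one_apply, Fields.one_apply]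
    rcases j with _ | j
    · simp [F.D_zero]
    · rw [if_neg (by omega), if_pos rfl, F.D_vac _ (by omega)]

/-- The state of a field. -/
def ev : F.good →ₗ[k] F.carrier where
  toFun A := A.1.1 (-1) F.vac
  map_add' A B := rfl
  map_smul' t A := rfl

/-- Goddard's uniqueness argument. If the state of a good field `A` is zero, translation shows that
all modes of `A` kill the vacuum. The vectors killed by all modes of `A` are stable under the
generating fields by locality, hence form the whole space. -/
theorem ev_injective : Function.Injective F.ev := by
  suffices h0 : ∀ A : F.good, A.1.1 (-1) F.vac = 0 → A = 0 from fun A B h =>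
    sub_eq_zero.mp (h0 (A - B) (sub_eq_zero.mpr h))
  rintro ⟨A, hA, hA0, hA1⟩ (h : A.1 (-1) F.vac = 0)
  let S : Submodule k F.carrier :=
    { carrier := {v | ∀ n, A.1 n v = 0}
      add_mem' := fun hv hw n => by rw [map_add, hv, hw, add_zero]
      zero_mem' := fun n => map_zero _
      smul_mem' := fun t v hv n => by rw [map_smul, hv, smul_zero] }
  have hS : S = ⊤ := by
    refine F.span_eq_top S (fun n => ?_) fun x v hv n => ?_
    · rcases le_or_gt 0 n with hn | hn
      · exact hA0 n hn
      · have e : n = -1 - ((-1 - n).toNat : ℕ) := by omega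
        rw [e, hA1, h, map_zero]
    · obtain ⟨N, hN⟩ := hA x
      obtain ⟨K, hK⟩ := (F.fld x).2 v
      -- As `A` kills `v`, the commutator applied to `v` is just `-A(w) x(z) v`. It is killed by a
      -- power of `z - w` and bounded in `z`, so it vanishes.
      have e := eq_zero_of_iterate_dif N (fun m l => -A.1 l ((F.fld x).1 m v)) (fun m l => by
          have := congrFun (congrFun (Fields.iterate_dif (F.fld x) A N v) m) l
          simp only [hN] at this
          rw [← this]
          refine congrFun (congrFun (congrArg (dif^[N]) (funext fun m => funext fun l => ?_)) m) l
          rw [hv l, map_zero, zero_sub])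
        ⟨K, fun m hm l => by rw [hK m hm, map_zero, neg_zero]⟩ (-1) n
      exact neg_eq_zero.mp e
  refine Subtype.ext (Subtype.ext (funext fun n => LinearMap.ext fun v => ?_))
  have : v ∈ S := hS ▸ Submodule.mem_top
  exact this n

/-- Locality is Dong's lemma. The conditions on the vacuum come from `expand_left_vac`, whose sum
is, by covariance of `fld x`, a single application of `D j`. -/
theorem fld_nprod_good (x : F.C) {A : Fields k F.carrier} (hA : A ∈ F.good) (n : ℤ) :
    Fields.nprod (F.fld x) A n ∈ F.good ∧
      (Fields.nprod (F.fld x) A n).1 (-1) F.vac = (F.fld x).1 n (A.1 (-1) F.vac) := by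
  obtain ⟨h0, h1⟩ := Fields.expand_left_vac (F.fld x) A F.D F.vac hA.2.1 hA.2.2 (F.fld_vac x) n
  have hv (j : ℕ) : (Fields.nprod (F.fld x) A n).1 (-1 - j) F.vac =
      F.D j ((F.fld x).1 n (A.1 (-1) F.vac)) := by
    rw [h1, F.D_fld]
    simp only [F.fld_der]
  have hv0 : (Fields.nprod (F.fld x) A n).1 (-1) F.vac = (F.fld x).1 n (A.1 (-1) F.vac) := by
    simpa [F.D_zero] using hv 0
  exact ⟨⟨fun y => (hA.1 x).nprod (F.fld_local y x) (hA.1 y) n, h0, fun j => by rw [hv0, hv]⟩, hv0⟩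

/-- The states of good fields contain the vacuum (identity field) and are stable under the `(-1)`-st
modes of the generating fields by `fld_nprod_good`; such modes generate everything. -/
theorem ev_surjective : Function.Surjective F.ev := by
  have h : LinearMap.range F.ev = ⊤ := by
    refine F.span_eq_top _ ⟨⟨Fields.one, F.one_good⟩, ?_⟩ ?_
    · exact (Fields.one_apply (k := k) (-1) F.vac).trans (if_pos rfl)
    · rintro x _ ⟨⟨A, hA⟩, rfl⟩
      exact ⟨⟨_, (F.fld_nprod_good x hA (-1)).1⟩, (F.fld_nprod_good x hA (-1)).2⟩
  exact fun v => (h ▸ Submodule.mem_top : v ∈ LinearMap.range F.ev)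

/-- The state-field correspondence. -/
noncomputable def Y : F.carrier →ₗ[k] Fields k F.carrier :=
  F.good.subtype ∘ₗ
    (LinearEquiv.ofBijective F.ev ⟨F.ev_injective, F.ev_surjective⟩).symm.toLinearMap

theorem Y_good (u : F.carrier) : F.Y u ∈ F.good := Subtype.coe_prop _

theorem Y_vac (u : F.carrier) : (F.Y u).1 (-1) F.vac = u :=
  (LinearEquiv.ofBijective F.ev ⟨F.ev_injective, F.ev_surjective⟩).apply_symm_apply u

theorem Y_eq {A : Fields k F.carrier} (hA : A ∈ F.good) {u : F.carrier}
    (h : A.1 (-1) F.vac = u) : F.Y u = A := by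
  have : (⟨F.Y u, F.Y_good u⟩ : F.good) = ⟨A, hA⟩ := F.ev_injective ((F.Y_vac u).trans h.symm)
  exact congrArg Subtype.val this

theorem Y_one : F.Y F.vac = Fields.one :=
  F.Y_eq F.one_good ((Fields.one_apply _ _).trans (if_pos rfl))

theorem Y_fld (x : F.C) : F.Y ((F.fld x).1 (-1) F.vac) = F.fld x := F.Y_eq (F.fld_good x) rfl

theorem Y_fld_prod (x : F.C) (n : ℤ) (u : F.carrier) :
    F.Y ((F.fld x).1 n u) = Fields.nprod (F.fld x) (F.Y u) n :=
  F.Y_eq (F.fld_nprod_good x (F.Y_good u) n).1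
    ((F.fld_nprod_good x (F.Y_good u) n).2.trans (by rw [F.Y_vac]))

/-- Good fields are local to the generators only. Locality to `Y v` spreads over all `u` by Dong's
lemma, since `Y` of the vacuum is the identity field and `Y (x₍₋₁₎w)` is a product of fields. -/
theorem Y_local (u v : F.carrier) : Fields.Local (F.Y u) (F.Y v) := by
  have h := F.span_eq_top ((Fields.localTo (F.Y v)).comap F.Y) ?_ ?_
  · have : u ∈ (Fields.localTo (F.Y v)).comap F.Y := h ▸ Submodule.mem_top
    exact this
  · change Fields.Local (F.Y F.vac) _
    rw [Y_one]
    exact (Fields.local_one _).symm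
  · intro x w (hw : Fields.Local (F.Y w) _)
    change Fields.Local (F.Y _) _
    rw [Y_fld_prod]
    exact (((F.Y_good w).1 x).nprod ((F.Y_good v).1 x).symm hw.symm (-1)).symm

/-- By uniqueness it suffices that the derivative of `Y u` is a good field with state `D p u`. -/
theorem Y_D (p : ℕ) (u : F.carrier) : F.Y (F.D p u) = Fields.hasse p (F.Y u) := by
  have h := F.Y_good u
  have e (j : ℕ) : (Fields.hasse p (F.Y u)).1 (-1 - j) F.vac = F.D j (F.D p u) := by
    have e1 : (-1 - j - p : ℤ) = -1 - (j + p : ℕ) := by push_cast; ring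
    -- On the mode `-1 - j` the sign disappears: `(-1)ᵖ C(-1-j, p) = C(j+p, p)`, the coefficient in
    -- `D_D`.
    have e2 : ((-1) ^ p * Ring.choose (-1 - j : ℤ) p : ℤ) = (j + p).choose j := by
      have e3 : (-1 - j : ℤ) = -(j + 1) := by ring
      rw [e3, Ring.choose_neg, Int.negOnePow_def, Units.smul_def, smul_eq_mul, ← mul_assoc]
      have e4 : ((j + 1 + p - 1 : ℤ)) = ((j + p : ℕ) : ℤ) := by push_cast; ring
      rw [e4, Ring.choose_natCast, Nat.choose_symm_add]
      simp [← mul_pow]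
    rw [Fields.hasse_apply, e1, h.2.2, Y_vac, F.D_D, e2, natCast_zsmul]
  refine F.Y_eq ⟨fun x => ((h.1 x).symm.hasse p).symm, fun n hn => ?_, fun j => ?_⟩ ?_
  · rw [Fields.hasse_apply]
    rcases le_or_gt (p : ℤ) n with hp | hp
    · rw [h.2.1 _ (by omega), smul_zero]
    · obtain ⟨n, rfl⟩ := Int.eq_ofNat_of_zero_le hn
      rw [Ring.choose_natCast, Nat.choose_eq_zero_of_lt (by omega)]
      simp
  · have e0 := e 0
    simp only [Nat.cast_zero, sub_zero, F.D_zero] at e0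
    rw [e, e0]
  · simpa [F.D_zero] using e 0

/-- Translation covariance spreads from the generating fields to all fields: the set of `u` for
which it holds contains the vacuum, and is stable under generating fields by `map_bracket`. -/
theorem D_Y (j : ℕ) (u : F.carrier) : ∀ (n : ℤ) (v : F.carrier), F.D j ((F.Y u).1 n v) =
    ∑ p ∈ Finset.HasAntidiagonal.antidiagonal j, (F.Y (F.D p.1 u)).1 n (F.D p.2 v) := by
  let S : Submodule k F.carrier :=
    { carrier := {u | ∀ (j : ℕ) (n : ℤ) (v : F.carrier), F.D j ((F.Y u).1 n v) =
        ∑ p ∈ Finset.HasAntidiagonal.antidiagonal j, (F.Y (F.D p.1 u)).1 n (F.D p.2 v)}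
      add_mem' := fun h h' j n v => by
        simp only [map_add, Submodule.coe_add, Pi.add_apply, LinearMap.add_apply, h j n v, h' j n v,
          Finset.sum_add_distrib]
      zero_mem' := fun j n v => by simp
      smul_mem' := fun t u h j n v => by
        simp only [map_smul, Submodule.coe_smul, Pi.smul_apply, LinearMap.smul_apply, h j n v,
          Finset.smul_sum] }
  have hS : S = ⊤ := by
    refine F.span_eq_top S (fun j n v => ?_) fun x u hu j n v => ?_
    · rw [Finset.sum_eq_single (0, j)]
      · rw [F.D_zero, F.Y_one, Fields.one_apply, Fields.one_apply]
        split_ifs <;> simp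
      · rintro ⟨a, b⟩ hab hne
        have : a ≠ 0 := fun h => hne (by
          subst h
          simpa using hab)
        rw [F.D_vac a (by omega), map_zero]
        simp
      · simp
    · rw [F.Y_fld_prod, Fields.nprod_apply,
        Fields.map_bracket (F.fld x) (F.Y u) (fun p => F.fld (F.derC p x))
          (fun p => F.Y (F.D p u)) F.D (fun j n v => F.D_fld j x n v) hu]
      refine Finset.sum_congr rfl fun p _ => ?_
      rw [F.D_fld, map_sum]
      simp only [F.Y_fld_prod, AddSubmonoidClass.coe_finsetSum, Finset.sum_apply,
        LinearMap.sum_apply]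
      rfl
  have : u ∈ S := hS ▸ Submodule.mem_top
  exact this j

/-- The product of `Y u` and `Y v` is a good field (Dong's lemma and covariance) with state `u₍ₙ₎v`,
so uniqueness identifies it. This turns the Borcherds identity into a statement about two local
fields. -/
theorem Y_prod (n : ℤ) (u v : F.carrier) :
    F.Y ((F.Y u).1 n v) = Fields.nprod (F.Y u) (F.Y v) n := by
  have hu := F.Y_good u
  have hv := F.Y_good v
  obtain ⟨h0, h1⟩ := Fields.expand_left_vac (F.Y u) (F.Y v) F.D F.vac hv.2.1 hv.2.2 hu.2.1 n
  have h2 (j : ℕ) : (Fields.nprod (F.Y u) (F.Y v) n).1 (-1 - j) F.vac =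
      F.D j ((F.Y u).1 n v) := by
    rw [h1, F.D_Y, F.Y_vac]
    simp only [F.Y_D]
  have h3 : (Fields.nprod (F.Y u) (F.Y v) n).1 (-1) F.vac = (F.Y u).1 n v := by
    simpa [F.D_zero] using h2 0
  exact F.Y_eq ⟨fun x => (F.Y_local u v).nprod (hu.1 x) (hv.1 x) n, h0, fun j => by rw [h2, h3]⟩ h3

theorem fld_mem_wt {x : F.C} {d : ℕ} (hx : x ∈ F.grC d) (n e : ℤ) {v : F.carrier}
    (hv : v ∈ F.wt e) {e' : ℤ} (he : (d : ℤ) + e - n - 1 = e') : (F.fld x).1 n v ∈ F.wt e' := by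
  subst he
  rcases lt_or_ge e 0 with h | h
  · rw [F.wt_of_neg h, Submodule.mem_bot] at hv
    rw [hv, map_zero]
    exact zero_mem _
  · obtain ⟨j, rfl⟩ := Int.eq_ofNat_of_zero_le h
    exact F.fld_mem x d n j v hx hv

theorem Y_mem (i : ℕ) {u : F.carrier} (hu : u ∈ F.gr i) (n : ℤ) (j : ℕ) (v : F.carrier)
    (hv : v ∈ F.gr j) : (F.Y u).1 n v ∈ F.wt ((i : ℤ) + j - n - 1) := by
  -- The condition is imposed for all integer weights `e`: inside a product of fields the
  -- intermediate vectors may have negative weight, where the homogeneous part is zero.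
  let S (i : ℕ) : Submodule k F.carrier :=
    { carrier := {u | ∀ (n e : ℤ) (v : F.carrier), v ∈ F.wt e →
        (F.Y u).1 n v ∈ F.wt ((i : ℤ) + e - n - 1)}
      add_mem' := fun h h' n e v hv => by
        rw [map_add]
        exact add_mem (h n e v hv) (h' n e v hv)
      zero_mem' := fun n e v hv => by simp
      smul_mem' := fun t u h n e v hv => by
        rw [map_smul]
        exact Submodule.smul_mem _ t (h n e v hv) }
  refine F.span_gr S ?_ ?_ i hu n j v hv
  · intro n e v hv
    rw [F.Y_one, Fields.one_apply]
    split_ifs with h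
    · subst h
      simpa using hv
    · exact zero_mem _
  · intro d x i u hx hu n e v hv
    rw [F.Y_fld_prod, Fields.nprod_apply, Fields.bracket]
    refine sub_mem ?_ (zsmul_mem ?_ _)
    · refine finsum_induction (· ∈ F.wt _) (zero_mem _) (fun _ _ => add_mem) fun j => zsmul_mem ?_ _
      refine F.fld_mem_wt hx _ _ (hu _ _ _ hv) ?_
      push_cast
      ring
    · refine finsum_induction (· ∈ F.wt _) (zero_mem _) (fun _ _ => add_mem) fun j => zsmul_mem ?_ _
      have := hu (n + -1 - j) _ _ (F.fld_mem_wt hx (0 + j) _ hv rfl)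
      convert this using 2
      push_cast
      ring

/-- The vertex algebra generated by a field system. -/
noncomputable def toVertexAlgebra : VertexAlgebra k where
  toGrMod := F.toGrMod
  vac := F.vac
  prod n :=
    { toFun := fun u => (F.Y u).1 n
      map_add' := fun u v => by rw [map_add]; rfl
      map_smul' := fun t u => by rw [map_smul]; rfl }
  vac_mem := F.vac_mem
  prod_mem n i j a b ha hb := F.Y_mem i ha n j b hb
  vac_prod n a := by
    change (F.Y F.vac).1 n a = _
    rw [F.Y_one, Fields.one_apply]
  prod_vac := F.Y_vac
  prod_vac_of_nonneg n a hn := (F.Y_good a).2.1 n hn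
  borcherds a b c m n l := by
    change ∑ᶠ j : ℕ, Ring.choose m j • (F.Y ((F.Y a).1 (n + j) b)).1 (m + l - j) c = _
    simp only [F.Y_prod]
    -- Locality evaluates the left-hand side as a bracket of fields; the two finite expansions in it
    -- are then merged into one sum.
    rw [(F.Y_local a b).borcherds, Fields.bracket, expand, expand,
      ← zsmulAddGroupHom_apply,
      EvZero.map_finsum (((Fields.bounded (F.Y b) (F.Y a) c).expand_term n l m))
        (zsmulAddGroupHom _),
      ← EvZero.finsum_sub ((Fields.bounded (F.Y a) (F.Y b) c).expand_term n m l)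
        (((Fields.bounded (F.Y b) (F.Y a) c).expand_term n l m).map (zsmulAddGroupHom _))]
    refine finsum_congr fun j => ?_
    simp only [zsmulAddGroupHom_apply, smul_sub]
    rw [smul_comm, add_comm l n]
    rfl

theorem toVertexAlgebra_prod (n : ℤ) (u v : F.carrier) :
    F.toVertexAlgebra.prod n u v = (F.Y u).1 n v := rfl

theorem toVertexAlgebra_der (j : ℕ) (u : F.carrier) : F.toVertexAlgebra.der j u = F.D j u := by
  change (F.Y u).1 (-1 - j) F.vac = _
  rw [(F.Y_good u).2.2, F.Y_vac]

end FieldSystem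

/-! ### The Lie algebra of modes of a truncated vertex algebra -/

/-- The signed binomial coefficient `(-1)ᵏ C(n, k)`. -/
noncomputable def sgnChoose (n : ℤ) (k : ℕ) : ℤ := (-1) ^ k * Ring.choose n k

@[simp]
theorem sgnChoose_zero (n : ℤ) : sgnChoose n 0 = 1 := by simp [sgnChoose]

/-- Vandermonde's identity; it is the numerical content of the Leibniz rule `Modes.der_br`. -/
theorem sgnChoose_add (m l : ℤ) (k : ℕ) : sgnChoose (m + l) k =
    ∑ p ∈ Finset.HasAntidiagonal.antidiagonal k, sgnChoose m p.1 * sgnChoose l p.2 := by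
  rw [sgnChoose, Ring.add_choose_eq k (Commute.all m l), Finset.mul_sum]
  refine Finset.sum_congr rfl fun p hp => ?_
  rw [← Finset.HasAntidiagonal.mem_antidiagonal.mp hp, sgnChoose, sgnChoose, pow_add]
  ring

theorem sgnChoose_mul (n : ℤ) (i j : ℕ) :
    sgnChoose n i * sgnChoose (n - i) j = (i + j).choose i * sgnChoose n (i + j) := by
  have h := Ring.choose_smul_choose n (Nat.le_add_right i j)
  rw [Nat.add_sub_cancel_left, nsmul_eq_mul] at h
  rw [sgnChoose, sgnChoose, sgnChoose, pow_add]
  linear_combination (-(-1) ^ i * (-1) ^ j) * h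

theorem sgnChoose_succ (n : ℤ) (i : ℕ) :
    (i + 1) * sgnChoose n (i + 1) = -(sgnChoose n i * (n - i)) := by
  have h := sgnChoose_mul n i 1
  have e : sgnChoose (n - i) 1 = -(n - i) := by simp [sgnChoose]
  rw [e, Nat.choose_succ_self_right] at h
  push_cast at h
  linear_combination -h

/-- This is the compatibility of `∂⁽ⁱ⁾` with the relation `(∂a)_n = -n a_{n-1}`. Both sides are
`n`-multiples obtained by differentiating in either order, so no division is needed. -/
theorem mul_sgnChoose (n : ℤ) (i : ℕ) : sgnChoose n i * (n - i) = n * sgnChoose (n - 1) i := by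
  have h := sgnChoose_mul n 1 i
  have e : sgnChoose n 1 = -n := by simp [sgnChoose]
  rw [e, Nat.choose_one_right, Nat.cast_one, add_comm 1 i] at h
  have h' := sgnChoose_succ n i
  push_cast at h
  linear_combination h + h'

theorem sgnChoose_neg (i k : ℕ) : sgnChoose (-1 - i) k = (i + k).choose i := by
  have e : (-1 - i : ℤ) = -(i + 1) := by ring
  have e' : ((i + 1 + k - 1 : ℤ)) = ((i + k : ℕ) : ℤ) := by push_cast; ring
  rw [sgnChoose, e, Ring.choose_neg, Int.negOnePow_def, Units.smul_def, smul_eq_mul, ← mul_assoc,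
    e', Ring.choose_natCast, Nat.choose_symm_add]
  simp [← mul_pow]

theorem sgnChoose_eq_zero {n k : ℕ} (h : n < k) : sgnChoose n k = 0 := by
  rw [sgnChoose, Ring.choose_natCast, Nat.choose_eq_zero_of_lt h]
  simp

namespace TruncVA

variable {k : Type u} [CommRing k] (v : TruncVA k)

/-- The relations `(∂a)_m = -m a_{m-1}` between modes. -/
noncomputable def modesRel : Submodule k ((ℤ →₀ v.V0) × (ℤ →₀ v.V1)) :=
  Submodule.span k {z | ∃ (m : ℤ) (a : v.V0),
    z = (m • Finsupp.single (m - 1) a, Finsupp.single m (v.d a))}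

/-- The module of modes `u_m`, for `m ∈ ℤ` and `u` in `V₀` or in `V₁`. -/
noncomputable def Modes : Type u := ((ℤ →₀ v.V0) × (ℤ →₀ v.V1)) ⧸ v.modesRel

namespace Modes

noncomputable instance : AddCommGroup v.Modes := inferInstanceAs (AddCommGroup (_ ⧸ v.modesRel))
noncomputable instance : Module k v.Modes := inferInstanceAs (Module k (_ ⧸ v.modesRel))

variable {v} {M : Type*} [AddCommGroup M] [Module k M]

/-- The mode `a_m` for `a ∈ V₀`. -/
noncomputable def m0 (m : ℤ) : v.V0 →ₗ[k] v.Modes :=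
  v.modesRel.mkQ ∘ₗ LinearMap.inl k _ _ ∘ₗ Finsupp.lsingle m

/-- The mode `x_m` for `x ∈ V₁`. -/
noncomputable def m1 (m : ℤ) : v.V1 →ₗ[k] v.Modes :=
  v.modesRel.mkQ ∘ₗ LinearMap.inr k _ _ ∘ₗ Finsupp.lsingle m

theorem m1_d (m : ℤ) (a : v.V0) : m1 m (v.d a) = -(m • m0 (m - 1) a) := by
  rw [eq_neg_iff_add_eq_zero, add_comm]
  have h : v.modesRel.mkQ (m • Finsupp.single (m - 1) a, Finsupp.single m (v.d a)) = 0 :=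
    (Submodule.Quotient.mk_eq_zero _).mpr (Submodule.subset_span ⟨m, a, rfl⟩)
  refine Eq.trans ?_ h
  change m • v.modesRel.mkQ (Finsupp.single (m - 1) a, 0) +
    v.modesRel.mkQ (0, Finsupp.single m (v.d a)) = _
  rw [← map_zsmul, ← map_add]
  simp

/-- Linear maps out of the module of modes. -/
noncomputable def lift (f0 : ℤ → v.V0 →ₗ[k] M) (f1 : ℤ → v.V1 →ₗ[k] M)
    (h : ∀ m a, f1 m (v.d a) = -(m • f0 (m - 1) a)) : v.Modes →ₗ[k] M :=
  v.modesRel.liftQ (LinearMap.coprod (Finsupp.lsum k f0) (Finsupp.lsum k f1)) (by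
    refine Submodule.span_le.mpr ?_
    rintro _ ⟨m, a, rfl⟩
    simp only [SetLike.mem_coe, LinearMap.mem_ker, LinearMap.coprod_apply, map_zsmul,
      Finsupp.lsum_single, h, add_neg_cancel])

section

variable (f0 : ℤ → v.V0 →ₗ[k] M) (f1 : ℤ → v.V1 →ₗ[k] M)
  (h : ∀ m a, f1 m (v.d a) = -(m • f0 (m - 1) a))

@[simp]
theorem lift_m0 (m : ℤ) (a : v.V0) : lift f0 f1 h (m0 m a) = f0 m a := by
  change LinearMap.coprod (Finsupp.lsum k f0) (Finsupp.lsum k f1) (Finsupp.single m a, 0) = _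
  simp

@[simp]
theorem lift_m1 (m : ℤ) (x : v.V1) : lift f0 f1 h (m1 m x) = f1 m x := by
  change LinearMap.coprod (Finsupp.lsum k f0) (Finsupp.lsum k f1) (0, Finsupp.single m x) = _
  simp

end

@[elab_as_elim]
theorem induction {p : v.Modes → Prop} (h0 : ∀ m a, p (m0 m a)) (h1 : ∀ m x, p (m1 m x))
    (hadd : ∀ X Y, p X → p Y → p (X + Y)) (X : v.Modes) : p X := by
  have hz : p 0 := by simpa using h0 0 0
  obtain ⟨⟨f, g⟩, rfl⟩ := v.modesRel.mkQ_surjective X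
  have e : v.modesRel.mkQ (f, g) = v.modesRel.mkQ (f, 0) + v.modesRel.mkQ (0, g) := by
    rw [← map_add]
    simp
  rw [e]
  clear e
  refine hadd _ _ ?_ ?_
  · induction f using Finsupp.induction_linear with
    | zero => exact hz
    | add f f' h h' =>
      have e : v.modesRel.mkQ (f + f', 0) = v.modesRel.mkQ (f, 0) + v.modesRel.mkQ (f', 0) := by
        rw [← map_add]
        simp
      exact e ▸ hadd _ _ h h'
    | single m a => exact h0 m a
  · induction g using Finsupp.induction_linear with
    | zero => exact hz
    | add f f' h h' =>
      have e : v.modesRel.mkQ (0, f + f') = v.modesRel.mkQ (0, f) + v.modesRel.mkQ (0, f') := by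
        rw [← map_add]
        simp
      exact e ▸ hadd _ _ h h'
    | single m a => exact h1 m a

theorem hom_ext {f g : v.Modes →ₗ[k] M} (h0 : ∀ m a, f (m0 m a) = g (m0 m a))
    (h1 : ∀ m x, f (m1 m x) = g (m1 m x)) : f = g := by
  ext X
  induction X using induction with
  | h0 m a => exact h0 m a
  | h1 m x => exact h1 m x
  | hadd X Y h h' => rw [map_add, map_add, h, h']

/-- The bracket with a mode of `V₀`. -/
noncomputable def br0 (m : ℤ) : v.V0 →ₗ[k] v.Modes →ₗ[k] v.Modes where
  toFun a := lift 0 (fun l => m0 (m + l) ∘ₗ v.res01 a) fun l b => by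
    have : v.res01 a (v.d b) = 0 := by
      rw [← neg_eq_zero, ← v.res10_eq, v.d_res10]
    simp [this]
  map_add' a b := hom_ext (by simp) (by simp)
  map_smul' t a := hom_ext (by simp) (by simp)

/-- The bracket with a mode of `V₁`. -/
noncomputable def br1 (m : ℤ) : v.V1 →ₗ[k] v.Modes →ₗ[k] v.Modes where
  toFun x := lift (fun l => m0 (m + l) ∘ₗ v.res10 x)
    (fun l => m1 (m + l) ∘ₗ v.res11 x + m • (m0 (m + l - 1) ∘ₗ v.pair x)) fun l a => by
    have : v.pair x (v.d a) = v.res10 x a := by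
      rw [v.pair_comm, v.d_pair, v.res10_eq]
    simp only [LinearMap.add_apply, LinearMap.comp_apply, LinearMap.smul_apply, ← v.d_res, m1_d,
      this, ← add_sub_assoc]
    module
  map_add' x y := hom_ext (by simp) (by intros; simp; abel)
  map_smul' t x := hom_ext (by simp) (by intros; simp [smul_comm _ t])

/-- The Lie bracket of modes: `[u_m, w_l] = ∑ⱼ C(m, j) (u₍ⱼ₎w)_{m+l-j}`. -/
noncomputable def br : v.Modes →ₗ[k] v.Modes →ₗ[k] v.Modes :=
  lift br0 br1 fun m a => hom_ext (by simp [br0, br1, v.d_res10]) fun l x => by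
    have e : m - 1 + l = m + l - 1 := by ring
    simp [br0, br1, v.d_res11, v.d_pair, e]

@[simp]
theorem br_m0_m0 (m l : ℤ) (a b : v.V0) : br (m0 m a) (m0 l b) = 0 := by
  simp [br, br0]

@[simp]
theorem br_m0_m1 (m l : ℤ) (a : v.V0) (x : v.V1) :
    br (m0 m a) (m1 l x) = m0 (m + l) (v.res01 a x) := by
  simp [br, br0]

@[simp]
theorem br_m1_m0 (m l : ℤ) (x : v.V1) (a : v.V0) :
    br (m1 m x) (m0 l a) = m0 (m + l) (v.res10 x a) := by
  simp [br, br1]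

@[simp]
theorem br_m1_m1 (m l : ℤ) (x y : v.V1) : br (m1 m x) (m1 l y) =
    m1 (m + l) (v.res11 x y) + m • m0 (m + l - 1) (v.pair x y) := by
  simp [br, br1]

/-- The only case with content is that of two vectors of `V₁`: the correction `∂(y₍₁₎x)` in the
skew-symmetry of `₍₀₎` contributes `-(m + l)(y₍₁₎x)_{m+l-1}`, which turns the coefficient `m` into
`-l`. -/
theorem br_skew (X Y : v.Modes) : br X Y = -br Y X := by
  have : br (v := v) = -br.flip := by
    refine hom_ext (fun m a => hom_ext (fun l b => ?_) fun l y => ?_)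
      (fun m x => hom_ext (fun l b => ?_) fun l y => ?_)
    · simp
    · simp [v.res10_eq, add_comm]
    · simp [v.res10_eq, add_comm]
    · simp only [br_m1_m1, LinearMap.neg_apply, LinearMap.flip_apply, add_comm l m]
      rw [v.res11_eq, v.pair_comm y x]
      simp only [map_add, map_neg, m1_d]
      module
  exact LinearMap.congr_fun (LinearMap.congr_fun this X) Y

/-- By additivity it is enough to treat modes. With two or more entries from `V₀` all terms vanish;
with one, the identity is the derivation property of `₍₀₎` on `V₀`-valued products; with none, it
combines `zero_res11` and `zero_pair`. -/
theorem br_br (X Y Z : v.Modes) : br X (br Y Z) = br (br X Y) Z + br Y (br X Z) := by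
  induction X using induction with
  | hadd X X' h h' =>
    simp only [map_add, LinearMap.add_apply, h, h']
    abel
  | h0 m a =>
    induction Y using induction with
    | hadd Y Y' h h' =>
      simp only [map_add, LinearMap.add_apply, h, h']
      abel
    | h0 l b =>
      induction Z using induction with
      | hadd Z Z' h h' =>
        simp only [map_add, h, h']
        abel
      | h0 n c => simp
      | h1 n z => simp
    | h1 l y =>
      induction Z using induction with
      | hadd Z Z' h h' =>
        simp only [map_add, h, h']
        abel
      | h0 n c => simp
      | h1 n z =>
        simp [v.zero_res01', ← add_assoc, add_comm l m]
  | h1 m x =>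
    induction Y using induction with
    | hadd Y Y' h h' =>
      simp only [map_add, LinearMap.add_apply, h, h']
      abel
    | h0 l b =>
      induction Z using induction with
      | hadd Z Z' h h' =>
        simp only [map_add, h, h']
        abel
      | h0 n c => simp
      | h1 n z =>
        simp [v.zero_res01, ← add_assoc, add_comm l m]
    | h1 l y =>
      induction Z using induction with
      | hadd Z Z' h h' =>
        simp only [map_add, h, h']
        abel
      | h0 n c =>
        simp [v.zero_res10 x y c, ← add_assoc, add_comm l m]
      | h1 n z =>
        -- Invariance of the pairing under `y`, with `y₍₀₎x` rewritten by skew-symmetry in terms of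
        -- `x₍₀₎y`.
        have e1 : v.pair x (v.res11 y z) =
            v.pair (v.res11 x y) z + v.res01 (v.pair x y) z + v.res10 y (v.pair x z) := by
          rw [v.zero_pair y x z, v.res11_eq y x]
          simp only [map_add, map_neg, LinearMap.add_apply, LinearMap.neg_apply, v.d_pair]
          abel
        have i1 : m + (l + n - 1) = m + l + n - 1 := by ring
        have i2 : m + l - 1 + n = m + l + n - 1 := by ring
        have i3 : l + (m + n) = m + l + n := by ring
        have i4 : l + (m + n - 1) = m + l + n - 1 := by ring
        simp only [br_m1_m1, br_m1_m0, br_m0_m1, map_add, map_zsmul, LinearMap.add_apply,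
          LinearMap.smul_apply, ← add_assoc, i1, i2, i3, i4, e1, v.zero_pair x y z,
          v.zero_res11 x y z]
        module

/-- The operators `∂⁽ʲ⁾ u_m = (-1)ʲ C(m, j) u_{m-j}` on the modes. -/
noncomputable def der (j : ℕ) : v.Modes →ₗ[k] v.Modes :=
  lift (fun m => sgnChoose m j • m0 (m - j)) (fun m => sgnChoose m j • m1 (m - j)) fun m a => by
    have e : m - j - 1 = m - 1 - j := by ring
    simp only [LinearMap.smul_apply, m1_d, smul_neg, smul_smul, e, mul_sgnChoose]

@[simp]
theorem der_m0 (j : ℕ) (m : ℤ) (a : v.V0) : der j (m0 m a) = sgnChoose m j • m0 (m - j) a := by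
  simp [der]

@[simp]
theorem der_m1 (j : ℕ) (m : ℤ) (x : v.V1) : der j (m1 m x) = sgnChoose m j • m1 (m - j) x := by
  simp [der]

/-- For terms of index `m + l` this is Vandermonde's identity. In the pairing term, of index `m + l
- 1`, Vandermonde is applied to `m - 1` and `l`, and the coefficient `m` is absorbed by
`mul_sgnChoose`. -/
theorem der_br (j : ℕ) (X Y : v.Modes) : der j (br X Y) =
    ∑ p ∈ Finset.HasAntidiagonal.antidiagonal j, br (der p.1 X) (der p.2 Y) := by
  have key {M : Type u} [AddCommGroup M] (m l : ℤ) (f : ℤ → M) :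
      sgnChoose (m + l) j • f (m + l - j) = ∑ p ∈ Finset.HasAntidiagonal.antidiagonal j,
        sgnChoose l p.2 • sgnChoose m p.1 • f (m - p.1 + (l - p.2)) := by
    rw [sgnChoose_add, Finset.sum_smul]
    refine Finset.sum_congr rfl fun p hp => ?_
    rw [← Finset.HasAntidiagonal.mem_antidiagonal.mp hp, smul_smul, _root_.mul_comm]
    congr 2
    push_cast
    ring
  induction X using induction with
  | hadd X X' h h' => simp only [map_add, LinearMap.add_apply, h, h', Finset.sum_add_distrib]
  | h0 m a =>
    induction Y using induction with
    | hadd Y Y' h h' => simp only [map_add, h, h', Finset.sum_add_distrib]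
    | h0 l b => simp
    | h1 l y =>
      simp only [br_m0_m1, der_m0, der_m1, map_zsmul, LinearMap.smul_apply]
      rw [key m l fun i => m0 i (v.res01 a y)]
  | h1 m x =>
    induction Y using induction with
    | hadd Y Y' h h' => simp only [map_add, h, h', Finset.sum_add_distrib]
    | h0 l b =>
      simp only [br_m1_m0, der_m0, der_m1, map_zsmul, LinearMap.smul_apply]
      rw [key m l fun i => m0 i (v.res10 x b)]
    | h1 l y =>
      simp only [br_m1_m1, der_m0, der_m1, map_zsmul, LinearMap.smul_apply, map_add]
      have e := key (m - 1) l fun i => m0 i (v.pair x y)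
      rw [key m l fun i => m1 i (v.res11 x y)]
      have e' : m + l - 1 = m - 1 + l := by ring
      rw [e', e, Finset.smul_sum, ← Finset.sum_add_distrib]
      refine Finset.sum_congr rfl fun p _ => ?_
      have e1 : m - 1 - p.1 + (l - p.2) = m - p.1 + (l - p.2) - 1 := by ring
      simp only [e1, smul_add, smul_smul]
      congr 2
      linear_combination -sgnChoose l p.2 * mul_sgnChoose m p.1

variable (v) in
/-- The span of the modes `u_m` with `0 ≤ m`. -/
noncomputable def nonneg : Submodule k v.Modes :=
  Submodule.span k ({X | ∃ m a, 0 ≤ m ∧ X = m0 m a} ∪ {X | ∃ m x, 0 ≤ m ∧ X = m1 m x})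

theorem m0_mem {m : ℤ} (h : 0 ≤ m) (a : v.V0) : m0 m a ∈ nonneg v :=
  Submodule.subset_span (Or.inl ⟨m, a, h, rfl⟩)

theorem m1_mem {m : ℤ} (h : 0 ≤ m) (x : v.V1) : m1 m x ∈ nonneg v :=
  Submodule.subset_span (Or.inr ⟨m, x, h, rfl⟩)

/-- The only term whose index could be negative is `m (x₍₁₎y)_{m+l-1}` with `m = l = 0`, and then
its coefficient vanishes. -/
theorem br_mem_nonneg {X Y : v.Modes} (hX : X ∈ nonneg v) (hY : Y ∈ nonneg v) :
    br X Y ∈ nonneg v := by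
  induction hX using Submodule.span_induction with
  | zero => simp
  | add X X' _ _ h h' => simpa using add_mem h h'
  | smul t X _ h => simpa using Submodule.smul_mem _ t h
  | mem X hX =>
    induction hY using Submodule.span_induction with
    | zero => simp
    | add X X' _ _ h h' => simpa using add_mem h h'
    | smul t X _ h => simpa using Submodule.smul_mem _ t h
    | mem Y hY =>
      rcases hX with ⟨m, a, hm, rfl⟩ | ⟨m, x, hm, rfl⟩ <;>
        rcases hY with ⟨l, b, hl, rfl⟩ | ⟨l, y, hl, rfl⟩
      · simp
      · simpa using m0_mem (by omega) _
      · simpa using m0_mem (by omega) _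
      · rw [br_m1_m1]
        refine add_mem (m1_mem (by omega) _) ?_
        rcases hm.eq_or_lt with rfl | hm
        · simp
        · exact zsmul_mem (m0_mem (by omega) _) _

end Modes
end TruncVA

/-! ### The conformal algebra of a truncated vertex algebra -/

namespace TruncVA

variable {k : Type u} [CommRing k] (v : TruncVA k)

/-- The relations `(i + 1) ∂⁽ⁱ⁺¹⁾a = ∂⁽ⁱ⁾(∂a)`. -/
noncomputable def hullRel : Submodule k ((ℕ →₀ v.V0) × (ℕ →₀ v.V1)) :=
  Submodule.span k {z | ∃ (i : ℕ) (a : v.V0),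
    z = ((i + 1) • Finsupp.single (i + 1) a, -Finsupp.single i (v.d a))}

/-- The module generated by symbols `∂⁽ⁱ⁾u` with `u` in `V₀` or in `V₁`. -/
noncomputable def Hull : Type u := ((ℕ →₀ v.V0) × (ℕ →₀ v.V1)) ⧸ v.hullRel

namespace Hull

noncomputable instance : AddCommGroup v.Hull := inferInstanceAs (AddCommGroup (_ ⧸ v.hullRel))
noncomputable instance : Module k v.Hull := inferInstanceAs (Module k (_ ⧸ v.hullRel))

variable {v} {M : Type*} [AddCommGroup M] [Module k M]

/-- The symbol `∂⁽ⁱ⁾a` for `a ∈ V₀`. -/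
noncomputable def c0 (i : ℕ) : v.V0 →ₗ[k] v.Hull :=
  v.hullRel.mkQ ∘ₗ LinearMap.inl k _ _ ∘ₗ Finsupp.lsingle i

/-- The symbol `∂⁽ⁱ⁾x` for `x ∈ V₁`. -/
noncomputable def c1 (i : ℕ) : v.V1 →ₗ[k] v.Hull :=
  v.hullRel.mkQ ∘ₗ LinearMap.inr k _ _ ∘ₗ Finsupp.lsingle i

theorem c1_d (i : ℕ) (a : v.V0) : c1 i (v.d a) = (i + 1) • c0 (i + 1) a := by
  symm
  rw [← sub_eq_zero]
  have h : v.hullRel.mkQ ((i + 1) • Finsupp.single (i + 1) a, -Finsupp.single i (v.d a)) = 0 :=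
    (Submodule.Quotient.mk_eq_zero _).mpr (Submodule.subset_span ⟨i, a, rfl⟩)
  refine Eq.trans ?_ h
  change (i + 1) • v.hullRel.mkQ (Finsupp.single (i + 1) a, 0) -
    v.hullRel.mkQ (0, Finsupp.single i (v.d a)) = _
  rw [← map_nsmul, ← map_sub]
  congr 1
  ext <;> simp

/-- Linear maps out of the hull. -/
noncomputable def lift (f0 : ℕ → v.V0 →ₗ[k] M) (f1 : ℕ → v.V1 →ₗ[k] M)
    (h : ∀ i a, (i + 1) • f0 (i + 1) a = f1 i (v.d a)) : v.Hull →ₗ[k] M :=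
  v.hullRel.liftQ (LinearMap.coprod (Finsupp.lsum k f0) (Finsupp.lsum k f1)) (by
    refine Submodule.span_le.mpr ?_
    rintro _ ⟨i, a, rfl⟩
    simp only [SetLike.mem_coe, LinearMap.mem_ker, LinearMap.coprod_apply, map_nsmul,
      Finsupp.lsum_single, h, map_neg, add_neg_cancel])

section

variable (f0 : ℕ → v.V0 →ₗ[k] M) (f1 : ℕ → v.V1 →ₗ[k] M)
  (h : ∀ i a, (i + 1) • f0 (i + 1) a = f1 i (v.d a))

@[simp]
theorem lift_c0 (i : ℕ) (a : v.V0) : lift f0 f1 h (c0 i a) = f0 i a := by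
  change LinearMap.coprod (Finsupp.lsum k f0) (Finsupp.lsum k f1) (Finsupp.single i a, 0) = _
  simp

@[simp]
theorem lift_c1 (i : ℕ) (x : v.V1) : lift f0 f1 h (c1 i x) = f1 i x := by
  change LinearMap.coprod (Finsupp.lsum k f0) (Finsupp.lsum k f1) (0, Finsupp.single i x) = _
  simp

end

@[elab_as_elim]
theorem induction {p : v.Hull → Prop} (h0 : ∀ i a, p (c0 i a)) (h1 : ∀ i x, p (c1 i x))
    (hadd : ∀ X Y, p X → p Y → p (X + Y)) (X : v.Hull) : p X := by
  have hz : p 0 := by simpa using h0 0 0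
  obtain ⟨⟨f, g⟩, rfl⟩ := v.hullRel.mkQ_surjective X
  have e : v.hullRel.mkQ (f, g) = v.hullRel.mkQ (f, 0) + v.hullRel.mkQ (0, g) := by
    rw [← map_add]
    simp
  rw [e]
  clear e
  refine hadd _ _ ?_ ?_
  · induction f using Finsupp.induction_linear with
    | zero => exact hz
    | add f f' h h' =>
      have e : v.hullRel.mkQ (f + f', 0) = v.hullRel.mkQ (f, 0) + v.hullRel.mkQ (f', 0) := by
        rw [← map_add]
        simp
      exact e ▸ hadd _ _ h h'
    | single m a => exact h0 m a
  · induction g using Finsupp.induction_linear with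
    | zero => exact hz
    | add f f' h h' =>
      have e : v.hullRel.mkQ (0, f + f') = v.hullRel.mkQ (0, f) + v.hullRel.mkQ (0, f') := by
        rw [← map_add]
        simp
      exact e ▸ hadd _ _ h h'
    | single m a => exact h1 m a

theorem hom_ext {f g : v.Hull →ₗ[k] M} (h0 : ∀ i a, f (c0 i a) = g (c0 i a))
    (h1 : ∀ i x, f (c1 i x) = g (c1 i x)) : f = g := by
  ext X
  induction X using induction with
  | h0 m a => exact h0 m a
  | h1 m x => exact h1 m x
  | hadd X Y h h' => rw [map_add, map_add, h, h']

/-! ### Divided powers on the hull, and its comparison with the modes -/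

/-- The operators `∂⁽ʲ⁾`. -/
noncomputable def der (j : ℕ) : v.Hull →ₗ[k] v.Hull :=
  lift (fun i => (i + j).choose i • c0 (i + j)) (fun i => (i + j).choose i • c1 (i + j))
    fun i a => by
      have e : i + 1 + j = i + j + 1 := by ring
      simp only [LinearMap.smul_apply, c1_d, smul_smul, e]
      congr 1
      have := Nat.add_one_mul_choose_eq (i + j) i
      linarith

@[simp]
theorem der_c0 (j i : ℕ) (a : v.V0) : der j (c0 i a) = (i + j).choose i • c0 (i + j) a := by
  simp [der]

@[simp]
theorem der_c1 (j i : ℕ) (x : v.V1) : der j (c1 i x) = (i + j).choose i • c1 (i + j) x := by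
  simp [der]

theorem der_zero (x : v.Hull) : der 0 x = x := by
  induction x using induction with
  | hadd X Y h h' => rw [map_add, h, h']
  | h0 i a => simp
  | h1 i a => simp

theorem der_der (i j : ℕ) (x : v.Hull) : der i (der j x) = (i + j).choose i • der (i + j) x := by
  have key (l : ℕ) : (l + j).choose l * (l + j + i).choose (l + j) =
      (i + j).choose i * (l + (i + j)).choose l := by
    have h1 := Nat.choose_mul (n := l + (i + j)) (k := l + j) (s := l) (by omega)
    have e1 : l + (i + j) - l = i + j := by omega
    have e2 : l + j - l = j := by omega
    have e3 : l + j + i = l + (i + j) := by omega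
    have e4 : (i + j).choose i = (i + j).choose j := Nat.choose_symm_add
    rw [e1, e2] at h1
    rw [e3, e4]
    linarith
  induction x using induction with
  | hadd X Y h h' => simp only [map_add, h, h', smul_add]
  | h0 l a =>
    have e : l + (i + j) = l + j + i := by omega
    simp only [der_c0, map_nsmul, smul_smul, key, e]
  | h1 l a =>
    have e : l + (i + j) = l + j + i := by omega
    simp only [der_c1, map_nsmul, smul_smul, key, e]

theorem der_c0_zero (i : ℕ) (a : v.V0) : der i (c0 0 a) = c0 i a := by simp

theorem der_c1_zero (i : ℕ) (x : v.V1) : der i (c1 0 x) = c1 i x := by simp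

/-- The modes of the elements of the hull. -/
noncomputable def mode (n : ℤ) : v.Hull →ₗ[k] v.Modes :=
  lift (fun i => sgnChoose n i • Modes.m0 (n - i)) (fun i => sgnChoose n i • Modes.m1 (n - i))
    fun i a => by
      have e : n - (i + 1 : ℕ) = n - i - 1 := by push_cast; ring
      simp only [LinearMap.smul_apply, Modes.m1_d, e, smul_neg, smul_smul, ← neg_smul,
        ← natCast_zsmul]
      rw [mul_neg, ← sgnChoose_succ]
      push_cast
      rfl

@[simp]
theorem mode_c0 (n : ℤ) (i : ℕ) (a : v.V0) :
    mode n (c0 i a) = sgnChoose n i • Modes.m0 (n - i) a := by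
  simp [mode]

@[simp]
theorem mode_c1 (n : ℤ) (i : ℕ) (x : v.V1) :
    mode n (c1 i x) = sgnChoose n i • Modes.m1 (n - i) x := by
  simp [mode]

theorem der_mode (j : ℕ) (n : ℤ) (x : v.Hull) : Modes.der j (mode n x) = mode n (der j x) := by
  have key (i : ℕ) : sgnChoose n i * sgnChoose (n - i) j =
      (i + j).choose i * sgnChoose n (i + j) := sgnChoose_mul n i j
  induction x using induction with
  | hadd X Y h h' => simp only [map_add, h, h']
  | h0 i a =>
    have e : n - (i + j : ℕ) = n - i - j := by push_cast; ring
    simp only [mode_c0, der_c0, map_nsmul, map_zsmul, Modes.der_m0, smul_smul, key, e,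
      ← natCast_zsmul]
  | h1 i a =>
    have e : n - (i + j : ℕ) = n - i - j := by push_cast; ring
    simp only [mode_c1, der_c1, map_nsmul, map_zsmul, Modes.der_m1, smul_smul, key, e,
      ← natCast_zsmul]

theorem mode_der (j : ℕ) (n : ℤ) (x : v.Hull) :
    mode n (der j x) = sgnChoose n j • mode (n - j) x := by
  have key (i : ℕ) : sgnChoose n j * sgnChoose (n - j) i =
      (i + j).choose i * sgnChoose n (i + j) := by
    rw [sgnChoose_mul, add_comm j i, Nat.choose_symm_add]
  induction x using induction with
  | hadd X Y h h' => simp only [map_add, h, h', smul_add]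
  | h0 i a =>
    have e : n - (i + j : ℕ) = n - j - i := by push_cast; ring
    simp only [mode_c0, der_c0, map_zsmul, smul_smul, key, e, ← natCast_zsmul]
  | h1 i a =>
    have e : n - (i + j : ℕ) = n - j - i := by push_cast; ring
    simp only [mode_c1, der_c1, map_zsmul, smul_smul, key, e, ← natCast_zsmul]

theorem mode_mem_nonneg {n : ℤ} (h : 0 ≤ n) (x : v.Hull) : mode n x ∈ Modes.nonneg v := by
  obtain ⟨n, rfl⟩ := Int.eq_ofNat_of_zero_le h
  induction x using induction with
  | hadd X Y h h' => simpa using add_mem h h'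
  | h0 i a =>
    rw [mode_c0]
    rcases le_or_gt i n with hi | hi
    · exact zsmul_mem (Modes.m0_mem (by omega) _) _
    · simp [sgnChoose_eq_zero hi]
  | h1 i a =>
    rw [mode_c1]
    rcases le_or_gt i n with hi | hi
    · exact zsmul_mem (Modes.m1_mem (by omega) _) _
    · simp [sgnChoose_eq_zero hi]

/-- The projection of the modes to the hull, `u_{-1-i} ↦ ∂⁽ⁱ⁾u` and `u_m ↦ 0` for `0 ≤ m`. -/
noncomputable def proj : v.Modes →ₗ[k] v.Hull :=
  Modes.lift (fun m => if m < 0 then c0 (-1 - m).toNat else 0)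
    (fun m => if m < 0 then c1 (-1 - m).toNat else 0) fun m a => by
      rcases lt_or_ge m 0 with h | h
      · obtain ⟨i, hi⟩ : ∃ i : ℕ, (i : ℤ) = -1 - m := ⟨(-1 - m).toNat, by omega⟩
        have e : (-1 - (m - 1)).toNat = i + 1 := by omega
        have e' : (-1 - m).toNat = i := by omega
        have e'' : -m = ((i + 1 : ℕ) : ℤ) := by omega
        rw [if_pos h, if_pos (by omega), e, e', c1_d, ← neg_smul, e'', natCast_zsmul]
      · rw [if_neg (by omega)]
        -- At `m = 0` the mode `a_{-1}` survives the projection, but its coefficient `m` is zero.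
        rcases h.eq_or_lt with rfl | h
        · simp
        · rw [if_neg (by omega)]
          simp

theorem proj_m0 (m : ℤ) (a : v.V0) :
    proj (Modes.m0 m a) = if m < 0 then c0 (-1 - m).toNat a else 0 := by
  rw [proj, Modes.lift_m0]
  split_ifs <;> rfl

theorem proj_m1 (m : ℤ) (x : v.V1) :
    proj (Modes.m1 m x) = if m < 0 then c1 (-1 - m).toNat x else 0 := by
  rw [proj, Modes.lift_m1]
  split_ifs <;> rfl

theorem proj_nonneg {X : v.Modes} (h : X ∈ Modes.nonneg v) : proj X = 0 := by
  induction h using Submodule.span_induction with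
  | zero => simp
  | add X X' _ _ h h' => rw [map_add, h, h', add_zero]
  | smul t X _ h => rw [map_smul, h, smul_zero]
  | mem X hX =>
    rcases hX with ⟨m, a, hm, rfl⟩ | ⟨m, x, hm, rfl⟩
    · rw [proj_m0, if_neg (by omega)]
    · rw [proj_m1, if_neg (by omega)]

theorem proj_mode_of_nonneg {n : ℤ} (h : 0 ≤ n) (x : v.Hull) : proj (mode n x) = 0 :=
  proj_nonneg (mode_mem_nonneg h x)

theorem sgnChoose_neg_one (i : ℕ) : sgnChoose (-1) i = 1 := by
  simpa using sgnChoose_neg 0 i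

theorem mode_neg_one_c0 (i : ℕ) (a : v.V0) : mode (-1) (c0 i a) = Modes.m0 (-1 - i) a := by
  rw [mode_c0, sgnChoose_neg_one, one_smul]

theorem mode_neg_one_c1 (i : ℕ) (x : v.V1) : mode (-1) (c1 i x) = Modes.m1 (-1 - i) x := by
  rw [mode_c1, sgnChoose_neg_one, one_smul]

theorem proj_mode_neg_one (x : v.Hull) : proj (mode (-1) x) = x := by
  induction x using induction with
  | hadd X Y h h' => rw [map_add, map_add, h, h']
  | h0 i a =>
    have e : (-1 - (-1 - i) : ℤ).toNat = i := by omega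
    rw [mode_neg_one_c0, proj_m0, if_pos (by omega), e]
  | h1 i a =>
    have e : (-1 - (-1 - i) : ℤ).toNat = i := by omega
    rw [mode_neg_one_c1, proj_m1, if_pos (by omega), e]

theorem proj_mode_neg (i : ℕ) (x : v.Hull) : proj (mode (-1 - i) x) = der i x := by
  have h := mode_der i (-1) x
  rw [sgnChoose_neg_one, one_smul] at h
  rw [← h, proj_mode_neg_one]

/-- A mode is, up to nonnegative modes, the `(-1)`-st mode of its projection. -/
theorem sub_mode_proj_mem (X : v.Modes) : X - mode (-1) (proj X) ∈ Modes.nonneg v := by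
  induction X using Modes.induction with
  | hadd X Y h h' =>
    rw [map_add, map_add]
    convert add_mem h h' using 1
    abel
  | h0 m a =>
    rw [proj_m0]
    split_ifs with h
    · have e : (-1 - ((-1 - m).toNat : ℕ) : ℤ) = m := by omega
      rw [mode_neg_one_c0, e, sub_self]
      exact zero_mem _
    · simpa using Modes.m0_mem (by omega) a
  | h1 m x =>
    rw [proj_m1]
    split_ifs with h
    · have e : (-1 - ((-1 - m).toNat : ℕ) : ℤ) = m := by omega
      rw [mode_neg_one_c1, e, sub_self]
      exact zero_mem _
    · simpa using Modes.m1_mem (by omega) x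

/-- The nonnegative modes are stable under `∂⁽ʲ⁾`, because `C(m, j) = 0` for `0 ≤ m < j`; hence
`∂⁽ʲ⁾` descends to the quotient by them. -/
theorem proj_der (j : ℕ) (X : v.Modes) : proj (Modes.der j X) = der j (proj X) := by
  have h : Modes.der j (X - mode (-1) (proj X)) ∈ Modes.nonneg v := by
    have h := sub_mode_proj_mem X
    generalize X - mode (-1) (proj X) = Z at h
    induction h using Submodule.span_induction with
    | zero => simp
    | add X X' _ _ h h' => rw [map_add]; exact add_mem h h'
    | smul t X _ h => rw [map_smul]; exact Submodule.smul_mem _ t h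
    | mem X hX =>
      rcases hX with ⟨m, a, hm, rfl⟩ | ⟨m, x, hm, rfl⟩ <;>
        obtain ⟨m, rfl⟩ := Int.eq_ofNat_of_zero_le hm
      · rw [Modes.der_m0]
        rcases le_or_gt j m with hi | hi
        · exact zsmul_mem (Modes.m0_mem (by omega) _) _
        · simp [sgnChoose_eq_zero hi]
      · rw [Modes.der_m1]
        rcases le_or_gt j m with hi | hi
        · exact zsmul_mem (Modes.m1_mem (by omega) _) _
        · simp [sgnChoose_eq_zero hi]
  have e := proj_nonneg h
  rwa [map_sub, map_sub, der_mode, proj_mode_neg_one, sub_eq_zero] at e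

/-- The negative modes form a subalgebra: all indices `m + l` and `m + l - 1` occurring in the
bracket stay negative, and there the projection followed by the `(-1)`-st mode is the identity. -/
theorem mode_neg_proj_br (x y : v.Hull) : mode (-1) (proj (Modes.br (mode (-1) x) (mode (-1) y))) =
    Modes.br (mode (-1) x) (mode (-1) y) := by
  have k0 (m : ℤ) (hm : m < 0) (a : v.V0) :
      mode (-1) (proj (Modes.m0 m a)) = Modes.m0 m a := by
    have e : (-1 - ((-1 - m).toNat : ℕ) : ℤ) = m := by omega
    rw [proj_m0, if_pos hm, mode_neg_one_c0, e]
  have k1 (m : ℤ) (hm : m < 0) (a : v.V1) :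
      mode (-1) (proj (Modes.m1 m a)) = Modes.m1 m a := by
    have e : (-1 - ((-1 - m).toNat : ℕ) : ℤ) = m := by omega
    rw [proj_m1, if_pos hm, mode_neg_one_c1, e]
  induction x using induction with
  | hadd X Y h h' => simp only [map_add, LinearMap.add_apply, h, h']
  | h0 i a =>
    induction y using induction with
    | hadd X Y h h' => simp only [map_add, h, h']
    | h0 j b => simp [mode_neg_one_c0]
    | h1 j y =>
      rw [mode_neg_one_c0, mode_neg_one_c1, Modes.br_m0_m1, k0 _ (by omega)]
  | h1 i x =>
    induction y using induction with
    | hadd X Y h h' => simp only [map_add, h, h']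
    | h0 j b =>
      rw [mode_neg_one_c0, mode_neg_one_c1, Modes.br_m1_m0, k0 _ (by omega)]
    | h1 j y =>
      rw [mode_neg_one_c1, mode_neg_one_c1, Modes.br_m1_m1, map_add, map_add, map_zsmul, map_zsmul,
        k0 _ (by omega), k1 _ (by omega)]

end Hull

end TruncVA

/-! ### The products of the conformal algebra -/

namespace TruncVA

variable {k : Type u} [CommRing k] {v : TruncVA k}

namespace Hull

/-- The products `x₍ₙ₎y` of the hull. -/
noncomputable def prod (n : ℕ) : v.Hull →ₗ[k] v.Hull →ₗ[k] v.Hull :=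
  (Modes.br.compl₁₂ (mode n) (mode (-1))).compr₂ proj

theorem prod_apply (n : ℕ) (x y : v.Hull) :
    prod n x y = proj (Modes.br (mode n x) (mode (-1) y)) := rfl

theorem proj_m0_of_nonneg {m : ℤ} (h : 0 ≤ m) (a : v.V0) : proj (Modes.m0 m a) = 0 :=
  proj_nonneg (Modes.m0_mem h a)

theorem proj_m1_of_nonneg {m : ℤ} (h : 0 ≤ m) (x : v.V1) : proj (Modes.m1 m x) = 0 :=
  proj_nonneg (Modes.m1_mem h x)

theorem prod_evZero (x y : v.Hull) : EvZero fun n => prod n x y := by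
  induction x using induction with
  | hadd X Y h h' => simpa using h.add h'
  | h0 i a =>
    induction y using induction with
    | hadd X Y h h' => simpa using h.add h'
    | h0 j b => exact ⟨0, fun n _ => by simp [prod_apply]⟩
    | h1 j y =>
      refine ⟨i + j + 2, fun n hn => ?_⟩
      beta_reduce
      rw [prod_apply, mode_c0, mode_neg_one_c1, map_zsmul, LinearMap.smul_apply, Modes.br_m0_m1,
        map_zsmul, proj_m0_of_nonneg (by omega), smul_zero]
  | h1 i x =>
    induction y using induction with
    | hadd X Y h h' => simpa using h.add h'
    | h0 j b =>
      refine ⟨i + j + 2, fun n hn => ?_⟩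
      beta_reduce
      rw [prod_apply, mode_c1, mode_neg_one_c0, map_zsmul, LinearMap.smul_apply, Modes.br_m1_m0,
        map_zsmul, proj_m0_of_nonneg (by omega), smul_zero]
    | h1 j y =>
      refine ⟨i + j + 2, fun n hn => ?_⟩
      beta_reduce
      rw [prod_apply, mode_c1, mode_neg_one_c1, map_zsmul, LinearMap.smul_apply, Modes.br_m1_m1,
        map_zsmul, map_add, map_zsmul, proj_m0_of_nonneg (by omega), proj_m1_of_nonneg (by omega),
        smul_zero, add_zero, smul_zero]

theorem der_prod_leibniz (i n : ℕ) (x y : v.Hull) : der i (prod n x y) =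
    ∑ p ∈ Finset.HasAntidiagonal.antidiagonal i, prod n (der p.1 x) (der p.2 y) := by
  simp only [prod_apply, ← proj_der, Modes.der_br, map_sum, der_mode]

theorem prod_der (i n : ℕ) (x y : v.Hull) :
    prod n (der i x) y = ((-1) ^ i * n.choose i : ℤ) • prod (n - i) x y := by
  have e : sgnChoose n i = (-1) ^ i * n.choose i := by rw [sgnChoose, Ring.choose_natCast]
  rw [prod_apply, mode_der, map_zsmul, LinearMap.smul_apply, map_zsmul, e]
  rcases le_or_gt i n with h | h
  · rw [prod_apply, Nat.cast_sub h]
  · simp [Nat.choose_eq_zero_of_lt h]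

/-- The right-hand side of the commutator formula for modes. -/
noncomputable def modeSum (m l : ℤ) (x y : v.Hull) : v.Modes :=
  ∑ᶠ j : ℕ, Ring.choose m j • mode (m + l - j) (prod j x y)

theorem modeSum_evZero (c : ℕ → ℤ) (m : ℕ → ℤ) (x y : v.Hull) :
    EvZero fun j : ℕ => c j • mode (m j) (prod j x y) := by
  obtain ⟨N, hN⟩ := prod_evZero x y
  exact ⟨N, fun j hj => by simp [hN j hj]⟩

theorem modeSum_add_left (m l : ℤ) (x x' y : v.Hull) :
    modeSum m l (x + x') y = modeSum m l x y + modeSum m l x' y := by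
  rw [modeSum, modeSum, modeSum, ← (modeSum_evZero _ _ _ _).finsum_add (modeSum_evZero _ _ _ _)]
  simp

theorem modeSum_add_right (m l : ℤ) (x y y' : v.Hull) :
    modeSum m l x (y + y') = modeSum m l x y + modeSum m l x y' := by
  rw [modeSum, modeSum, modeSum, ← (modeSum_evZero _ _ _ _).finsum_add (modeSum_evZero _ _ _ _)]
  simp

/-- The first `i` terms vanish by `prod_der`. After the shift of summation, the coefficients agree
by `C(m, j+i) C(j+i, i) = C(m, i) C(m-i, j)`. -/
theorem modeSum_der (i : ℕ) (m l : ℤ) (x y : v.Hull) :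
    modeSum m l (der i x) y = sgnChoose m i • modeSum (m - i) l x y := by
  rw [modeSum, (modeSum_evZero _ _ _ _).finsum_shift i]
  · rw [modeSum, ← zsmulAddGroupHom_apply, (modeSum_evZero _ _ _ _).map_finsum]
    refine finsum_congr fun j => ?_
    have h := Ring.choose_smul_choose m (Nat.le_add_left i j)
    rw [Nat.add_sub_cancel, nsmul_eq_mul] at h
    have e : m + l - (j + i : ℕ) = m - i + l - j := by push_cast; ring
    rw [zsmulAddGroupHom_apply, prod_der, map_zsmul, smul_smul, smul_smul, Nat.add_sub_cancel, e,
      sgnChoose]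
    congr 1
    linear_combination (-1) ^ i * h
  · intro j hj
    rw [prod_der, Nat.choose_eq_zero_of_lt hj]
    simp

theorem der_modeSum (i : ℕ) (m l : ℤ) (x y : v.Hull) : Modes.der i (modeSum m l x y) =
    ∑ p ∈ Finset.HasAntidiagonal.antidiagonal i, modeSum m l (der p.1 x) (der p.2 y) := by
  have e := (modeSum_evZero (fun j => Ring.choose m j) (fun j => m + l - j) x y).map_finsum
    (Modes.der i).toAddMonoidHom
  simp only [LinearMap.toAddMonoidHom_coe, map_zsmul, der_mode, der_prod_leibniz, map_sum,
    Finset.smul_sum] at e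
  refine e.trans (finsum_sum_comm _ _ fun p _ => ?_)
  exact (modeSum_evZero _ _ _ _).support_finite

theorem finsum_eq_add {M : Type*} [AddCommGroup M] (f : ℕ → M) (h : ∀ j, 2 ≤ j → f j = 0) :
    ∑ᶠ j, f j = f 0 + f 1 := by
  have e : EvZero f := ⟨2, h⟩
  rw [e.finsum_succ, (e.shift 1).finsum_succ, finsum_eq_zero_of_forall_eq_zero, add_zero]
  exact fun j => h _ (by omega)

theorem prod_c1_c1 (x y : v.V1) : prod 0 (c1 0 x) (c1 0 y) = c1 0 (v.res11 x y) ∧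
    prod 1 (c1 0 x) (c1 0 y) = c0 0 (v.pair x y) ∧
    ∀ j, 2 ≤ j → prod j (c1 0 x) (c1 0 y) = 0 := by
  refine ⟨?_, ?_, fun j hj => ?_⟩ <;>
    rw [prod_apply, mode_neg_one_c1, mode_c1, sgnChoose_zero, one_smul, Modes.br_m1_m1, map_add,
      map_zsmul]
  · simp [proj_m1]
  · simp [proj_m1, proj_m0]
  · rw [proj_m1_of_nonneg (by omega), proj_m0_of_nonneg (by omega), smul_zero, add_zero]

theorem prod_c1_c0 (x : v.V1) (b : v.V0) : prod 0 (c1 0 x) (c0 0 b) = c0 0 (v.res10 x b) ∧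
    ∀ j, 1 ≤ j → prod j (c1 0 x) (c0 0 b) = 0 := by
  refine ⟨?_, fun j hj => ?_⟩ <;>
    rw [prod_apply, mode_neg_one_c0, mode_c1, sgnChoose_zero, one_smul, Modes.br_m1_m0]
  · simp [proj_m0]
  · rw [proj_m0_of_nonneg (by omega)]

theorem prod_c0_c1 (a : v.V0) (y : v.V1) : prod 0 (c0 0 a) (c1 0 y) = c0 0 (v.res01 a y) ∧
    ∀ j, 1 ≤ j → prod j (c0 0 a) (c1 0 y) = 0 := by
  refine ⟨?_, fun j hj => ?_⟩ <;>
    rw [prod_apply, mode_neg_one_c1, mode_c0, sgnChoose_zero, one_smul, Modes.br_m0_m1]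
  · simp [proj_m0]
  · rw [proj_m0_of_nonneg (by omega)]

theorem prod_c0_c0 (j : ℕ) (a b : v.V0) : prod j (c0 0 a) (c0 0 b) = 0 := by
  simp [prod_apply]

theorem br_mode_of_gen (m l : ℤ) {x : v.Hull} {y : v.Hull}
    (h : ∀ m l, Modes.br (mode m x) (mode l y) = modeSum m l x y) (i : ℕ) :
    Modes.br (mode m (der i x)) (mode l y) = modeSum m l (der i x) y := by
  rw [mode_der, modeSum_der, map_zsmul, LinearMap.smul_apply, h]

/-- Applying `∂⁽ⁱ⁾` to the formula for `y` gives the sum, over `a + b = i`, of the formulas for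
`∂⁽ᵃ⁾x` and `∂⁽ᵇ⁾y`. Those with `b < i` are known by induction, and the one for `(0, i)` is left. No
factorial has to be inverted. -/
theorem br_mode_of_forall {y : v.Hull}
    (h : ∀ x m l, Modes.br (mode m x) (mode l y) = modeSum m l x y) (i : ℕ) :
    ∀ x m l, Modes.br (mode m x) (mode l (der i y)) = modeSum m l x (der i y) := by
  induction i using Nat.strong_induction_on with
  | _ i ih =>
    intro x m l
    have e := congrArg (Modes.der i) (h x m l)
    rw [Modes.der_br, der_modeSum, ← sub_eq_zero, ← Finset.sum_sub_distrib,
      Finset.sum_eq_single (0, i)] at e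
    · simpa [der_zero, der_mode, sub_eq_zero] using e
    · rintro ⟨a, b⟩ hab hne
      have hab' : a + b = i := Finset.HasAntidiagonal.mem_antidiagonal.mp hab
      have : b ≠ i := fun hb => hne (by simp [hb]; omega)
      simp only [der_mode]
      rw [ih b (by omega), sub_self]
    · simp

/-- The commutator formula for modes. -/
theorem br_mode (m l : ℤ) (x y : v.Hull) :
    Modes.br (mode m x) (mode l y) = modeSum m l x y := by
  have add_left {x x' y : v.Hull} {m l : ℤ}
      (h : Modes.br (mode m x) (mode l y) = modeSum m l x y)
      (h' : Modes.br (mode m x') (mode l y) = modeSum m l x' y) :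
      Modes.br (mode m (x + x')) (mode l y) = modeSum m l (x + x') y := by
    rw [map_add, map_add, LinearMap.add_apply, h, h', modeSum_add_left]
  induction y using induction with
  | hadd y y' h h' => rw [map_add, map_add, h, h', modeSum_add_right]
  | h0 j b =>
    rw [← der_c0_zero]
    refine br_mode_of_forall (fun x m l => ?_) j x m l
    induction x using induction with
    | hadd X X' h h' => exact add_left h h'
    | h0 i a =>
      rw [← der_c0_zero]
      refine br_mode_of_gen m l (fun m l => ?_) i
      rw [modeSum, finsum_eq_zero_of_forall_eq_zero]
      · simp
      · simp [prod_c0_c0]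
    | h1 i x =>
      rw [← der_c1_zero]
      refine br_mode_of_gen m l (fun m l => ?_) i
      obtain ⟨h0, h1⟩ := prod_c1_c0 x b
      rw [modeSum, finsum_eq_add _ fun j hj => by rw [h1 j (by omega), map_zero, smul_zero], h0,
        h1 1 le_rfl]
      simp
  | h1 j y =>
    rw [← der_c1_zero]
    refine br_mode_of_forall (fun x m l => ?_) j x m l
    induction x using induction with
    | hadd X X' h h' => exact add_left h h'
    | h0 i a =>
      rw [← der_c0_zero]
      refine br_mode_of_gen m l (fun m l => ?_) i
      obtain ⟨h0, h1⟩ := prod_c0_c1 a y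
      rw [modeSum, finsum_eq_add _ fun j hj => by rw [h1 j (by omega), map_zero, smul_zero], h0,
        h1 1 le_rfl]
      simp
    | h1 i x =>
      rw [← der_c1_zero]
      refine br_mode_of_gen m l (fun m l => ?_) i
      obtain ⟨h0, h1, h2⟩ := prod_c1_c1 x y
      rw [modeSum, finsum_eq_add _ fun j hj => by rw [h2 j hj, map_zero, smul_zero], h0, h1]
      simp

/-- Nonnegative modes act on the quotient by nonnegative modes, so a representative `Y` may be
replaced by the negative one of the same class. -/
theorem proj_br_nonneg {X Y : v.Modes} (hX : X ∈ Modes.nonneg v) :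
    proj (Modes.br X (mode (-1) (proj Y))) = proj (Modes.br X Y) := by
  have h := proj_nonneg (Modes.br_mem_nonneg hX (sub_mode_proj_mem Y))
  rw [map_sub, map_sub, sub_eq_zero] at h
  exact h.symm

/-- Write `x₍ₙ₎y` as the class of `-[y_{-1}, x_n]` and expand by the commutator formula. The terms
have index `n - 1 - j`: those with `j < n` vanish in the quotient, and the others give the divided
powers `∂⁽ʲ⁻ⁿ⁾`. -/
theorem prod_comm (n : ℕ) (x y : v.Hull) : prod n x y =
    (-1 : ℤ) ^ (n + 1) • ∑ᶠ j : ℕ, (-1 : ℤ) ^ j • der j (prod (n + j) y x) := by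
  have e := (modeSum_evZero (fun j => Ring.choose (-1 : ℤ) j) (fun j => -1 + n - j) y x).map_finsum
    (proj (v := v)).toAddMonoidHom
  have hz : EvZero fun j : ℕ => proj (Ring.choose (-1 : ℤ) j • mode (-1 + n - j) (prod j y x)) :=
    (modeSum_evZero _ _ _ _).map (proj (v := v)).toAddMonoidHom
  simp only [LinearMap.toAddMonoidHom_coe] at e
  rw [prod_apply, Modes.br_skew, br_mode, map_neg, modeSum, e, hz.finsum_shift n]
  · have hs : EvZero fun j : ℕ => (-1 : ℤ) ^ j • der j (prod (n + j) y x) := by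
      obtain ⟨N, hN⟩ := prod_evZero y x
      exact ⟨N, fun j hj => by
        have := hN (n + j) (by omega)
        beta_reduce at this
        simp [this]⟩
    rw [← zsmulAddGroupHom_apply, hs.map_finsum, ← neg_one_zsmul, ← zsmulAddGroupHom_apply,
      (hz.shift n).map_finsum]
    refine finsum_congr fun j => ?_
    have e' : (-1 + n - (j + n : ℕ) : ℤ) = -1 - j := by push_cast; ring
    rw [map_zsmul, e', proj_mode_neg, VertexAlgebra.choose_neg_one, add_comm j n]
    simp only [zsmulAddGroupHom_apply, smul_smul]
    congr 1
    ring
  · intro j hj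
    rw [map_zsmul, proj_mode_of_nonneg (by omega), smul_zero]

/-- This is the Jacobi identity for `x_m`, `y_n`, `z_{-1}`, read in the quotient. The commutator
formula for `[x_m, y_n]` stops at `j = m` as `m ≥ 0`. -/
theorem prod_assoc (m n : ℕ) (x y z : v.Hull) : prod m x (prod n y z) = prod n y (prod m x z) +
    ∑ j ∈ Finset.range (m + 1), m.choose j • prod (m + n - j) (prod j x y) z := by
  rw [prod_apply, prod_apply, proj_br_nonneg (mode_mem_nonneg (by omega) x), prod_apply n,
    prod_apply m x z, proj_br_nonneg (mode_mem_nonneg (by omega) y), Modes.br_br, map_add]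
  refine (add_comm _ _).trans (congrArg _ ?_)
  rw [br_mode, modeSum, finsum_eq_sum_of_support_subset (s := Finset.range (m + 1))]
  · simp only [map_sum, LinearMap.sum_apply]
    refine Finset.sum_congr rfl fun j hj => ?_
    have hj : j ≤ m := by simpa [Nat.lt_succ_iff] using hj
    have e : (m + n - j : ℤ) = (m + n - j : ℕ) := by omega
    rw [Ring.choose_natCast, natCast_zsmul, map_nsmul, LinearMap.smul_apply, map_nsmul, e]
    rfl
  · intro j hj
    by_contra hc
    refine hj ?_
    have hc : m < j := by simpa [Nat.lt_succ_iff] using hc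
    simp [Ring.choose_natCast, Nat.choose_eq_zero_of_lt hc]

/-- The commutator formula at the indices `-1`, `-1`. It identifies the relations of `UC` with those
of the enveloping algebra of the Lie algebra of negative modes. -/
theorem finsum_der_prod (x y : v.Hull) : ∑ᶠ j : ℕ, (-1 : ℤ) ^ j • der (j + 1) (prod j x y) =
    proj (Modes.br (mode (-1) x) (mode (-1) y)) := by
  have e := (modeSum_evZero (fun j => Ring.choose (-1 : ℤ) j) (fun j => -1 + -1 - j) x y).map_finsum
    (proj (v := v)).toAddMonoidHom
  simp only [LinearMap.toAddMonoidHom_coe] at e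
  rw [br_mode, modeSum, e]
  refine finsum_congr fun j => ?_
  have e' : (-1 + -1 - j : ℤ) = -1 - (j + 1 : ℕ) := by push_cast; ring
  rw [map_zsmul, e', proj_mode_neg, VertexAlgebra.choose_neg_one]

end Hull

end TruncVA

/-! ### Gradings -/

theorem isInternal_of_projections {k M : Type*} [CommRing k] [AddCommGroup M] [Module k M]
    (gr : ℕ → Submodule k M) (P : ℕ → M →ₗ[k] M) (h1 : ∀ n x, P n x ∈ gr n)
    (h2 : ∀ n m x, x ∈ gr n → P m x = if n = m then x else 0)
    (h3 : ∀ x, ∃ s : Finset ℕ, ∑ n ∈ s, P n x = x) : DirectSum.IsInternal gr := by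
  have hc (f : DirectSum ℕ fun i => gr i) (n : ℕ) :
      P n (DirectSum.coeAddMonoidHom gr f) = f n := by
    induction f using DirectSum.induction_on with
    | zero => simp
    | of i x =>
      rw [DirectSum.coeAddMonoidHom_of, h2 i n x x.2]
      split_ifs with h
      · subst h
        rw [DirectSum.of_eq_same]
      · rw [DirectSum.of_eq_of_ne _ _ _ (Ne.symm h)]
        rfl
    | add f g hf hg => rw [map_add, map_add, hf, hg, DirectSum.add_apply, Submodule.coe_add]
  refine ⟨fun f g h => ?_, fun x => ?_⟩
  · ext n
    rw [← hc, ← hc, h]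
  · obtain ⟨s, hs⟩ := h3 x
    refine ⟨∑ n ∈ s, DirectSum.of (fun i => gr i) n ⟨P n x, h1 n x⟩, ?_⟩
    rw [map_sum]
    simpa only [DirectSum.coeAddMonoidHom_of] using hs

theorem GrMod.mem_wt {k : Type u} [CommRing k] (M : GrMod k) {e : ℤ} {n : ℕ} (h : e = n)
    {x : M.carrier} (hx : x ∈ M.gr n) : x ∈ M.wt e := by
  rwa [M.wt_of_eq h]

namespace TruncVA

variable {k : Type u} [CommRing k] (v : TruncVA k)

namespace Hull

/-- The homogeneous parts of the hull. -/
noncomputable def gr (n : ℕ) : Submodule k v.Hull :=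
  Submodule.span k ({x | ∃ a, x = c0 n a} ∪ {x | ∃ i y, i + 1 = n ∧ x = c1 i y})

variable {v}

theorem c0_mem (n : ℕ) (a : v.V0) : c0 n a ∈ gr v n :=
  Submodule.subset_span (Or.inl ⟨a, rfl⟩)

theorem c1_mem (n : ℕ) (x : v.V1) : c1 n x ∈ gr v (n + 1) :=
  Submodule.subset_span (Or.inr ⟨n, x, rfl, rfl⟩)

theorem gr_le {n : ℕ} {S : Submodule k v.Hull} (h0 : ∀ a, c0 n a ∈ S)
    (h1 : ∀ i x, i + 1 = n → c1 i x ∈ S) : gr v n ≤ S := by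
  refine Submodule.span_le.mpr ?_
  rintro _ (⟨a, rfl⟩ | ⟨i, x, h, rfl⟩)
  exacts [h0 a, h1 i x h]

/-- The projections to the homogeneous parts. -/
noncomputable def grProj (n : ℕ) : v.Hull →ₗ[k] v.Hull :=
  lift (fun i => if i = n then c0 i else 0) (fun i => if i + 1 = n then c1 i else 0) fun i a => by
    split_ifs
    · rw [c1_d]
    · simp

theorem grProj_c0 (n i : ℕ) (a : v.V0) : grProj n (c0 i a) = if i = n then c0 i a else 0 := by
  rw [grProj, lift_c0]
  split_ifs <;> rfl

theorem grProj_c1 (n i : ℕ) (x : v.V1) : grProj n (c1 i x) = if i + 1 = n then c1 i x else 0 := by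
  rw [grProj, lift_c1]
  split_ifs <;> rfl

theorem isInternal_gr : DirectSum.IsInternal (gr v) := by
  refine isInternal_of_projections _ grProj (fun n x => ?_) (fun n m x hx => ?_) fun x => ?_
  · induction x using induction with
    | hadd x y h h' => simpa using add_mem h h'
    | h0 i a =>
      rw [grProj_c0]
      split_ifs with h
      exacts [h ▸ c0_mem i a, zero_mem _]
    | h1 i x =>
      rw [grProj_c1]
      split_ifs with h
      exacts [h ▸ c1_mem i x, zero_mem _]
  · induction hx using Submodule.span_induction with
    | zero => simp
    | add x y _ _ h h' =>
      rw [map_add, h, h']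
      split_ifs <;> simp
    | smul t x _ h =>
      rw [map_smul, h]
      split_ifs <;> simp
    | mem x hx =>
      rcases hx with ⟨a, rfl⟩ | ⟨i, x, rfl, rfl⟩
      exacts [grProj_c0 _ _ _, grProj_c1 _ _ _]
  · suffices h : ∃ N, ∀ M, N ≤ M → ∑ n ∈ Finset.range M, grProj n x = x from
      ⟨Finset.range h.choose, h.choose_spec _ le_rfl⟩
    induction x using induction with
    | hadd x y h h' =>
      obtain ⟨N, hN⟩ := h
      obtain ⟨N', hN'⟩ := h'
      refine ⟨max N N', fun M hM => ?_⟩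
      simp only [map_add, Finset.sum_add_distrib]
      rw [hN M (le_trans (le_max_left _ _) hM), hN' M (le_trans (le_max_right _ _) hM)]
    | h0 i a =>
      refine ⟨i + 1, fun M hM => ?_⟩
      simp [grProj_c0, Finset.sum_ite_eq, show i < M by omega]
    | h1 i x =>
      refine ⟨i + 2, fun M hM => ?_⟩
      simp [grProj_c1, Finset.sum_ite_eq, show i + 1 < M by omega]

variable (v) in
/-- The hull as a graded module. -/
noncomputable def grMod : GrMod k := ⟨v.Hull, gr v, isInternal_gr⟩

variable (v) in
/-- The homogeneous part of integer weight. -/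
noncomputable def wt (e : ℤ) : Submodule k v.Hull := (grMod v).wt e

theorem proj_m0_mem {m e : ℤ} (h : e = -m - 1) (a : v.V0) :
    proj (Modes.m0 m a) ∈ wt v e := by
  rw [proj_m0]
  split_ifs with hm
  · exact (grMod v).mem_wt (by omega) (c0_mem _ _)
  · exact zero_mem _

theorem proj_m1_mem {m e : ℤ} (h : e = -m) (x : v.V1) :
    proj (Modes.m1 m x) ∈ wt v e := by
  rw [proj_m1]
  split_ifs with hm
  · exact (grMod v).mem_wt (by push_cast; omega) (c1_mem _ _)
  · exact zero_mem _

theorem proj_br_mem (n l : ℤ) (i j : ℕ) {e : ℤ} (he : e = i + j - n - l - 2) {x y : v.Hull}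
    (hx : x ∈ gr v i) (hy : y ∈ gr v j) :
    proj (Modes.br (mode n x) (mode l y)) ∈ wt v e := by
  subst he
  induction hx using Submodule.span_induction with
  | zero => simp
  | add x x' _ _ h h' => simpa using add_mem h h'
  | smul t x _ h => simpa using Submodule.smul_mem _ t h
  | mem x hx =>
    induction hy using Submodule.span_induction with
    | zero => simp
    | add x x' _ _ h h' => simpa using add_mem h h'
    | smul t x _ h => simpa using Submodule.smul_mem _ t h
    | mem y hy =>
      rcases hx with ⟨a, rfl⟩ | ⟨i, x, rfl, rfl⟩ <;> rcases hy with ⟨b, rfl⟩ | ⟨j, y, rfl, rfl⟩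
      · simp
      · simp only [mode_c0, mode_c1, map_zsmul, LinearMap.smul_apply, Modes.br_m0_m1]
        exact zsmul_mem (zsmul_mem (proj_m0_mem (by push_cast; ring) _) _) _
      · simp only [mode_c0, mode_c1, map_zsmul, LinearMap.smul_apply, Modes.br_m1_m0]
        exact zsmul_mem (zsmul_mem (proj_m0_mem (by push_cast; ring) _) _) _
      · simp only [mode_c0, mode_c1, map_zsmul, LinearMap.smul_apply, Modes.br_m1_m1, map_add]
        exact zsmul_mem (zsmul_mem (add_mem (proj_m1_mem (by push_cast; ring) _)
          (zsmul_mem (proj_m0_mem (by push_cast; ring) _) _)) _) _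

theorem prod_mem (n i j : ℕ) {x y : v.Hull} (hx : x ∈ gr v i) (hy : y ∈ gr v j) :
    prod n x y ∈ wt v ((i : ℤ) + j - n - 1) :=
  proj_br_mem n (-1) i j (by ring) hx hy

theorem der_mem (j i : ℕ) {x : v.Hull} (hx : x ∈ gr v i) : der j x ∈ gr v (i + j) := by
  have h : gr v i ≤ (gr v (i + j)).comap (der j) := by
    refine gr_le (fun a => ?_) fun i x h => ?_
    · rw [Submodule.mem_comap, der_c0]
      exact nsmul_mem (c0_mem _ _) _
    · subst h
      have e : i + 1 + j = i + j + 1 := by ring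
      rw [Submodule.mem_comap, der_c1, e]
      exact nsmul_mem (c1_mem _ _) _
  exact h hx

variable (v) in
/-- The conformal algebra freely generated by the `1`-truncated conformal algebra of `v`. -/
noncomputable def conformalAlgebra : ConformalAlgebra k where
  toGrMod := grMod v
  der := der
  der_mem j i _ h := der_mem j i h
  der_zero := der_zero
  der_der := der_der
  prod := prod
  prod_mem n i j _ _ := prod_mem n i j
  der_prod := prod_der
  prod_comm := prod_comm
  prod_assoc := prod_assoc

variable (v) in
/-- The quotient map presenting the hull. -/
noncomputable def mkQ : (ℕ →₀ v.V0) × (ℕ →₀ v.V1) →ₗ[k] v.Hull := v.hullRel.mkQ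

theorem pres_eq_mkQ : LinearMap.coprod (Finsupp.lsum k fun i : ℕ => der i ∘ₗ c0 0)
    (Finsupp.lsum k fun i : ℕ => der i ∘ₗ c1 0) = mkQ v := by
  refine LinearMap.prod_ext (Finsupp.lhom_ext fun i a => ?_) (Finsupp.lhom_ext fun i x => ?_)
  · simp only [LinearMap.comp_apply, LinearMap.inl_apply, LinearMap.coprod_apply,
      Finsupp.lsum_single, map_zero, add_zero, der_c0_zero]
    rfl
  · simp only [LinearMap.comp_apply, LinearMap.inr_apply, LinearMap.coprod_apply,
      Finsupp.lsum_single, map_zero, zero_add, der_c1_zero]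
    rfl

variable (v) in
/-- The universal property of the hull. -/
noncomputable def conformalHull : ConformalHull v (conformalAlgebra v) where
  j0 := c0 0
  j1 := c1 0
  j0_mem a := c0_mem 0 a
  j1_mem x := c1_mem 0 x
  pres_surjective x := by
    obtain ⟨z, rfl⟩ := v.hullRel.mkQ_surjective x
    exact ⟨z, LinearMap.congr_fun pres_eq_mkQ z⟩
  ker_pres := (congrArg LinearMap.ker pres_eq_mkQ).trans v.hullRel.ker_mkQ
  res01 a y := (prod_c0_c1 a y).1
  res10 x b := (prod_c1_c0 x b).1
  res11 x y := (prod_c1_c1 x y).1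
  pair x y := (prod_c1_c1 x y).2.1

end Hull

end TruncVA

/-! ### The enveloping algebra of the conformal algebra -/

namespace TruncVA

variable {k : Type u} [CommRing k] {v : TruncVA k}

namespace Hull

/-- The Lie bracket `∑ⱼ (-1)ʲ ∂⁽ʲ⁺¹⁾(x₍ⱼ₎y)` of the hull. -/
noncomputable def lie (x y : v.Hull) : v.Hull := proj (Modes.br (mode (-1) x) (mode (-1) y))

theorem mode_lie (x y : v.Hull) :
    mode (-1) (lie x y) = Modes.br (mode (-1) x) (mode (-1) y) := mode_neg_proj_br x y

theorem der_lie (j : ℕ) (x y : v.Hull) : der j (lie x y) =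
    ∑ p ∈ Finset.HasAntidiagonal.antidiagonal j, lie (der p.1 x) (der p.2 y) := by
  simp only [lie, ← proj_der, Modes.der_br, map_sum, der_mode]

theorem lie_mem {i j : ℕ} {x y : v.Hull} (hx : x ∈ gr v i) (hy : y ∈ gr v j) :
    lie x y ∈ gr v (i + j) := by
  have h := proj_br_mem (-1) (-1) i j (e := (i + j : ℕ)) (by push_cast; ring) hx hy
  exact h

variable (v) in
/-- The two-sided ideal generated by the elements `xy - yx - [x, y]`. -/
noncomputable def envIdeal : TwoSidedIdeal (TensorAlgebra k v.Hull) :=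
  TwoSidedIdeal.span {r | ∃ x y : v.Hull, r = TensorAlgebra.ι k x * TensorAlgebra.ι k y -
    TensorAlgebra.ι k y * TensorAlgebra.ι k x - TensorAlgebra.ι k (lie x y)}

end Hull

variable (v) in
/-- The enveloping algebra of the hull. -/
noncomputable def Env : Type u := (Hull.envIdeal v).ringCon.Quotient

namespace Env

open Hull

noncomputable instance : Ring v.Env := inferInstanceAs (Ring (Hull.envIdeal v).ringCon.Quotient)
noncomputable instance : Algebra k v.Env :=
  inferInstanceAs (Algebra k (Hull.envIdeal v).ringCon.Quotient)

variable (v) in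
/-- The projection from the tensor algebra. -/
noncomputable def mk : TensorAlgebra k v.Hull →ₐ[k] v.Env := (Hull.envIdeal v).ringCon.mkₐ k

theorem mk_surjective : Function.Surjective (mk v) := RingCon.mkₐ_surjective _

theorem mk_eq_zero (z : TensorAlgebra k v.Hull) : mk v z = 0 ↔ z ∈ Hull.envIdeal v :=
  (RingCon.eq (Hull.envIdeal v).ringCon (a := z) (b := 0)).trans
    (TwoSidedIdeal.mem_iff (Hull.envIdeal v) z).symm

variable (v) in
/-- The canonical map from the hull. -/
noncomputable def of : v.Hull →ₗ[k] v.Env := (mk v).toLinearMap ∘ₗ TensorAlgebra.ι k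

theorem mk_ι (x : v.Hull) : mk v (TensorAlgebra.ι k x) = of v x := rfl

theorem of_mul_of (x y : v.Hull) : of v x * of v y = of v y * of v x + of v (lie x y) := by
  have h : mk v (TensorAlgebra.ι k x * TensorAlgebra.ι k y -
      TensorAlgebra.ι k y * TensorAlgebra.ι k x - TensorAlgebra.ι k (lie x y)) = 0 :=
    (mk_eq_zero _).mpr (TwoSidedIdeal.subset_span ⟨x, y, rfl⟩)
  rw [map_sub, map_sub, map_mul, map_mul, mk_ι, mk_ι, mk_ι] at h
  rw [← sub_eq_zero, ← h]
  abel

@[elab_as_elim]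
theorem induction {p : v.Env → Prop} (one : p 1) (mul : ∀ x u, p u → p (of v x * u))
    (add : ∀ u w, p u → p w → p (u + w)) (smul : ∀ (t : k) u, p u → p (t • u)) (u : v.Env) :
    p u := by
  obtain ⟨z, rfl⟩ := mk_surjective u
  suffices h : ∀ u, p u → p (mk v z * u) by simpa using h 1 one
  induction z using TensorAlgebra.induction with
  | algebraMap t =>
    intro u hu
    rw [AlgHom.commutes, ← Algebra.smul_def]
    exact smul t u hu
  | ι x => exact mul x
  | mul z z' h h' =>
    intro u hu
    rw [map_mul, _root_.mul_assoc]
    exact h _ (h' _ hu)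
  | add z z' h h' =>
    intro u hu
    rw [map_add, add_mul]
    exact add _ _ (h _ hu) (h' _ hu)

section Lift

variable {A : Type*} [Ring A] [Algebra k A] (f : v.Hull →ₗ[k] A)
  (h : ∀ x y, f x * f y - f y * f x = f (lie x y))

/-- Algebra homomorphisms out of the enveloping algebra. -/
noncomputable def lift : v.Env →ₐ[k] A :=
  (Hull.envIdeal v).ringCon.liftₐ (TensorAlgebra.lift k f) (by
    intro z w hzw
    have hle : Hull.envIdeal v ≤ TwoSidedIdeal.ker (TensorAlgebra.lift k f) := by
      refine TwoSidedIdeal.span_le.mpr ?_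
      rintro _ ⟨x, y, rfl⟩
      simp [TwoSidedIdeal.mem_ker, h]
    have e := hle ((TwoSidedIdeal.rel_iff _ z w).mp hzw)
    rw [TwoSidedIdeal.mem_ker, map_sub, sub_eq_zero] at e
    exact e)

theorem lift_mk (z : TensorAlgebra k v.Hull) : lift f h (mk v z) = TensorAlgebra.lift k f z :=
  RingCon.liftₐ_mk _ _ _ z

@[simp]
theorem lift_of (x : v.Hull) : lift f h (of v x) = f x := by
  rw [← mk_ι, lift_mk, TensorAlgebra.lift_ι_apply]

end Lift

/-! ### The induced module: modes acting on the enveloping algebra -/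

/-- The action of `y` in the hull on `U`-valued functions of a mode. -/
noncomputable def twist : v.Hull →ₗ[k] Module.End k (v.Modes →ₗ[k] v.Env) :=
  LinearMap.mk₂ k (fun y F => (LinearMap.mulLeft k (of v y)) ∘ₗ F +
      F ∘ₗ (Modes.br (v := v)).flip (mode (-1) y))
    (fun x y F => by ext X; simp [add_mul]; abel)
    (fun t x F => by ext X; simp)
    (fun x F G => by ext X; simp [mul_add]; abel)
    (fun t x F => by ext X; simp)

theorem twist_apply (y : v.Hull) (F : v.Modes →ₗ[k] v.Env) (X : v.Modes) :
    twist y F X = of v y * F X + F (Modes.br X (mode (-1) y)) := rfl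

/-- An action of modes should satisfy `X(y u) = y X(u) + [X, y_{-1}](u)`. Read as an operation of
`y` on the function `X ↦ X(u)`, this rule is `twist`. Compatibility with the bracket, which follows
from the Jacobi identity, makes it an action of the enveloping algebra, so that the rule determines
the modes on every `u` from their values on `1`. -/
theorem twist_lie (x y : v.Hull) : twist x * twist y - twist y * twist x = twist (lie x y) := by
  refine LinearMap.ext fun F => LinearMap.ext fun X => ?_
  rw [LinearMap.sub_apply, LinearMap.sub_apply, Module.End.mul_apply, Module.End.mul_apply]
  simp only [twist_apply, mode_lie, mul_add, ← _root_.mul_assoc]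
  rw [of_mul_of x y, Modes.br_br X, Modes.br_skew (mode (-1) x)]
  simp only [map_add, map_neg, add_mul]
  abel

/-- The action of the enveloping algebra on its functions of a mode. -/
noncomputable def twistHom : v.Env →ₐ[k] Module.End k (v.Modes →ₗ[k] v.Env) :=
  lift (A := Module.End k (v.Modes →ₗ[k] v.Env)) twist twist_lie

/-- The action of modes on the enveloping algebra. -/
noncomputable def act : v.Modes →ₗ[k] v.Env →ₗ[k] v.Env :=
  LinearMap.mk₂ k (fun X u => twistHom u (of v ∘ₗ proj) X)
    (fun X Y u => by rw [map_add]) (fun t X u => by rw [map_smul])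
    (fun X u w => by rw [map_add]; rfl) (fun t X u => by rw [map_smul]; rfl)

theorem act_apply (X : v.Modes) (u : v.Env) : act X u = twistHom u (of v ∘ₗ proj) X := rfl

theorem act_one (X : v.Modes) : act X 1 = of v (proj X) := by
  rw [act_apply, map_one]
  rfl

theorem act_mul (X : v.Modes) (y : v.Hull) (u : v.Env) :
    act X (of v y * u) = of v y * act X u + act (Modes.br X (mode (-1) y)) u := by
  rw [act_apply, map_mul, twistHom, lift_of, Module.End.mul_apply, twist_apply]
  rfl

theorem act_of (X : v.Modes) (y : v.Hull) :
    act X (of v y) = of v y * of v (proj X) + of v (proj (Modes.br X (mode (-1) y))) := by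
  have := act_mul X y 1
  rwa [mul_one, act_one, act_one] at this

/-- The definition prescribes this on `1` only. It propagates because moving `x_{-1}` past `y` costs
the mode of `[x, y]`, exactly as in the algebra itself. -/
theorem act_mode_neg_one (x : v.Hull) (u : v.Env) : act (mode (-1) x) u = of v x * u := by
  induction u using induction generalizing x with
  | one => rw [act_one, proj_mode_neg_one, mul_one]
  | add u w h h' => rw [map_add, h, h', mul_add]
  | smul t u h => rw [map_smul, h, mul_smul_comm]
  | mul y u h =>
    rw [act_mul, h, ← mode_lie, h, ← _root_.mul_assoc, ← _root_.mul_assoc, of_mul_of x y, add_mul]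

/-- For products this is the Jacobi identity. The content is the case of the vacuum: subtracting
from `X` and `Y` their negative parts leaves nonnegative modes, whose bracket projects to zero. -/
theorem act_br (X Y : v.Modes) (u : v.Env) :
    act (Modes.br X Y) u = act X (act Y u) - act Y (act X u) := by
  induction u using induction generalizing X Y with
  | one =>
    have h := proj_nonneg (Modes.br_mem_nonneg (sub_mode_proj_mem X) (sub_mode_proj_mem Y))
    simp only [map_sub, LinearMap.sub_apply] at h
    have h1 : proj (Modes.br X Y) = proj (Modes.br X (mode (-1) (proj Y))) -
        proj (Modes.br Y (mode (-1) (proj X))) - lie (proj X) (proj Y) := by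
      rw [Modes.br_skew Y, map_neg, lie]
      rw [sub_eq_zero] at h
      rw [sub_eq_iff_eq_add] at h
      rw [h]
      abel
    rw [act_one, act_one, act_one, act_of, act_of, of_mul_of (proj X) (proj Y), h1, map_sub,
      map_sub]
    abel
  | add u w h h' =>
    simp only [map_add, h, h']
    abel
  | smul t u h => simp only [map_smul, h, smul_sub]
  | mul y u h =>
    have e : Modes.br (Modes.br X Y) (mode (-1) y) = Modes.br X (Modes.br Y (mode (-1) y)) -
        Modes.br Y (Modes.br X (mode (-1) y)) := by
      rw [Modes.br_br X]
      abel
    simp only [act_mul, map_add, h, e, map_sub, LinearMap.sub_apply, mul_sub]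
    abel

/-! ### Divided powers on the enveloping algebra -/

/-- The algebra homomorphism `u ↦ ∑ⱼ ∂⁽ʲ⁾u tʲ`. -/
noncomputable def derSeries : v.Env →ₐ[k] PowerSeries v.Env :=
  lift
    { toFun := fun x => PowerSeries.mk fun i => of v (Hull.der i x)
      map_add' := fun x y => by ext; simp
      map_smul' := fun t x => by ext; simp } fun x y => by
    ext n
    simp only [LinearMap.coe_mk, AddHom.coe_mk, map_sub, PowerSeries.coeff_mul,
      PowerSeries.coeff_mk]
    -- One of the two antidiagonal sums is reversed so that the same pair of derivatives of `x` and
    -- `y` occurs in both orders.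
    rw [← Finset.Nat.sum_antidiagonal_swap, ← Finset.sum_sub_distrib, der_lie, map_sum]
    rw [← Finset.Nat.sum_antidiagonal_swap]
    refine Finset.sum_congr rfl fun p _ => ?_
    simp [of_mul_of (Hull.der p.1 x)]

/-- The operators `∂⁽ʲ⁾` on the enveloping algebra. -/
noncomputable def der (j : ℕ) : v.Env →ₗ[k] v.Env :=
  ((PowerSeries.coeff (R := v.Env) j).restrictScalars k) ∘ₗ derSeries.toLinearMap

theorem der_apply (j : ℕ) (u : v.Env) : der j u = PowerSeries.coeff j (derSeries u) := rfl

theorem der_one {j : ℕ} (h : 0 < j) : der j (1 : v.Env) = 0 := by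
  rw [der_apply, map_one, PowerSeries.coeff_one, if_neg (by omega)]

theorem der_mul (j : ℕ) (u w : v.Env) : der j (u * w) =
    ∑ p ∈ Finset.HasAntidiagonal.antidiagonal j, der p.1 u * der p.2 w := by
  simp only [der_apply, map_mul, PowerSeries.coeff_mul]

theorem der_of (j : ℕ) (x : v.Hull) : der j (of v x) = of v (Hull.der j x) := by
  rw [der_apply, derSeries, lift_of]
  simp

theorem der_zero (u : v.Env) : der 0 u = u := by
  induction u using induction with
  | one => rw [der_apply, map_one, PowerSeries.coeff_zero_one]
  | add u w h h' => rw [map_add, h, h']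
  | smul t u h => rw [map_smul, h]
  | mul x u h => simp [der_mul, der_of, h, Hull.der_zero]

end Env

end TruncVA

/-! ### The vertex algebra structure on the enveloping algebra -/

/-- Vandermonde's identity distributes `C(i + j, i)` over the ways of splitting `i` between two
factors; this is why `∂⁽ⁱ⁾∂⁽ʲ⁾ = C(i+j, i) ∂⁽ⁱ⁺ʲ⁾` passes to products. -/
theorem sum_antidiagonal_choose {M : Type*} [AddCommMonoid M] (i j : ℕ) (f : ℕ → ℕ → M) :
    ∑ p ∈ Finset.HasAntidiagonal.antidiagonal j, ∑ q ∈ Finset.HasAntidiagonal.antidiagonal i,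
      ((q.1 + p.1).choose q.1 * (q.2 + p.2).choose q.2) • f (q.1 + p.1) (q.2 + p.2) =
    (i + j).choose i • ∑ p ∈ Finset.HasAntidiagonal.antidiagonal (i + j), f p.1 p.2 := by
  have h : (i + j).choose i • ∑ p ∈ Finset.HasAntidiagonal.antidiagonal (i + j), f p.1 p.2 =
      ∑ p ∈ Finset.HasAntidiagonal.antidiagonal (i + j),
        ∑ q ∈ Finset.HasAntidiagonal.antidiagonal i,
          (p.1.choose q.1 * p.2.choose q.2) • f p.1 p.2 := by
    rw [Finset.smul_sum]
    refine Finset.sum_congr rfl fun p hp => ?_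
    rw [← Finset.HasAntidiagonal.mem_antidiagonal.mp hp, Nat.add_choose_eq, Finset.sum_smul]
  rw [h, Finset.sum_comm, Finset.sum_comm (s := Finset.HasAntidiagonal.antidiagonal (i + j))]
  refine Finset.sum_congr rfl fun q hq => ?_
  have hq := Finset.HasAntidiagonal.mem_antidiagonal.mp hq
  -- The right-hand side has additional pairs with `p.1 < q.1` or `p.2 < q.2`, whose binomial
  -- coefficients are zero.
  refine Finset.sum_bij_ne_zero (fun p _ _ => (q.1 + p.1, q.2 + p.2)) ?_ ?_ ?_ ?_
  · rintro ⟨a, b⟩ hp -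
    have hp := Finset.HasAntidiagonal.mem_antidiagonal.mp hp
    rw [Finset.HasAntidiagonal.mem_antidiagonal]
    simp only at hp ⊢
    omega
  · rintro ⟨a, b⟩ _ _ ⟨a', b'⟩ _ _ h
    simp only [Prod.mk.injEq] at h ⊢
    omega
  · rintro ⟨s, t⟩ hp hne
    have hp := Finset.HasAntidiagonal.mem_antidiagonal.mp hp
    have h1 : q.1 ≤ s := by
      by_contra hc
      rw [Nat.choose_eq_zero_of_lt (show (s, t).1 < q.1 by simpa using hc)] at hne
      simp at hne
    have h2 : q.2 ≤ t := by
      by_contra hc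
      rw [Nat.choose_eq_zero_of_lt (show (s, t).2 < q.2 by simpa using hc)] at hne
      simp at hne
    have e1 : q.1 + (s - q.1) = s := by omega
    have e2 : q.2 + (t - q.2) = t := by omega
    refine ⟨(s - q.1, t - q.2), ?_, ?_, ?_⟩
    · rw [Finset.HasAntidiagonal.mem_antidiagonal]
      simp only at hp ⊢
      omega
    · simpa only [e1, e2] using hne
    · simp only [e1, e2]
  · rintro ⟨a, b⟩ _ _
    rfl

theorem coeff_monomial_mul_eq {R : Type*} [Semiring R] (d n : ℕ) (r : R) (p : Polynomial R) :
    (Polynomial.monomial d r * p).coeff n = if d ≤ n then r * p.coeff (n - d) else 0 := by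
  rw [← Polynomial.C_mul_X_pow_eq_monomial, mul_assoc, Polynomial.coeff_C_mul,
    Polynomial.coeff_X_pow_mul']
  split_ifs <;> simp

theorem sum_antidiagonal_left_comm {M : Type*} [AddCommMonoid M] (n : ℕ) (f : ℕ → ℕ → ℕ → M) :
    ∑ p ∈ Finset.HasAntidiagonal.antidiagonal n,
      ∑ q ∈ Finset.HasAntidiagonal.antidiagonal p.2, f p.1 q.1 q.2 =
    ∑ p ∈ Finset.HasAntidiagonal.antidiagonal n,
      ∑ q ∈ Finset.HasAntidiagonal.antidiagonal p.2, f q.1 p.1 q.2 := by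
  rw [← sum_antidiagonal_assoc n f, ← sum_antidiagonal_assoc n fun a b c => f b a c]
  refine Finset.sum_congr rfl fun p _ => ?_
  rw [← Finset.Nat.sum_antidiagonal_swap]
  rfl

namespace TruncVA

variable {k : Type u} [CommRing k] {v : TruncVA k}

namespace Env

open Hull

theorem der_der (i j : ℕ) (u : v.Env) : der i (der j u) = (i + j).choose i • der (i + j) u := by
  induction u using induction generalizing i j with
  | one =>
    rcases Nat.eq_zero_or_pos j with rfl | hj
    · simp [der_zero]
    · rw [der_one hj, der_one (by omega), map_zero, smul_zero]
  | add u w h h' => simp only [map_add, h, h', smul_add]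
  | smul t u h => rw [map_smul, map_smul, map_smul, h, smul_comm]
  | mul x u h =>
    simp only [der_mul, map_sum, der_of, h, Hull.der_der, map_nsmul]
    rw [← sum_antidiagonal_choose i j fun a b => of v (Hull.der a x) * der b u]
    simp only [smul_mul_smul_comm]

/-- Induction along the rule defining the action; both terms of that rule become triple antidiagonal
sums, matched by regrouping. -/
theorem der_act (j : ℕ) (X : v.Modes) (u : v.Env) : der j (act X u) =
    ∑ p ∈ Finset.HasAntidiagonal.antidiagonal j, act (Modes.der p.1 X) (der p.2 u) := by
  induction u using induction generalizing j X with
  | one =>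
    rw [act_one, der_of, Finset.sum_eq_single (j, 0)]
    · rw [der_zero, act_one, proj_der]
    · rintro ⟨a, b⟩ hab hne
      have hab := Finset.HasAntidiagonal.mem_antidiagonal.mp hab
      have : b ≠ 0 := fun hb => hne (by subst hb; simp at hab; simp [hab])
      rw [der_one (by omega), map_zero]
    · simp
  | add u w h h' => simp only [map_add, h, h', Finset.sum_add_distrib]
  | smul t u h => simp only [map_smul, h, Finset.smul_sum]
  | mul y u h =>
    simp only [act_mul, map_add, der_mul, h, der_of, Finset.mul_sum, map_sum, Modes.der_br,
      LinearMap.sum_apply, der_mode, Finset.sum_add_distrib]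
    rw [sum_antidiagonal_left_comm j fun a b c =>
        of v (Hull.der a y) * act (Modes.der b X) (der c u),
      sum_antidiagonal_assoc j fun a b c =>
        act (Modes.br (Modes.der a X) (mode (-1) (Hull.der b y))) (der c u)]

/-! ### The grading of the enveloping algebra -/

/-- The monomials as `k`-linear maps. -/
noncomputable def mono (n : ℕ) : v.Env →ₗ[k] Polynomial v.Env where
  toFun u := Polynomial.monomial n u
  map_add' := map_add _
  map_smul' t u := (Polynomial.smul_monomial t n u).symm

/-- The grading of the hull, as the linear map `x ↦ ∑ₙ xₙ tⁿ`. -/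
noncomputable def grHom : v.Hull →ₗ[k] Polynomial v.Env :=
  Hull.lift (fun i => mono i ∘ₗ of v ∘ₗ c0 i) (fun i => mono (i + 1) ∘ₗ of v ∘ₗ c1 i)
    fun i a => (map_nsmul (mono (i + 1) ∘ₗ of v) _ _).symm.trans
      (congrArg (mono (i + 1) ∘ₗ of v) (c1_d i a).symm)

theorem grHom_of_mem {n : ℕ} {x : v.Hull} (hx : x ∈ gr v n) :
    grHom x = Polynomial.monomial n (of v x) := by
  induction hx using Submodule.span_induction with
  | zero => simp
  | add x y _ _ h h' => simp only [map_add, h, h']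
  | smul t x _ h =>
    rw [map_smul, h, map_smul, Polynomial.smul_monomial]
  | mem x hx =>
    rcases hx with ⟨a, rfl⟩ | ⟨i, x, rfl, rfl⟩
    · rw [grHom, lift_c0]
      rfl
    · rw [grHom, lift_c1]
      rfl

theorem exists_gr_induction {p : v.Hull → Prop} (h : ∀ n, ∀ x ∈ gr v n, p x)
    (hadd : ∀ x y, p x → p y → p (x + y)) (x : v.Hull) : p x := by
  induction x using Hull.induction with
  | h0 i a => exact h _ _ (c0_mem i a)
  | h1 i x => exact h _ _ (c1_mem i x)
  | hadd X Y h h' => exact hadd _ _ h h'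

/-- The homomorphism `u ↦ ∑ₙ uₙ tⁿ`, where `uₙ` is the component of degree `n` of `u`. -/
noncomputable def grSeries : v.Env →ₐ[k] Polynomial v.Env :=
  lift grHom fun x y => by
    induction x using exists_gr_induction with
    | hadd x x' h h' =>
      have e : lie (x + x') y = lie x y + lie x' y := by simp [lie]
      rw [e]
      simp only [map_add, ← h, ← h', add_mul, mul_add]
      abel
    | h i x hx =>
      induction y using exists_gr_induction with
      | hadd y y' h h' =>
        have e : lie x (y + y') = lie x y + lie x y' := by simp [lie]
        rw [e]
        simp only [map_add, ← h, ← h', add_mul, mul_add]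
        abel
      | h j y hy =>
        rw [grHom_of_mem hx, grHom_of_mem hy, grHom_of_mem (lie_mem hx hy),
          Polynomial.monomial_mul_monomial, Polynomial.monomial_mul_monomial, add_comm j i,
          ← map_sub, of_mul_of x y, add_sub_cancel_left]

/-- The projections to the homogeneous parts. -/
noncomputable def grProj (n : ℕ) : v.Env →ₗ[k] v.Env :=
  ((Polynomial.lcoeff v.Env n).restrictScalars k) ∘ₗ grSeries.toLinearMap

theorem grProj_apply (n : ℕ) (u : v.Env) : grProj n u = (grSeries u).coeff n := rfl

variable (v) in
/-- The homogeneous parts of the enveloping algebra. -/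
noncomputable def gr (n : ℕ) : Submodule k v.Env where
  carrier := {u | grSeries u = Polynomial.monomial n u}
  add_mem' {u w} (hu : _ = _) (hw : _ = _) := by
    change grSeries (u + w) = _
    rw [map_add, map_add, hu, hw]
  zero_mem' := by
    change grSeries 0 = _
    simp
  smul_mem' t u (hu : _ = _) := by
    change grSeries (t • u) = _
    rw [map_smul, hu, Polynomial.smul_monomial]

theorem one_mem : (1 : v.Env) ∈ gr v 0 := by
  change grSeries 1 = _
  simp

theorem of_mul_mem {i j : ℕ} {x : v.Hull} {u : v.Env} (hx : x ∈ Hull.gr v i) (hu : u ∈ gr v j) :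
    of v x * u ∈ gr v (i + j) := by
  change grSeries _ = _
  have hu : grSeries u = _ := hu
  rw [map_mul, hu, grSeries, lift_of, grHom_of_mem hx, Polynomial.monomial_mul_monomial]

/-- A single induction with two uses: for `S = gr` the projections land in the homogeneous parts,
and for general `S` the homogeneous parts are spanned by products of homogeneous generators. -/
theorem grProj_mem_of (S : ℕ → Submodule k v.Env) (h1 : 1 ∈ S 0)
    (h : ∀ (d : ℕ) (x : v.Hull) (j : ℕ) (u : v.Env), x ∈ Hull.gr v d → u ∈ S j →
      of v x * u ∈ S (d + j)) (n : ℕ) (u : v.Env) : grProj n u ∈ S n := by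
  induction u using induction generalizing n with
  | one =>
    rw [grProj_apply, map_one, Polynomial.coeff_one]
    split_ifs with hn
    · exact hn ▸ h1
    · exact zero_mem _
  | add u w hu hw => rw [map_add]; exact add_mem (hu n) (hw n)
  | smul t u hu => rw [map_smul]; exact Submodule.smul_mem _ t (hu n)
  | mul x u hu =>
    induction x using exists_gr_induction with
    | hadd x y hx hy => rw [map_add, add_mul, map_add]; exact add_mem hx hy
    | h d x hx =>
      rw [grProj_apply, map_mul, grSeries, lift_of, grHom_of_mem hx, coeff_monomial_mul_eq]
      split_ifs with hd
      · have := h d x (n - d) _ hx (hu (n - d))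
        rwa [Nat.add_sub_cancel' hd] at this
      · exact zero_mem _

theorem grProj_of_mem {n : ℕ} (m : ℕ) {u : v.Env} (hu : u ∈ gr v n) :
    grProj m u = if n = m then u else 0 := by
  have hu : grSeries u = _ := hu
  rw [grProj_apply, hu, Polynomial.coeff_monomial]

theorem gr_le (S : ℕ → Submodule k v.Env) (h1 : 1 ∈ S 0)
    (h : ∀ (d : ℕ) (x : v.Hull) (j : ℕ) (u : v.Env), x ∈ Hull.gr v d → u ∈ S j →
      of v x * u ∈ S (d + j)) (n : ℕ) : gr v n ≤ S n := fun u hu => by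
  have := grProj_mem_of S h1 h n u
  rwa [grProj_of_mem n hu, if_pos rfl] at this

theorem exists_sum_grProj (u : v.Env) : ∃ N, ∀ M, N ≤ M →
    ∑ n ∈ Finset.range M, grProj n u = u := by
  induction u using induction with
  | one =>
    refine ⟨1, fun M hM => ?_⟩
    simp only [grProj_of_mem _ one_mem, Finset.sum_ite_eq]
    rw [if_pos (by simp; omega)]
  | add x y h h' =>
    obtain ⟨N, hN⟩ := h
    obtain ⟨N', hN'⟩ := h'
    refine ⟨max N N', fun M hM => ?_⟩
    simp only [map_add, Finset.sum_add_distrib]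
    rw [hN M (le_trans (le_max_left _ _) hM), hN' M (le_trans (le_max_right _ _) hM)]
  | smul t u h =>
    obtain ⟨N, hN⟩ := h
    refine ⟨N, fun M hM => ?_⟩
    simp only [map_smul, ← Finset.smul_sum, hN M hM]
  | mul x u h =>
    induction x using exists_gr_induction with
    | hadd x y hx hy =>
      obtain ⟨N, hN⟩ := hx
      obtain ⟨N', hN'⟩ := hy
      refine ⟨max N N', fun M hM => ?_⟩
      simp only [map_add, add_mul, Finset.sum_add_distrib]
      rw [hN M (le_trans (le_max_left _ _) hM), hN' M (le_trans (le_max_right _ _) hM)]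
    | h d x hx =>
      obtain ⟨N, hN⟩ := h
      refine ⟨N + d, fun M hM => ?_⟩
      have e (n : ℕ) : grProj n (of v x * u) = if d ≤ n then of v x * grProj (n - d) u else 0 := by
        rw [grProj_apply, map_mul, grSeries, lift_of, grHom_of_mem hx,
          coeff_monomial_mul_eq]
        rfl
      simp only [e]
      obtain ⟨L, rfl⟩ := Nat.exists_eq_add_of_le' (show d ≤ M by omega)
      rw [add_comm L d, Finset.sum_range_add, Finset.sum_eq_zero, zero_add]
      · simp only [Nat.le_add_right, if_true, Nat.add_sub_cancel_left, ← Finset.mul_sum]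
        rw [hN L (by omega)]
      · intro n hn
        rw [if_neg (by simpa using hn)]

theorem grProj_mem (n : ℕ) (u : v.Env) : grProj n u ∈ gr v n :=
  grProj_mem_of (gr v) one_mem (fun _ _ _ _ => of_mul_mem) n u

theorem isInternal_gr : DirectSum.IsInternal (gr v) :=
  isInternal_of_projections _ grProj grProj_mem (fun _ m _ hx => grProj_of_mem m hx)
    fun u => ⟨_, (exists_sum_grProj u).choose_spec _ le_rfl⟩

variable (v) in
/-- The enveloping algebra as a graded module. -/
noncomputable def grMod : GrMod k := ⟨v.Env, gr v, isInternal_gr⟩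

variable (v) in
/-- The homogeneous part of integer weight. -/
noncomputable def wt (e : ℤ) : Submodule k v.Env := (grMod v).wt e

theorem mem_wt {e : ℤ} {n : ℕ} (h : e = n) {u : v.Env} (hu : u ∈ gr v n) : u ∈ wt v e :=
  (grMod v).mem_wt h hu

theorem wt_of_neg {e : ℤ} (h : e < 0) {u : v.Env} (hu : u ∈ wt v e) : u = 0 := by
  have e : wt v e = ⊥ := (grMod v).wt_of_neg h
  rwa [e, Submodule.mem_bot] at hu

theorem of_mem_wt {e : ℤ} {x : v.Hull} (hx : x ∈ Hull.wt v e) : of v x ∈ wt v e := by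
  rcases e with n | n
  · have := of_mul_mem (show x ∈ Hull.gr v n from hx) one_mem
    rwa [mul_one] at this
  · have hx : x = 0 := hx
    subst hx
    simp

theorem of_mul_mem_wt {i : ℕ} {e e' : ℤ} (he : e' = i + e) {x : v.Hull} {u : v.Env}
    (hx : x ∈ Hull.gr v i) (hu : u ∈ wt v e) : of v x * u ∈ wt v e' := by
  rcases e with n | n
  · exact mem_wt (by simpa using he) (of_mul_mem hx hu)
  · have hu : u = 0 := hu
    subst hu
    simp

/-- The weight of a mode is tested on `1` and carried past each homogeneous factor. Both kinds of
modes are treated together because their brackets mix the two kinds. -/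
theorem act_gen_mem (j : ℕ) {u : v.Env} (hu : u ∈ gr v j) :
    (∀ m a (e : ℤ), e = j - m - 1 → act (Modes.m0 m a) u ∈ wt v e) ∧
      ∀ m x (e : ℤ), e = j - m → act (Modes.m1 m x) u ∈ wt v e := by
  let S (j : ℕ) : Submodule k v.Env :=
    { carrier := {u | (∀ m a (e : ℤ), e = j - m - 1 → act (Modes.m0 m a) u ∈ wt v e) ∧
        ∀ m x (e : ℤ), e = j - m → act (Modes.m1 m x) u ∈ wt v e}
      add_mem' := fun h h' => ⟨fun m a e he => by
        rw [map_add]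
        exact add_mem (h.1 m a e he) (h'.1 m a e he), fun m a e he => by
        rw [map_add]
        exact add_mem (h.2 m a e he) (h'.2 m a e he)⟩
      zero_mem' := ⟨fun m a e he => by simp, fun m a e he => by simp⟩
      smul_mem' := fun t u h => ⟨fun m a e he => by
        rw [map_smul]
        exact Submodule.smul_mem _ t (h.1 m a e he), fun m a e he => by
        rw [map_smul]
        exact Submodule.smul_mem _ t (h.2 m a e he)⟩ }
  refine gr_le S ⟨fun m a e he => ?_, fun m a e he => ?_⟩ (fun d y j u hy hu => ?_) j hu
  · rw [act_one]
    exact of_mem_wt (proj_m0_mem (by simpa using he) a)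
  · rw [act_one]
    exact of_mem_wt (proj_m1_mem (by simpa using he) a)
  · refine ⟨fun m a e he => ?_, fun m x e he => ?_⟩ <;> rw [act_mul]
    · refine add_mem (of_mul_mem_wt (by push_cast at he; omega) hy (hu.1 m a _ rfl)) ?_
      induction hy using Submodule.span_induction with
      | zero => simp
      | add x y _ _ h h' => simpa using add_mem h h'
      | smul t x _ h => simpa using Submodule.smul_mem _ t h
      | mem y hy =>
        rcases hy with ⟨b, rfl⟩ | ⟨i, y, rfl, rfl⟩
        · simp [mode_neg_one_c0]
        · rw [mode_neg_one_c1, Modes.br_m0_m1]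
          exact hu.1 _ _ _ (by push_cast at he; omega)
    · refine add_mem (of_mul_mem_wt (by push_cast at he; omega) hy (hu.2 m x _ rfl)) ?_
      induction hy using Submodule.span_induction with
      | zero => simp
      | add x y _ _ h h' => simpa using add_mem h h'
      | smul t x _ h => simpa using Submodule.smul_mem _ t h
      | mem y hy =>
        rcases hy with ⟨b, rfl⟩ | ⟨i, y, rfl, rfl⟩
        · rw [mode_neg_one_c0, Modes.br_m1_m0]
          exact hu.1 _ _ _ (by push_cast at he; omega)
        · rw [mode_neg_one_c1, Modes.br_m1_m1, map_add, LinearMap.add_apply, map_zsmul,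
            LinearMap.smul_apply]
          exact add_mem (hu.2 _ _ _ (by push_cast at he; omega))
            (zsmul_mem (hu.1 _ _ _ (by push_cast at he; omega)) _)

theorem act_mode_mem (d j : ℕ) (n : ℤ) {x : v.Hull} {u : v.Env} (hx : x ∈ Hull.gr v d)
    (hu : u ∈ gr v j) : act (mode n x) u ∈ wt v ((d : ℤ) + j - n - 1) := by
  induction hx using Submodule.span_induction with
  | zero => simp
  | add x y _ _ h h' => simpa using add_mem h h'
  | smul t x _ h => simpa using Submodule.smul_mem _ t h
  | mem y hy =>
    rcases hy with ⟨b, rfl⟩ | ⟨i, y, rfl, rfl⟩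
    · rw [mode_c0, map_zsmul, LinearMap.smul_apply]
      exact zsmul_mem ((act_gen_mem j hu).1 _ _ _ (by ring)) _
    · rw [mode_c1, map_zsmul, LinearMap.smul_apply]
      exact zsmul_mem ((act_gen_mem j hu).2 _ _ _ (by push_cast; ring)) _

/-- For weight reasons: if `x` has weight `d` and `u` has components in weights below `M`, then `x_n
u` has negative weights for `n ≥ d + M`. -/
theorem exists_act_mode_eq_zero (x : v.Hull) (u : v.Env) :
    ∃ N : ℤ, ∀ n, N ≤ n → act (mode n x) u = 0 := by
  induction x using exists_gr_induction with
  | hadd x y h h' =>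
    obtain ⟨N, hN⟩ := h
    obtain ⟨N', hN'⟩ := h'
    refine ⟨max N N', fun n hn => ?_⟩
    rw [map_add, map_add, LinearMap.add_apply, hN n (le_trans (le_max_left _ _) hn),
      hN' n (le_trans (le_max_right _ _) hn), add_zero]
  | h d x hx =>
    obtain ⟨M, hM⟩ := exists_sum_grProj u
    refine ⟨d + M, fun n hn => ?_⟩
    rw [← hM M le_rfl, map_sum]
    refine Finset.sum_eq_zero fun j hj => ?_
    have hj : j < M := by simpa using hj
    exact wt_of_neg (by omega) (act_mode_mem d j n hx (grProj_mem j u))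

/-! ### The fields on the enveloping algebra, their locality, and the resulting vertex algebra -/

variable (v) in
/-- The fields on the enveloping algebra attached to the elements of the hull. -/
noncomputable def fld : v.Hull →ₗ[k] Fields k v.Env where
  toFun x := ⟨fun n => act (mode n x), exists_act_mode_eq_zero x⟩
  map_add' x y := Subtype.ext (funext fun n => by
    change act (mode n (x + y)) = act (mode n x) + act (mode n y)
    rw [map_add, map_add])
  map_smul' t x := Subtype.ext (funext fun n => by
    change act (mode n (t • x)) = t • act (mode n x)
    rw [map_smul, map_smul])

theorem fld_apply (x : v.Hull) (n : ℤ) (u : v.Env) : (fld v x).1 n u = act (mode n x) u := rfl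

theorem fld_der (i : ℕ) (x : v.Hull) : fld v (Hull.der i x) = Fields.hasse i (fld v x) := by
  refine Subtype.ext (funext fun n => LinearMap.ext fun u => ?_)
  rw [Fields.hasse_apply, fld_apply, fld_apply, mode_der, map_zsmul, LinearMap.smul_apply]
  rfl

/-- The commutator of two generating fields is a combination of the delta distribution and, through
the pairing on `V₁`, its first derivative; hence the exponent `2`. -/
theorem local_of_gen {x y : v.Hull} (hx : x ∈ Set.range (c0 0) ∪ Set.range (c1 0))
    (hy : y ∈ Set.range (c0 0) ∪ Set.range (c1 0)) : Fields.Local (fld v x) (fld v y) := by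
  refine Fields.local_of_iterate_dif (N := 2) fun u m l => ?_
  simp only [fld_apply, ← act_br]
  rcases hx with ⟨a, rfl⟩ | ⟨x, rfl⟩ <;> rcases hy with ⟨b, rfl⟩ | ⟨y, rfl⟩ <;>
    simp only [mode_c0, mode_c1, sgnChoose_zero, one_smul, Nat.cast_zero, sub_zero,
      Modes.br_m0_m0, Modes.br_m0_m1, Modes.br_m1_m0, Modes.br_m1_m1, Function.iterate_succ,
      Function.iterate_zero, Function.comp_apply, id, dif, map_add, map_zsmul, LinearMap.add_apply,
      LinearMap.smul_apply]
  · simp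
  · have e : m + 1 + l = m + (l + 1) := by ring
    have e' : m + 1 + 1 + l = m + 1 + (l + 1) := by ring
    have e'' : m + 1 + (l + 1) = m + (l + 1 + 1) := by ring
    simp [e, e', e'']
  · have e : m + 1 + l = m + (l + 1) := by ring
    have e' : m + 1 + 1 + l = m + 1 + (l + 1) := by ring
    have e'' : m + 1 + (l + 1) = m + (l + 1 + 1) := by ring
    simp [e, e', e'']
  · have e : m + 1 + l = m + (l + 1) := by ring
    have e' : m + 1 + 1 + l = m + 1 + (l + 1) := by ring
    have e'' : m + 1 + (l + 1) = m + (l + 1 + 1) := by ring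
    simp only [e, e', e'']
    module

/-- Derivatives of local fields are local, so one argument can be extended from the generators to
the hull; symmetry then allows the same for the other. -/
theorem fld_local (x y : v.Hull) : Fields.Local (fld v x) (fld v y) := by
  have hgen {y : v.Hull} (h : ∀ z ∈ (Set.range (c0 0) ∪ Set.range (c1 0) : Set v.Hull),
      Fields.Local (fld v z) (fld v y)) (x : v.Hull) : Fields.Local (fld v x) (fld v y) := by
    induction x using Hull.induction with
    | hadd x x' h h' => rw [map_add]; exact h.add_left h'
    | h0 i a =>
      rw [← der_c0_zero, fld_der]
      exact (h _ (Or.inl ⟨a, rfl⟩)).hasse i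
    | h1 i a =>
      rw [← der_c1_zero, fld_der]
      exact (h _ (Or.inr ⟨a, rfl⟩)).hasse i
  exact hgen (fun z hz => (hgen (fun w hw => local_of_gen hw hz) y).symm) x

theorem der_act_mode (j : ℕ) (x : v.Hull) (n : ℤ) (u : v.Env) : der j (act (mode n x) u) =
    ∑ p ∈ Finset.HasAntidiagonal.antidiagonal j, act (mode n (Hull.der p.1 x)) (der p.2 u) := by
  simp only [der_act, der_mode]

variable (v) in
/-- The system of fields defining the vertex algebra structure on the enveloping algebra. -/
noncomputable def fieldSystem : FieldSystem k where
  toGrMod := grMod v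
  C := v.Hull
  grC := Hull.gr v
  vac := (1 : v.Env)
  fld := fld v
  derC := Hull.der
  D := der
  vac_mem := one_mem
  fld_mem x d n j u hx hu := act_mode_mem d j n hx hu
  span_gr S h1 h := by
    refine gr_le S h1 fun d x j u hx hu => ?_
    have := h d x j u hx hu
    exact (act_mode_neg_one x u) ▸ this
  fld_local := fld_local
  fld_vac x n hn := by
    change act (mode n x) 1 = 0
    rw [act_one, proj_mode_of_nonneg hn, map_zero]
  fld_vac' x j := by
    change act (mode (-1 - j) x) 1 = der j (act (mode (-1) x) 1)
    rw [act_one, act_mode_neg_one, mul_one, proj_mode_neg, der_of]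
  D_zero := der_zero
  D_vac j hj := der_one hj
  D_D := der_der
  D_fld j x n u := der_act_mode j x n u
  fld_der := fld_der

variable (v) in
/-- The vertex envelope of the hull. -/
noncomputable def vertexAlgebra : VertexAlgebra k := (fieldSystem v).toVertexAlgebra

theorem prod_of (n : ℤ) (x : v.Hull) (u : v.Env) :
    (vertexAlgebra v).prod n (of v x) u = act (mode n x) u := by
  have e : of v x = ((fieldSystem v).fld x).1 (-1) (fieldSystem v).vac := by
    change _ = act (mode (-1) x) 1
    rw [act_mode_neg_one, mul_one]
  have h := (fieldSystem v).Y_fld x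
  have h' := (fieldSystem v).toVertexAlgebra_prod n (of v x) u
  refine h'.trans ?_
  rw [e, h]
  rfl

theorem der_eq (j : ℕ) (u : v.Env) : (vertexAlgebra v).der j u = der j u :=
  (fieldSystem v).toVertexAlgebra_der j u

theorem prod_of_of (n : ℕ) (x y : v.Hull) :
    of v (Hull.prod n x y) = (vertexAlgebra v).prod n (of v x) (of v y) := by
  rw [prod_of, act_of, proj_mode_of_nonneg (by omega), map_zero, mul_zero, zero_add]
  rfl

theorem rel_eq (x y : v.Hull) : (conformalAlgebra v).rel x y = TensorAlgebra.ι k x *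
    TensorAlgebra.ι k y - TensorAlgebra.ι k y * TensorAlgebra.ι k x -
    TensorAlgebra.ι k (lie x y) := by
  rw [lie, ← finsum_der_prod]
  rfl

variable (v) in
/-- The presentation of the vertex envelope of the hull. -/
noncomputable def conformalEnvelope :
    ConformalEnvelope (conformalAlgebra v) (vertexAlgebra v) where
  p := (mk v).toLinearMap
  p_surjective := mk_surjective
  p_eq_zero z := by
    have e : {r | ∃ x y, r = (conformalAlgebra v).rel x y} =
        {r | ∃ x y : v.Hull, r = TensorAlgebra.ι k x * TensorAlgebra.ι k y -
          TensorAlgebra.ι k y * TensorAlgebra.ι k x - TensorAlgebra.ι k (lie x y)} := by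
      ext r
      exact exists_congr fun x => exists_congr fun y => Eq.congr_right (rel_eq x y)
    rw [e]
    exact mk_eq_zero z
  p_one := map_one (mk v)
  p_mul x z := by
    refine (map_mul (mk v) _ _).trans ?_
    exact (act_mode_neg_one x (mk v z)).symm.trans (prod_of (-1) x (mk v z)).symm
  p_mem n x hx := by
    have := of_mul_mem (show x ∈ Hull.gr v n from hx) one_mem
    rwa [mul_one] at this
  p_der j x := by
    exact (der_of j (show v.Hull from x)).symm.trans (der_eq j (of v x)).symm
  p_prod := prod_of_of

end Env

end TruncVA

/-! ### Quotients of vertex algebras -/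

namespace VertexAlgebra

variable {k : Type u} [CommRing k] (V : VertexAlgebra k)

theorem gr_induction {p : V.carrier → Prop} (h : ∀ n, ∀ x ∈ V.gr n, p x) (h0 : p 0)
    (hadd : ∀ x y, p x → p y → p (x + y)) (x : V.carrier) : p x := by
  have hx : x ∈ ⨆ n, V.gr n := by
    rw [V.isInternal.submodule_iSup_eq_top]
    exact Submodule.mem_top
  exact Submodule.iSup_induction _ (motive := p) hx h h0 hadd

theorem exists_prod_eq_zero (a b : V.carrier) : ∃ N : ℤ, ∀ n, N ≤ n → V.prod n a b = 0 := by
  induction a using V.gr_induction with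
  | h0 => exact ⟨0, by simp⟩
  | hadd x y hx hy =>
    obtain ⟨N, hN⟩ := hx
    obtain ⟨N', hN'⟩ := hy
    refine ⟨max N N', fun n hn => ?_⟩
    rw [map_add, LinearMap.add_apply, hN n (le_trans (le_max_left _ _) hn),
      hN' n (le_trans (le_max_right _ _) hn), add_zero]
  | h i a ha =>
    induction b using V.gr_induction with
    | h0 => exact ⟨0, by simp⟩
    | hadd x y hx hy =>
      obtain ⟨N, hN⟩ := hx
      obtain ⟨N', hN'⟩ := hy
      refine ⟨max N N', fun n hn => ?_⟩
      rw [map_add, hN n (le_trans (le_max_left _ _) hn),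
        hN' n (le_trans (le_max_right _ _) hn), add_zero]
    | h j b hb => exact ⟨i + j, fun n hn => V.prod_eq_zero ha hb (by omega)⟩

/-- The Borcherds identity with `m = 0`, `n = -1`. It expresses the products with `a₍₋₁₎b` through
those with `a` and with `b`, which drives the inductions over words in the generators. -/
theorem negOne_prod_eq_finsum (a b c : V.carrier) (l : ℤ) : V.prod l (V.prod (-1) a b) c =
    ∑ᶠ j : ℕ, (V.prod (-1 - j) a (V.prod (l + j) b c) + V.prod (-1 + l - j) b (V.prod j a c)) := by
  have h := V.borcherds a b c 0 (-1) l
  rw [finsum_eq_single _ 0] at h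
  · simp only [Ring.choose_zero_right, one_smul, Nat.cast_zero, zero_add, sub_zero, add_zero,
      choose_neg_one, ← mul_pow] at h
    simpa using h
  · intro j hj
    obtain ⟨m, rfl⟩ := Nat.exists_eq_succ_of_ne_zero hj
    simp [Ring.choose_zero_succ]

theorem negOne_prod_evZero (a b c : V.carrier) (l : ℤ) : EvZero fun j : ℕ =>
    V.prod (-1 - j) a (V.prod (l + j) b c) + V.prod (-1 + l - j) b (V.prod j a c) := by
  obtain ⟨N, hN⟩ := V.exists_prod_eq_zero b c
  obtain ⟨N', hN'⟩ := V.exists_prod_eq_zero a c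
  refine ⟨(N - l).toNat + N'.toNat, fun j hj => ?_⟩
  beta_reduce
  rw [hN _ (by omega), hN' _ (by omega), map_zero, map_zero, add_zero]

variable (J : Submodule k V.carrier) (hl : ∀ n a, ∀ b ∈ J, V.prod n a b ∈ J)
  (hr : ∀ n, ∀ a ∈ J, ∀ b, V.prod n a b ∈ J)

/-- The products induced on the quotient by an ideal. -/
def quotProd (n : ℤ) : V.carrier ⧸ J →ₗ[k] V.carrier ⧸ J →ₗ[k] V.carrier ⧸ J :=
  J.liftQ
    { toFun := fun a => J.mapQ J (V.prod n a) (hl n a)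
      map_add' := fun a b => by ext; simp
      map_smul' := fun t a => by ext; simp } fun a ha => by
    rw [LinearMap.mem_ker]
    ext b
    simpa using hr n a ha b

theorem quotProd_mkQ (n : ℤ) (a b : V.carrier) :
    V.quotProd J hl hr n (J.mkQ a) (J.mkQ b) = J.mkQ (V.prod n a b) := rfl

theorem isInternal_quot (P : ℕ → V.carrier →ₗ[k] V.carrier) (h1 : ∀ n x, P n x ∈ V.gr n)
    (h2 : ∀ n m x, x ∈ V.gr n → P m x = if n = m then x else 0)
    (h3 : ∀ x, ∃ s : Finset ℕ, ∑ n ∈ s, P n x = x) (hJ : ∀ n, ∀ x ∈ J, P n x ∈ J) :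
    DirectSum.IsInternal fun n => (V.gr n).map J.mkQ := by
  refine isInternal_of_projections _ (fun n => J.mapQ J (P n) (hJ n)) (fun n x => ?_)
    (fun n m x hx => ?_) fun x => ?_
  · obtain ⟨x, rfl⟩ := J.mkQ_surjective x
    exact ⟨P n x, h1 n x, rfl⟩
  · obtain ⟨x, hx, rfl⟩ := hx
    have : J.mapQ J (P m) (hJ m) (J.mkQ x) = J.mkQ (P m x) := rfl
    rw [this, h2 n m x hx]
    split_ifs <;> simp
  · obtain ⟨x, rfl⟩ := J.mkQ_surjective x
    obtain ⟨s, hs⟩ := h3 x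
    refine ⟨s, ?_⟩
    have : ∑ n ∈ s, J.mapQ J (P n) (hJ n) (J.mkQ x) = J.mkQ (∑ n ∈ s, P n x) := by
      rw [map_sum]
      rfl
    rw [this, hs]

variable (P : ℕ → V.carrier →ₗ[k] V.carrier) (h1 : ∀ n x, P n x ∈ V.gr n)
  (h2 : ∀ n m x, x ∈ V.gr n → P m x = if n = m then x else 0)
  (h3 : ∀ x, ∃ s : Finset ℕ, ∑ n ∈ s, P n x = x) (hJ : ∀ n, ∀ x ∈ J, P n x ∈ J)

/-- The quotient of a vertex algebra by a graded ideal. -/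
def quot : VertexAlgebra k where
  carrier := V.carrier ⧸ J
  gr n := (V.gr n).map J.mkQ
  isInternal := V.isInternal_quot J P h1 h2 h3 hJ
  vac := J.mkQ V.vac
  prod := V.quotProd J hl hr
  vac_mem := ⟨_, V.vac_mem, rfl⟩
  prod_mem n i j := by
    rintro _ _ ⟨a, ha, rfl⟩ ⟨b, hb, rfl⟩
    rw [quotProd_mkQ]
    have h := V.prod_mem n i j a b ha hb
    generalize (i : ℤ) + j - n - 1 = e at h ⊢
    rcases e with e | e
    · exact ⟨_, h, rfl⟩
    · have h : V.prod n a b = 0 := h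
      rw [h, map_zero]
      exact zero_mem _
  vac_prod n a := by
    obtain ⟨a, rfl⟩ := J.mkQ_surjective a
    rw [quotProd_mkQ, V.vac_prod]
    split_ifs <;> simp
  prod_vac a := by
    obtain ⟨a, rfl⟩ := J.mkQ_surjective a
    rw [quotProd_mkQ, V.prod_vac]
  prod_vac_of_nonneg n a hn := by
    obtain ⟨a, rfl⟩ := J.mkQ_surjective a
    rw [quotProd_mkQ, V.prod_vac_of_nonneg n a hn, map_zero]
  borcherds a b c m n l := by
    obtain ⟨a, rfl⟩ := J.mkQ_surjective a
    obtain ⟨b, rfl⟩ := J.mkQ_surjective b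
    obtain ⟨c, rfl⟩ := J.mkQ_surjective c
    obtain ⟨N1, hN1⟩ := V.exists_prod_eq_zero a b
    obtain ⟨N2, hN2⟩ := V.exists_prod_eq_zero b c
    obtain ⟨N3, hN3⟩ := V.exists_prod_eq_zero a c
    have e1 : EvZero fun j : ℕ =>
        Ring.choose m j • V.prod (m + l - j) (V.prod (n + j) a b) c :=
      ⟨(N1 - n).toNat, fun j hj => by
        beta_reduce
        rw [hN1 (n + j) (by omega)]
        simp⟩
    have e2 : EvZero fun j : ℕ => ((-1) ^ j * Ring.choose n j : ℤ) •
        (V.prod (m + n - j) a (V.prod (l + j) b c) -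
          (n.negOnePow : ℤ) • V.prod (n + l - j) b (V.prod (m + j) a c)) :=
      ⟨(N2 - l).toNat + (N3 - m).toNat, fun j hj => by
        beta_reduce
        rw [hN2 (l + j) (by omega), hN3 (m + j) (by omega)]
        simp⟩
    have h := congrArg J.mkQ.toAddMonoidHom (V.borcherds a b c m n l)
    rw [e1.map_finsum, e2.map_finsum] at h
    simp only [LinearMap.toAddMonoidHom_coe, map_zsmul, map_sub] at h
    exact h

/-- The projection to the quotient of a vertex algebra. -/
def quotHom : V ⟶ V.quot J hl hr P h1 h2 h3 hJ :=
  Hom.mk (V := V) (W := V.quot J hl hr P h1 h2 h3 hJ) J.mkQ (fun n a ha => ⟨a, ha, rfl⟩) rfl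
    fun _ _ _ => rfl

end VertexAlgebra

/-! ### The left ideal of relations -/

theorem ConformalAlgebra.tder_one {k : Type u} [CommRing k] (C : ConformalAlgebra k) (j : ℕ) :
    C.tder j 1 = if j = 0 then 1 else 0 := by
  simp [tder, PowerSeries.coeff_one]

theorem ConformalHull.mem_relIdeal {k : Type u} [CommRing k] {v : TruncVA k}
    {C : ConformalAlgebra k} (h : ConformalHull v C) {z : TensorAlgebra k C.carrier} :
    z ∈ h.relIdeal ↔ ∀ I : Ideal (TensorAlgebra k C.carrier),
      (∀ u, (TensorAlgebra.ι k (h.j0 v.vac) - 1) * u ∈ I) ∧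
      (∀ a b, TensorAlgebra.ι k (h.j0 a) * TensorAlgebra.ι k (h.j0 b) -
        TensorAlgebra.ι k (h.j0 (v.mul a b)) ∈ I) ∧
      (∀ a x, TensorAlgebra.ι k (h.j0 a) * TensorAlgebra.ι k (h.j1 x) -
        TensorAlgebra.ι k (h.j1 (v.lmul a x)) ∈ I) ∧
      (∀ (j : ℕ), ∀ z ∈ I, C.tder j z ∈ I) → z ∈ I :=
  Submodule.mem_sInf

namespace TruncVA

variable {k : Type u} [CommRing k] {v : TruncVA k}

namespace Env

open Hull

variable (v) in
/-- The operators `∂⁽ʲ⁾` on the tensor algebra of the hull. -/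
noncomputable def tder (j : ℕ) : TensorAlgebra k v.Hull →ₗ[k] TensorAlgebra k v.Hull :=
  (conformalAlgebra v).tder j

theorem tder_ι (j : ℕ) (x : v.Hull) :
    tder v j (TensorAlgebra.ι k x) = TensorAlgebra.ι k (Hull.der j x) :=
  (conformalAlgebra v).tder_ι j x

theorem tder_mul (j : ℕ) (z w : TensorAlgebra k v.Hull) : tder v j (z * w) =
    ∑ p ∈ Finset.HasAntidiagonal.antidiagonal j, tder v p.1 z * tder v p.2 w :=
  (conformalAlgebra v).tder_mul j z w

theorem tder_one (j : ℕ) : tder v j 1 = if j = 0 then 1 else 0 :=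
  (conformalAlgebra v).tder_one j

theorem mk_tder (j : ℕ) (z : TensorAlgebra k v.Hull) : mk v (tder v j z) = der j (mk v z) := by
  induction z using TensorAlgebra.induction generalizing j with
  | algebraMap t =>
    rw [Algebra.algebraMap_eq_smul_one, map_smul, map_smul, map_smul, map_smul, tder_one, map_one]
    rcases Nat.eq_zero_or_pos j with rfl | hj
    · rw [if_pos rfl, der_zero, map_one]
    · rw [if_neg (by omega), der_one hj, map_zero]
  | ι x => rw [tder_ι, mk_ι, mk_ι, der_of]
  | mul z w h h' => rw [tder_mul, map_sum, map_mul, der_mul]; simp only [map_mul, h, h']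
  | add z w h h' => simp only [map_add, h, h']

variable (v) in
/-- The left ideal of relations in the tensor algebra of the hull. -/
noncomputable def tensorIdeal : Ideal (TensorAlgebra k v.Hull) := (conformalHull v).relIdeal

theorem mem_tensorIdeal {z : TensorAlgebra k v.Hull} : z ∈ tensorIdeal v ↔
    ∀ I : Ideal (TensorAlgebra k v.Hull), (∀ u, (TensorAlgebra.ι k (c0 0 v.vac) - 1) * u ∈ I) ∧
      (∀ a b, TensorAlgebra.ι k (c0 0 a : v.Hull) * TensorAlgebra.ι k (c0 0 b) -
        TensorAlgebra.ι k (c0 0 (v.mul a b)) ∈ I) ∧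
      (∀ a x, TensorAlgebra.ι k (c0 0 a : v.Hull) * TensorAlgebra.ι k (c1 0 x) -
        TensorAlgebra.ι k (c1 0 (v.lmul a x)) ∈ I) ∧
      (∀ (j : ℕ), ∀ z ∈ I, tder v j z ∈ I) → z ∈ I :=
  (conformalHull v).mem_relIdeal

variable (v) in
/-- The image in the enveloping algebra of the ideal of relations. -/
noncomputable def relIdeal : Submodule k v.Env :=
  ((tensorIdeal v).restrictScalars k).map (mk v).toLinearMap

theorem mem_relIdeal_of_mem {z : TensorAlgebra k v.Hull} (h : z ∈ tensorIdeal v) :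
    mk v z ∈ relIdeal v := ⟨z, h, rfl⟩

theorem mul_mem_relIdeal (w : v.Env) {u : v.Env} (hu : u ∈ relIdeal v) : w * u ∈ relIdeal v := by
  obtain ⟨w, rfl⟩ := mk_surjective w
  obtain ⟨z, hz, rfl⟩ := hu
  exact ⟨w * z, Ideal.mul_mem_left (tensorIdeal v) w hz, map_mul (mk v) w z⟩

theorem der_mem_relIdeal (j : ℕ) {u : v.Env} (hu : u ∈ relIdeal v) : der j u ∈ relIdeal v := by
  obtain ⟨z, hz, rfl⟩ := hu
  refine ⟨tder v j z, ?_, mk_tder j z⟩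
  exact mem_tensorIdeal.mpr fun I hI => hI.2.2.2 j z (mem_tensorIdeal.mp hz I hI)

theorem vac_mem_relIdeal (u : v.Env) : (of v (c0 0 v.vac) - 1) * u ∈ relIdeal v := by
  obtain ⟨z, rfl⟩ := mk_surjective u
  have h : (TensorAlgebra.ι k (c0 0 v.vac : v.Hull) - 1) * z ∈ tensorIdeal v :=
    mem_tensorIdeal.mpr fun I hI => hI.1 z
  have := mem_relIdeal_of_mem h
  rwa [map_mul, map_sub, map_one, mk_ι] at this

theorem mul_mem_relIdeal_gen (a b : v.V0) :
    of v (c0 0 a) * of v (c0 0 b) - of v (c0 0 (v.mul a b)) ∈ relIdeal v := by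
  have h : TensorAlgebra.ι k (c0 0 a : v.Hull) * TensorAlgebra.ι k (c0 0 b) -
      TensorAlgebra.ι k (c0 0 (v.mul a b)) ∈ tensorIdeal v :=
    mem_tensorIdeal.mpr fun I hI => hI.2.1 a b
  have := mem_relIdeal_of_mem h
  rwa [map_sub, map_mul, mk_ι, mk_ι, mk_ι] at this

theorem lmul_mem_relIdeal_gen (a : v.V0) (x : v.V1) :
    of v (c0 0 a) * of v (c1 0 x) - of v (c1 0 (v.lmul a x)) ∈ relIdeal v := by
  have h : TensorAlgebra.ι k (c0 0 a : v.Hull) * TensorAlgebra.ι k (c1 0 x) -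
      TensorAlgebra.ι k (c1 0 (v.lmul a x)) ∈ tensorIdeal v :=
    mem_tensorIdeal.mpr fun I hI => hI.2.2.1 a x
  have := mem_relIdeal_of_mem h
  rwa [map_sub, map_mul, mk_ι, mk_ι, mk_ι] at this

/-- An induction principle: the preimage of such an `S` in the tensor algebra is one of the left
ideals whose intersection is the ideal of relations. -/
theorem relIdeal_le {S : Submodule k v.Env} (h1 : ∀ u, (of v (c0 0 v.vac) - 1) * u ∈ S)
    (h2 : ∀ a b, of v (c0 0 a) * of v (c0 0 b) - of v (c0 0 (v.mul a b)) ∈ S)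
    (h3 : ∀ a x, of v (c0 0 a) * of v (c1 0 x) - of v (c1 0 (v.lmul a x)) ∈ S)
    (hmul : ∀ x, ∀ u ∈ S, of v x * u ∈ S) (hder : ∀ j, ∀ u ∈ S, der j u ∈ S) :
    relIdeal v ≤ S := by
  have hmul' (w u : v.Env) (hu : u ∈ S) : w * u ∈ S := by
    induction w using induction with
    | one => rwa [one_mul]
    | mul x w h => rw [_root_.mul_assoc]; exact hmul x _ h
    | add w w' h h' => rw [add_mul]; exact add_mem h h'
    | smul t w h => rw [smul_mul_assoc]; exact Submodule.smul_mem _ t h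
  let I : Ideal (TensorAlgebra k v.Hull) :=
    { carrier := {z | mk v z ∈ S}
      add_mem' := fun {z w} hz hw => by
        change mk v (z + w) ∈ S
        rw [map_add]
        exact add_mem hz hw
      zero_mem' := by
        change mk v 0 ∈ S
        rw [map_zero]
        exact zero_mem _
      smul_mem' := fun w z hz => by
        change mk v (w * z) ∈ S
        rw [map_mul]
        exact hmul' _ _ hz }
  rintro _ ⟨z, hz, rfl⟩
  refine mem_tensorIdeal.mp hz I ⟨fun u => ?_, fun a b => ?_, fun a x => ?_, fun j z hz => ?_⟩
  · have e := map_mul (mk v) (TensorAlgebra.ι k (c0 0 v.vac : v.Hull) - 1) u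
    rw [map_sub, map_one, mk_ι] at e
    change mk v _ ∈ S
    exact e ▸ h1 (mk v u)
  · have e := map_sub (mk v) (TensorAlgebra.ι k (c0 0 a : v.Hull) * TensorAlgebra.ι k (c0 0 b))
      (TensorAlgebra.ι k (c0 0 (v.mul a b)))
    rw [map_mul, mk_ι, mk_ι, mk_ι] at e
    change mk v _ ∈ S
    exact e ▸ h2 a b
  · have e := map_sub (mk v) (TensorAlgebra.ι k (c0 0 a : v.Hull) * TensorAlgebra.ι k (c1 0 x))
      (TensorAlgebra.ι k (c1 0 (v.lmul a x)))
    rw [map_mul, mk_ι, mk_ι, mk_ι] at e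
    change mk v _ ∈ S
    exact e ▸ h3 a x
  · change mk v _ ∈ S
    exact (mk_tder j z) ▸ hder j _ hz

end Env

end TruncVA

/-! ### The vertex envelope -/

namespace TruncVA

variable {k : Type u} [CommRing k] {v : TruncVA k}

namespace Modes

/-- The modes of `1_A` are central, so multiplication by `1_A - 1` commutes with all modes. -/
theorem br_m0_vac (m : ℤ) (X : v.Modes) : br X (m0 m v.vac) = 0 := by
  have h (x : v.V1) : v.res01 v.vac x = 0 := by
    rw [← neg_eq_zero, ← v.res10_eq, v.res10_vac]
  induction X using induction with
  | hadd X Y h h' => rw [map_add, LinearMap.add_apply, h, h', add_zero]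
  | h0 m a => simp
  | h1 m x => simp [v.res10_vac]

theorem der_zero (X : v.Modes) : der 0 X = X := by
  induction X using induction with
  | hadd X Y h h' => rw [map_add, h, h']
  | h0 m a => simp
  | h1 m a => simp

end Modes

namespace Env

open Hull

/-! ### The image of `R` is a graded ideal -/

theorem act_of_nonneg {X : v.Modes} (hX : X ∈ Modes.nonneg v) (x : v.Hull) :
    act X (of v x) = of v (proj (Modes.br X (mode (-1) x))) := by
  rw [act_of, proj_nonneg hX, map_zero, mul_zero, zero_add]

theorem act_of_mul_of {X : v.Modes} (hX : X ∈ Modes.nonneg v) (x y : v.Hull) :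
    act X (of v x * of v y) = of v x * of v (proj (Modes.br X (mode (-1) y))) +
      act (Modes.br X (mode (-1) x)) (of v y) := by
  rw [act_mul, act_of_nonneg hX]

/-- For nonnegative modes only the zeroth mode of some `z` in `V₁` survives. It acts as a derivation
by `zero_mul`, so the result is a sum of two relations of the same kind. -/
theorem act_mul_gen_mem (a b : v.V0) (X : v.Modes) (hX : X ∈ Modes.nonneg v) :
    act X (of v (c0 0 a) * of v (c0 0 b) - of v (c0 0 (v.mul a b))) ∈ relIdeal v := by
  induction hX using Submodule.span_induction with
  | zero => simp
  | add X X' _ _ h h' => rw [map_add, LinearMap.add_apply]; exact add_mem h h'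
  | smul t X _ h => rw [map_smul, LinearMap.smul_apply]; exact Submodule.smul_mem _ t h
  | mem X hX =>
    rcases hX with ⟨m, e, hm, rfl⟩ | ⟨m, z, hm, rfl⟩
    · rw [map_sub, act_of_mul_of (Modes.m0_mem hm _), act_of_nonneg (Modes.m0_mem hm _)]
      simp [mode_neg_one_c0]
    · rw [map_sub, act_of_mul_of (Modes.m1_mem hm _), act_of_nonneg (Modes.m1_mem hm _)]
      simp only [mode_neg_one_c0, Modes.br_m1_m0, Nat.cast_zero, sub_zero]
      rcases hm.eq_or_lt with rfl | hm
      · have e (c : v.V0) : Modes.m0 (0 + -1) c = mode (-1) (c0 0 c) := by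
          rw [mode_neg_one_c0]
          simp
        rw [e, e, e, act_mode_neg_one, proj_mode_neg_one, proj_mode_neg_one, v.zero_mul, map_add,
          map_add]
        convert add_mem (mul_mem_relIdeal_gen a (v.res10 z b))
          (mul_mem_relIdeal_gen (v.res10 z a) b) using 1
        abel
      · rw [proj_m0_of_nonneg (by omega), proj_m0_of_nonneg (by omega),
          act_of_nonneg (Modes.m0_mem (by omega) _)]
        simp [mode_neg_one_c0]

/-- Three nonnegative modes survive. The mode `e_0` of `e ∈ V₀` gives a relation for a product in
`V₀` by `zero_lmul'`; the mode `z_0` of `z ∈ V₁` gives two relations of the same kind by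
`zero_lmul`; and `z_1` gives a relation in `V₀`, the correction term in `lmul_pair` cancelling the
commutator of `z_1` with `a`. -/
theorem act_lmul_gen_mem (a : v.V0) (x : v.V1) (X : v.Modes) (hX : X ∈ Modes.nonneg v) :
    act X (of v (c0 0 a) * of v (c1 0 x) - of v (c1 0 (v.lmul a x))) ∈ relIdeal v := by
  have e0 (c : v.V0) : Modes.m0 (-1) c = mode (-1) (c0 0 c) := by
    rw [mode_neg_one_c0]
    simp
  have e1 (c : v.V1) : Modes.m1 (-1) c = mode (-1) (c1 0 c) := by
    rw [mode_neg_one_c1]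
    simp
  induction hX using Submodule.span_induction with
  | zero => simp
  | add X X' _ _ h h' => rw [map_add, LinearMap.add_apply]; exact add_mem h h'
  | smul t X _ h => rw [map_smul, LinearMap.smul_apply]; exact Submodule.smul_mem _ t h
  | mem X hX =>
    rcases hX with ⟨m, e, hm, rfl⟩ | ⟨m, z, hm, rfl⟩
    · rw [map_sub, act_of_mul_of (Modes.m0_mem hm _), act_of_nonneg (Modes.m0_mem hm _)]
      simp only [mode_neg_one_c0, mode_neg_one_c1, Modes.br_m0_m0, Modes.br_m0_m1, Nat.cast_zero,
        sub_zero, map_zero, LinearMap.zero_apply, add_zero]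
      rcases hm.eq_or_lt with rfl | hm
      · rw [zero_add, e0, e0, proj_mode_neg_one, proj_mode_neg_one, v.zero_lmul']
        exact mul_mem_relIdeal_gen a _
      · rw [proj_m0_of_nonneg (by omega), proj_m0_of_nonneg (by omega)]
        simp
    · rw [map_sub, act_of_mul_of (Modes.m1_mem hm _), act_of_nonneg (Modes.m1_mem hm _)]
      simp only [mode_neg_one_c0, mode_neg_one_c1, Modes.br_m1_m0, Modes.br_m1_m1, Nat.cast_zero,
        sub_zero]
      rcases hm.eq_or_lt with rfl | hm
      · simp only [zero_add, zero_smul, add_zero]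
        rw [e0, e1, e1, act_mode_neg_one, proj_mode_neg_one, proj_mode_neg_one, v.zero_lmul,
          map_add, map_add]
        convert add_mem (lmul_mem_relIdeal_gen a (v.res11 z x))
          (lmul_mem_relIdeal_gen (v.res10 z a) x) using 1
        abel
      · rw [map_add proj, map_add proj, proj_m1_of_nonneg (by omega), proj_m1_of_nonneg (by omega),
          act_of_nonneg (Modes.m0_mem (by omega) _), mode_neg_one_c1, Modes.br_m0_m1, zero_add,
          zero_add, map_zsmul proj, map_zsmul proj, map_zsmul (of v), map_zsmul (of v)]
        rcases (show 1 ≤ m by omega).eq_or_lt with rfl | hm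
        · have i : (1 + -1 - 1 : ℤ) = -1 := by norm_num
          have i' : (1 + -1 + (-1 - (0 : ℕ)) : ℤ) = -1 := by norm_num
          rw [i, i', one_smul, one_smul, e0, e0, e0, proj_mode_neg_one, proj_mode_neg_one,
            proj_mode_neg_one]
          have e : v.pair z (v.lmul a x) = v.mul a (v.pair z x) + v.res01 (v.res10 z a) x := by
            rw [v.pair_comm, v.lmul_pair, v.pair_comm z, v.res10_eq x, sub_neg_eq_add]
          rw [e, map_add, map_add, add_sub_add_right_eq_sub]
          exact mul_mem_relIdeal_gen a _
        · rw [proj_m0_of_nonneg (by omega), proj_m0_of_nonneg (by omega),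
            proj_m0_of_nonneg (by omega)]
          simp

/-- Any mode is a nonnegative mode plus a negative one, and the latter acts by left multiplication,
under which the ideal is stable. -/
theorem act_mem_of_nonneg {u : v.Env} (hu : u ∈ relIdeal v)
    (h : ∀ X ∈ Modes.nonneg v, act X u ∈ relIdeal v) (X : v.Modes) : act X u ∈ relIdeal v := by
  have e : act X u = act (X - mode (-1) (proj X)) u + of v (proj X) * u := by
    rw [map_sub, LinearMap.sub_apply, act_mode_neg_one, sub_add_cancel]
  rw [e]
  exact add_mem (h _ (sub_mode_proj_mem X)) (mul_mem_relIdeal _ hu)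

/-- The vectors of the ideal sent into it by all modes satisfy the hypotheses of `relIdeal_le`.
Stability under left multiplication follows from the commutation rule `act_mul`. -/
theorem act_mem_relIdeal (X : v.Modes) {u : v.Env} (hu : u ∈ relIdeal v) :
    act X u ∈ relIdeal v := by
  let S : Submodule k v.Env :=
    { carrier := {u | u ∈ relIdeal v ∧ ∀ X, act X u ∈ relIdeal v}
      add_mem' := fun h h' => ⟨add_mem h.1 h'.1, fun X => by
        rw [map_add]
        exact add_mem (h.2 X) (h'.2 X)⟩
      zero_mem' := ⟨zero_mem _, fun X => by simp⟩
      smul_mem' := fun t u h => ⟨Submodule.smul_mem _ t h.1, fun X => by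
        rw [map_smul]
        exact Submodule.smul_mem _ t (h.2 X)⟩ }
  have hS : relIdeal v ≤ S := by
    refine relIdeal_le (fun u => ⟨vac_mem_relIdeal u, fun X => ?_⟩)
      (fun a b => ⟨mul_mem_relIdeal_gen a b, fun X => ?_⟩)
      (fun a x => ⟨lmul_mem_relIdeal_gen a x, fun X => ?_⟩)
      (fun x u hu => ⟨mul_mem_relIdeal _ hu.1, fun X => ?_⟩)
      (fun j u hu => ⟨der_mem_relIdeal j hu.1, fun X => ?_⟩)
    · have e : act X ((of v (c0 0 v.vac) - 1) * u) = (of v (c0 0 v.vac) - 1) * act X u := by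
        rw [sub_mul, sub_mul, map_sub, act_mul, one_mul, one_mul, mode_neg_one_c0,
          Modes.br_m0_vac]
        simp
      rw [e]
      exact vac_mem_relIdeal _
    · exact act_mem_of_nonneg (mul_mem_relIdeal_gen a b) (act_mul_gen_mem a b) X
    · exact act_mem_of_nonneg (lmul_mem_relIdeal_gen a x) (act_lmul_gen_mem a x) X
    · rw [act_mul]
      exact add_mem (mul_mem_relIdeal _ (hu.2 X)) (hu.2 _)
    -- By the Leibniz rule, `X ∂⁽ʲ⁾u` is `∂⁽ʲ⁾(X u)` minus terms in which a derivative of `X` acts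
    -- on `∂⁽ᵇ⁾u` with `b < j`; these are covered by the induction hypothesis.
    · induction j using Nat.strong_induction_on generalizing X with
      | _ j ih =>
        have e := der_act j X u
        rw [← Finset.add_sum_erase _ _
          (show (0, j) ∈ Finset.HasAntidiagonal.antidiagonal j by simp)] at e
        rw [Modes.der_zero, ← sub_eq_iff_eq_add] at e
        rw [← e]
        refine sub_mem (der_mem_relIdeal j (hu.2 X)) (sum_mem fun p hp => ?_)
        obtain ⟨hne, hp⟩ := Finset.mem_erase.mp hp
        have hp := Finset.HasAntidiagonal.mem_antidiagonal.mp hp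
        refine ih p.2 ?_ _
        have : p.1 ≠ 0 := fun h => hne (Prod.ext h (by simp; omega))
        omega
  exact (hS hu).2 X

theorem der_mem_gr (j n : ℕ) {u : v.Env} (hu : u ∈ gr v n) : der j u ∈ gr v (n + j) := by
  have h := (vertexAlgebra v).prod_mem_gr (n := -1 - j) (l := n + j) hu one_mem
    (by push_cast; ring)
  rw [← der_eq]
  exact h

theorem grProj_mul_of_mem {d : ℕ} {w : v.Env} (hw : w ∈ gr v d) (n : ℕ) (u : v.Env) :
    grProj n (w * u) = if d ≤ n then w * grProj (n - d) u else 0 := by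
  have hw : grSeries w = _ := hw
  rw [grProj_apply, map_mul, hw, coeff_monomial_mul_eq]
  rfl

theorem of_mem_gr {d : ℕ} {x : v.Hull} (hx : x ∈ Hull.gr v d) : of v x ∈ gr v d := by
  have := of_mul_mem hx one_mem
  rwa [mul_one] at this

/-- The generating relations are homogeneous, and the operations generating the ideal from them
respect homogeneous components. -/
theorem grProj_mem_relIdeal (n : ℕ) {u : v.Env} (hu : u ∈ relIdeal v) :
    grProj n u ∈ relIdeal v := by
  let S : Submodule k v.Env :=
    { carrier := {u | u ∈ relIdeal v ∧ ∀ n, grProj n u ∈ relIdeal v}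
      add_mem' := fun h h' => ⟨add_mem h.1 h'.1, fun X => by
        rw [map_add]
        exact add_mem (h.2 X) (h'.2 X)⟩
      zero_mem' := ⟨zero_mem _, fun X => by simp⟩
      smul_mem' := fun t u h => ⟨Submodule.smul_mem _ t h.1, fun X => by
        rw [map_smul]
        exact Submodule.smul_mem _ t (h.2 X)⟩ }
  have hom {d : ℕ} {u : v.Env} (hd : u ∈ gr v d) (hu : u ∈ relIdeal v) : u ∈ S :=
    ⟨hu, fun n => by
      rw [grProj_of_mem n hd]
      split_ifs
      exacts [hu, zero_mem _]⟩
  have h0 (a : v.V0) : of v (c0 0 a) ∈ gr v 0 := of_mem_gr (c0_mem 0 a)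
  have h1 (x : v.V1) : of v (c1 0 x) ∈ gr v 1 := of_mem_gr (c1_mem 0 x)
  have hS : relIdeal v ≤ S := by
    refine relIdeal_le (fun u => ⟨vac_mem_relIdeal u, fun n => ?_⟩)
      (fun a b => hom (d := 0) (sub_mem (of_mul_mem (c0_mem 0 a) (h0 b)) (h0 _))
        (mul_mem_relIdeal_gen a b))
      (fun a x => hom (d := 1) (sub_mem (by simpa using of_mul_mem (c0_mem 0 a) (h1 x)) (h1 _))
        (lmul_mem_relIdeal_gen a x))
      (fun x u hu => ⟨mul_mem_relIdeal _ hu.1, fun n => ?_⟩)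
      (fun j u hu => ⟨der_mem_relIdeal j hu.1, fun n => ?_⟩)
    -- Here `u` is arbitrary, but the factor `1_A - 1` has weight `0`, so taking components only
    -- affects `u`.
    · rw [grProj_mul_of_mem (sub_mem (h0 _) one_mem)]
      split_ifs
      exacts [vac_mem_relIdeal _, zero_mem _]
    · induction x using exists_gr_induction with
      | hadd x y hx hy => rw [map_add, add_mul, map_add]; exact add_mem hx hy
      | h d x hx =>
        rw [grProj_mul_of_mem (of_mem_gr hx)]
        split_ifs
        exacts [mul_mem_relIdeal _ (hu.2 _), zero_mem _]
    · obtain ⟨N, hN⟩ := exists_sum_grProj u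
      rw [← hN N le_rfl, map_sum, map_sum]
      refine sum_mem fun i _ => ?_
      rw [grProj_of_mem n (der_mem_gr j i (grProj_mem i u))]
      split_ifs
      exacts [der_mem_relIdeal j (hu.2 i), zero_mem _]
  exact (hS hu).2 n

/-- Induction on `u` as a word in the hull: `negOne_prod_eq_finsum` reduces the product with `x u`
to modes of `x` and products with `u`, and the modes preserve the ideal. -/
theorem prod_mem_relIdeal_right (n : ℤ) (u : v.Env) {w : v.Env} (hw : w ∈ relIdeal v) :
    (vertexAlgebra v).prod n u w ∈ relIdeal v := by
  induction u using induction generalizing n w with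
  | one =>
    have := (vertexAlgebra v).vac_prod n w
    refine (Submodule.mem_toAddSubgroup (relIdeal v)).mp ?_
    have e : (vertexAlgebra v).prod n (1 : v.Env) w = if n = -1 then w else 0 := this
    rw [e]
    split_ifs
    exacts [hw, zero_mem _]
  | add u u' h h' =>
    have e : (vertexAlgebra v).prod n (u + u') w =
      (vertexAlgebra v).prod n u w + (vertexAlgebra v).prod n u' w :=
      LinearMap.congr_fun (map_add ((vertexAlgebra v).prod n) u u') w
    rw [e]
    exact add_mem (h n hw) (h' n hw)
  | smul t u h =>
    have e : (vertexAlgebra v).prod n (t • u) w = t • (vertexAlgebra v).prod n u w :=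
      LinearMap.congr_fun (map_smul ((vertexAlgebra v).prod n) t u) w
    rw [e]
    exact Submodule.smul_mem _ t (h n hw)
  | mul x u h =>
    have e : of v x * u = (vertexAlgebra v).prod (-1) (of v x) u :=
      (act_mode_neg_one x u).symm.trans (prod_of (-1) x u).symm
    have e' := (congrArg (fun z => (vertexAlgebra v).prod n z w) e).trans
      ((vertexAlgebra v).negOne_prod_eq_finsum (of v x) u w n)
    refine e' ▸ ?_
    refine finsum_induction (· ∈ relIdeal v) (zero_mem _) (fun _ _ => add_mem) fun j =>
      add_mem ?_ (h _ ?_)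
    · exact (prod_of (-1 - j) x _).symm ▸ act_mem_relIdeal _ (h _ hw)
    · exact (prod_of j x w).symm ▸ act_mem_relIdeal _ hw

/-- By skew-symmetry `u₍ₙ₎w` is a combination of divided powers of products with `u` on the right;
closure of the ideal under `∂⁽ʲ⁾` is used here. -/
theorem prod_mem_relIdeal_left (n : ℤ) {u : v.Env} (hu : u ∈ relIdeal v) (w : v.Env) :
    (vertexAlgebra v).prod n u w ∈ relIdeal v := by
  obtain ⟨N, hN⟩ := (vertexAlgebra v).exists_prod_eq_zero w u
  have h := (vertexAlgebra v).comm_formula w u n (N - n).toNat fun j hj => hN _ (by omega)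
  refine h ▸ ?_
  refine zsmul_mem (sum_mem fun j _ => zsmul_mem ?_ _) _
  have e := der_eq (v := v) j ((vertexAlgebra v).prod (n + j) w u)
  exact e ▸ der_mem_relIdeal j (prod_mem_relIdeal_right _ w hu)

/-! ### The vertex envelope as a quotient -/

variable (v) in
/-- The vertex envelope of a `1`-truncated vertex algebra. -/
noncomputable def envelope : VertexAlgebra k :=
  (vertexAlgebra v).quot (relIdeal v) (fun n a _ hb => prod_mem_relIdeal_right n a hb)
    (fun n _ ha b => prod_mem_relIdeal_left n ha b) grProj grProj_mem
    (fun _ m _ hx => grProj_of_mem m hx) (fun u => ⟨_, (exists_sum_grProj u).choose_spec _ le_rfl⟩)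
    fun n _ hu => grProj_mem_relIdeal n hu

variable (v) in
/-- The projection to the vertex envelope. -/
noncomputable def toEnvelope : vertexAlgebra v ⟶ envelope v :=
  VertexAlgebra.quotHom _ _ _ _ _ _ _ _ _

theorem toEnvelope_surjective : Function.Surjective (toEnvelope v).toLin :=
  (relIdeal v).mkQ_surjective

theorem ker_toEnvelope : LinearMap.ker (toEnvelope v).toLin = relIdeal v :=
  (relIdeal v).ker_mkQ

end Env

end TruncVA

open TruncVA in
/-- The presentation of the vertex envelope of a vertex algebroid. -/
noncomputable def VertexAlgebroid.vertexEnvelope {k : Type u} [CommRing k] [Invertible (2 : k)]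
    (𝒜 : VertexAlgebroid k) : VertexEnvelope 𝒜 (Env.envelope 𝒜.toTrunc) where
  C := Hull.conformalAlgebra 𝒜.toTrunc
  hull := Hull.conformalHull 𝒜.toTrunc
  W := Env.vertexAlgebra 𝒜.toTrunc
  env := Env.conformalEnvelope 𝒜.toTrunc
  q := Env.toEnvelope 𝒜.toTrunc
  q_surjective := Env.toEnvelope_surjective
  ker_q := Env.ker_toEnvelope

/-! ### Modes acting on a vertex algebra -/

namespace VertexAlgebra

variable {k : Type u} [CommRing k] (V : VertexAlgebra k)

/-- The Borcherds identity with the vacuum in the middle. The vacuum has a single nonzero mode, so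
at most one term survives. -/
theorem der_vac_prod (a c : V.carrier) (i : ℕ) (n : ℤ) :
    V.prod n (V.prod (-1 - i) a V.vac) c = sgnChoose n i • V.prod (n - i) a c := by
  have h := V.borcherds a V.vac c 0 (-1 - i) n
  have hl : ∀ j : ℕ, j ≠ 0 → Ring.choose (0 : ℤ) j = 0 := fun j hj => by
    obtain ⟨m, rfl⟩ := Nat.exists_eq_succ_of_ne_zero hj
    exact Ring.choose_zero_succ _ _
  rw [finsum_eq_single _ 0 fun j hj => by rw [hl j hj, zero_smul]] at h
  simp only [Ring.choose_zero_right, one_smul, Nat.cast_zero, zero_add, sub_zero, add_zero] at h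
  rw [h]
  change ∑ᶠ j : ℕ, sgnChoose (-1 - i) j • _ = _
  rcases lt_or_ge n 0 with hn | hn
  -- For `n < 0` the surviving term comes from the first half of the identity, at `j = -1 - n`.
  · obtain ⟨j, rfl⟩ : ∃ j : ℕ, n = -1 - j := ⟨(-1 - n).toNat, by omega⟩
    rw [finsum_eq_single _ j]
    · rw [V.vac_prod, V.vac_prod, if_pos (by omega), if_neg (by omega), smul_zero, sub_zero,
        sgnChoose_neg, sgnChoose_neg, add_comm j i, Nat.choose_symm_add]
      congr 3
      ring_nf
    · intro l hl
      rw [V.vac_prod, V.vac_prod, if_neg (by omega), if_neg (by omega), map_zero, smul_zero,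
        sub_zero, smul_zero]
  · obtain ⟨m, rfl⟩ := Int.eq_ofNat_of_zero_le hn
    -- For `n ≥ 0` the first half vanishes, and the second half contributes only at `j = n - i`,
    -- hence nothing when `n < i`.
    rcases lt_or_ge m i with hm | hm
    · rw [sgnChoose_eq_zero hm, zero_smul]
      refine finsum_eq_zero_of_forall_eq_zero fun l => ?_
      rw [V.vac_prod, V.vac_prod, if_neg (by omega), if_neg (by omega), map_zero, smul_zero,
        sub_zero, smul_zero]
    · obtain ⟨j, rfl⟩ := Nat.exists_eq_add_of_le hm
      rw [finsum_eq_single _ j]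
      · rw [V.vac_prod, V.vac_prod, if_neg (by omega), if_pos (by omega), map_zero, zero_sub,
          sgnChoose_neg, smul_neg, smul_smul, ← neg_smul]
        have e : ((i + j : ℕ) : ℤ) - i = j := by push_cast; ring
        have e' : (-1 - i : ℤ) = -(1 + i) := by ring
        rw [e, sgnChoose, e', Int.negOnePow_neg, Int.negOnePow_add, Int.negOnePow_one,
          Ring.choose_natCast]
        congr 1
        push_cast
        have e'' : ((i : ℤ).negOnePow : ℤ) = (-1) ^ i := by simp [Int.negOnePow_def]
        rw [e'']
        ring
      · intro l hl
        rw [V.vac_prod, V.vac_prod, if_neg (by omega), if_neg (by omega), map_zero, smul_zero,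
          sub_zero, smul_zero]

theorem commutator_formula (a b c : V.carrier) (m l : ℤ) (N : ℕ)
    (h : ∀ j : ℕ, N ≤ j → V.prod j a b = 0) :
    V.prod m a (V.prod l b c) - V.prod l b (V.prod m a c) =
      ∑ j ∈ Finset.range N, Ring.choose m j • V.prod (m + l - j) (V.prod j a b) c := by
  have hb := V.borcherds a b c m 0 l
  rw [finsum_range _ N, finsum_eq_single _ 0] at hb
  · simpa using hb.symm
  · intro j hj
    obtain ⟨m, rfl⟩ := Nat.exists_eq_succ_of_ne_zero hj
    simp [Ring.choose_zero_succ]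
  · intro j hj
    simp [h j hj]

section Desc

variable {V} {J : Submodule k V.carrier} {hl : ∀ n a, ∀ b ∈ J, V.prod n a b ∈ J}
  {hr : ∀ n, ∀ a ∈ J, ∀ b, V.prod n a b ∈ J} {P : ℕ → V.carrier →ₗ[k] V.carrier}
  {h1 : ∀ n x, P n x ∈ V.gr n} {h2 : ∀ n m x, x ∈ V.gr n → P m x = if n = m then x else 0}
  {h3 : ∀ x, ∃ s : Finset ℕ, ∑ n ∈ s, P n x = x} {hJ : ∀ n, ∀ x ∈ J, P n x ∈ J}

/-- Morphisms out of the quotient of a vertex algebra. -/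
def quotDesc {W : VertexAlgebra k} (φ : V ⟶ W) (h : ∀ x ∈ J, φ.toLin x = 0) :
    V.quot J hl hr P h1 h2 h3 hJ ⟶ W :=
  Hom.mk (V := V.quot J hl hr P h1 h2 h3 hJ) (W := W) (J.liftQ φ.toLin h)
    (fun n a ha => by
      obtain ⟨a, ha, rfl⟩ := ha
      exact φ.map_gr n a ha)
    φ.map_vac fun n a b => by
      obtain ⟨a, rfl⟩ := J.mkQ_surjective a
      obtain ⟨b, rfl⟩ := J.mkQ_surjective b
      exact φ.map_prod n a b

end Desc

/-- A morphism `v → V_{≤ 1}` from its underlying maps to `V`. -/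
def toTrunc {v : TruncVA k} (f0 : v.V0 →ₗ[k] V.carrier) (f1 : v.V1 →ₗ[k] V.carrier)
    (h0 : ∀ a, f0 a ∈ V.gr 0) (h1 : ∀ x, f1 x ∈ V.gr 1) (h_vac : f0 v.vac = V.vac)
    (h_d : ∀ a, f1 (v.d a) = V.prod (-2) (f0 a) V.vac)
    (h_mul : ∀ a b, f0 (v.mul a b) = V.prod (-1) (f0 a) (f0 b))
    (h_lmul : ∀ a x, f1 (v.lmul a x) = V.prod (-1) (f0 a) (f1 x))
    (h_res10 : ∀ x a, f0 (v.res10 x a) = V.prod 0 (f1 x) (f0 a))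
    (h_res11 : ∀ x y, f1 (v.res11 x y) = V.prod 0 (f1 x) (f1 y))
    (h_pair : ∀ x y, f0 (v.pair x y) = V.prod 1 (f1 x) (f1 y)) : v ⟶ V.trunc :=
  TruncVA.Hom.mk (v := v) (w := V.trunc) (f0.codRestrict (V.gr 0) h0) (f1.codRestrict (V.gr 1) h1)
    (Subtype.ext h_vac) (fun a => Subtype.ext (h_d a)) (fun a b => Subtype.ext (h_mul a b))
    (fun a x => Subtype.ext (h_lmul a x))
    -- The products `x₍₋₁₎a`, and after it `a₍₀₎x`, are determined by the other operations, so their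
    -- preservation is a consequence.
    (fun x a => Subtype.ext (by
      have e := v.lmul_eq a x
      have e' := V.trunc_lmul (f0 a) (f1 x) (h0 a) (h1 x)
      rw [← h_lmul, ← h_res10, ← h_d, e, map_sub, sub_left_inj] at e'
      exact e'))
    (fun a x => Subtype.ext (by
      have e := v.res10_eq x a
      have e' := congrArg Subtype.val (V.trunc.res10_eq ⟨f1 x, h1 x⟩ ⟨f0 a, h0 a⟩)
      have e'' : V.prod 0 (f1 x) (f0 a) = -V.prod 0 (f0 a) (f1 x) := e'
      rw [← h_res10, e, map_neg, neg_inj] at e''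
      exact e''))
    (fun x a => Subtype.ext (h_res10 x a)) (fun x y => Subtype.ext (h_res11 x y))
    (fun x y => Subtype.ext (h_pair x y))

end VertexAlgebra

namespace TruncVA

variable {k : Type u} [CommRing k] {v : TruncVA k} {V : VertexAlgebra k} (f : v ⟶ V.trunc)

namespace Hom

/-- The component of weight `0`, with values in the whole vertex algebra. -/
def val0 : v.V0 →ₗ[k] V.carrier := (V.gr 0).subtype ∘ₗ f.f0

/-- The component of weight `1`, with values in the whole vertex algebra. -/
def val1 : v.V1 →ₗ[k] V.carrier := (V.gr 1).subtype ∘ₗ f.f1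

theorem val0_mem (a : v.V0) : val0 f a ∈ V.gr 0 := (show V.gr 0 from f.f0 a).2

theorem val1_mem (x : v.V1) : val1 f x ∈ V.gr 1 := (show V.gr 1 from f.f1 x).2

theorem val0_vac : val0 f v.vac = V.vac := congrArg (V.gr 0).subtype f.map_vac

theorem val1_d (a : v.V0) : val1 f (v.d a) = V.prod (-2) (val0 f a) V.vac :=
  congrArg (V.gr 1).subtype (f.map_d a)

theorem val0_mul (a b : v.V0) : val0 f (v.mul a b) = V.prod (-1) (val0 f a) (val0 f b) :=
  congrArg (V.gr 0).subtype (f.map_mul a b)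

theorem val1_lmul (a : v.V0) (x : v.V1) :
    val1 f (v.lmul a x) = V.prod (-1) (val0 f a) (val1 f x) :=
  congrArg (V.gr 1).subtype (f.map_lmul a x)

theorem val0_res01 (a : v.V0) (x : v.V1) :
    val0 f (v.res01 a x) = V.prod 0 (val0 f a) (val1 f x) :=
  congrArg (V.gr 0).subtype (f.map_res01 a x)

theorem val0_res10 (x : v.V1) (a : v.V0) :
    val0 f (v.res10 x a) = V.prod 0 (val1 f x) (val0 f a) :=
  congrArg (V.gr 0).subtype (f.map_res10 x a)

theorem val1_res11 (x y : v.V1) : val1 f (v.res11 x y) = V.prod 0 (val1 f x) (val1 f y) :=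
  congrArg (V.gr 1).subtype (f.map_res11 x y)

theorem val0_pair (x y : v.V1) : val0 f (v.pair x y) = V.prod 1 (val1 f x) (val1 f y) :=
  congrArg (V.gr 0).subtype (f.map_pair x y)

end Hom

namespace Modes

open TruncVA.Hom

/-- The action of modes on a vertex algebra. -/
noncomputable def toEnd : v.Modes →ₗ[k] Module.End k V.carrier :=
  lift (fun m => V.prod m ∘ₗ val0 f) (fun m => V.prod m ∘ₗ val1 f) fun m a => by
    refine LinearMap.ext fun c => ?_
    have h := V.der_vac_prod (val0 f a) c 1 m
    have e : (-1 - (1 : ℕ) : ℤ) = -2 := by norm_num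
    rw [e, ← val1_d] at h
    refine h.trans ?_
    simp [sgnChoose]

@[simp]
theorem toEnd_m0 (m : ℤ) (a : v.V0) : toEnd f (m0 m a) = V.prod m (val0 f a) := lift_m0 _ _ _ m a

@[simp]
theorem toEnd_m1 (m : ℤ) (x : v.V1) : toEnd f (m1 m x) = V.prod m (val1 f x) := lift_m1 _ _ _ m x

theorem toEnd_nonneg {X : v.Modes} (h : X ∈ nonneg v) : toEnd f X V.vac = 0 := by
  induction h using Submodule.span_induction with
  | zero => simp
  | add X X' _ _ h h' => rw [map_add, LinearMap.add_apply, h, h', add_zero]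
  | smul t X _ h => rw [map_smul, LinearMap.smul_apply, h, smul_zero]
  | mem X hX =>
    rcases hX with ⟨m, a, hm, rfl⟩ | ⟨m, x, hm, rfl⟩
    · rw [toEnd_m0, V.prod_vac_of_nonneg m _ hm]
    · rw [toEnd_m1, V.prod_vac_of_nonneg m _ hm]

/-- In `V` the commutator formula for vectors of weights `0` and `1` has no terms beyond those in
the bracket of modes, for weight reasons. -/
theorem toEnd_br_gen (m l : ℤ) :
    (∀ a b, toEnd f (br (m0 m a) (m0 l b)) =
      toEnd f (m0 m a) * toEnd f (m0 l b) - toEnd f (m0 l b) * toEnd f (m0 m a)) ∧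
    (∀ a x, toEnd f (br (m0 m a) (m1 l x)) =
      toEnd f (m0 m a) * toEnd f (m1 l x) - toEnd f (m1 l x) * toEnd f (m0 m a)) ∧
    (∀ x a, toEnd f (br (m1 m x) (m0 l a)) =
      toEnd f (m1 m x) * toEnd f (m0 l a) - toEnd f (m0 l a) * toEnd f (m1 m x)) ∧
    ∀ x y, toEnd f (br (m1 m x) (m1 l y)) =
      toEnd f (m1 m x) * toEnd f (m1 l y) - toEnd f (m1 l y) * toEnd f (m1 m x) := by
  refine ⟨fun a b => ?_, fun a x => ?_, fun x a => ?_, fun x y => ?_⟩ <;>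
    refine LinearMap.ext fun c => ?_ <;>
    rw [LinearMap.sub_apply, Module.End.mul_apply, Module.End.mul_apply] <;>
    simp only [br_m0_m0, br_m0_m1, br_m1_m0, br_m1_m1, toEnd_m0, toEnd_m1, map_zero, map_add,
      map_zsmul, LinearMap.zero_apply, LinearMap.add_apply, LinearMap.smul_apply]
  · rw [V.commutator_formula _ _ c m l 0 fun j _ =>
      V.prod_eq_zero (val0_mem f a) (val0_mem f b) (by push_cast; omega)]
    simp
  · rw [V.commutator_formula _ _ c m l 1 fun j _ =>
      V.prod_eq_zero (val0_mem f a) (val1_mem f x) (by push_cast; omega)]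
    simp [val0_res01]
  · rw [V.commutator_formula _ _ c m l 1 fun j _ =>
      V.prod_eq_zero (val1_mem f x) (val0_mem f a) (by push_cast; omega)]
    simp [val0_res10]
  · rw [V.commutator_formula _ _ c m l 2 fun j _ =>
      V.prod_eq_zero (val1_mem f x) (val1_mem f y) (by push_cast; omega)]
    simp [val1_res11, val0_pair, Finset.sum_range_succ]

theorem toEnd_br (X Y : v.Modes) : toEnd f (br X Y) =
    toEnd f X * toEnd f Y - toEnd f Y * toEnd f X := by
  induction X using induction with
  | hadd X X' h h' =>
    rw [map_add, LinearMap.add_apply, map_add, h, h', map_add, add_mul, mul_add, add_sub_add_comm]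
  | h0 m a =>
    induction Y using induction with
    | hadd Y Y' h h' => rw [map_add, map_add, h, h', map_add, add_mul, mul_add, add_sub_add_comm]
    | h0 l b => exact (toEnd_br_gen f m l).1 a b
    | h1 l x => exact (toEnd_br_gen f m l).2.1 a x
  | h1 m x =>
    induction Y using induction with
    | hadd Y Y' h h' => rw [map_add, map_add, h, h', map_add, add_mul, mul_add, add_sub_add_comm]
    | h0 l b => exact (toEnd_br_gen f m l).2.2.1 x b
    | h1 l y => exact (toEnd_br_gen f m l).2.2.2 x y

end Modes

end TruncVA

/-! ### The universal property of the vertex envelope -/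

namespace TruncVA

namespace Env

open Hull
open TruncVA.Hom (val0 val1 val0_mem val1_mem val0_vac val0_mul val1_lmul)

variable {k : Type u} [CommRing k] {v : TruncVA k} {V : VertexAlgebra k} (f : v ⟶ V.trunc)

/-- The action of the enveloping algebra on a vertex algebra. -/
noncomputable def toEnd : v.Env →ₐ[k] Module.End k V.carrier :=
  lift (Modes.toEnd f ∘ₗ mode (-1)) fun x y => by
    simp only [LinearMap.comp_apply]
    rw [mode_lie, Modes.toEnd_br]

/-- The linear map from the enveloping algebra to a vertex algebra. -/
noncomputable def eval : v.Env →ₗ[k] V.carrier := LinearMap.applyₗ V.vac ∘ₗ (toEnd f).toLinearMap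

theorem eval_one : eval f 1 = V.vac := by
  change toEnd f 1 V.vac = _
  rw [map_one]
  rfl

theorem eval_mul (x : v.Hull) (u : v.Env) :
    eval f (of v x * u) = Modes.toEnd f (mode (-1) x) (eval f u) := by
  change toEnd f (of v x * u) V.vac = _
  rw [map_mul, toEnd, lift_of]
  rfl

theorem eval_of (x : v.Hull) : eval f (of v x) = Modes.toEnd f (mode (-1) x) V.vac := by
  rw [← mul_one (of v x), eval_mul, eval_one]

theorem eval_c0 (a : v.V0) : eval f (of v (c0 0 a)) = val0 f a := by
  rw [eval_of, mode_neg_one_c0, Modes.toEnd_m0]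
  exact V.prod_vac _

theorem eval_c1 (x : v.V1) : eval f (of v (c1 0 x)) = val1 f x := by
  rw [eval_of, mode_neg_one_c1, Modes.toEnd_m1]
  exact V.prod_vac _

/-- The map intertwines all modes, not only the negative ones that define it. On `1` this holds
because nonnegative modes kill the vacuum of `V`; it then propagates by the commutation rule. -/
theorem eval_act (X : v.Modes) (u : v.Env) : eval f (act X u) = Modes.toEnd f X (eval f u) := by
  induction u using induction generalizing X with
  | one =>
    have h := Modes.toEnd_nonneg f (sub_mode_proj_mem X)
    rw [map_sub, LinearMap.sub_apply, sub_eq_zero] at h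
    rw [act_one, eval_of, eval_one, h]
  | add u w h h' => simp only [map_add, h, h']
  | smul t u h => simp only [map_smul, h]
  | mul x u h =>
    rw [act_mul, map_add, eval_mul, h, h, Modes.toEnd_br, eval_mul, LinearMap.sub_apply,
      Module.End.mul_apply, Module.End.mul_apply, add_sub_cancel]

/-- For derivatives of generators this is `der_vac_prod`: in `V` the modes of `∂⁽ⁱ⁾a` are given by
the coefficients used to define modes of the hull. -/
theorem toEnd_mode (n : ℤ) (x : v.Hull) :
    Modes.toEnd f (mode n x) = V.prod n (eval f (of v x)) := by
  refine LinearMap.ext fun c => ?_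
  rw [eval_of]
  induction x using Hull.induction with
  | hadd x y h h' => simp only [map_add, LinearMap.add_apply, h, h']
  | h0 i a =>
    rw [mode_neg_one_c0, mode_c0, map_zsmul, Modes.toEnd_m0, Modes.toEnd_m0, V.der_vac_prod]
    rfl
  | h1 i x =>
    rw [mode_neg_one_c1, mode_c1, map_zsmul, Modes.toEnd_m1, Modes.toEnd_m1, V.der_vac_prod]
    rfl

theorem eval_prod_of (n : ℤ) (x : v.Hull) (w : v.Env) :
    eval f ((vertexAlgebra v).prod n (of v x) w) = V.prod n (eval f (of v x)) (eval f w) := by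
  rw [prod_of, eval_act, toEnd_mode]

theorem of_mul_eq_prod (x : v.Hull) (u : v.Env) :
    of v x * u = (vertexAlgebra v).prod (-1) (of v x) u :=
  (act_mode_neg_one x u).symm.trans (prod_of (-1) x u).symm

theorem eval_mul_eq_prod (x : v.Hull) (u : v.Env) :
    eval f (of v x * u) = V.prod (-1) (eval f (of v x)) (eval f u) := by
  rw [eval_mul, toEnd_mode]

/-- Both sides obey the same expansion of the product with `x₍₋₁₎u`, so induction on `u` reduces to
the case of the hull. -/
theorem eval_prod (n : ℤ) (u w : v.Env) :
    eval f ((vertexAlgebra v).prod n u w) = V.prod n (eval f u) (eval f w) := by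
  induction u using induction generalizing n w with
  | one =>
    have e : (vertexAlgebra v).prod n (1 : v.Env) w = if n = -1 then w else 0 :=
      (vertexAlgebra v).vac_prod n w
    rw [e, eval_one, V.vac_prod]
    split_ifs
    exacts [rfl, map_zero _]
  | add u u' h h' =>
    have e : (vertexAlgebra v).prod n (u + u') w =
      (vertexAlgebra v).prod n u w + (vertexAlgebra v).prod n u' w :=
      LinearMap.congr_fun (map_add ((vertexAlgebra v).prod n) u u') w
    rw [e, map_add, map_add, LinearMap.add_apply]
    exact ((eval f).map_add _ _).trans (congrArg₂ _ (h n w) (h' n w))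
  | smul t u h =>
    have e : (vertexAlgebra v).prod n (t • u) w = t • (vertexAlgebra v).prod n u w :=
      LinearMap.congr_fun (map_smul ((vertexAlgebra v).prod n) t u) w
    rw [e, map_smul, map_smul, LinearMap.smul_apply]
    exact ((eval f).map_smul _ _).trans (congrArg _ (h n w))
  | mul x u h =>
    rw [eval_mul_eq_prod, V.negOne_prod_eq_finsum]
    have e' := (congrArg (fun z => (vertexAlgebra v).prod n z w) (of_mul_eq_prod x u)).trans
      ((vertexAlgebra v).negOne_prod_eq_finsum (of v x) u w n)
    refine (congrArg (eval f) e').trans ?_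
    refine (((vertexAlgebra v).negOne_prod_evZero (of v x) u w n).map_finsum
      (eval f).toAddMonoidHom).trans ?_
    refine finsum_congr fun j => ?_
    refine ((eval f).map_add _ _).trans ?_
    refine congrArg₂ _ ((eval_prod_of f _ x _).trans ?_) ((h _ _).trans ?_)
    · rw [h]
    · rw [eval_prod_of]

theorem eval_mem (n : ℕ) {u : v.Env} (hu : u ∈ gr v n) : eval f u ∈ V.gr n := by
  refine gr_le (fun n => (V.gr n).comap (eval f)) ?_ (fun d x j u hx hu => ?_) n hu
  · rw [Submodule.mem_comap, eval_one]
    exact V.vac_mem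
  · rw [Submodule.mem_comap] at hu ⊢
    rw [eval_mul_eq_prod]
    refine V.prod_mem_gr (i := d) ?_ hu (by push_cast; ring)
    refine Hull.gr_le (S := (V.gr d).comap (eval f ∘ₗ of v)) (fun a => ?_) (fun i x h => ?_) hx
    · change eval f (of v (c0 d a)) ∈ V.gr d
      rw [eval_of, mode_neg_one_c0, Modes.toEnd_m0]
      exact V.prod_mem_gr (val0_mem f a) V.vac_mem (by push_cast; ring)
    · change eval f (of v (c1 i x)) ∈ V.gr d
      rw [eval_of, mode_neg_one_c1, Modes.toEnd_m1]
      exact V.prod_mem_gr (val1_mem f x) V.vac_mem (by rw [← h]; push_cast; ring)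

theorem eval_der (j : ℕ) (u : v.Env) : eval f (der j u) = V.der j (eval f u) := by
  rw [← der_eq]
  exact (eval_prod f _ u 1).trans (congrArg (V.prod _ _) (eval_one f))

theorem eval_relIdeal {u : v.Env} (hu : u ∈ relIdeal v) : eval f u = 0 := by
  refine relIdeal_le (S := LinearMap.ker (eval f)) (fun u => ?_) (fun a b => ?_) (fun a x => ?_)
    (fun x u hu => ?_) (fun j u hu => ?_) hu
  · rw [LinearMap.mem_ker, sub_mul, map_sub, eval_mul_eq_prod, eval_c0, val0_vac, V.vac_prod,
      if_pos rfl, _root_.one_mul, sub_self]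
  · rw [LinearMap.mem_ker, map_sub, eval_mul_eq_prod, eval_c0, eval_c0, eval_c0, val0_mul, sub_self]
  · rw [LinearMap.mem_ker, map_sub, eval_mul_eq_prod, eval_c0, eval_c1, eval_c1, val1_lmul,
      sub_self]
  · rw [LinearMap.mem_ker] at hu ⊢
    rw [eval_mul, hu, map_zero]
  · rw [LinearMap.mem_ker] at hu ⊢
    rw [eval_der, hu, map_zero]

/-- The morphism from the vertex envelope of the hull. -/
noncomputable def evalHom : vertexAlgebra v ⟶ V :=
  VertexAlgebra.Hom.mk (V := vertexAlgebra v) (eval f) (fun n _ hu => eval_mem f n hu)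
    (eval_one f) (eval_prod f)

/-- The morphism from the vertex envelope. -/
noncomputable def desc : envelope v ⟶ V :=
  VertexAlgebra.quotDesc (evalHom f) fun _ hu => eval_relIdeal f hu

variable (v) in
/-- The projection from the enveloping algebra to the vertex envelope. -/
noncomputable def toEnv : v.Env →ₗ[k] (envelope v).carrier := (toEnvelope v).toLin

variable (v) in
/-- The canonical map of weight `0` to the envelope. -/
noncomputable def incl0 : v.V0 →ₗ[k] (envelope v).carrier :=
  toEnv v ∘ₗ of v ∘ₗ c0 0

variable (v) in
/-- The canonical map of weight `1` to the envelope. -/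
noncomputable def incl1 : v.V1 →ₗ[k] (envelope v).carrier :=
  toEnv v ∘ₗ of v ∘ₗ c1 0

theorem toEnvelope_eq {u w : v.Env} (h : u - w ∈ relIdeal v) :
    toEnv v u = toEnv v w :=
  (Submodule.Quotient.eq (relIdeal v)).mpr h

theorem toEnvelope_prod_of (n : ℤ) (x : v.Hull) (u : v.Env) :
    (envelope v).prod n (toEnv v (of v x)) (toEnv v u) =
      toEnv v (act (mode n x) u) :=
  ((toEnvelope v).map_prod n (of v x) u).symm.trans (congrArg _ (prod_of n x u))

variable (v) in
/-- The canonical morphism to the truncation of the vertex envelope. -/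
noncomputable def unit : v ⟶ (envelope v).trunc :=
  (envelope v).toTrunc (incl0 v) (incl1 v)
    (fun a => (toEnvelope v).map_gr 0 _ (of_mem_gr (c0_mem 0 a)))
    (fun x => (toEnvelope v).map_gr 1 _ (of_mem_gr (c1_mem 0 x)))
    (toEnvelope_eq (u := of v (c0 0 v.vac)) (w := 1)
      (by simpa only [mul_one] using vac_mem_relIdeal (v := v) 1))
    (fun a => by
      have e : of v (c1 0 (v.d a)) = act (mode (-2) (c0 0 a)) 1 := by
        rw [act_one, c1_d]
        simp [proj_m0]
      exact (congrArg (toEnv v) e).trans (toEnvelope_prod_of (-2) (c0 0 a) (1 : v.Env)).symm)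
    (fun a b => by
      refine Eq.trans ?_ (toEnvelope_prod_of (-1) (c0 0 a) (of v (c0 0 b))).symm
      rw [act_mode_neg_one]
      exact (toEnvelope_eq (mul_mem_relIdeal_gen a b)).symm)
    (fun a x => by
      refine Eq.trans ?_ (toEnvelope_prod_of (-1) (c0 0 a) (of v (c1 0 x))).symm
      rw [act_mode_neg_one]
      exact (toEnvelope_eq (lmul_mem_relIdeal_gen a x)).symm)
    (fun x a => by
      refine Eq.trans ?_ (toEnvelope_prod_of 0 (c1 0 x) (of v (c0 0 a))).symm
      refine congrArg (toEnv v) ?_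
      simp [act_of, proj_m0, proj_m1])
    (fun x y => by
      refine Eq.trans ?_ (toEnvelope_prod_of 0 (c1 0 x) (of v (c1 0 y))).symm
      refine congrArg (toEnv v) ?_
      simp [act_of, proj_m0, proj_m1])
    (fun x y => by
      refine Eq.trans ?_ (toEnvelope_prod_of 1 (c1 0 x) (of v (c1 0 y))).symm
      refine congrArg (toEnv v) ?_
      simp [act_of, proj_m0, proj_m1])

theorem unit_desc : unit v ≫ (VertexAlgebra.truncFunctor k).map (desc f) = f :=
  Hom.ext (LinearMap.ext fun a => Subtype.ext (eval_c0 f a))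
    (LinearMap.ext fun x => Subtype.ext (eval_c1 f x))

/-- The envelope is generated by the images of `V₀` and `V₁`: divided powers give the hull, and left
`(-1)`-st products with the hull, starting from the vacuum, give everything. A morphism preserves
these operations. -/
theorem envelope_hom_ext {F G : envelope v ⟶ V}
    (h : unit v ≫ (VertexAlgebra.truncFunctor k).map F =
    unit v ≫ (VertexAlgebra.truncFunctor k).map G) : F = G := by
  have h0 (a : v.V0) : F.toLin (incl0 v a) = G.toLin (incl0 v a) :=
    congrArg (fun φ : v ⟶ V.trunc => val0 φ a) h
  have h1 (x : v.V1) : F.toLin (incl1 v x) = G.toLin (incl1 v x) :=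
    congrArg (fun φ : v ⟶ V.trunc => val1 φ x) h
  have hder (j : ℕ) (u : v.Env) (H : envelope v ⟶ V) :
      H.toLin (toEnv v (der j u)) = V.der j (H.toLin (toEnv v u)) := by
    have e := congrArg (toEnvelope v ≫ H).toLin (der_eq j u)
    refine e.symm.trans ?_
    refine ((toEnvelope v ≫ H).map_prod _ u (vertexAlgebra v).vac).trans ?_
    exact congrArg (V.prod _ _) (toEnvelope v ≫ H).map_vac
  have hof : F.toLin ∘ₗ toEnv v ∘ₗ of v =
      G.toLin ∘ₗ toEnv v ∘ₗ of v := by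
    refine Hull.hom_ext (fun i a => ?_) fun i x => ?_
    · have e : of v (c0 i a) = der i (of v (c0 0 a)) := by rw [der_of, der_c0_zero]
      simp only [LinearMap.comp_apply]
      rw [e]
      exact (hder i _ F).trans ((congrArg _ (h0 a)).trans (hder i _ G).symm)
    · have e : of v (c1 i x) = der i (of v (c1 0 x)) := by rw [der_of, der_c1_zero]
      simp only [LinearMap.comp_apply]
      rw [e]
      exact (hder i _ F).trans ((congrArg _ (h1 x)).trans (hder i _ G).symm)
  refine VertexAlgebra.Hom.ext (LinearMap.ext fun z => ?_)
  obtain ⟨u, rfl⟩ := toEnvelope_surjective z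
  change (toEnvelope v ≫ F).toLin u = (toEnvelope v ≫ G).toLin u
  induction u using induction with
  | one => exact (toEnvelope v ≫ F).map_vac.trans (toEnvelope v ≫ G).map_vac.symm
  | add u w h h' =>
    exact ((toEnvelope v ≫ F).toLin.map_add u w).trans
      ((congrArg₂ _ h h').trans ((toEnvelope v ≫ G).toLin.map_add u w).symm)
  | smul t u h =>
    exact ((toEnvelope v ≫ F).toLin.map_smul t u).trans
      ((congrArg _ h).trans ((toEnvelope v ≫ G).toLin.map_smul t u).symm)
  | mul x u h =>
    rw [of_mul_eq_prod]
    refine ((toEnvelope v ≫ F).map_prod _ _ _).trans (Eq.trans ?_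
      ((toEnvelope v ≫ G).map_prod _ _ _).symm)
    exact congrArg₂ (fun y z => V.prod (-1) y z) (LinearMap.congr_fun hof x) h

end Env

end TruncVA

/-! ### The weights `0` and `1` of the vertex envelope -/

namespace TruncVA

variable {k : Type u} [CommRing k] (v : TruncVA k)

theorem rmul_d (a b : v.V0) : v.rmul (v.d a) b = v.lmul b (v.d a) := by
  rw [v.lmul_eq, v.d_res10, map_zero, sub_zero]

theorem lmul_comm (a b : v.V0) (y : v.V1) : v.lmul a (v.lmul b y) = v.lmul b (v.lmul a y) := by
  have h := v.mul_lmul a b y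
  rw [v.mul_comm, v.mul_lmul b a, add_right_comm, add_left_inj, add_left_inj] at h
  exact h.symm

/-- This is the commutator `[a_{-1}, x_{-1}] = (a₍₀₎x)_{-2}` on vectors of weight `0`, whose
right-hand side is the mode `-1` of `∂(a₍₀₎x)`. It is what makes `truncAct` compatible with the
bracket. -/
theorem lmul_rmul (a b : v.V0) (x : v.V1) :
    v.lmul a (v.rmul x b) - v.rmul x (v.mul a b) = v.rmul (v.d (v.res01 a x)) b := by
  have e (c : v.V0) : v.rmul x c = v.lmul c x + v.d (v.res10 x c) := by
    rw [v.lmul_eq, sub_add_cancel]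
  rw [e, e, v.mul_lmul, v.zero_mul, map_add v.d, v.d_mul, v.d_mul, map_add, v.res10_eq, v.res10_eq,
    v.rmul_d b]
  simp only [map_neg, LinearMap.neg_apply]
  abel

/-! ### A model of the envelope modulo weights at least `2` -/

/-- The action of a vector of weight `0` on the sum of the parts of weights `0` and `1`. -/
def leftMul : v.V0 →ₗ[k] Module.End k (v.V0 × v.V1) where
  toFun a := (v.mul a).prodMap (v.lmul a)
  map_add' a b := by ext <;> simp
  map_smul' t a := by ext <;> simp

/-- The action of a vector of weight `1` on the sum of the parts of weights `0` and `1`. -/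
def rightMul : v.V1 →ₗ[k] Module.End k (v.V0 × v.V1) where
  toFun x := LinearMap.inr k v.V0 v.V1 ∘ₗ v.rmul x ∘ₗ LinearMap.fst k v.V0 v.V1
  map_add' a b := by ext <;> simp
  map_smul' t a := by ext <;> simp

@[simp]
theorem leftMul_apply (a : v.V0) (n : v.V0 × v.V1) :
    v.leftMul a n = (v.mul a n.1, v.lmul a n.2) := rfl

@[simp]
theorem rightMul_apply (x : v.V1) (n : v.V0 × v.V1) : v.rightMul x n = (0, v.rmul x n.1) := rfl

theorem leftMul_comm (a b : v.V0) : v.leftMul a * v.leftMul b = v.leftMul b * v.leftMul a := by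
  refine LinearMap.ext fun n => Prod.ext ?_ (v.lmul_comm a b n.2)
  change v.mul a (v.mul b n.1) = v.mul b (v.mul a n.1)
  rw [← v.mul_assoc, v.mul_comm a b, v.mul_assoc]

theorem leftMul_rightMul (a : v.V0) (x : v.V1) : v.leftMul a * v.rightMul x -
    v.rightMul x * v.leftMul a = v.rightMul (v.d (v.res01 a x)) := by
  refine LinearMap.ext fun n => Prod.ext ?_ (v.lmul_rmul a n.1 x)
  change v.mul a 0 - 0 = 0
  rw [map_zero, sub_zero]

theorem rightMul_mul (x y : v.V1) : v.rightMul x * v.rightMul y = 0 := by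
  refine LinearMap.ext fun n => Prod.ext rfl ?_
  exact map_zero (v.rmul x)

/-- The operators `∂⁽ʲ⁾` on the sum of the parts of weights `0` and `1`. -/
def truncDer : ℕ → Module.End k (v.V0 × v.V1)
  | 0 => 1
  | 1 => LinearMap.inr k v.V0 v.V1 ∘ₗ v.d ∘ₗ LinearMap.fst k v.V0 v.V1
  | _ + 2 => 0

variable {v}

theorem truncDer_one_apply (n : v.V0 × v.V1) : v.truncDer 1 n = (0, v.d n.1) := rfl

namespace Hull

/-- The action of the hull on the sum of the parts of weights `0` and `1`. -/
noncomputable def truncAct : v.Hull →ₗ[k] Module.End k (v.V0 × v.V1) :=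
  lift (fun | 0 => v.leftMul | 1 => v.rightMul ∘ₗ v.d | _ + 2 => 0)
    (fun | 0 => v.rightMul | _ + 1 => 0) fun i a => by
      rcases i with _ | i <;> simp

theorem truncAct_c0_zero (a : v.V0) : truncAct (c0 0 a) = v.leftMul a := lift_c0 _ _ _ 0 a

theorem truncAct_c0_one (a : v.V0) : truncAct (c0 1 a) = v.rightMul (v.d a) := lift_c0 _ _ _ 1 a

theorem truncAct_c0 (i : ℕ) (a : v.V0) : truncAct (c0 (i + 2) a) = 0 := lift_c0 _ _ _ (i + 2) a

theorem truncAct_c1_zero (x : v.V1) : truncAct (c1 0 x) = v.rightMul x := lift_c1 _ _ _ 0 x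

theorem truncAct_c1 (i : ℕ) (x : v.V1) : truncAct (c1 (i + 1) x) = 0 := lift_c1 _ _ _ (i + 1) x

theorem lie_c0_c0 (i j : ℕ) (a b : v.V0) : lie (c0 i a) (c0 j b) = 0 := by
  rw [lie, mode_neg_one_c0, mode_neg_one_c0, Modes.br_m0_m0, map_zero]

theorem lie_c0_c1 (i j : ℕ) (a : v.V0) (x : v.V1) :
    lie (c0 i a) (c1 j x) = c0 (i + j + 1) (v.res01 a x) := by
  have e : (-1 - (-1 - i + (-1 - j)) : ℤ).toNat = i + j + 1 := by omega
  rw [lie, mode_neg_one_c0, mode_neg_one_c1, Modes.br_m0_m1, proj_m0, if_pos (by omega), e]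

theorem lie_c1_c0 (i j : ℕ) (x : v.V1) (a : v.V0) :
    lie (c1 i x) (c0 j a) = c0 (i + j + 1) (v.res10 x a) := by
  have e : (-1 - (-1 - i + (-1 - j)) : ℤ).toNat = i + j + 1 := by omega
  rw [lie, mode_neg_one_c1, mode_neg_one_c0, Modes.br_m1_m0, proj_m0, if_pos (by omega), e]

theorem lie_c1_c1 (i j : ℕ) (x y : v.V1) : lie (c1 i x) (c1 j y) =
    c1 (i + j + 1) (v.res11 x y) + (-1 - i : ℤ) • c0 (i + j + 2) (v.pair x y) := by
  have e : (-1 - (-1 - i + (-1 - j)) : ℤ).toNat = i + j + 1 := by omega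
  have e' : (-1 - (-1 - i + (-1 - j) - 1) : ℤ).toNat = i + j + 2 := by omega
  rw [lie, mode_neg_one_c1, mode_neg_one_c1, Modes.br_m1_m1, map_add, map_zsmul, proj_m1, proj_m0,
    if_pos (by omega), if_pos (by omega), e, e']

/-- Elements of weight at least `2` act by zero and two operators of weight `1` compose to zero. The
cases left are commutation within `V₀`, including `∂a`, and the commutator of `V₀` with `V₁`, which
are `leftMul_comm` and `leftMul_rightMul`. -/
theorem truncAct_lie (x y : v.Hull) :
    truncAct x * truncAct y - truncAct y * truncAct x = truncAct (lie x y) := by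
  have hl (x x' y : v.Hull) : lie (x + x') y = lie x y + lie x' y := by simp [lie]
  have hr (x y y' : v.Hull) : lie x (y + y') = lie x y + lie x y' := by simp [lie]
  have key : ∀ (j : ℕ) (a : v.V0) (x : v.V1), truncAct (c0 (j + 1) (v.res01 a x)) =
      truncAct (c0 0 a) * truncAct (c1 j x) - truncAct (c1 j x) * truncAct (c0 0 a) := by
    intro j a x
    rcases j with _ | j
    · rw [truncAct_c0_one, truncAct_c1_zero, truncAct_c0_zero, leftMul_rightMul]
    · rw [truncAct_c0, truncAct_c1, mul_zero, MulZeroClass.zero_mul, sub_zero]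
  have key' : ∀ (i j : ℕ) (a : v.V0) (x : v.V1), truncAct (c0 (i + j + 1) (v.res01 a x)) =
      truncAct (c0 i a) * truncAct (c1 j x) - truncAct (c1 j x) * truncAct (c0 i a) := by
    intro i j a x
    rcases i with _ | _ | i
    · rw [zero_add, key]
    · have e : 0 + 1 + j + 1 = j + 2 := by ring
      rw [e, truncAct_c0, zero_add, truncAct_c0_one]
      rcases j with _ | j
      · rw [truncAct_c1_zero, rightMul_mul, rightMul_mul, sub_zero]
      · rw [truncAct_c1, mul_zero, MulZeroClass.zero_mul, sub_zero]
    · have e : i + 1 + 1 + j + 1 = i + j + 1 + 2 := by ring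
      rw [e, truncAct_c0, truncAct_c0, mul_zero, MulZeroClass.zero_mul, sub_zero]
  have comm : ∀ (j : ℕ) (a b : v.V0), truncAct (c0 0 a) * truncAct (c0 j b) =
      truncAct (c0 j b) * truncAct (c0 0 a) := by
    intro j a b
    rcases j with _ | _ | j
    · rw [truncAct_c0_zero, truncAct_c0_zero, leftMul_comm]
    · have h := v.leftMul_rightMul a (v.d b)
      have e := v.res10_eq (v.d b) a
      rw [v.d_res10, eq_comm, neg_eq_zero] at e
      rw [e, map_zero, map_zero, sub_eq_zero] at h
      rw [zero_add, truncAct_c0_one, truncAct_c0_zero, h]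
    · rw [truncAct_c0, mul_zero, MulZeroClass.zero_mul]
  induction x using Hull.induction with
  | hadd x x' h h' => rw [hl, map_add, map_add, ← h, ← h', add_mul, mul_add]; abel
  | h0 i a =>
    induction y using Hull.induction with
    | hadd y y' h h' => rw [hr, map_add, map_add, ← h, ← h', add_mul, mul_add]; abel
    | h0 j b =>
      rw [lie_c0_c0, map_zero, sub_eq_zero]
      rcases i with _ | _ | i
      · exact comm j a b
      · rcases j with _ | _ | j
        · exact (comm _ b a).symm
        · rw [zero_add, truncAct_c0_one, truncAct_c0_one, rightMul_mul, rightMul_mul]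
        · rw [truncAct_c0, mul_zero, MulZeroClass.zero_mul]
      · rw [truncAct_c0, mul_zero, MulZeroClass.zero_mul]
    | h1 j x => rw [lie_c0_c1, key']
  | h1 i x =>
    induction y using Hull.induction with
    | hadd y y' h h' => rw [hr, map_add, map_add, ← h, ← h', add_mul, mul_add]; abel
    | h0 j b => rw [lie_c1_c0, v.res10_eq, map_neg, map_neg, add_comm i j, key', neg_sub]
    | h1 j y =>
      rw [lie_c1_c1, map_add, map_zsmul, truncAct_c0, truncAct_c1, smul_zero, add_zero]
      rcases i with _ | i
      · rcases j with _ | j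
        · rw [truncAct_c1_zero, truncAct_c1_zero, rightMul_mul, rightMul_mul, sub_zero]
        · rw [truncAct_c1, mul_zero, MulZeroClass.zero_mul, sub_zero]
      · rw [truncAct_c1, mul_zero, MulZeroClass.zero_mul, sub_zero]

theorem truncAct_der_add_two (j : ℕ) (x : v.Hull) : truncAct (der (j + 2) x) = 0 := by
  induction x using Hull.induction with
  | hadd x y h h' => rw [map_add, map_add, h, h', add_zero]
  | h0 i a =>
    have e : i + (j + 2) = i + j + 2 := by ring
    rw [der_c0, map_nsmul, e, truncAct_c0, smul_zero]
  | h1 i x =>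
    have e : i + (j + 2) = i + j + 1 + 1 := by ring
    rw [der_c1, map_nsmul, e, truncAct_c1, smul_zero]

theorem truncAct_der_mul_truncDer (j : ℕ) (x : v.Hull) (n : v.V0 × v.V1) :
    truncAct (der (j + 1) x) (v.truncDer 1 n) = 0 := by
  rcases j with _ | j
  · rw [truncDer_one_apply]
    induction x using Hull.induction with
    | hadd x y h h' => rw [map_add, map_add, LinearMap.add_apply, h, h', add_zero]
    | h0 i a =>
      rw [der_c0, map_nsmul, LinearMap.smul_apply, zero_add]
      rcases i with _ | i
      · rw [zero_add, truncAct_c0_one, rightMul_apply, map_zero]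
        exact smul_zero _
      · rw [truncAct_c0, LinearMap.zero_apply, smul_zero]
    | h1 i x => rw [der_c1, map_nsmul, zero_add, truncAct_c1, smul_zero, LinearMap.zero_apply]
  · rw [truncAct_der_add_two, LinearMap.zero_apply]

/-- The Leibniz rule has content only for `j = 1` and generators in `V₀`, where it is `d_mul`; all
other terms vanish by weight. -/
theorem truncDer_truncAct (j : ℕ) (x : v.Hull) (n : v.V0 × v.V1) :
    v.truncDer j (truncAct x n) =
      ∑ p ∈ Finset.HasAntidiagonal.antidiagonal j, truncAct (der p.1 x) (v.truncDer p.2 n) := by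
  rcases j with _ | _ | j
  · have e : Finset.HasAntidiagonal.antidiagonal 0 = {(0, 0)} := rfl
    rw [e, Finset.sum_singleton, der_zero]
    rfl
  · have e : Finset.HasAntidiagonal.antidiagonal (0 + 1) = {(0, 1), (1, 0)} := rfl
    rw [e, Finset.sum_pair (by decide), der_zero]
    change (v.truncDer 1 (truncAct x n)) = truncAct x (v.truncDer 1 n) + truncAct (der 1 x) n
    simp only [truncDer_one_apply]
    induction x using Hull.induction with
    | hadd x y h h' =>
      simp only [map_add, LinearMap.add_apply, Prod.fst_add]
      rw [add_add_add_comm, ← h, ← h', Prod.mk_add_mk, add_zero]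
    | h0 i a =>
      rw [der_c0, map_nsmul]
      rcases i with _ | _ | i
      · rw [zero_add, truncAct_c0_one, truncAct_c0_zero, leftMul_apply, leftMul_apply,
          v.d_mul, add_comm]
        simp
      · rw [zero_add, truncAct_c0, truncAct_c0_one, rightMul_apply, rightMul_apply, map_zero,
          map_zero]
        simp
      · rw [truncAct_c0, add_assoc i 1 1, add_right_comm, truncAct_c0]
        simp
    | h1 i x =>
      rw [der_c1, map_nsmul, truncAct_c1]
      rcases i with _ | i
      · rw [truncAct_c1_zero, rightMul_apply, rightMul_apply, map_zero, map_zero]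
        simp
      · rw [truncAct_c1]
        simp
  · refine (Finset.sum_eq_zero fun p hp => ?_).symm
    rw [Finset.HasAntidiagonal.mem_antidiagonal] at hp
    obtain ⟨p, q⟩ := p
    rcases q with _ | _ | q
    · have e : p = j + 2 := by simpa using hp
      subst e
      change truncAct (der (j + 2) x) _ = 0
      rw [truncAct_der_add_two, LinearMap.zero_apply]
    · have e : p = j + 1 := by simp only at hp; omega
      subst e
      exact truncAct_der_mul_truncDer j x n
    · exact map_zero (truncAct (der p x))

end Hull

namespace Env

open Hull

/-- The action of the enveloping algebra on the sum of the parts of weights `0` and `1`. -/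
noncomputable def truncAct : v.Env →ₐ[k] Module.End k (v.V0 × v.V1) :=
  lift Hull.truncAct truncAct_lie

variable (v) in
/-- The action on the vacuum. -/
noncomputable def truncEval : v.Env →ₗ[k] v.V0 × v.V1 :=
  LinearMap.applyₗ (v.vac, (0 : v.V1)) ∘ₗ truncAct.toLinearMap

theorem truncEval_one : truncEval v 1 = (v.vac, 0) := by
  change truncAct (1 : v.Env) (v.vac, (0 : v.V1)) = _
  rw [map_one]
  rfl

theorem truncEval_mul (x : v.Hull) (u : v.Env) :
    truncEval v (of v x * u) = Hull.truncAct x (truncEval v u) := by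
  change truncAct (of v x * u) (v.vac, (0 : v.V1)) = _
  rw [map_mul, truncAct, lift_of]
  rfl

theorem truncEval_of (x : v.Hull) : truncEval v (of v x) = Hull.truncAct x (v.vac, 0) := by
  rw [← mul_one (of v x), truncEval_mul, truncEval_one]

theorem truncEval_c0 (a : v.V0) : truncEval v (of v (c0 0 a)) = (a, 0) := by
  rw [truncEval_of, truncAct_c0_zero, leftMul_apply, v.mul_vac, map_zero]

theorem truncEval_c1 (x : v.V1) : truncEval v (of v (c1 0 x)) = (0, x) := by
  rw [truncEval_of, truncAct_c1_zero, rightMul_apply, v.rmul_vac]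

theorem truncEval_der (j : ℕ) (u : v.Env) :
    truncEval v (der j u) = v.truncDer j (truncEval v u) := by
  induction u using induction generalizing j with
  | one =>
    rcases j with _ | _ | j
    · rw [der_zero]
      rfl
    · rw [der_one (by omega), map_zero, truncEval_one]
      change _ = (0, v.d v.vac)
      rw [d_vac]
      rfl
    · rw [der_one (by omega), map_zero]
      rfl
  | add u w h h' => simp only [map_add, h, h']
  | smul t u h => simp only [map_smul, h]
  | mul x u h =>
    rw [der_mul, map_sum, truncEval_mul, truncDer_truncAct]
    refine Finset.sum_congr rfl fun p _ => ?_
    rw [der_of, truncEval_mul, h]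

/-- The relations hold in the model, so evaluation on the vacuum descends to the envelope. It is a
left inverse of the canonical maps in weights `0` and `1`, which shows that the relations cause no
collapse there. -/
theorem truncEval_relIdeal {u : v.Env} (hu : u ∈ relIdeal v) : truncEval v u = 0 := by
  refine relIdeal_le (S := LinearMap.ker (truncEval v)) (fun u => ?_) (fun a b => ?_)
    (fun a x => ?_) (fun x u hu => ?_) (fun j u hu => ?_) hu
  · rw [LinearMap.mem_ker, sub_mul, map_sub, _root_.one_mul, truncEval_mul, truncAct_c0_zero,
      leftMul_apply, v.mul_comm, v.mul_vac, vac_lmul, sub_self]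
  · rw [LinearMap.mem_ker, map_sub, truncEval_mul, truncEval_c0, truncEval_c0, truncAct_c0_zero,
      leftMul_apply, map_zero, sub_self]
  · rw [LinearMap.mem_ker, map_sub, truncEval_mul, truncEval_c1, truncEval_c1, truncAct_c0_zero,
      leftMul_apply, map_zero, sub_self]
  · rw [LinearMap.mem_ker] at hu ⊢
    rw [truncEval_mul, hu, map_zero]
  · rw [LinearMap.mem_ker] at hu ⊢
    rw [truncEval_der, hu, map_zero]

/-! ### The canonical map is bijective in weights `0` and `1` -/

variable (v) in
/-- The parts of weights `0` and `1` of an element of the envelope. -/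
noncomputable def envelopeTrunc : (envelope v).carrier →ₗ[k] v.V0 × v.V1 :=
  (relIdeal v).liftQ (truncEval v) fun _ => truncEval_relIdeal

theorem envelopeTrunc_incl0 (a : v.V0) : envelopeTrunc v (incl0 v a) = (a, 0) := truncEval_c0 a

theorem envelopeTrunc_incl1 (x : v.V1) : envelopeTrunc v (incl1 v x) = (0, x) := truncEval_c1 x

theorem toEnv_mul (x : v.Hull) (u : v.Env) :
    toEnv v (of v x * u) = (envelope v).prod (-1) (toEnv v (of v x)) (toEnv v u) :=
  (congrArg (toEnv v) (act_mode_neg_one x u)).symm.trans (toEnvelope_prod_of (-1) x u).symm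

theorem incl1_d (a : v.V0) : toEnv v (of v (c0 1 a)) = incl1 v (v.d a) := by
  change _ = toEnv v (of v (c1 0 (v.d a)))
  rw [c1_d, zero_add, one_smul]

theorem incl_mul (a b : v.V0) :
    incl0 v (v.mul a b) = (envelope v).prod (-1) (incl0 v a) (incl0 v b) :=
  Hom.val0_mul (unit v) a b

theorem incl_lmul (a : v.V0) (x : v.V1) :
    incl1 v (v.lmul a x) = (envelope v).prod (-1) (incl0 v a) (incl1 v x) :=
  Hom.val1_lmul (unit v) a x

theorem incl_rmul (x : v.V1) (a : v.V0) :
    incl1 v (v.rmul x a) = (envelope v).prod (-1) (incl1 v x) (incl0 v a) :=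
  congrArg ((envelope v).gr 1).subtype ((unit v).map_rmul x a)

theorem incl_vac : incl0 v v.vac = toEnv v 1 := Hom.val0_vac (unit v)

variable (v) in
/-- The images of the parts of weights `0` and `1` in the envelope. -/
noncomputable def inclRange : ℕ → Submodule k (envelope v).carrier
  | 0 => LinearMap.range (incl0 v)
  | 1 => LinearMap.range (incl1 v)
  | _ + 2 => ⊤

theorem toEnv_of_mem {d : ℕ} {x : v.Hull} (hx : x ∈ Hull.gr v d) :
    toEnv v (of v x) ∈ inclRange v d := by
  refine Hull.gr_le (S := (inclRange v d).comap (toEnv v ∘ₗ of v)) (fun a => ?_)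
    (fun i x h => ?_) hx
  · rcases d with _ | _ | d
    · exact ⟨a, rfl⟩
    · exact ⟨v.d a, (incl1_d a).symm⟩
    · exact Submodule.mem_top
  · subst h
    rcases i with _ | i
    · exact ⟨x, rfl⟩
    · exact Submodule.mem_top

/-- In a word of total weight at most `1`, each factor is in weight `0` or `1`, and modulo the
relations `a·b`, `a·x` and `x·a` are again images of elements of `V₀` or `V₁`. From weight `2` on
nothing is claimed. -/
theorem toEnv_mem (n : ℕ) {u : v.Env} (hu : u ∈ gr v n) : toEnv v u ∈ inclRange v n := by
  refine gr_le (fun n => (inclRange v n).comap (toEnv v)) ⟨v.vac, incl_vac⟩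
    (fun d x j u hx hu => ?_) n hu
  rw [Submodule.mem_comap] at hu ⊢
  rw [toEnv_mul]
  have hx := toEnv_of_mem hx
  rcases d with _ | _ | d
  · obtain ⟨a, ha⟩ := hx
    rw [← ha]
    rcases j with _ | _ | j
    · obtain ⟨b, hb⟩ := hu
      rw [← hb]
      exact ⟨_, incl_mul a b⟩
    · obtain ⟨y, hy⟩ := hu
      rw [← hy]
      exact ⟨_, incl_lmul a y⟩
    · have e : 0 + (j + 1 + 1) = j + 2 := by ring
      rw [e]
      exact Submodule.mem_top
  · obtain ⟨x, hx⟩ := hx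
    rw [← hx]
    rcases j with _ | j
    · obtain ⟨b, hb⟩ := hu
      rw [← hb]
      exact ⟨_, incl_rmul x b⟩
    · have e : 0 + 1 + (j + 1) = j + 2 := by ring
      rw [e]
      exact Submodule.mem_top
  · have e : d + 1 + 1 + j = d + j + 2 := by ring
    rw [e]
    exact Submodule.mem_top

theorem envelope_gr_le (n : ℕ) : (envelope v).gr n ≤ inclRange v n := by
  rintro _ ⟨u, hu, rfl⟩
  exact toEnv_mem n hu

variable (v) in
/-- The inverse of the canonical map in weight `0`. -/
noncomputable def unitInv0 : (envelope v).gr 0 →ₗ[k] v.V0 :=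
  LinearMap.fst k v.V0 v.V1 ∘ₗ envelopeTrunc v ∘ₗ ((envelope v).gr 0).subtype

variable (v) in
/-- The inverse of the canonical map in weight `1`. -/
noncomputable def unitInv1 : (envelope v).gr 1 →ₗ[k] v.V1 :=
  LinearMap.snd k v.V0 v.V1 ∘ₗ envelopeTrunc v ∘ₗ ((envelope v).gr 1).subtype

theorem unitInv0_unit (a : v.V0) : unitInv0 v ((unit v).f0 a) = a :=
  congrArg Prod.fst (envelopeTrunc_incl0 a)

theorem unitInv1_unit (x : v.V1) : unitInv1 v ((unit v).f1 x) = x :=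
  congrArg Prod.snd (envelopeTrunc_incl1 x)

theorem unit_unitInv0 (a : (envelope v).gr 0) : (unit v).f0 (unitInv0 v a) = a := by
  obtain ⟨a, ha⟩ := a
  obtain ⟨a, rfl⟩ := envelope_gr_le 0 ha
  exact congrArg (unit v).f0 (unitInv0_unit a)

theorem unit_unitInv1 (x : (envelope v).gr 1) : (unit v).f1 (unitInv1 v x) = x := by
  obtain ⟨x, hx⟩ := x
  obtain ⟨x, rfl⟩ := envelope_gr_le 1 hx
  exact congrArg (unit v).f1 (unitInv1_unit x)

variable (v) in
/-- The vertex envelope does not change the parts of weights `0` and `1`. -/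
noncomputable def unitIso : v ≅ (envelope v).trunc :=
  isoOfInv (unit v) (unitInv0 v) (unitInv1 v) unitInv0_unit unit_unitInv0 unitInv1_unit
    unit_unitInv1

end Env

end TruncVA

/-! ### The vertex envelope functor and its adjunction -/

namespace TruncVA

/-- A splitting from an endomorphism of `V₁` which factors through a section of `V₁ → T`. -/
def Splitting.ofEndomorphism {k : Type u} [CommRing k] {v : TruncVA k} (r : v.V1 →ₗ[k] v.V1)
    (h : ∀ x ∈ v.Omega, r x = 0) (h' : ∀ x, r x - x ∈ v.Omega) : v.Splitting where
  s := v.Omega.liftQ r h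
  mkQ_s τ := by
    obtain ⟨x, rfl⟩ := v.Omega.mkQ_surjective τ
    exact (Submodule.Quotient.eq v.Omega).mpr (h' x)

variable {k : Type u} [CommRing k]

namespace Env

/-- The truncation of a morphism of vertex algebras. -/
def truncMap {V W : VertexAlgebra k} (F : V ⟶ W) : V.trunc ⟶ W.trunc :=
  (VertexAlgebra.truncFunctor k).map F

theorem truncMap_id (V : VertexAlgebra k) : truncMap (𝟙 V) = 𝟙 V.trunc :=
  (VertexAlgebra.truncFunctor k).map_id V

theorem truncMap_comp {V W X : VertexAlgebra k} (F : V ⟶ W) (G : W ⟶ X) :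
    truncMap (F ≫ G) = truncMap F ≫ truncMap G := (VertexAlgebra.truncFunctor k).map_comp F G

variable {v w : TruncVA k} {V W : VertexAlgebra k}

theorem unit_truncMap_desc (f : v ⟶ V.trunc) : unit v ≫ truncMap (desc f) = f := unit_desc f

theorem unit_truncMap_desc_assoc (f : v ⟶ V.trunc) (g : V.trunc ⟶ w) :
    unit v ≫ truncMap (desc f) ≫ g = f ≫ g := by
  rw [← Category.assoc, unit_truncMap_desc]

theorem desc_eq {f : v ⟶ V.trunc} {F : envelope v ⟶ V} (h : f = unit v ≫ truncMap F) :
    desc f = F := envelope_hom_ext ((unit_desc f).trans h)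

theorem desc_id_comp_unit (v : TruncVA k) : desc (𝟙 v ≫ unit v) = 𝟙 (envelope v) :=
  desc_eq (by rw [truncMap_id, Category.comp_id, Category.id_comp])

theorem desc_comp (f : v ⟶ w) (g : w ⟶ V.trunc) : desc (f ≫ g) = desc (f ≫ unit w) ≫ desc g :=
  desc_eq (by rw [truncMap_comp, unit_truncMap_desc_assoc, Category.assoc, unit_truncMap_desc])

variable (i : w ≅ V.trunc)

theorem desc_unit_comp_inv (F : envelope v ⟶ V) :
    desc ((unit v ≫ truncMap F ≫ i.inv) ≫ i.hom) = F :=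
  desc_eq (by simp only [Category.assoc, Iso.inv_hom_id, Category.comp_id])

theorem unit_desc_comp_inv (g : v ⟶ w) : unit v ≫ truncMap (desc (g ≫ i.hom)) ≫ i.inv = g := by
  rw [unit_truncMap_desc_assoc, Category.assoc, Iso.hom_inv_id, Category.comp_id]

theorem desc_comp_iso {u : TruncVA k} (f : u ⟶ v) (g : v ⟶ w) :
    desc ((f ≫ g) ≫ i.hom) = desc (f ≫ unit v) ≫ desc (g ≫ i.hom) := by
  rw [Category.assoc, desc_comp]

theorem unit_truncMap_comp {u : TruncVA k} (j : u ≅ W.trunc) (F : envelope v ⟶ V) (G : V ⟶ W) :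
    unit v ≫ truncMap (F ≫ G) ≫ j.inv =
      (unit v ≫ truncMap F ≫ i.inv) ≫ i.hom ≫ truncMap G ≫ j.inv := by
  simp only [truncMap_comp, Category.assoc, Iso.inv_hom_id_assoc]

theorem unit_truncMap_id (i : w ≅ (envelope v).trunc) :
    (unit v ≫ truncMap (𝟙 (envelope v)) ≫ i.inv) ≫ i.hom = unit v := by
  rw [truncMap_id, Category.id_comp, Category.assoc, Iso.inv_hom_id, Category.comp_id]

end Env

variable (k)

/-- The vertex envelope as a functor on `1`-truncated vertex algebras. -/
noncomputable def envelopeFunctor : TruncVA k ⥤ VertexAlgebra k where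
  obj v := Env.envelope v
  map {v w} f := Env.desc (f ≫ Env.unit w)
  map_id v := Env.desc_id_comp_unit v
  map_comp {u v w} f g := (congrArg Env.desc (Category.assoc f g (Env.unit w))).trans
    (Env.desc_comp f (g ≫ Env.unit w))

/-- The unit of the vertex envelope. -/
noncomputable def envelopeUnit :
    𝟭 (TruncVA k) ⟶ envelopeFunctor k ⋙ VertexAlgebra.truncFunctor k where
  app v := Env.unit v
  naturality v w f := (Env.unit_desc (f ≫ Env.unit w)).symm

end TruncVA

/-! ### Vertex algebroids: the submodule `Ω`, splittings and the adjunction -/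

namespace VertexAlgebroid

variable {k : Type u} [CommRing k] [Invertible (2 : k)]

theorem fst_eq_zero_of_mem_Omega (𝒜 : VertexAlgebroid k) {x : 𝒜.T × 𝒜.Ω}
    (h : x ∈ 𝒜.toTrunc.Omega) : x.1 = 0 := by
  have hle : 𝒜.toTrunc.Omega ≤ LinearMap.ker (LinearMap.fst k 𝒜.T 𝒜.Ω) := by
    refine Submodule.span_le.mpr ?_
    rintro _ ⟨a, b, rfl⟩
    exact smul_zero (A := 𝒜.T) (show 𝒜.A from a)
  exact hle h

/-- Only here is it used that `∂A` generates `Ω`. The submodule on the right is a `k`-span, but it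
is stable under `A`. -/
theorem mem_Omega_of_fst_eq_zero {𝒜 : VertexAlgebroid k} (h𝒜 : isSurjective k 𝒜)
    {x : 𝒜.T × 𝒜.Ω} (h : x.1 = 0) : x ∈ 𝒜.toTrunc.Omega := by
  obtain ⟨τ, ω⟩ := x
  obtain rfl : τ = 0 := h
  have hω : ω ∈ Submodule.span 𝒜.A (Set.range 𝒜.d) := by
    have e : Submodule.span 𝒜.A (Set.range 𝒜.d) = ⊤ := h𝒜
    rw [e]
    exact Submodule.mem_top
  induction hω using Submodule.span_induction with
  | zero => exact zero_mem 𝒜.toTrunc.Omega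
  | mem ω h =>
    obtain ⟨a, rfl⟩ := h
    exact TruncVA.d_mem (v := 𝒜.toTrunc) a
  | add ω ω' _ _ h h' =>
    have e : ((0 : 𝒜.T), ω + ω') = (0, ω) + (0, ω') := by rw [Prod.mk_add_mk, add_zero]
    rw [e]
    exact add_mem (S := Submodule k (𝒜.T × 𝒜.Ω)) h h'
  | smul a ω _ h =>
    have e : ((0 : 𝒜.T), a • ω) = 𝒜.uLmul a (0, ω) := by simp
    rw [e]
    exact TruncVA.Omega_lmul (v := 𝒜.toTrunc) a h

/-- For surjective vertex algebroids, all morphisms of truncated vertex algebras preserve `Ω`. -/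
def homOfTrunc {𝒜 ℬ : VertexAlgebroid k} (h𝒜 : isSurjective k 𝒜) (f : 𝒜.toTrunc ⟶ ℬ.toTrunc) :
    𝒜 ⟶ ℬ :=
  Hom.mk (𝒜 := 𝒜) (ℬ := ℬ) f fun _ h => fst_eq_zero_of_mem_Omega ℬ
    (VertexAlgebra.map_Omega f (mem_Omega_of_fst_eq_zero h𝒜 h))

variable (k) in
/-- The vertex envelope as a functor. -/
noncomputable def vertexEnvelopeFunctor : VertexAlgebroid k ⥤ VertexAlgebra k :=
  toTruncFunctor k ⋙ TruncVA.envelopeFunctor k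

/-- Under `unitIso` the weight `1` part is `T ⊕ Ω`, and its submodule `Ω` is the second summand. The
projection to `T` kills this summand and is the identity modulo it, so it factors through a section.
-/
theorem isSplittable_vertexEnvelope {𝒜 : VertexAlgebroid k} (h𝒜 : isSurjective k 𝒜) :
    VertexAlgebra.isSplittable k ((vertexEnvelopeFunctor k).obj 𝒜) := by
  let e := TruncVA.Env.unitIso 𝒜.toTrunc
  let p : 𝒜.T × 𝒜.Ω →ₗ[k] 𝒜.T × 𝒜.Ω := LinearMap.inl k 𝒜.T 𝒜.Ω ∘ₗ LinearMap.fst k 𝒜.T 𝒜.Ω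
  have hinv (x) : e.hom.f1 (e.inv.f1 x) = x :=
    LinearMap.congr_fun (congrArg TruncVA.Hom.f1 e.inv_hom_id) x
  refine ⟨TruncVA.Splitting.ofEndomorphism (e.hom.f1 ∘ₗ p ∘ₗ e.inv.f1) (fun x hx => ?_)
    fun x => ?_⟩
  · have h := fst_eq_zero_of_mem_Omega 𝒜 (VertexAlgebra.map_Omega e.inv hx)
    have h' : p (e.inv.f1 x) = 0 := Prod.ext h rfl
    exact (congrArg e.hom.f1 h').trans (map_zero e.hom.f1)
  · have h (y : 𝒜.T × 𝒜.Ω) : p y - y ∈ 𝒜.toTrunc.Omega :=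
      mem_Omega_of_fst_eq_zero h𝒜 (sub_self y.1)
    have h := h (e.inv.f1 x)
    have h' := VertexAlgebra.map_Omega e.hom h
    have h'' := (map_sub e.hom.f1 (p (e.inv.f1 x)) (e.inv.f1 x)).trans
      (congrArg (e.hom.f1 (p (e.inv.f1 x)) - ·) (hinv x))
    exact (congrArg (· ∈ (TruncVA.Env.envelope 𝒜.toTrunc).trunc.Omega) h'').mp h'

/-- The vertex envelope as a functor from surjective vertex algebroids to splittable vertex
algebras. -/
noncomputable def splitEnvelopeFunctor :
    (isSurjective k).FullSubcategory ⥤ (VertexAlgebra.isSplittable k).FullSubcategory :=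
  (VertexAlgebra.isSplittable k).lift ((isSurjective k).ι ⋙ vertexEnvelopeFunctor k)
    fun 𝒜 => isSplittable_vertexEnvelope 𝒜.property

variable (s : ∀ V : (VertexAlgebra.isSplittable k).FullSubcategory, V.obj.trunc.Splitting)

/-- The universal property of the vertex envelope, for surjective vertex algebroids. -/
noncomputable def splitEnvelopeHomEquiv (𝒜 : (isSurjective k).FullSubcategory)
    (V : (VertexAlgebra.isSplittable k).FullSubcategory) :
    (splitEnvelopeFunctor.obj 𝒜 ⟶ V) ≃ (𝒜 ⟶ (VertexAlgebra.algebroidFunctor s).obj V) where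
  toFun F := ObjectProperty.homMk (homOfTrunc 𝒜.property (TruncVA.Env.unit 𝒜.obj.toTrunc ≫
    TruncVA.Env.truncMap F.hom ≫ (s V).algebroidIso.inv))
  invFun g := ObjectProperty.homMk (TruncVA.Env.desc (g.hom.hom ≫ (s V).algebroidIso.hom))
  left_inv F := ObjectProperty.hom_ext _
    (TruncVA.Env.desc_unit_comp_inv (s V).algebroidIso F.hom)
  right_inv g := ObjectProperty.hom_ext _ (VertexAlgebroid.Hom.ext
    (TruncVA.Env.unit_desc_comp_inv (s V).algebroidIso g.hom.hom))

/-- The adjunction between the vertex envelope and the vertex algebroid of a splittable vertex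
algebra. -/
noncomputable def splitEnvelopeAdjunction :
    splitEnvelopeFunctor ⊣ VertexAlgebra.algebroidFunctor s :=
  Adjunction.mkOfHomEquiv
    { homEquiv := splitEnvelopeHomEquiv s
      homEquiv_naturality_left_symm := fun {𝒜 ℬ V} f g => ObjectProperty.hom_ext _
        (TruncVA.Env.desc_comp_iso (s V).algebroidIso f.hom.hom g.hom.hom)
      homEquiv_naturality_right := fun {𝒜 V W} f g =>
        ObjectProperty.hom_ext _ (VertexAlgebroid.Hom.ext
          (TruncVA.Env.unit_truncMap_comp (s V).algebroidIso (s W).algebroidIso f.hom g.hom)) }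

theorem splitEnvelopeAdjunction_unit (𝒜 : (isSurjective k).FullSubcategory) :
    ((splitEnvelopeAdjunction s).unit.app 𝒜).hom.hom ≫
      (s (splitEnvelopeFunctor.obj 𝒜)).algebroidIso.hom = TruncVA.Env.unit 𝒜.obj.toTrunc :=
  TruncVA.Env.unit_truncMap_id (s (splitEnvelopeFunctor.obj 𝒜)).algebroidIso

end VertexAlgebroid

/-! ### The theorem -/

theorem theorem9p14 {k : Type u} [CommRing k] [Invertible (2 : k)] :
    ∃ (U : VertexAlgebroid k ⥤ VertexAlgebra k)
      (E : ∀ 𝒜 : VertexAlgebroid k, VertexEnvelope 𝒜 (U.obj 𝒜))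
      (η : VertexAlgebroid.toTruncFunctor k ⟶ U ⋙ VertexAlgebra.truncFunctor k),
      (∀ (𝒜 : VertexAlgebroid k) (a : 𝒜.A),
        ((U.obj 𝒜).gr 0).subtype ((η.app 𝒜).f0 a) = (E 𝒜).can0 a) ∧
      (∀ (𝒜 : VertexAlgebroid k) (x : 𝒜.T × 𝒜.Ω),
        ((U.obj 𝒜).gr 1).subtype ((η.app 𝒜).f1 x) = (E 𝒜).can1 x) ∧
      (∀ (𝒜 : VertexAlgebroid k) (V : VertexAlgebra k) (f : 𝒜.toTrunc ⟶ V.trunc),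
        ∃! F : U.obj 𝒜 ⟶ V, η.app 𝒜 ≫ (VertexAlgebra.truncFunctor k).map F = f) ∧
      ∃ hs : ∀ 𝒜 : (VertexAlgebroid.isSurjective k).FullSubcategory,
          VertexAlgebra.isSplittable k (U.obj 𝒜.obj),
        ∀ s : ∀ V : (VertexAlgebra.isSplittable k).FullSubcategory, V.obj.trunc.Splitting,
          ∃ adj : (VertexAlgebra.isSplittable k).lift
              ((VertexAlgebroid.isSurjective k).ι ⋙ U) hs ⊣ VertexAlgebra.algebroidFunctor s,
            ∀ 𝒜 : (VertexAlgebroid.isSurjective k).FullSubcategory,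
              (adj.unit.app 𝒜).hom.hom ≫ (s ⟨U.obj 𝒜.obj, hs 𝒜⟩).algebroidIso.hom =
                η.app 𝒜.obj := by
  -- The unit was assembled from the images of the generators of the hull, so its components are the
  -- canonical maps by definition.
  refine ⟨VertexAlgebroid.vertexEnvelopeFunctor k, fun 𝒜 => 𝒜.vertexEnvelope,
    Functor.whiskerLeft (VertexAlgebroid.toTruncFunctor k) (TruncVA.envelopeUnit k),
    fun _ _ => rfl, fun _ _ => rfl, fun 𝒜 V f => ?_,
    fun 𝒜 => VertexAlgebroid.isSplittable_vertexEnvelope 𝒜.property, fun s =>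
    ⟨VertexAlgebroid.splitEnvelopeAdjunction s,
      VertexAlgebroid.splitEnvelopeAdjunction_unit s⟩⟩
  exact ⟨TruncVA.Env.desc f, TruncVA.Env.unit_desc f, fun F hF =>
    TruncVA.Env.envelope_hom_ext (hF.trans (TruncVA.Env.unit_desc f).symm)⟩
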